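/- **Proposition 4.19.** Let $R$ be a commutative $\mathbb{Q}$-algebra, $Y$ a smooth $R$-scheme of relative dimension $m$, and $f\in\Gamma(Y,\mathcal{O}_Y)$. Let $X=\mathbf{R}\mathrm{Crit}(Y,f)$ be the derived critical locus, with structure sheaf $\mathcal{O}_X=\bigoplus_q\Lambda^q\mathcal{T}_Y$ ($\Lambda^q\mathcal{T}_Y$ in cohomological degree $-q$) and differential given by contraction with $df$. Give $X$ its canonical exact $(-1)$-shifted symplectic structure $(\omega,\lambda)$, where $\lambda=\nu-f$, $\omega=d\nu$ and $\nu$ is the canonical element of $\Omega^1_Y\otimes\mathcal{T}_Y\subset\Omega^1_X$ (locally $\nu=\sum_i\eta_i\,dy_i$, with $(\eta_i)$ the basis of $\mathcal{T}_Y$ dual to $(dy_i)$). Write $i\colon X\to Y$ for the natural map. (a) For $\mathcal{L}=i^*\mathcal{K}_Y=\mathcal{O}_X\otimes\Omega^m_Y$, contraction of polyvector fields with forms gives an isomorphism of complexes $\mathcal{L}\cong(\Omega^*_Y,\ \delta=df\wedge-)[m]$. Let $F$ be the order filtration on the differential operators $\mathcal{D}_X(\mathcal{L})$ of the $\mathcal{O}_X$-module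 $\mathcal{L}$. Let $t$ be the anti-involution of $\mathcal{D}_X(\mathcal{L})$ (formal adjoint) induced by the cup product $\mathcal{L}\otimes\mathcal{L}\to\mathcal{K}_Y[m]$ and the right $\mathcal{D}_Y$-module structure of $\mathcal{K}_Y$, and put $a(\hbar)^*=-a^t(-\hbar)$. The space of self-dual quantisations with $\hbar\partial_\hbar$-derivation of $(\omega,\lambda)$ on $\mathcal{L}$ is the Maurer–Cartan space of pairs $(\Delta,D)$, i.e. of Maurer–Cartan elements $\Delta+D\epsilon$, in the derived global sections of $$\mathrm{cocone}\Bigl(\hbar\partial_\hbar\colon \prod_{i\ge1}\hbar^iF_{i+1}\mathcal{D}_X(\mathcal{L})\to\prod_{i\ge-1}\hbar^iF_{i+1}\mathcal{D}_X(\mathcal{L})\,\epsilon\Bigr)^{*=\mathrm{id}}$$ whose reduction modulo $\hbar$ is the Poisson structure with formal derivation corresponding to $(\omega,\lambda)$. For a strict pair on $Y$ the Maurer–Cartan equation says that $(\delta+\Delta)^2=0$ and $[\delta+\Delta,D]=\hbar\partial_\hbar(\Delta)$; one calls $D$ the $\hbar\partial_\hbar$-connection. (b) A point of this space is given by $\Delta=\hbar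 d\in\hbar F_2\mathcal{D}_X(\mathcal{L})$, with $d$ the de Rham differential, and by the $D\in F_1\mathcal{D}_X(\mathcal{L})\oplus\hbar^{-1}F_0\mathcal{D}_X(\mathcal{L})$ which acts on $\Omega^p_Y$ as multiplication by $\bigl(\tfrac m2-p\bigr)-\hbar^{-1}f$. (c) The space is contractible, so $(\hbar d,D)$ is the essentially unique self-dual quantisation of $(X,\omega,\lambda)$ with $\hbar\partial_\hbar$-derivation. -/

import Mathlib

open scoped TensorProduct
open AlgebraicGeometry CategoryTheory

universe u v w

noncomputable section

namespace DCrit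

section Algebra

variable (R : Type u) [CommRing R] (B : Type v) [CommRing B] [Algebra R B]

/-- The algebra `Ω^*` of differential forms; `Ω^p` is its submodule `⋀[B]^p Ω[B⁄R]`. -/
abbrev Forms : Type v := ExteriorAlgebra B (Ω[B⁄R])

variable {R B} in
/-- The exact one-form `db`, as an element of `Ω^*`. -/
def dOne (b : B) : Forms R B := ExteriorAlgebra.ι B (KaehlerDifferential.D R B b)

/-- The parity automorphism `α ↦ (-1)^p α` for `α ∈ Ω^p`. -/
abbrev inv : Forms R B →ₐ[B] Forms R B := CliffordAlgebra.involute

theorem dOne_mul (b : B) (α : Forms R B) : dOne b * α = inv R B α * dOne b := by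
  induction α using CliffordAlgebra.induction with
  | algebraMap r => simp [Algebra.commutes]
  | ι x =>
    simp only [CliffordAlgebra.involute_ι, neg_mul]
    exact eq_neg_of_add_eq_zero_left (ExteriorAlgebra.ι_add_mul_swap _ _)
  | mul a b ha hb => rw [← mul_assoc, ha, mul_assoc, hb, map_mul, mul_assoc]
  | add a b ha hb => rw [mul_add, ha, hb, map_add, add_mul]

/-- Pairs `(α, β)` of forms with multiplication
`(α, β) (α', β') = (α α', β α' + (-1)^{deg α} α β')`. An algebra map of the form
`α ↦ (α, dα)` is the same as an odd derivation `d`. -/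
@[ext] structure Pair where
  /-- first component -/
  fst : Forms R B
  /-- second component -/
  snd : Forms R B

namespace Pair

instance : Zero (Pair R B) := ⟨⟨0, 0⟩⟩
instance : One (Pair R B) := ⟨⟨1, 0⟩⟩
instance : Add (Pair R B) := ⟨fun x y => ⟨x.fst + y.fst, x.snd + y.snd⟩⟩
instance : Neg (Pair R B) := ⟨fun x => ⟨-x.fst, -x.snd⟩⟩
instance : Mul (Pair R B) :=
  ⟨fun x y => ⟨x.fst * y.fst, x.snd * y.fst + inv R B x.fst * y.snd⟩⟩

@[simp] theorem fst_zero : (0 : Pair R B).fst = 0 := rfl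
@[simp] theorem snd_zero : (0 : Pair R B).snd = 0 := rfl
@[simp] theorem fst_one : (1 : Pair R B).fst = 1 := rfl
@[simp] theorem snd_one : (1 : Pair R B).snd = 0 := rfl
@[simp] theorem fst_add (x y : Pair R B) : (x + y).fst = x.fst + y.fst := rfl
@[simp] theorem snd_add (x y : Pair R B) : (x + y).snd = x.snd + y.snd := rfl
@[simp] theorem fst_neg (x : Pair R B) : (-x).fst = -x.fst := rfl
@[simp] theorem snd_neg (x : Pair R B) : (-x).snd = -x.snd := rfl
@[simp] theorem fst_mul (x y : Pair R B) : (x * y).fst = x.fst * y.fst := rfl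
@[simp] theorem snd_mul (x y : Pair R B) :
    (x * y).snd = x.snd * y.fst + inv R B x.fst * y.snd := rfl

instance : Ring (Pair R B) where
  add_assoc _ _ _ := by ext <;> simp [add_assoc]
  zero_add _ := by ext <;> simp
  add_zero _ := by ext <;> simp
  add_comm _ _ := by ext <;> simp [add_comm]
  nsmul := nsmulRec
  zsmul := zsmulRec
  neg_add_cancel _ := by ext <;> simp
  mul_assoc _ _ _ := by ext <;> simp [mul_assoc, add_mul, mul_add, add_assoc]
  one_mul _ := by ext <;> simp
  mul_one _ := by ext <;> simp
  left_distrib _ _ _ := by ext <;> simp [mul_add]; abel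
  right_distrib _ _ _ := by ext <;> simp [add_mul]; abel
  zero_mul _ := by ext <;> simp
  mul_zero _ := by ext <;> simp

/-- `Pair R B` is a `B`-algebra through `b ↦ (b, db)`. -/
instance : Algebra B (Pair R B) :=
  RingHom.toAlgebra'
    { toFun := fun b => ⟨algebraMap B _ b, dOne b⟩
      map_one' := by ext <;> simp [dOne]
      map_zero' := by ext <;> simp [dOne]
      map_add' := fun b c => by ext <;> simp [dOne]
      map_mul' := fun b c => by
        ext
        · simp
        · simp [dOne, Algebra.smul_def, Algebra.commutes c, add_comm] }
    (fun b x => by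
      ext
      · simp [Algebra.commutes]
      · simp [dOne_mul, Algebra.commutes, add_comm])

theorem fst_algebraMap (b : B) : (algebraMap B (Pair R B) b).fst = algebraMap B _ b := rfl
theorem snd_algebraMap (b : B) : (algebraMap B (Pair R B) b).snd = dOne b := rfl

instance : Algebra R (Pair R B) := Algebra.compHom _ (algebraMap R B)

instance : IsScalarTower R B (Pair R B) := IsScalarTower.of_algebraMap_eq' rfl

theorem fst_smul (b : B) (x : Pair R B) : (b • x).fst = b • x.fst := by
  rw [Algebra.smul_def, fst_mul, fst_algebraMap, Algebra.smul_def]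
theorem snd_smul (b : B) (x : Pair R B) : (b • x).snd = dOne b * x.fst + b • x.snd := by
  rw [Algebra.smul_def, snd_mul, fst_algebraMap, snd_algebraMap, Algebra.smul_def]
  simp
theorem fst_smul' (r : R) (x : Pair R B) : (r • x).fst = r • x.fst := by
  rw [← algebraMap_smul B r x, fst_smul, algebraMap_smul]
theorem snd_smul' (r : R) (x : Pair R B) : (r • x).snd = r • x.snd := by
  rw [← algebraMap_smul B r x, snd_smul, algebraMap_smul]
  simp [dOne]

/-- The derivation `b ↦ (db, 0)`. -/
def der : Derivation R B (Pair R B) where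
  toFun b := ⟨dOne b, 0⟩
  map_add' b c := by ext <;> simp [dOne]
  map_smul' r b := by
    ext
    · rw [fst_smul']; simp [dOne]
    · rw [snd_smul']; simp
  map_one_eq_zero' := by ext <;> simp [dOne]
  leibniz' b c := by
    ext
    · simp [dOne, fst_smul]
    · rw [snd_add, snd_smul, snd_smul]
      change (0 : Forms R B) = dOne b * dOne c + b • 0 + (dOne c * dOne b + c • 0)
      rw [smul_zero, smul_zero, add_zero, add_zero]
      exact (ExteriorAlgebra.ι_add_mul_swap _ _).symm

/-- The `B`-linear map `Ω¹ → Pair R B` sending `db` to `(db, 0)`. -/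
def oneHom : Ω[B⁄R] →ₗ[B] Pair R B := (der R B).liftKaehlerDifferential

theorem oneHom_anti (θ θ' : Ω[B⁄R]) :
    oneHom R B θ * oneHom R B θ' + oneHom R B θ' * oneHom R B θ = 0 := by
  have h : ∀ θ : Ω[B⁄R], θ ∈ Submodule.span B (Set.range (KaehlerDifferential.D R B)) := fun θ => by
    rw [KaehlerDifferential.span_range_derivation]; trivial
  induction h θ using Submodule.span_induction with
  | zero => simp
  | add x y _ _ hx hy =>
    rw [map_add, add_mul, mul_add, add_add_add_comm, hx, hy, add_zero]
  | smul b x _ hx => rw [map_smul, smul_mul_assoc, mul_smul_comm, ← smul_add, hx, smul_zero]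
  | mem x hx =>
    obtain ⟨b, rfl⟩ := hx
    induction h θ' using Submodule.span_induction with
    | zero => simp
    | add x y _ _ hx hy =>
      rw [map_add, add_mul, mul_add, add_add_add_comm, hx, hy, add_zero]
    | smul b x _ hx => rw [map_smul, smul_mul_assoc, mul_smul_comm, ← smul_add, hx, smul_zero]
    | mem x hx =>
      obtain ⟨c, rfl⟩ := hx
      simp only [oneHom, Derivation.liftKaehlerDifferential_comp_D]
      ext
      · exact ExteriorAlgebra.ι_add_mul_swap _ _
      · simp [der]

theorem oneHom_sq (θ : Ω[B⁄R]) : oneHom R B θ * oneHom R B θ = 0 := by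
  have h : θ ∈ Submodule.span B (Set.range (KaehlerDifferential.D R B)) := by
    rw [KaehlerDifferential.span_range_derivation]; trivial
  induction h using Submodule.span_induction with
  | zero => simp
  | add x y _ _ hx hy =>
    have := oneHom_anti R B x y
    rw [map_add, add_mul, mul_add, mul_add, hx, hy, zero_add, add_zero, this]
  | smul b x _ hx => rw [map_smul, smul_mul_assoc, mul_smul_comm, hx, smul_zero, smul_zero]
  | mem x hx =>
    obtain ⟨b, rfl⟩ := hx
    simp only [oneHom, Derivation.liftKaehlerDifferential_comp_D]
    ext
    · exact ExteriorAlgebra.ι_sq_zero _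
    · simp [der]

/-- The algebra map `α ↦ (α, dα)`. -/
def total : Forms R B →ₐ[B] Pair R B := ExteriorAlgebra.lift B ⟨oneHom R B, oneHom_sq R B⟩

end Pair

/-- The de Rham differential `d : Ω^* → Ω^{*+1}`: the odd `R`-linear derivation with
`d b = db` and `d (db) = 0`. -/
def deRham : Module.End R (Forms R B) where
  toFun α := (Pair.total R B α).snd
  map_add' α β := by simp
  map_smul' r α := by
    rw [← algebraMap_smul B r α, map_smul, algebraMap_smul, Pair.snd_smul', RingHom.id_apply]

theorem total_fst (α : Forms R B) : (Pair.total R B α).fst = α := by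
  induction α using CliffordAlgebra.induction with
  | algebraMap r => rw [AlgHom.commutes]; rfl
  | ι x =>
    rw [Pair.total, ExteriorAlgebra.lift_ι_apply]
    have h : x ∈ Submodule.span B (Set.range (KaehlerDifferential.D R B)) := by
      rw [KaehlerDifferential.span_range_derivation]; trivial
    induction h using Submodule.span_induction with
    | zero => simp
    | add x y _ _ hx hy => simp [hx, hy]
    | smul b x _ hx => rw [map_smul, Algebra.smul_def, Pair.fst_mul, hx, map_smul, Algebra.smul_def]; rfl
    | mem x hx =>
      obtain ⟨b, rfl⟩ := hx
      simp only [Pair.oneHom, Derivation.liftKaehlerDifferential_comp_D]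
      rfl
  | mul a b ha hb => simp [ha, hb]
  | add a b ha hb => simp [ha, hb]

theorem deRham_algebraMap (b : B) : deRham R B (algebraMap B _ b) = dOne b := by
  change (Pair.total R B _).snd = _
  rw [AlgHom.commutes]; rfl

theorem deRham_dOne (b : B) : deRham R B (dOne b) = 0 := by
  change (Pair.total R B _).snd = _
  rw [dOne, Pair.total, ExteriorAlgebra.lift_ι_apply]
  simp only [Pair.oneHom, Derivation.liftKaehlerDifferential_comp_D]
  rfl

theorem deRham_mul (α β : Forms R B) :
    deRham R B (α * β) = deRham R B α * β + inv R B α * deRham R B β := by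
  change (Pair.total R B _).snd = _
  rw [map_mul, Pair.snd_mul, total_fst, total_fst]; rfl


/-! ### Functoriality of forms -/

section Functoriality

variable {R B} {C : Type w} [CommRing C] [Algebra R C]

/-- Pull-back of differential forms along an `R`-algebra map `φ : B → C`: the algebra map
`Ω^*_B → Ω^*_C` with `b ↦ φ b` and `db ↦ d(φ b)`. -/
def formsMap (φ : B →ₐ[R] C) : Forms R B →ₐ[R] Forms R C :=
  letI : Algebra B C := φ.toRingHom.toAlgebra
  haveI : IsScalarTower R B C := IsScalarTower.of_algebraMap_eq' φ.comp_algebraMap.symm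
  (ExteriorAlgebra.lift B
    ⟨((ExteriorAlgebra.ι C).restrictScalars B) ∘ₗ KaehlerDifferential.map R R B C,
      fun _ => ExteriorAlgebra.ι_sq_zero _⟩ : Forms R B →ₐ[B] Forms R C).restrictScalars R

end Functoriality

/-! ## The derived critical locus and its line bundle

For `f ∈ B` the structure sheaf of the derived critical locus `X` of `f` is the commutative dg
algebra `O_X = ⨁ Λ^q T` of polyvector fields, `Λ^q T` in cohomological degree `-q`, with
differential the contraction with `df`.  The line bundle is `L = Ω^*` with `Ω^p` in degree `p - m`
and differential `α ↦ df ∧ α`, on which `O_X` acts by contraction. -/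

/-- The graded algebra `O_X` of polyvector fields. -/
abbrev Polyvectors : Type v := ExteriorAlgebra B (Derivation R B B)

/-- The differential of `O_X`: contraction with `df`, so `v ↦ v(f)` on vector fields. -/
def polyDiff (f : B) : Polyvectors R B →ₗ[B] Polyvectors R B :=
  CliffordAlgebra.contractLeft
    ({ toFun := fun v => v f
       map_add' := fun _ _ => rfl
       map_smul' := fun _ _ => rfl } : Module.Dual B (Derivation R B B))

/-- The action of `O_X` on `Ω^*`: functions act by multiplication and vector fields `v` by
contraction, `v₁ ⋯ v_q ↦ ι_{v₁} ∘ ⋯ ∘ ι_{v_q}`. -/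
def act : Polyvectors R B →ₐ[B] Module.End B (Forms R B) :=
  ExteriorAlgebra.lift B
    ⟨CliffordAlgebra.contractLeft ∘ₗ
        (KaehlerDifferential.linearMapEquivDerivation R B (M := B)).symm.toLinearMap,
      fun _ => LinearMap.ext fun α => CliffordAlgebra.contractLeft_contractLeft _ α⟩

/-- The `R`-linear endomorphisms of `L`. -/
abbrev Op : Type v := Module.End R (Forms R B)

variable {R B}

/-- The operator on `L` given by an element of `O_X`. -/
def opOf (a : Polyvectors R B) : Op R B := (act R B a).restrictScalars R

/-- Multiplication by `b ∈ B`. -/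
def mulOp (b : B) : Op R B := LinearMap.mulLeft R (algebraMap B (Forms R B) b)

/-- The differential `δ = df ∧ -` of `L`. -/
def koszul (f : B) : Op R B := LinearMap.mulLeft R (dOne f)

variable (R B) in
/-- The parity operator, `(-1)^p` on `Ω^p`. -/
def parity : Op R B := (inv R B).toLinearMap.restrictScalars R

/-- The operator which acts on `Ω^p` as multiplication by the scalar `c p`. -/
def degreeScale (c : ℕ → R) : Op R B :=
  ((DirectSum.toModule B ℕ (Forms R B)
      (fun p => algebraMap R B (c p) • (⋀[B]^p (Ω[B⁄R])).subtype)) ∘ₗ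
    (DirectSum.decomposeLinearEquiv (fun p => ⋀[B]^p (Ω[B⁄R]))).toLinearMap).restrictScalars R

theorem degreeScale_apply (c : ℕ → R) {p : ℕ} {α : Forms R B} (hα : α ∈ ⋀[B]^p (Ω[B⁄R])) :
    degreeScale c α = c p • α := by
  have h : DirectSum.decompose (fun p => ⋀[B]^p (Ω[B⁄R])) α =
      DirectSum.of (fun p => ⋀[B]^p (Ω[B⁄R])) p ⟨α, hα⟩ :=
    DirectSum.decompose_of_mem (fun p => ⋀[B]^p (Ω[B⁄R])) hα
  simp only [degreeScale, LinearMap.coe_restrictScalars, LinearMap.comp_apply,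
    LinearEquiv.coe_coe, DirectSum.decomposeLinearEquiv_apply, h]
  rw [← DirectSum.lof_eq_of B, DirectSum.toModule_lof]
  simp

/-- An endomorphism `P` of an exterior algebra raises exterior degree by `j ∈ ℤ`. -/
def Raises {M : Type w} [AddCommGroup M] [Module B M] [Module R M] [IsScalarTower R B M]
    (j : ℤ) (P : Module.End R (ExteriorAlgebra B M)) : Prop :=
  ∀ (p : ℕ), ∀ α ∈ ⋀[B]^p M,
    (∀ q : ℕ, (q : ℤ) = p + j → P α ∈ ⋀[B]^q M) ∧ ((p : ℤ) + j < 0 → P α = 0)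

/-- The graded commutator `P Q - (-1)^{i j} Q P` of operators of degrees `i` and `j`. -/
def gComm (i j : ℤ) (P Q : Op R B) : Op R B := P * Q - (i * j).negOnePow • (Q * P)

/-- `OrdLT k j P`: `P` is a differential operator on the `O_X`-module `L`, homogeneous of
cohomological degree `j` and of order `< k`, i.e. its graded commutators with all elements
of `O_X` have order `< k - 1`, the only operator of order `< 0` being zero. -/
def OrdLT : ℕ → ℤ → Op R B → Prop
  | 0, _, P => P = 0
  | k + 1, j, P => Raises j P ∧ ∀ (q : ℕ), ∀ a ∈ ⋀[B]^q (Derivation R B B),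
      OrdLT k (j - q) (gComm j (-q) P (opOf a))

/-- The operators of degree `j` in `F_k D_X(L)`, where `F` is the filtration by order
(so this is `{0}` for `k < 0`). -/
def DX (k j : ℤ) : Set (Op R B) := {P | OrdLT (k + 1).toNat j P}

/-- Differential operators on `Ω^*` of order `< k` over `B` (no condition on the degree). -/
def BaseOrdLT : ℕ → Op R B → Prop
  | 0, P => P = 0
  | k + 1, P => ∀ b : B, BaseOrdLT k (P * mulOp b - mulOp b * P)

/-- `IsTranspose m j P Q`: the operators `P`, `Q` of degree `j` are related by the
anti-involution `t` of `D_X(L)`, i.e. `Q = P^t`.  Here `m` is the dimension of `Y`.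

The pairing `L ⊗ L → K_Y[m]` is, up to the sign which makes it `O_X`-bilinear, the cup product
`Ω^p ⊗ Ω^{m-p} → Ω^m = K_Y`, and the right `D_Y`-module structure of `K_Y` says that `Q` is the
formal adjoint of `P`: the two sides of `⟨P α, β⟩ = ± ⟨α, Q β⟩` differ by a total divergence
`d (S α)`, with `S` a differential operator depending on `β`. -/
def IsTranspose (m : ℕ) (j : ℤ) (P Q : Op R B) : Prop :=
  ∀ p q : ℕ, (p : ℤ) + j + q = m → ∀ β ∈ ⋀[B]^q (Ω[B⁄R]),
    ∃ (k : ℕ) (S : Op R B), BaseOrdLT k S ∧ ∀ α ∈ ⋀[B]^p (Ω[B⁄R]),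
      P α * β = (j * (p + 1)).negOnePow • (α * Q β) + deRham R B (S α)

/-- The possible coefficients `a`, of degree `j`, of `ħ^i` in self-dual elements of
`∏ ħ^i F_{i+1} D_X(L)`: those `a ∈ F_{i+1} D_X(L)` with `-(-1)^i a^t = a`. -/
def SelfDualCoeff (m : ℕ) (i j : ℤ) : Set (Op R B) :=
  {P | P ∈ DX (i + 1) j ∧ IsTranspose m j P ((i + 1).negOnePow • P)}

/-! ### The canonical exact symplectic structure -/

/-- `ξ` is a graded derivation of `O_X` over `R`, of cohomological degree `e`. -/
def IsGradedDer (e : ℤ) (ξ : Module.End R (Polyvectors R B)) : Prop :=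
  Raises (-e) ξ ∧ ∀ (q : ℕ), ∀ a ∈ ⋀[B]^q (Derivation R B B), ∀ b,
    ξ (a * b) = ξ a * b + (e * q).negOnePow • (a * ξ b)

/-- The bracket `{x, a} = [[P, x], a]` on `O_X` given by the symbol of a second order operator `P`
of degree `1`, for `x` of degree `-r` and `a` of degree `-q`. -/
def symbolBracket (P : Op R B) (r q : ℕ) (x a : Polyvectors R B) : Op R B :=
  gComm (1 - r) (-q) (gComm 1 (-r) P (opOf x)) (opOf a)

/-- Functions `g i` and vector fields `v i` with `db = ∑ v i (b) d(g i)` for all `b`; equivalently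
`∑ v i ⊗ d(g i)` is the canonical element of `T ⊗ Ω¹`. -/
def IsFrame {r : ℕ} (g : Fin r → B) (v : Fin r → Derivation R B B) : Prop :=
  ∀ b : B, KaehlerDifferential.D R B b = ∑ i, v i b • KaehlerDifferential.D R B (g i)

/-- The operators `P ∈ F_2 D_X(L)` of degree `1` and `Q ∈ F_1 D_X(L)` of degree `0` represent the
classical data of the canonical exact symplectic structure
`λ = ν - f`, `ω = dν`, `ν = ∑ v_i d(g_i)`:

* the bivector `π` with bracket `{ , }` given by the symbol of `P` is the inverse of
  `ω = ∑ dv_i d(g_i)`.  That is, `da = ∑ d(g_i) {v_i, a} + dv_i {g_i, a}` for all `a`, an identity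
  of one-forms on `X` which is tested on graded derivations `ξ`;
* the vector field given by the symbol of `Q` is the contraction of `π` with `ν`.

(The remaining component `-f` of `λ` is a function and needs no contraction.) -/
def RepresentsExact (P Q : Op R B) : Prop :=
  P ∈ DX 2 1 ∧ Q ∈ DX 1 0 ∧
  ∀ (r : ℕ) (g : Fin r → B) (v : Fin r → Derivation R B B), IsFrame g v →
    ∀ (q : ℕ), ∀ a ∈ ⋀[B]^q (Derivation R B B),
      (∀ (e : ℤ) (ξ : Module.End R (Polyvectors R B)), IsGradedDer e ξ →
        opOf (ξ a) =
          ∑ i, (opOf (ξ (algebraMap B _ (g i))) *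
                  symbolBracket P 1 q (ExteriorAlgebra.ι B (v i)) a +
                opOf (ξ (ExteriorAlgebra.ι B (v i))) *
                  symbolBracket P 0 q (algebraMap B _ (g i)) a)) ∧
      gComm 0 (-q) Q (opOf a) =
        ∑ i, opOf (ExteriorAlgebra.ι B (v i)) * symbolBracket P 0 q (algebraMap B _ (g i)) a

/-! ## Polynomial forms on simplices and Maurer--Cartan spaces -/

variable (R) in
/-- Polynomial functions on the `n`-simplex: `R[t_0, …, t_n]/(∑ t_i - 1)`. -/
abbrev SimplexRing (n : ℕ) : Type u :=
  MvPolynomial (Fin (n + 1)) R ⧸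
    Ideal.span {(∑ i, MvPolynomial.X i - 1 : MvPolynomial (Fin (n + 1)) R)}

variable (R) in
/-- Pull-back of functions along the map of simplices given by `θ` on vertices. -/
def simplexPull {k n : ℕ} (θ : Fin (k + 1) → Fin (n + 1)) : SimplexRing R n →ₐ[R] SimplexRing R k :=
  Ideal.Quotient.liftₐ _
    (MvPolynomial.aeval fun i => Ideal.Quotient.mk _ (∑ j with θ j = i, MvPolynomial.X j))
    (by
      intro a ha
      have h : Ideal.span {(∑ i, MvPolynomial.X i - 1 : MvPolynomial (Fin (n + 1)) R)} ≤
          RingHom.ker (MvPolynomial.aeval fun i => (Ideal.Quotient.mk _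
            (∑ j with θ j = i, MvPolynomial.X j) : SimplexRing R k)) := by
        rw [Ideal.span_le, Set.singleton_subset_iff]
        simp only [SetLike.mem_coe, RingHom.mem_ker, map_sub, map_sum, MvPolynomial.aeval_X, map_one]
        rw [Finset.sum_fiberwise, ← map_sum, ← map_one (Ideal.Quotient.mk _), ← map_sub]
        exact Ideal.Quotient.eq_zero_iff_mem.mpr (Ideal.subset_span rfl)
      exact h ha)

variable (R) in
/-- The polynomial de Rham algebra of the `n`-simplex, with coefficients in `R`. -/
abbrev SimplexForms (n : ℕ) : Type u := Forms R (SimplexRing R n)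

variable (R B) in
/-- Operators with coefficients in forms on the `n`-simplex, acting on `Ω^* ⊗ Ω(Δ^n)`. -/
def FormOp (n : ℕ) : Type (max u v) := Op R B ⊗[R] SimplexForms R n

instance (n : ℕ) : Ring (FormOp R B n) := inferInstanceAs (Ring (Op R B ⊗[R] SimplexForms R n))

instance (n : ℕ) : Algebra R (FormOp R B n) :=
  inferInstanceAs (Algebra R (Op R B ⊗[R] SimplexForms R n))

/-- The pure tensor `P ⊗ η`. -/
def pureOp {n : ℕ} (P : Op R B) (η : SimplexForms R n) : FormOp R B n := P ⊗ₜ[R] η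

/-- The elements of total degree `J` of `V ⊗ Ω(Δ^n)`, where `V j` is the part of degree `j` of a
graded space of operators.  The Koszul sign rule makes `P ⊗ η`, for `η` a `q`-form, act on
`Ω^* ⊗ Ω(Δ^n)` by `α ⊗ ζ ↦ (-1)^{q deg α} P α ⊗ η ζ`, so as `P (-1)^{q deg}` in the first factor
and as multiplication by `η` in the second. -/
def tensorForms {n : ℕ} (V : ℤ → Set (Op R B)) (J : ℤ) : Submodule R (FormOp R B n) :=
  Submodule.span R {x | ∃ q : ℕ, ∃ P ∈ V (J - q), ∃ η ∈ ⋀[SimplexRing R n]^q (Ω[SimplexRing R n⁄R]),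
    x = pureOp (P * parity R B ^ q) η}

/-- The differential of `Ω(Δ^n)` on operators with coefficients in forms:
`P ⊗ η ↦ (-1)^{deg P} P ⊗ dη`. -/
def simplexDiff {n : ℕ} : FormOp R B n →+ FormOp R B n :=
  (AddMonoidHom.mulLeft (pureOp (parity R B) 1)).comp
    (LinearMap.lTensor (Op R B) (deRham R (SimplexRing R n))).toAddMonoidHom

variable (R B) in
/-- Laurent series in `ħ` with coefficients in `FormOp R B n`. -/
abbrev QSeries (n : ℕ) : Type (max u v) := HahnSeries ℤ (FormOp R B n)

/-- The operator `P ħ^i`, as a constant function on the simplex. -/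
def term {n : ℕ} (i : ℤ) (P : Op R B) : QSeries R B n := HahnSeries.single i (pureOp P 1)

/-- The derivation `ħ ∂/∂ħ`. -/
def hbarDer {n : ℕ} (x : QSeries R B n) : QSeries R B n where
  coeff i := i • x.coeff i
  isPWO_support' := x.isPWO_support.mono fun i hi => by
    rw [Function.mem_support] at hi
    exact fun h => hi (by rw [h, smul_zero])

/-- `IsQuantisation m f (Δ, D)`: the pair `(Δ, D)` is an `n`-simplex in the space of self-dual
quantisations with `ħ∂_ħ`-derivation of the canonical exact `(-1)`-shifted symplectic structure of
the derived critical locus of `f`, on the line bundle `L`.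

The first four conditions say that `Δ + D ε` is a Maurer--Cartan element of
`cocone (ħ∂_ħ : ∏_{i ≥ 1} ħ^i F_{i+1} D_X(L) → ∏_{i ≥ -1} ħ^i F_{i+1} D_X(L) ε)^{* = id} ⊗ Ω(Δ^n)`,
equivalently that `δ + d_{Δ^n} + Δ` squares to zero and commutes with `ħ∂_ħ + D`.  The last
condition says that its reduction modulo `ħ`, an `n`-simplex in the space of Poisson structures
with formal derivation, is constant and corresponds to the exact symplectic structure. -/
structure IsQuantisation (m : ℕ) (f : B) {n : ℕ} (x : QSeries R B n × QSeries R B n) : Prop where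
  coeff_fst : ∀ i : ℤ, (i ≤ 0 → x.1.coeff i = 0) ∧ x.1.coeff i ∈ tensorForms (SelfDualCoeff m i) 1
  coeff_snd : ∀ i : ℤ, x.2.coeff i ∈ tensorForms (SelfDualCoeff m i) 0
  square_zero : (term 0 (koszul f) + x.1) * (term 0 (koszul f) + x.1) + x.1.map simplexDiff = 0
  connection : (term 0 (koszul f) + x.1) * x.2 - x.2 * (term 0 (koszul f) + x.1) +
    x.2.map simplexDiff = hbarDer x.1
  classical : ∃ P Q : Op R B, RepresentsExact P Q ∧
    (∀ i : ℤ, (x.1 - term 1 P).coeff i ∈ tensorForms (DX i) 1) ∧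
    (∀ i : ℤ, (x.2 - (term 0 Q - term (-1) (mulOp f))).coeff i ∈ tensorForms (DX i) 0)

/-- Compatibility of `x` over `C` with `y` over `B`, for a restriction map `ρ : B → C` and a face
`θ : Δ^k → Δ^n`: the restriction of `y` along `ρ` is the restriction of `x` to the face.  The
restriction along `ρ` of an operator on `Ω^*_B` is the differential operator on `Ω^*_C` which
commutes with the pull-back of forms. -/
def Restricts {C : Type w} [CommRing C] [Algebra R C] (ρ : B →ₐ[R] C) {k n : ℕ}
    (θ : Fin (k + 1) → Fin (n + 1)) (y : QSeries R B k) (x : QSeries R C n) : Prop :=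
  ∀ i : ℤ,
    TensorProduct.map (LinearMap.lcomp R (Forms R C) (formsMap ρ).toLinearMap)
        (formsMap (simplexPull R θ)).toLinearMap (x.coeff i) =
      LinearMap.rTensor (SimplexForms R k) (LinearMap.compRight R (formsMap ρ).toLinearMap)
        (y.coeff i)

/-! ### The explicit quantisation -/

/-- `Δ = ħ d`. -/
def explicitDelta (n : ℕ) : QSeries R B n := term 1 (deRham R B)

/-- The operator acting on `Ω^p` as multiplication by `(m/2 - p) - ħ⁻¹ f`. -/
def explicitD [Algebra ℚ R] (m : ℕ) (f : B) (n : ℕ) : QSeries R B n :=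
  term 0 (degreeScale fun p => algebraMap ℚ R ((m : ℚ) / 2 - p)) - term (-1) (mulOp f)

variable (R B) in
/-- The comparison map `i^*K_Y = O_X ⊗ Ω^m → Ω^*`, `a ⊗ κ ↦ a ⌟ κ`. -/
def lineBundleMap (m : ℕ) :
    Polyvectors R B ⊗[B] (⋀[B]^m (Ω[B⁄R])) →ₗ[B] Forms R B :=
  TensorProduct.lift
    ((LinearMap.lcomp B (Forms R B) (⋀[B]^m (Ω[B⁄R])).subtype) ∘ₗ (act R B).toLinearMap)

end Algebra

/-! ## Globalisation

For a scheme `Y` over `R`, the space of quantisations is the Maurer--Cartan space of derived global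
sections.  It is modelled as the homotopy limit over the poset of affine open subsets: an
`N`-simplex consists of compatible simplices, one for each simplex of the nerve of
`affineOpens × [N]`. -/

section Scheme

variable {R : Type u} [CommRing R] {Y : Scheme.{u}} (s : Y ⟶ Spec (CommRingCat.of R))

/-- Functions on an open subset `U` of the `R`-scheme `Y`. -/
def Sections (_ : Y ⟶ Spec (CommRingCat.of R)) (U : Y.Opens) : Type u := Γ(Y, U)

instance (U : Y.Opens) : CommRing (Sections s U) := inferInstanceAs (CommRing Γ(Y, U))

instance (U : Y.Opens) : Algebra R (Sections s U) :=
  ((Y.presheaf.map (homOfLE (le_top : U ≤ ⊤)).op).hom.comp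
    (((Scheme.ΓSpecIso (CommRingCat.of R)).inv ≫ s.appTop).hom)).toAlgebra

/-- Restriction of functions from `U` to `V ⊆ U`. -/
def restrict {U V : Y.Opens} (h : V ≤ U) : Sections s U →ₐ[R] Sections s V :=
  { (Y.presheaf.map (homOfLE h).op).hom with
    commutes' := fun r => by
      change ((Y.presheaf.map (homOfLE (le_top : U ≤ ⊤)).op) ≫
        (Y.presheaf.map (homOfLE h).op)).hom _ = _
      rw [← Functor.map_comp]
      rfl }

/-- The restriction of a global function to `U`. -/
def resTop (f : Γ(Y, ⊤)) (U : Y.Opens) : Sections s U :=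
  (Y.presheaf.map (homOfLE (le_top : U ≤ ⊤)).op).hom f

variable (Y) in
/-- Non-degenerate `n`-simplices of the nerve of the poset `affineOpens × [N]`. -/
structure Chain (N n : ℕ) where
  /-- the vertices of the simplex -/
  vertex : Fin (n + 1) → Y.affineOpens × Fin (N + 1)
  strictMono : StrictMono vertex

namespace Chain

variable {N n k : ℕ}

/-- The smallest open subset occurring in a chain. -/
def opens (c : Chain Y N n) : Y.Opens := (c.vertex 0).1

/-- The face of a chain spanned by the vertices in the image of `θ`. -/
def face (c : Chain Y N n) (θ : Fin (k + 1) ↪o Fin (n + 1)) : Chain Y N k :=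
  ⟨c.vertex ∘ θ, c.strictMono.comp θ.strictMono⟩

theorem opens_le (c : Chain Y N n) (θ : Fin (k + 1) ↪o Fin (n + 1)) :
    c.opens ≤ (c.face θ).opens :=
  (c.strictMono.monotone (Fin.zero_le (θ 0))).1

/-- The chain projects to the boundary of the simplex `Δ^N`. -/
def OnBoundary (c : Chain Y N n) : Prop := ¬ Function.Surjective fun i => (c.vertex i).2

end Chain

/-- Families of pairs `(Δ, D)` indexed by chains. -/
abbrev Cochains (N : ℕ) : Type u :=
  ∀ (n : ℕ) (c : Chain Y N n), QSeries R (Sections s c.opens) n × QSeries R (Sections s c.opens) n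

/-- The members of the family `x` at the chains satisfying `T` form a compatible family of
simplices in the spaces of quantisations.  If `T` holds always, then this says that `x` is an
`N`-simplex of the space of self-dual quantisations with `ħ∂_ħ`-derivation of the canonical exact
`(-1)`-shifted symplectic structure on the derived critical locus of `f`. -/
def IsQuantisationOn (m : ℕ) (f : Γ(Y, ⊤)) {N : ℕ} (T : ∀ n, Chain Y N n → Prop)
    (x : Cochains s N) : Prop :=
  ∀ (n : ℕ) (c : Chain Y N n), T n c →
    IsQuantisation m (resTop s f c.opens) (x n c) ∧
    ∀ (k : ℕ) (θ : Fin (k + 1) ↪o Fin (n + 1)),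
      Restricts (restrict s (c.opens_le θ)) θ (x k (c.face θ)).1 (x n c).1 ∧
      Restricts (restrict s (c.opens_le θ)) θ (x k (c.face θ)).2 (x n c).2

/-- The space of self-dual quantisations with `ħ∂_ħ`-derivation of the canonical exact
`(-1)`-shifted symplectic structure is contractible: every map from the boundary of `Δ^N` to it
extends to `Δ^N`.  For `N = 0` this says that it is non-empty, and for `N = 1` that any two
points are connected by a path. -/
def QuantisationsContractible (m : ℕ) (f : Γ(Y, ⊤)) : Prop :=
  ∀ (N : ℕ) (x : Cochains s N), IsQuantisationOn s m f (fun _ c => c.OnBoundary) x →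
    ∃ y : Cochains s N, IsQuantisationOn s m f (fun _ _ => True) y ∧
      ∀ (n : ℕ) (c : Chain Y N n), c.OnBoundary → y n c = x n c

end Scheme

end DCrit

end

/-! Locally on Y the cotangent module Ω¹ is finite projective of rank m, so there are functions g_i
and vector fields v_i with db = Σ v_i(b) dg_i for all b and Σ v_i(g_i) = m. Such a frame replaces
étale coordinates. On Ω^p the operators Σ dg_i ι_{v_i} and Σ ι_{v_i} dg_i are multiplication by p
and by m - p, and since ℚ ⊆ R one may divide by these integers when they are non-zero. This yields
Ω^p = 0 for p > m, the generation of Ω^* from top forms by contractions, the isomorphism of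
complexes (`lineBundleMap_isomorphism`), and the fact that operators of order zero are polyvector
fields (`OrdLT.exists_opOf`).

Put Q = df + ħd and D = N - ħ⁻¹f, where N is m/2 - p on Ω^p. That this is a point is a computation:
Q² = 0 and [Q, D] = ħd; the transpose of d is d, and N changes sign under p ↔ m - p; finally [d, b]
= db ∧ and [d, ι_v] = L_v give the canonical Poisson bracket (`isQuantisation_explicit`).

For contractibility, let 𝔤_k consist of the self-dual series whose coefficient of ħ^i has order at
most i + 1 - k. Another quantisation is (Q + x, D + y), and the classical condition puts x and y in
𝔤_1. Self-duality then puts them in 𝔤_2 (`filt_two_of_filt_one`), because an operator of order i at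
ħ^i would need a transpose of the wrong sign. Let h(x) be -1/2 times the sum over i of ι_{v_i}
[ħ⁻¹g_i, x] ± [ħ⁻¹g_i, x] ι_{v_i}. By Cartan calculus and Euler's identity for symbols, A = ħ∂_ħ +
[D, -] - [[Q, -] + ∂, h] acts on 𝔤_k/𝔤_{k+1} as k - 1 (`contraction_euler`), which is invertible for
k ≥ 2. With u = y - h(x) the Maurer--Cartan equations imply a fixed point equation A x = Φ(u, x), in
which Φ(u, -) raises the filtration of differences. So each u in 𝔤_2 of degree 0 determines exactly
one x, and the Bianchi identities show that this x solves the Maurer--Cartan equations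
(`MCData.isMC_of_fixed_point`).

Thus (x, y) ↦ u identifies the Maurer--Cartan space of an affine chart with a linear space,
compatibly with faces of simplices. Filling a boundary becomes the extension of polynomial forms
from the boundary of a simplex (`exists_extension`, `exists_fill`).

To globalise, differential operators and their transposes extend uniquely along open immersions,
hence so do quantisations (`FrameExtension.exists_quantisation`, `FrameExtension.series_unique`). A
filling is chosen by recursion on the dimension of chains: the values on the proper faces are
restricted to the smallest open set of the chain, where `exists_fill` applies (`exists_chain_fill`).
-/

noncomputable section

namespace DCrit

/-! ## Graded commutators and exterior algebras -/

/-- The ring structure on operators, found before the additive structure of linear maps. -/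
instance (priority := 5000) opRing (R : Type u) [CommRing R] (B : Type v) [CommRing B]
    [Algebra R B] : Ring (Op R B) := Module.End.instRing

section Signs

variable {M : Type w} [AddCommGroup M]

theorem negOnePow_smul_smul (n : ℤ) (x : M) : n.negOnePow • n.negOnePow • x = x := by
  rw [smul_smul, ← Int.negOnePow_add, Int.negOnePow_even _ (Even.add_self n), one_smul]

theorem negOnePow_smul_mem {S : AddSubgroup M} (n : ℤ) {x : M} (h : x ∈ S) :
    n.negOnePow • x ∈ S := by
  rcases Int.units_eq_one_or n.negOnePow with h' | h' <;> rw [h'] <;> simpa using h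

end Signs

/-! ### Degrees and signs in exterior algebras -/

section Exterior

variable {B : Type v} [CommRing B] {M : Type w} [AddCommGroup M] [Module B M]

theorem involute_of_mem {q : ℕ} {a : ExteriorAlgebra B M} (ha : a ∈ ⋀[B]^q M) :
    CliffordAlgebra.involute a = (q : ℤ).negOnePow • a := by
  induction ha using Submodule.pow_induction_on_left' with
  | algebraMap r => simp
  | add x y i hx hy hx' hy' => rw [map_add, hx', hy', smul_add]
  | mem_mul x hx i y hy hy' =>
    obtain ⟨v, rfl⟩ := hx
    rw [map_mul, hy', CliffordAlgebra.involute_ι, Nat.cast_succ, Int.negOnePow_succ, Units.neg_smul,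
      neg_mul, mul_smul_comm]

theorem ι_mul_eq (v : M) (a : ExteriorAlgebra B M) :
    ExteriorAlgebra.ι B v * a = CliffordAlgebra.involute a * ExteriorAlgebra.ι B v := by
  induction a using CliffordAlgebra.induction with
  | algebraMap r => simp [Algebra.commutes]
  | ι x =>
    simp only [CliffordAlgebra.involute_ι, neg_mul]
    exact eq_neg_of_add_eq_zero_left (ExteriorAlgebra.ι_add_mul_swap _ _)
  | mul a b ha hb => rw [← mul_assoc, ha, mul_assoc, hb, map_mul, mul_assoc]
  | add a b ha hb => rw [mul_add, ha, hb, map_add, add_mul]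

theorem graded_comm {p q : ℕ} {a b : ExteriorAlgebra B M} (ha : a ∈ ⋀[B]^p M)
    (hb : b ∈ ⋀[B]^q M) : a * b = ((p : ℤ) * q).negOnePow • (b * a) := by
  induction ha using Submodule.pow_induction_on_left' with
  | algebraMap r => simp [Algebra.commutes]
  | add x y i hx hy hx' hy' => rw [add_mul, hx', hy', mul_add, smul_add]
  | mem_mul x hx i y hy hy' =>
    obtain ⟨v, rfl⟩ := hx
    rw [mul_assoc, hy', mul_smul_comm, ← mul_assoc, ι_mul_eq, involute_of_mem hb, smul_mul_assoc,
      smul_mul_assoc, smul_smul, ← Int.negOnePow_add, mul_assoc]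
    congr 2
    push_cast
    ring

theorem ι_mem (v : M) : ExteriorAlgebra.ι B v ∈ ⋀[B]^1 M := by
  change _ ∈ LinearMap.range (ExteriorAlgebra.ι B) ^ 1
  rw [pow_one]; exact ⟨v, rfl⟩

theorem algebraMap_mem (b : B) : algebraMap B (ExteriorAlgebra B M) b ∈ ⋀[B]^0 M := by
  change _ ∈ LinearMap.range (ExteriorAlgebra.ι B) ^ 0
  rw [pow_zero]; exact Submodule.algebraMap_mem b

theorem mul_mem_exteriorPower {p q : ℕ} {a b : ExteriorAlgebra B M} (ha : a ∈ ⋀[B]^p M)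
    (hb : b ∈ ⋀[B]^q M) : a * b ∈ ⋀[B]^(p + q) M := by
  change _ ∈ LinearMap.range (ExteriorAlgebra.ι B) ^ (p + q)
  rw [pow_add]; exact Submodule.mul_mem_mul ha hb

/-- Degree zero is kept apart because its target degree does not exist as a natural number. The two
clauses match those of `Raises`. -/
theorem contractLeft_mem_exteriorPower (φ : Module.Dual B M) {q : ℕ} {a : ExteriorAlgebra B M}
    (ha : a ∈ ⋀[B]^q M) :
    (∀ p : ℕ, p + 1 = q → CliffordAlgebra.contractLeft φ a ∈ ⋀[B]^p M) ∧
      (q = 0 → CliffordAlgebra.contractLeft φ a = 0) := by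
  induction ha using Submodule.pow_induction_on_left' with
  | algebraMap r =>
    exact ⟨fun p h => by omega, fun _ => CliffordAlgebra.contractLeft_algebraMap _ _ _⟩
  | add x y i hx hy hx' hy' =>
    exact ⟨fun p h => by rw [map_add]; exact add_mem (hx'.1 p h) (hy'.1 p h),
      fun h => by rw [map_add, hx'.2 h, hy'.2 h, add_zero]⟩
  | mem_mul x hx i y hy hy' =>
    obtain ⟨v, rfl⟩ := hx
    refine ⟨fun p h => ?_, fun h => by omega⟩
    obtain rfl : p = i := by omega
    have e := CliffordAlgebra.contractLeft_ι_mul (Q := (0 : QuadraticForm B M)) (d := φ) v y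
    change CliffordAlgebra.contractLeft φ (CliffordAlgebra.ι _ v * y) ∈ _
    rw [e]
    refine sub_mem (Submodule.smul_mem _ _ hy) ?_
    rcases p with _ | p
    · rw [hy'.2 rfl, mul_zero]; exact zero_mem _
    · rw [add_comm p 1]
      exact mul_mem_exteriorPower (ι_mem v) (hy'.1 p rfl)

variable {R : Type u} [CommRing R] [Module R M] [Algebra R B] [IsScalarTower R B M]

theorem Raises.mul {i j : ℤ} {P Q : Module.End R (ExteriorAlgebra B M)} (hP : Raises (B := B) i P)
    (hQ : Raises (B := B) j Q) : Raises (B := B) (i + j) (P * Q) := by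
  intro p α hα
  by_cases h : (p : ℤ) + j < 0
  · have h0 : (P * Q) α = 0 := by rw [Module.End.mul_apply, (hQ p α hα).2 h, map_zero]
    exact ⟨fun q _ => by rw [h0]; exact zero_mem _, fun _ => h0⟩
  · obtain ⟨r, hr⟩ := Int.eq_ofNat_of_zero_le (not_lt.1 h)
    have := (hQ p α hα).1 r (by rw [hr])
    exact ⟨fun q hq => (hP r _ this).1 q (by rw [hq, ← hr]; ring),
      fun h' => (hP r _ this).2 (by rw [← hr]; linarith)⟩

theorem Raises.add {i : ℤ} {P Q : Module.End R (ExteriorAlgebra B M)} (hP : Raises (B := B) i P)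
    (hQ : Raises (B := B) i Q) : Raises (B := B) i (P + Q) := fun p α hα =>
  ⟨fun q hq => by
    rw [LinearMap.add_apply]; exact add_mem ((hP p α hα).1 q hq) ((hQ p α hα).1 q hq),
   fun h => by rw [LinearMap.add_apply, (hP p α hα).2 h, (hQ p α hα).2 h, add_zero]⟩

theorem Raises.neg {i : ℤ} {P : Module.End R (ExteriorAlgebra B M)} (hP : Raises (B := B) i P) :
    Raises (B := B) i (-P) := fun p α hα =>
  ⟨fun q hq => by
    rw [LinearMap.neg_apply]; exact neg_mem ((hP p α hα).1 q hq),
   fun h => by rw [LinearMap.neg_apply, (hP p α hα).2 h, neg_zero]⟩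

theorem Raises.sub {i : ℤ} {P Q : Module.End R (ExteriorAlgebra B M)} (hP : Raises (B := B) i P)
    (hQ : Raises (B := B) i Q) : Raises (B := B) i (P - Q) := by
  rw [sub_eq_add_neg]; exact hP.add hQ.neg

theorem Raises.zero {i : ℤ} : Raises (B := B) i (0 : Module.End R (ExteriorAlgebra B M)) :=
  fun _ _ _ => ⟨fun _ _ => zero_mem _, fun _ => rfl⟩

theorem Raises.units_smul {i : ℤ} (ε : ℤˣ) {P : Module.End R (ExteriorAlgebra B M)}
    (hP : Raises (B := B) i P) : Raises (B := B) i (ε • P) := by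
  rcases Int.units_eq_one_or ε with h | h <;> rw [h]
  · simpa using hP
  · simpa using hP.neg

theorem Raises.congr {i j : ℤ} {P : Module.End R (ExteriorAlgebra B M)} (hP : Raises (B := B) i P)
    (h : i = j) : Raises (B := B) j P := h ▸ hP

end Exterior

/-! ### Calculus of graded commutators and of the order filtration -/

section Comm

variable {R : Type u} [CommRing R] {B : Type v} [CommRing B] [Algebra R B]

theorem gComm_add_left (i j : ℤ) (P P' Q : Op R B) :
    gComm i j (P + P') Q = gComm i j P Q + gComm i j P' Q := by
  simp only [gComm, add_mul, mul_add, smul_add]; abel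

theorem gComm_add_right (i j : ℤ) (P Q Q' : Op R B) :
    gComm i j P (Q + Q') = gComm i j P Q + gComm i j P Q' := by
  simp only [gComm, add_mul, mul_add, smul_add]; abel

theorem gComm_sub_left (i j : ℤ) (P P' Q : Op R B) :
    gComm i j (P - P') Q = gComm i j P Q - gComm i j P' Q := by
  simp only [gComm, sub_mul, mul_sub, smul_sub]; abel

theorem gComm_neg_left (i j : ℤ) (P Q : Op R B) : gComm i j (-P) Q = -gComm i j P Q := by
  simp only [gComm, neg_mul, mul_neg, smul_neg]; abel

theorem gComm_zero_left (i j : ℤ) (Q : Op R B) : gComm i j 0 Q = 0 := by simp [gComm]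

theorem gComm_zero_right (i j : ℤ) (Q : Op R B) : gComm i j Q 0 = 0 := by simp [gComm]

theorem gComm_smul_left (i j : ℤ) (r : R) (P Q : Op R B) :
    gComm i j (r • P) Q = r • gComm i j P Q := by
  simp only [gComm, smul_mul_assoc, mul_smul_comm, smul_sub]
  rw [smul_comm r]

theorem gComm_sum_left {ι : Type*} (s : Finset ι) (i j : ℤ) (P : ι → Op R B) (Q : Op R B) :
    gComm i j (∑ a ∈ s, P a) Q = ∑ a ∈ s, gComm i j (P a) Q := by
  simp only [gComm, Finset.sum_mul, Finset.mul_sum, Finset.smul_sum, Finset.sum_sub_distrib]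

theorem gComm_units_smul_left (i j : ℤ) (ε : ℤˣ) (P Q : Op R B) :
    gComm i j (ε • P) Q = ε • gComm i j P Q := by
  rcases Int.units_eq_one_or ε with h | h <;> rw [h] <;> simp [gComm_neg_left]

/-- The graded Leibniz rule. Here and in the next two identities the signs are generalised to units
of ℤ; as each of them is ±1, finitely many identities in a noncommutative ring remain. -/
theorem gComm_mul_right (i j k : ℤ) (P Q S : Op R B) :
    gComm i (j + k) P (Q * S) =
      gComm i j P Q * S + (i * j).negOnePow • (Q * gComm i k P S) := by
  simp only [gComm, mul_add, Int.negOnePow_add]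
  generalize (i * j).negOnePow = a
  generalize (i * k).negOnePow = b
  rcases Int.units_eq_one_or a with rfl | rfl <;> rcases Int.units_eq_one_or b with rfl | rfl <;>
    simp only [one_smul, Units.neg_smul, mul_one, neg_neg, mul_neg] <;>
    noncomm_ring

theorem gComm_mul_left (i j k : ℤ) (P Q S : Op R B) :
    gComm (i + j) k (P * Q) S =
      P * gComm j k Q S + (j * k).negOnePow • (gComm i k P S * Q) := by
  simp only [gComm, add_mul, Int.negOnePow_add]
  generalize (j * k).negOnePow = a
  generalize (i * k).negOnePow = b
  rcases Int.units_eq_one_or a with rfl | rfl <;> rcases Int.units_eq_one_or b with rfl | rfl <;>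
    simp only [one_smul, Units.neg_smul, mul_one, neg_neg, mul_neg] <;>
    noncomm_ring

theorem gComm_jacobi' (i j k : ℤ) (P Q S : Op R B) :
    gComm (i + j) k (gComm i j P Q) S =
      gComm i (j + k) P (gComm j k Q S) + (j * k).negOnePow • gComm (i + k) j (gComm i k P S) Q := by
  simp only [gComm, add_mul, mul_add, Int.negOnePow_add, mul_comm k j]
  generalize (i * j).negOnePow = a
  generalize (i * k).negOnePow = b
  generalize (j * k).negOnePow = c
  rcases Int.units_eq_one_or a with rfl | rfl <;> rcases Int.units_eq_one_or b with rfl | rfl <;>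
    rcases Int.units_eq_one_or c with rfl | rfl <;>
    simp only [one_smul, Units.neg_smul, mul_one, neg_neg, mul_neg] <;>
    noncomm_ring

theorem gComm_symm (i j : ℤ) (P Q : Op R B) :
    gComm i j P Q = -((i * j).negOnePow • gComm j i Q P) := by
  simp only [gComm, mul_comm j i]
  generalize (i * j).negOnePow = a
  rcases Int.units_eq_one_or a with rfl | rfl <;>
    simp only [one_smul, Units.neg_smul] <;> noncomm_ring

theorem Raises.gComm {i j : ℤ} {P Q : Op R B} (hP : Raises (B := B) i P)
    (hQ : Raises (B := B) j Q) : Raises (B := B) (i + j) (gComm i j P Q) :=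
  (hP.mul hQ).sub (((hQ.mul hP).congr (add_comm _ _)).units_smul _)

/-! ### Polyvectors as operators -/

theorem opOf_mul (a b : Polyvectors R B) : opOf (a * b) = opOf a * opOf b := by
  ext; simp [opOf]

theorem opOf_add (a b : Polyvectors R B) : opOf (a + b) = opOf a + opOf b := by
  ext; simp [opOf]

theorem opOf_algebraMap (b : B) : opOf (algebraMap B (Polyvectors R B) b) = mulOp b := by
  ext; simp [opOf, mulOp, Algebra.smul_def]

theorem opOf_smul (b : B) (a : Polyvectors R B) : opOf (b • a) = mulOp b * opOf a := by
  rw [Algebra.smul_def, opOf_mul, opOf_algebraMap]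

theorem opOf_units_smul (ε : ℤˣ) (a : Polyvectors R B) : opOf (ε • a) = ε • opOf a := by
  ext
  rcases Int.units_eq_one_or ε with rfl | rfl <;> simp [opOf]

theorem opOf_zero : opOf (0 : Polyvectors R B) = 0 := by ext; simp [opOf]

theorem opOf_sub (a b : Polyvectors R B) : opOf (a - b) = opOf a - opOf b := by
  ext; simp [opOf]

theorem opOf_sum {ι : Type*} (s : Finset ι) (a : ι → Polyvectors R B) :
    opOf (∑ i ∈ s, a i) = ∑ i ∈ s, opOf (a i) :=
  map_sum (AddMonoidHom.mk' (opOf (R := R) (B := B)) opOf_add) a s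

theorem opOf_smul' (r : R) (a : Polyvectors R B) : opOf (r • a) = r • opOf a := by
  rw [← algebraMap_smul B r a, opOf_smul]
  ext α
  simp [mulOp, Algebra.smul_def, ← IsScalarTower.algebraMap_apply]

theorem mulOp_mul (a b : B) : mulOp (R := R) (a * b) = mulOp a * mulOp b := by
  simp only [← opOf_algebraMap, map_mul, opOf_mul]

theorem mulOp_add (a b : B) : mulOp (R := R) (a + b) = mulOp a + mulOp b := by
  simp only [← opOf_algebraMap, map_add, opOf_add]

theorem mulOp_sub (a b : B) : mulOp (R := R) (a - b) = mulOp a - mulOp b := by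
  simp only [← opOf_algebraMap, map_sub, opOf_sub]

theorem mulOp_apply (b : B) (α : Forms R B) : mulOp b α = b • α := by
  simp [mulOp, Algebra.smul_def]

theorem smul_op (b : B) (P : Op R B) : b • P = mulOp b * P := by
  ext α; rw [LinearMap.smul_apply, Module.End.mul_apply, mulOp_apply]

theorem mulOp_zero : mulOp (R := R) (0 : B) = 0 := by
  ext; simp [mulOp_apply]

theorem mulOp_algebraMap (r : R) (P : Op R B) : mulOp (algebraMap R B r) * P = r • P := by
  rw [← smul_op]; ext; simp

/-- Contraction with a vector field. -/
def iota (v : Derivation R B B) : Op R B := opOf (ExteriorAlgebra.ι B v)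

theorem iota_apply (v : Derivation R B B) (α : Forms R B) : iota v α =
    CliffordAlgebra.contractLeft ((KaehlerDifferential.linearMapEquivDerivation R B).symm v) α := by
  simp only [iota, opOf, act, LinearMap.coe_restrictScalars, ExteriorAlgebra.lift_ι_apply]
  rfl

theorem iota_add (v w : Derivation R B B) : iota (v + w) = iota v + iota w := by
  simp only [iota, map_add, opOf_add]

theorem iota_smul (b : B) (v : Derivation R B B) : iota (b • v) = mulOp b * iota v := by
  simp only [iota, map_smul, opOf_smul]

theorem iota_sum {ι : Type*} (s : Finset ι) (v : ι → Derivation R B B) :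
    iota (∑ i ∈ s, v i) = ∑ i ∈ s, iota (v i) :=
  map_sum (AddMonoidHom.mk' (iota (R := R) (B := B)) iota_add) v s

theorem raises_mulOp (b : B) : Raises (B := B) 0 (mulOp (R := R) b) := fun p α hα =>
  ⟨fun q hq => by
    obtain rfl : q = p := by omega
    rw [mulOp_apply]; exact Submodule.smul_mem _ _ hα, fun h => by omega⟩

theorem raises_iota (v : Derivation R B B) : Raises (B := B) (-1) (iota v) := fun p α hα =>
  ⟨fun q hq => by
    rw [iota_apply]; exact (contractLeft_mem_exteriorPower _ hα).1 q (by omega), fun h => by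
    rw [iota_apply]; exact (contractLeft_mem_exteriorPower _ hα).2 (by omega)⟩

theorem raises_opOf {q : ℕ} {a : Polyvectors R B} (ha : a ∈ ⋀[B]^q (Derivation R B B)) :
    Raises (B := B) (-q) (opOf a) := by
  induction ha using Submodule.pow_induction_on_left' with
  | algebraMap r => rw [opOf_algebraMap]; exact raises_mulOp r
  | add x y i hx hy hx' hy' => rw [opOf_add]; exact hx'.add hy'
  | mem_mul x hx i y hy hy' =>
    obtain ⟨v, rfl⟩ := hx
    rw [opOf_mul]
    exact ((raises_iota v).mul hy').congr (by push_cast; ring)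

theorem gComm_opOf_opOf {p q : ℕ} {a b : Polyvectors R B} (ha : a ∈ ⋀[B]^p (Derivation R B B))
    (hb : b ∈ ⋀[B]^q (Derivation R B B)) : gComm (-p) (-q) (opOf a) (opOf b) = 0 := by
  rw [gComm, ← opOf_mul, ← opOf_mul, graded_comm ha hb, opOf_units_smul, neg_mul_neg, sub_self]

/-! ### The order filtration -/

theorem OrdLT.congr {k : ℕ} {i j : ℤ} {P : Op R B} (hP : OrdLT k i P) (h : i = j) :
    OrdLT k j P := h ▸ hP

theorem OrdLT.raises {k : ℕ} {j : ℤ} {P : Op R B} (h : OrdLT k j P) : Raises (B := B) j P := by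
  cases k with
  | zero => rw [show P = 0 from h]; exact Raises.zero
  | succ k => exact h.1

theorem OrdLT.zero (k : ℕ) (j : ℤ) : OrdLT k j (0 : Op R B) := by
  induction k generalizing j with
  | zero => rfl
  | succ k ih => exact ⟨Raises.zero, fun q a _ => by rw [gComm_zero_left]; exact ih _⟩

theorem OrdLT.add {k : ℕ} {j : ℤ} {P Q : Op R B} (hP : OrdLT k j P) (hQ : OrdLT k j Q) :
    OrdLT k j (P + Q) := by
  induction k generalizing j P Q with
  | zero => rw [show P = 0 from hP, show Q = 0 from hQ, add_zero]; rfl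
  | succ k ih =>
    exact ⟨hP.1.add hQ.1, fun q a ha => by
      rw [gComm_add_left]; exact ih (hP.2 q a ha) (hQ.2 q a ha)⟩

theorem OrdLT.neg {k : ℕ} {j : ℤ} {P : Op R B} (hP : OrdLT k j P) : OrdLT k j (-P) := by
  induction k generalizing j P with
  | zero => rw [show P = 0 from hP, neg_zero]; rfl
  | succ k ih =>
    exact ⟨hP.1.neg, fun q a ha => by rw [gComm_neg_left]; exact ih (hP.2 q a ha)⟩

theorem OrdLT.sub {k : ℕ} {j : ℤ} {P Q : Op R B} (hP : OrdLT k j P) (hQ : OrdLT k j Q) :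
    OrdLT k j (P - Q) := by
  rw [sub_eq_add_neg]; exact hP.add hQ.neg

theorem OrdLT.sum {ι : Type*} {s : Finset ι} {k : ℕ} {j : ℤ} {P : ι → Op R B}
    (h : ∀ i ∈ s, OrdLT k j (P i)) : OrdLT k j (∑ i ∈ s, P i) :=
  Finset.sum_induction P (OrdLT k j) (fun _ _ => OrdLT.add) (OrdLT.zero k j) h

theorem OrdLT.units_smul {k : ℕ} {j : ℤ} {P : Op R B} (hP : OrdLT k j P) (ε : ℤˣ) :
    OrdLT k j (ε • P) := by
  rcases Int.units_eq_one_or ε with h | h <;> rw [h]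
  · simpa using hP
  · simpa using hP.neg

theorem OrdLT.succ {k : ℕ} {j : ℤ} {P : Op R B} (hP : OrdLT k j P) : OrdLT (k + 1) j P := by
  induction k generalizing j P with
  | zero => rw [show P = 0 from hP]; exact OrdLT.zero _ _
  | succ k ih => exact ⟨hP.1, fun q a ha => ih (hP.2 q a ha)⟩

theorem OrdLT.mono {k l : ℕ} {j : ℤ} {P : Op R B} (hP : OrdLT k j P) (h : k ≤ l) :
    OrdLT l j P := by
  induction h with
  | refl => exact hP
  | step _ ih => exact ih.succ

/-- Elements of `O_X` graded-commute with one another, so only the commutator with `P` survives in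
the Leibniz rule. -/
theorem OrdLT.opOf_mul {k : ℕ} {j : ℤ} {P : Op R B} (hP : OrdLT k j P) {q : ℕ}
    {a : Polyvectors R B} (ha : a ∈ ⋀[B]^q (Derivation R B B)) :
    OrdLT k (-q + j) (opOf a * P) := by
  induction k generalizing j P with
  | zero => rw [show P = 0 from hP, mul_zero]; rfl
  | succ k ih =>
    refine ⟨(raises_opOf ha).mul hP.1, fun r c hc => ?_⟩
    rw [gComm_mul_left, gComm_opOf_opOf ha hc, zero_mul, smul_zero, add_zero]
    exact (ih (hP.2 r c hc)).congr (by ring)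

theorem OrdLT.mul_opOf {k : ℕ} {j : ℤ} {P : Op R B} (hP : OrdLT k j P) {q : ℕ}
    {a : Polyvectors R B} (ha : a ∈ ⋀[B]^q (Derivation R B B)) :
    OrdLT k (j + -q) (P * opOf a) := by
  induction k generalizing j P with
  | zero => rw [show P = 0 from hP, zero_mul]; rfl
  | succ k ih =>
    refine ⟨hP.1.mul (raises_opOf ha), fun r c hc => ?_⟩
    rw [gComm_mul_left, gComm_opOf_opOf ha hc, mul_zero, zero_add]
    exact ((ih (hP.2 r c hc)).units_smul _).congr (by ring)

theorem OrdLT.mulOp_mul {k : ℕ} {j : ℤ} {P : Op R B} (hP : OrdLT k j P) (b : B) :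
    OrdLT k j (mulOp b * P) := by
  rw [← opOf_algebraMap]
  exact (hP.opOf_mul (algebraMap_mem b)).congr (by simp)

theorem OrdLT.smul {k : ℕ} {j : ℤ} {P : Op R B} (hP : OrdLT k j P) (r : R) :
    OrdLT k j (r • P) := by
  rw [← mulOp_algebraMap]; exact hP.mulOp_mul _

variable (R B) in
/-- The `B`-module of operators of degree `j` and order `< k`. -/
def ordSub (k : ℕ) (j : ℤ) : Submodule B (Op R B) where
  carrier := {P | OrdLT k j P}
  add_mem' := OrdLT.add
  zero_mem' := OrdLT.zero k j
  smul_mem' b P hP := by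
    change OrdLT _ _ _
    rw [smul_op]; exact OrdLT.mulOp_mul hP b

theorem OrdLT.gComm_mulOp {k : ℕ} {j : ℤ} {P : Op R B} (hP : OrdLT (k + 1) j P) (b : B) :
    OrdLT k j (gComm j 0 P (mulOp b)) := by
  have := hP.2 0 _ (algebraMap_mem b)
  rw [opOf_algebraMap] at this
  simpa using this

theorem OrdLT.gComm_iota {k : ℕ} {j : ℤ} {P : Op R B} (hP : OrdLT (k + 1) j P)
    (v : Derivation R B B) : OrdLT k (j - 1) (gComm j (-1) P (iota v)) :=
  hP.2 1 _ (ι_mem v)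

/-- It suffices to test the order on commutators with functions and vector fields. -/
theorem ordLT_succ {k : ℕ} {j : ℤ} {P : Op R B} (h : Raises (B := B) j P)
    (hb : ∀ b : B, OrdLT k j (gComm j 0 P (mulOp b)))
    (hv : ∀ v : Derivation R B B, OrdLT k (j - 1) (gComm j (-1) P (iota v))) :
    OrdLT (k + 1) j P := by
  refine ⟨h, fun q a ha => ?_⟩
  induction ha using Submodule.pow_induction_on_left' with
  | algebraMap r => rw [opOf_algebraMap]; simpa using hb r
  | add x y i hx hy hx' hy' => rw [opOf_add, gComm_add_right]; exact hx'.add hy'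
  | mem_mul x hx i y hy hy' =>
    obtain ⟨v, rfl⟩ := hx
    rw [DCrit.opOf_mul, show (-((i.succ : ℕ) : ℤ)) = -1 + -(i : ℤ) by push_cast; ring, gComm_mul_right]
    refine OrdLT.add ?_ ?_
    · exact ((hv v).mul_opOf hy).congr (by push_cast; ring)
    · exact ((hy'.opOf_mul (ι_mem v)).congr (by push_cast; ring)).units_smul _

theorem OrdLT.of_opOf {q : ℕ} {a : Polyvectors R B} (ha : a ∈ ⋀[B]^q (Derivation R B B)) :
    OrdLT 1 (-q) (opOf a) :=
  ⟨raises_opOf ha, fun _ _ hc => gComm_opOf_opOf ha hc⟩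

theorem ordLT_mulOp (b : B) : OrdLT 1 0 (mulOp (R := R) b) := by
  rw [← opOf_algebraMap]; exact OrdLT.of_opOf (q := 0) (algebraMap_mem b)

theorem ordLT_iota (v : Derivation R B B) : OrdLT 1 (-1) (iota v) := OrdLT.of_opOf (ι_mem v)

/-- Differential operators compose, and the order is additive. -/
theorem OrdLT.mul {k l : ℕ} {i j : ℤ} {P Q : Op R B} (hP : OrdLT (k + 1) i P)
    (hQ : OrdLT (l + 1) j Q) : OrdLT (k + l + 1) (i + j) (P * Q) := by
  obtain ⟨n, hn⟩ : ∃ n, n = k + l := ⟨_, rfl⟩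
  -- Each term of the Leibniz rule lowers the order of one factor only, so the induction runs on the
  -- total order. A factor of order zero has no non-zero commutator with `O_X`.
  induction n using Nat.strong_induction_on generalizing k l i j P Q with
  | _ n ih =>
  refine ⟨hP.1.mul hQ.1, fun q a ha => ?_⟩
  rw [gComm_mul_left]
  refine OrdLT.add ?_ (OrdLT.units_smul ?_ _)
  · cases l with
    | zero => rw [show gComm j (-q) Q (opOf a) = 0 from hQ.2 q a ha, mul_zero]; exact OrdLT.zero _ _
    | succ l => exact (ih (k + l) (by omega) hP (hQ.2 q a ha) rfl).congr (by ring)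
  · cases k with
    | zero => rw [show gComm i (-q) P (opOf a) = 0 from hP.2 q a ha, zero_mul]; exact OrdLT.zero _ _
    | succ k =>
      have := ih (k + l) (by omega) (hP.2 q a ha) hQ rfl
      exact (this.congr (by ring)).mono (by omega)

theorem OrdLT.base {k : ℕ} {j : ℤ} {P : Op R B} (hP : OrdLT k j P) : BaseOrdLT k P := by
  induction k generalizing j P with
  | zero => exact hP
  | succ k ih =>
    intro b
    have := ih (hP.gComm_mulOp b)
    simpa [gComm] using this

end Comm

end DCrit

end

noncomputable section

namespace DCrit

/-! ## Contractions, Lie derivatives and frames -/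

/-! ### Division by positive integers -/

section Rational

variable (R : Type u) [CommRing R] [Algebra ℚ R] {M : Type w} [AddCommGroup M] [Module R M]

theorem exists_natCast_mul_eq_one {n : ℕ} (hn : n ≠ 0) : ∃ r : R, r * (n : R) = 1 := by
  refine ⟨algebraMap ℚ R (n : ℚ)⁻¹, ?_⟩
  rw [← map_natCast (algebraMap ℚ R) n, ← map_mul, inv_mul_cancel₀ (Nat.cast_ne_zero.2 hn), map_one]

variable {R}

/-- The hypothesis ℚ ⊆ R enters through this division by a positive integer. A general predicate
allows its use for vanishing, for submodules and for inductive constructions alike. -/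
theorem mem_of_natCast_smul_mem {n : ℕ} (hn : n ≠ 0) {p : M → Prop}
    (hp : ∀ (r : R) x, p x → p (r • x)) {x : M} (h : p ((n : R) • x)) : p x := by
  obtain ⟨r, hr⟩ := exists_natCast_mul_eq_one R hn
  have := hp r _ h
  rwa [smul_smul, hr, one_smul] at this

theorem eq_zero_of_natCast_smul {n : ℕ} (hn : n ≠ 0) {x : M} (h : (n : R) • x = 0) : x = 0 :=
  mem_of_natCast_smul_mem (p := fun x => x = 0) hn (fun r x hx => by rw [hx, smul_zero]) h

end Rational

/-! ### Cartan calculus on differential forms -/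

section Forms

variable {R : Type u} [CommRing R] {B : Type v} [CommRing B] [Algebra R B]

theorem op_ext {P Q : Op R B} (h : ∀ p : ℕ, ∀ α ∈ ⋀[B]^p (Ω[B⁄R]), P α = Q α) : P = Q := by
  ext α
  induction α using DirectSum.Decomposition.inductionOn (fun p => ⋀[B]^p (Ω[B⁄R])) with
  | zero => simp
  | homogeneous a => exact h _ _ a.2
  | add a b ha hb => rw [map_add, map_add, ha, hb]

theorem omega_induction {p : Ω[B⁄R] → Prop} (θ : Ω[B⁄R]) (D : ∀ b, p (KaehlerDifferential.D R B b))
    (zero : p 0) (add : ∀ x y, p x → p y → p (x + y)) (smul : ∀ (b : B) x, p x → p (b • x)) :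
    p θ := by
  have h : θ ∈ Submodule.span B (Set.range (KaehlerDifferential.D R B)) := by
    rw [KaehlerDifferential.span_range_derivation]; trivial
  induction h using Submodule.span_induction with
  | zero => exact zero
  | add x y _ _ hx hy => exact add x y hx hy
  | smul b x _ hx => exact smul b x hx
  | mem x hx => obtain ⟨b, rfl⟩ := hx; exact D b

/-- Forms are generated from `1` by multiplications with functions and exact one-forms. -/
theorem forms_induction {p : Forms R B → Prop} (α : Forms R B) (one : p 1)
    (add : ∀ x y, p x → p y → p (x + y)) (smul : ∀ (b : B) x, p x → p (b • x))
    (wedge : ∀ (b : B) x, p x → p (dOne b * x)) : p α := by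
  have zero : p 0 := by simpa using smul 0 1 one
  induction α using CliffordAlgebra.left_induction with
  | algebraMap r => rw [Algebra.algebraMap_eq_smul_one]; exact smul r 1 one
  | add x y hx hy => exact add x y hx hy
  | ι_mul x m hx =>
    induction m using omega_induction with
    | D b => exact wedge b x hx
    | zero => rw [map_zero, zero_mul]; exact zero
    | add y z hy hz => rw [map_add, add_mul]; exact add _ _ hy hz
    | smul b y hy => rw [map_smul, smul_mul_assoc]; exact smul _ _ hy

theorem dOne_mem (b : B) : (dOne b : Forms R B) ∈ ⋀[B]^1 (Ω[B⁄R]) := ι_mem _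

theorem koszul_apply (b : B) (α : Forms R B) : koszul b α = dOne b * α := rfl

theorem koszul_sq (b : B) : koszul (R := R) b * koszul b = 0 := by
  ext α
  change dOne b * (dOne b * α) = 0
  rw [← mul_assoc, dOne, ExteriorAlgebra.ι_sq_zero, zero_mul]

theorem koszul_mul_mulOp (b c : B) : koszul (R := R) b * mulOp c = mulOp c * koszul b := by
  ext α
  change dOne b * mulOp c α = mulOp c (dOne b * α)
  rw [mulOp_apply, mulOp_apply, mul_smul_comm]

theorem deRham_smul (b : B) (α : Forms R B) :
    deRham R B (b • α) = dOne b * α + b • deRham R B α := by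
  rw [Algebra.smul_def, deRham_mul, deRham_algebraMap, AlgHom.commutes, Algebra.smul_def]

theorem deRham_dOne_mul (b : B) (α : Forms R B) :
    deRham R B (dOne b * α) = -(dOne b * deRham R B α) := by
  rw [deRham_mul, deRham_dOne, zero_mul, zero_add, dOne]
  simp

theorem deRham_one : deRham R B (1 : Forms R B) = 0 := by
  rw [← map_one (algebraMap B (Forms R B)), deRham_algebraMap]
  simp [dOne]

theorem deRham_mul_mulOp (b : B) : deRham R B * mulOp b = koszul b + mulOp b * deRham R B := by
  ext α
  change deRham R B (mulOp b α) = dOne b * α + mulOp b (deRham R B α)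
  rw [mulOp_apply, mulOp_apply, deRham_smul]

theorem deRham_mul_koszul (b : B) : deRham R B * koszul b = -(koszul b * deRham R B) := by
  ext α
  exact deRham_dOne_mul b α

theorem deRham_sq : deRham R B * deRham R B = 0 := by
  ext α
  change deRham R B (deRham R B α) = 0
  induction α using forms_induction with
  | one => rw [deRham_one, map_zero]
  | add x y hx hy => rw [map_add, map_add, hx, hy, add_zero]
  | smul b x hx =>
    rw [deRham_smul, map_add, deRham_dOne_mul, deRham_smul, hx, smul_zero, add_zero,
      neg_add_cancel]
  | wedge b x hx => rw [deRham_dOne_mul, map_neg, deRham_dOne_mul, hx, mul_zero, neg_zero, neg_zero]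

theorem deRham_mem {p : ℕ} {α : Forms R B} (hα : α ∈ ⋀[B]^p (Ω[B⁄R])) :
    deRham R B α ∈ ⋀[B]^(p + 1) (Ω[B⁄R]) := by
  induction hα using Submodule.pow_induction_on_left' with
  | algebraMap r => rw [deRham_algebraMap]; exact dOne_mem r
  | add x y i hx hy hx' hy' => rw [map_add]; exact add_mem hx' hy'
  | mem_mul x hx i y hy hy' =>
    obtain ⟨θ, rfl⟩ := hx
    induction θ using omega_induction with
    | D b =>
      change deRham R B (dOne b * y) ∈ _
      rw [deRham_dOne_mul, Nat.succ_eq_add_one, add_comm i 1, add_assoc]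
      exact neg_mem (mul_mem_exteriorPower (dOne_mem b) hy')
    | zero => rw [map_zero, zero_mul, map_zero]; exact zero_mem _
    | add x z hx hz => rw [map_add, add_mul, map_add]; exact add_mem hx hz
    | smul b x hx =>
      rw [map_smul, smul_mul_assoc, deRham_smul]
      refine add_mem ?_ (Submodule.smul_mem _ _ hx)
      have := mul_mem_exteriorPower (dOne_mem b) (mul_mem_exteriorPower (ι_mem (B := B) x) hy)
      rwa [show 1 + (1 + i) = i.succ + 1 by omega] at this

theorem raises_deRham : Raises (B := B) 1 (deRham R B) := fun p α hα =>
  ⟨fun q hq => by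
    obtain rfl : q = p + 1 := by omega
    exact deRham_mem hα, fun h => by omega⟩

theorem raises_koszul (b : B) : Raises (B := B) 1 (koszul (R := R) b) := fun p α hα =>
  ⟨fun q hq => by
    obtain rfl : q = 1 + p := by omega
    exact mul_mem_exteriorPower (dOne_mem b) hα, fun h => by omega⟩

/-- The `B`-linear form on `Ω¹` given by a vector field. -/
abbrev pairing (v : Derivation R B B) : Module.Dual B (Ω[B⁄R]) :=
  (KaehlerDifferential.linearMapEquivDerivation R B).symm v

theorem pairing_D (v : Derivation R B B) (b : B) : pairing v (KaehlerDifferential.D R B b) = v b :=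
  Derivation.liftKaehlerDifferential_comp_D v b

theorem iota_ι_mul (v : Derivation R B B) (θ : Ω[B⁄R]) (α : Forms R B) :
    iota v (ExteriorAlgebra.ι B θ * α) = pairing v θ • α - ExteriorAlgebra.ι B θ * iota v α := by
  rw [iota_apply, iota_apply]
  exact CliffordAlgebra.contractLeft_ι_mul (Q := (0 : QuadraticForm B (Ω[B⁄R]))) _ _ _

theorem iota_dOne_mul (v : Derivation R B B) (b : B) (α : Forms R B) :
    iota v (dOne b * α) = v b • α - dOne b * iota v α := by
  rw [dOne, iota_ι_mul, pairing_D]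

theorem iota_smul_apply (v : Derivation R B B) (b : B) (α : Forms R B) :
    iota v (b • α) = b • iota v α := by
  rw [iota_apply, iota_apply, map_smul]

theorem iota_one (v : Derivation R B B) : iota v (1 : Forms R B) = 0 := by
  rw [iota_apply]
  exact CliffordAlgebra.contractLeft_one (Q := (0 : QuadraticForm B (Ω[B⁄R]))) _

theorem iota_mul (v : Derivation R B B) (α β : Forms R B) :
    iota v (α * β) = iota v α * β + inv R B α * iota v β := by
  induction α using forms_induction with
  | one => rw [one_mul, iota_one, zero_mul, zero_add, map_one, one_mul]
  | add x y hx hy => simp only [add_mul, map_add, hx, hy]; abel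
  | smul b x hx =>
    simp only [smul_mul_assoc, iota_smul_apply, hx, map_smul, smul_add]
  | wedge b x hx =>
    rw [mul_assoc, iota_dOne_mul, hx, iota_dOne_mul, map_mul, dOne,
      show inv R B (ExteriorAlgebra.ι B (KaehlerDifferential.D R B b)) = -dOne b from
        CliffordAlgebra.involute_ι _, dOne]
    simp only [mul_add, sub_mul, mul_assoc, smul_mul_assoc, neg_mul]
    abel

theorem iota_mul_koszul (v : Derivation R B B) (b : B) :
    iota v * koszul b = mulOp (v b) - koszul b * iota v := by
  ext α
  change iota v (dOne b * α) = mulOp (v b) α - dOne b * iota v α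
  rw [iota_dOne_mul, mulOp_apply]

theorem iota_mul_mulOp (v : Derivation R B B) (b : B) :
    iota v * mulOp b = mulOp b * iota v := by
  ext α
  change iota v (mulOp b α) = mulOp b (iota v α)
  rw [mulOp_apply, mulOp_apply, iota_smul_apply]

/-- The Lie derivative of forms along a vector field. -/
def lieOp (v : Derivation R B B) : Op R B := deRham R B * iota v + iota v * deRham R B

theorem raises_lieOp (v : Derivation R B B) : Raises (B := B) 0 (lieOp v) :=
  ((raises_deRham.mul (raises_iota v)).congr (by norm_num)).add
    (((raises_iota v).mul raises_deRham).congr (by norm_num))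

theorem lieOp_mul_mulOp (v : Derivation R B B) (b : B) :
    lieOp v * mulOp b = mulOp (v b) + mulOp b * lieOp v := by
  rw [lieOp, add_mul, mul_assoc, iota_mul_mulOp, ← mul_assoc, deRham_mul_mulOp, mul_assoc,
    deRham_mul_mulOp, mul_add, iota_mul_koszul, ← mul_assoc (iota v), iota_mul_mulOp]
  noncomm_ring

theorem lieOp_mul_koszul (v : Derivation R B B) (b : B) :
    lieOp v * koszul b = koszul (v b) + koszul b * lieOp v := by
  rw [lieOp, add_mul, mul_assoc, iota_mul_koszul, mul_sub, deRham_mul_mulOp, ← mul_assoc,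
    deRham_mul_koszul, mul_assoc (iota v), deRham_mul_koszul, mul_neg, ← mul_assoc (iota v),
    iota_mul_koszul]
  noncomm_ring

/-- Forms are generated from `1` by functions and exact one-forms, so an operator which commutes
with these up to sign is determined by its value at `1`. -/
theorem op_eq_zero {P : Op R B} (one : P 1 = 0) (smul : ∀ b : B, P * mulOp b = mulOp b * P)
    (ε : ℤˣ) (wedge : ∀ b : B, P * koszul b = ε • (koszul b * P)) : P = 0 := by
  ext α
  rw [LinearMap.zero_apply]
  induction α using forms_induction with
  | one => exact one
  | add x y hx hy => rw [map_add, hx, hy, add_zero]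
  | smul b x hx =>
    rw [← mulOp_apply, ← Module.End.mul_apply, smul, Module.End.mul_apply, hx, map_zero]
  | wedge b x hx =>
    rw [← koszul_apply, ← Module.End.mul_apply, wedge]
    rcases Int.units_eq_one_or ε with rfl | rfl
    · rw [one_smul, Module.End.mul_apply, hx, map_zero]
    · rw [Units.neg_smul, one_smul, LinearMap.neg_apply, Module.End.mul_apply, hx, map_zero,
        neg_zero]

/-- The defect of Cartan's formula kills `1`, commutes with functions and anticommutes with exact
one-forms, so `op_eq_zero` applies. -/
theorem lieOp_mul_iota (v w : Derivation R B B) :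
    lieOp v * iota w = iota ⁅v, w⁆ + iota w * lieOp v := by
  rw [← sub_eq_zero]
  refine op_eq_zero ?_ (fun b => ?_) (-1) (fun b => ?_)
  · simp only [LinearMap.sub_apply, LinearMap.add_apply, Module.End.mul_apply, lieOp, iota_one,
      deRham_one, map_zero]
    simp
  · rw [sub_mul, add_mul, mul_assoc (lieOp v), iota_mul_mulOp, ← mul_assoc, lieOp_mul_mulOp,
      iota_mul_mulOp, mul_assoc (iota w), lieOp_mul_mulOp, mul_add, iota_mul_mulOp,
      ← mul_assoc (iota w), iota_mul_mulOp]
    noncomm_ring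
  · rw [Units.neg_smul, one_smul, sub_mul, add_mul, mul_assoc (lieOp v), iota_mul_koszul, mul_sub,
      lieOp_mul_mulOp, ← mul_assoc, lieOp_mul_koszul, iota_mul_koszul, mul_assoc (iota w),
      lieOp_mul_koszul, mul_add, iota_mul_koszul, ← mul_assoc (iota w), iota_mul_koszul,
      Derivation.commutator_apply, mulOp_sub]
    noncomm_ring

/-! ### Commutators -/

theorem gComm_deRham_mulOp (b : B) : gComm 1 0 (deRham R B) (mulOp b) = koszul b := by
  simp [gComm, deRham_mul_mulOp]

theorem gComm_deRham_iota (v : Derivation R B B) :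
    gComm 1 (-1) (deRham R B) (iota v) = lieOp v := by
  simp [gComm, lieOp, sub_eq_add_neg]

theorem gComm_koszul_mulOp (b c : B) : gComm 1 0 (koszul (R := R) b) (mulOp c) = 0 := by
  simp [gComm, koszul_mul_mulOp]

theorem gComm_koszul_iota (b : B) (v : Derivation R B B) :
    gComm 1 (-1) (koszul b) (iota v) = mulOp (v b) := by
  simp [gComm, iota_mul_koszul]

theorem gComm_lieOp_mulOp (v : Derivation R B B) (b : B) :
    gComm 0 0 (lieOp v) (mulOp b) = mulOp (v b) := by
  simp [gComm, lieOp_mul_mulOp]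

theorem gComm_lieOp_iota (v w : Derivation R B B) :
    gComm 0 (-1) (lieOp v) (iota w) = iota ⁅v, w⁆ := by
  simp [gComm, lieOp_mul_iota]

theorem polyDiff_ι_mul (b : B) (w : Derivation R B B) (y : Polyvectors R B) :
    polyDiff R B b (ExteriorAlgebra.ι B w * y) =
      w b • y - ExteriorAlgebra.ι B w * polyDiff R B b y :=
  CliffordAlgebra.contractLeft_ι_mul (Q := (0 : QuadraticForm B (Derivation R B B))) _ _ _

theorem polyDiff_algebraMap (b c : B) :
    polyDiff R B b (algebraMap B (Polyvectors R B) c) = 0 :=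
  CliffordAlgebra.contractLeft_algebraMap (0 : QuadraticForm B (Derivation R B B)) _ _

/-- This makes `L` a dg module over `O_X`. Both sides are graded derivations in `a`, so it suffices
to compare them on functions and vector fields. -/
theorem gComm_koszul_opOf (b : B) {q : ℕ} {a : Polyvectors R B}
    (ha : a ∈ ⋀[B]^q (Derivation R B B)) :
    gComm 1 (-q) (koszul b) (opOf a) = opOf (polyDiff R B b a) := by
  induction ha using Submodule.pow_induction_on_left' with
  | algebraMap r =>
    rw [opOf_algebraMap, polyDiff_algebraMap, opOf_zero]
    simpa using gComm_koszul_mulOp (R := R) b r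
  | add x y i hx hy hx' hy' => rw [opOf_add, gComm_add_right, hx', hy', map_add, opOf_add]
  | mem_mul x hx i y hy hy' =>
    obtain ⟨v, rfl⟩ := hx
    rw [opOf_mul, show (-((i.succ : ℕ) : ℤ)) = -1 + -(i : ℤ) by push_cast; ring, gComm_mul_right,
      hy', polyDiff_ι_mul, opOf_sub, opOf_smul, opOf_mul, ← iota, gComm_koszul_iota]
    simp [sub_eq_add_neg]

theorem ordLT_koszul (b : B) : OrdLT 2 1 (koszul (R := R) b) :=
  ordLT_succ (raises_koszul b) (fun c => by rw [gComm_koszul_mulOp]; exact OrdLT.zero _ _)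
    (fun v => by rw [gComm_koszul_iota]; exact ordLT_mulOp _)

theorem ordLT_lieOp (v : Derivation R B B) : OrdLT 2 0 (lieOp v) :=
  ordLT_succ (raises_lieOp v) (fun c => by rw [gComm_lieOp_mulOp]; exact ordLT_mulOp _)
    (fun w => by rw [gComm_lieOp_iota]; exact ordLT_iota _)

/-- Over `O_X` the de Rham differential has order two rather than one: contractions count as
scalars, and its commutator with ι_v is the first order operator L_v. -/
theorem ordLT_deRham : OrdLT 3 1 (deRham R B) :=
  ordLT_succ raises_deRham (fun c => by rw [gComm_deRham_mulOp]; exact ordLT_koszul _)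
    (fun w => by rw [gComm_deRham_iota]; exact ordLT_lieOp _)

/-! ### Frames -/

variable {r : ℕ} {g : Fin r → B} {v : Fin r → Derivation R B B}

theorem IsFrame.expand (h : IsFrame g v) (θ : Ω[B⁄R]) :
    θ = ∑ i, pairing (v i) θ • KaehlerDifferential.D R B (g i) := by
  induction θ using omega_induction with
  | D b => simp only [pairing_D]; exact h b
  | zero => simp
  | add x y hx hy =>
    simp only [map_add, add_smul, Finset.sum_add_distrib]
    rw [← hx, ← hy]
  | smul b x hx =>
    simp only [map_smul, smul_assoc, ← Finset.smul_sum]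
    rw [← hx]

/-- Derivations factor through Ω¹. A general target is allowed so that the formula can be used for
quotients by operators of lower order and for derivations into `O_X`. -/
theorem IsFrame.derivation_apply (h : IsFrame g v) {M : Type*} [AddCommGroup M] [Module B M]
    [Module R M] [IsScalarTower R B M] (w : Derivation R B M) (b : B) :
    w b = ∑ i, v i b • w (g i) := by
  have := congrArg w.liftKaehlerDifferential (h b)
  simpa only [map_sum, map_smul, Derivation.liftKaehlerDifferential_comp_D] using this

theorem IsFrame.derivation_eq (h : IsFrame g v) (w : Derivation R B B) :
    w = ∑ i, w (g i) • v i := by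
  ext b
  rw [h.derivation_apply w b]
  have : (∑ i, w (g i) • v i) b = ∑ i, (w (g i) • v i) b := by
    rw [← Derivation.coeFnAddMonoidHom_apply, map_sum, Finset.sum_apply]; rfl
  rw [this]
  exact Finset.sum_congr rfl fun i _ => mul_comm _ _

/-- `∑ dg_i ∧ ι_{v_i}` acts on `Ω^p` as multiplication by `p`. -/
theorem IsFrame.sum_koszul_iota (h : IsFrame g v) {p : ℕ} {α : Forms R B}
    (hα : α ∈ ⋀[B]^p (Ω[B⁄R])) :
    ∑ i, dOne (g i) * iota (v i) α = (p : R) • α := by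
  induction hα using Submodule.pow_induction_on_left' with
  | algebraMap b =>
    rw [Nat.cast_zero, zero_smul]
    refine Finset.sum_eq_zero fun i _ => ?_
    rw [Algebra.algebraMap_eq_smul_one, iota_smul_apply, iota_one, smul_zero, mul_zero]
  | add x y i hx hy hx' hy' =>
    simp only [map_add, mul_add, Finset.sum_add_distrib, hx', hy', smul_add]
  | mem_mul x hx i y hy hy' =>
    obtain ⟨θ, rfl⟩ := hx
    have e : ∀ j, dOne (g j) * iota (v j) (ExteriorAlgebra.ι B θ * y) =
        (pairing (v j) θ • dOne (g j)) * y +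
          ExteriorAlgebra.ι B θ * (dOne (g j) * iota (v j) y) := fun j => by
      have e1 : dOne (g j) * ExteriorAlgebra.ι B θ = -(ExteriorAlgebra.ι B θ * dOne (g j)) :=
        eq_neg_of_add_eq_zero_left (ExteriorAlgebra.ι_add_mul_swap _ _)
      rw [iota_ι_mul, mul_sub, ← mul_assoc (dOne (g j)), e1, mul_smul_comm, smul_mul_assoc,
        neg_mul, sub_neg_eq_add, mul_assoc]
    have e2 : ∑ j, pairing (v j) θ • (dOne (g j) : Forms R B) = ExteriorAlgebra.ι B θ := by
      conv_rhs => rw [h.expand θ, map_sum]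
      simp only [map_smul]; rfl
    rw [Finset.sum_congr rfl fun j _ => e j, Finset.sum_add_distrib, ← Finset.sum_mul, e2,
      ← Finset.mul_sum, hy', mul_smul_comm, Nat.cast_succ, add_smul, one_smul, add_comm]

/-- `∑ v_i ∧ (dg_i ⌟ -)` acts on `Λ^q T` as multiplication by `q`. -/
theorem IsFrame.sum_ι_polyDiff (h : IsFrame g v) {q : ℕ} {a : Polyvectors R B}
    (ha : a ∈ ⋀[B]^q (Derivation R B B)) :
    ∑ i, ExteriorAlgebra.ι B (v i) * polyDiff R B (g i) a = (q : R) • a := by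
  induction ha using Submodule.pow_induction_on_left' with
  | algebraMap b =>
    rw [Nat.cast_zero, zero_smul]
    refine Finset.sum_eq_zero fun i _ => ?_
    rw [polyDiff_algebraMap, mul_zero]
  | add x y i hx hy hx' hy' =>
    simp only [map_add, mul_add, Finset.sum_add_distrib, hx', hy', smul_add]
  | mem_mul x hx i y hy hy' =>
    obtain ⟨w, rfl⟩ := hx
    have e : ∀ j, ExteriorAlgebra.ι B (v j) * polyDiff R B (g j) (ExteriorAlgebra.ι B w * y) =
        (w (g j) • ExteriorAlgebra.ι B (v j)) * y +
          ExteriorAlgebra.ι B w * (ExteriorAlgebra.ι B (v j) * polyDiff R B (g j) y) := fun j => by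
      have e1 : ExteriorAlgebra.ι B (v j) * ExteriorAlgebra.ι B w =
          -(ExteriorAlgebra.ι B w * ExteriorAlgebra.ι B (v j)) :=
        eq_neg_of_add_eq_zero_left (ExteriorAlgebra.ι_add_mul_swap _ _)
      rw [polyDiff_ι_mul, mul_sub, ← mul_assoc (ExteriorAlgebra.ι B (v j)),
        e1, mul_smul_comm, smul_mul_assoc, neg_mul, sub_neg_eq_add, mul_assoc]
    have e2 : ∑ j, w (g j) • ExteriorAlgebra.ι B (v j) = ExteriorAlgebra.ι B w := by
      conv_rhs => rw [h.derivation_eq w, map_sum]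
      simp only [map_smul]
    rw [Finset.sum_congr rfl fun j _ => e j, Finset.sum_add_distrib, ← Finset.sum_mul, e2,
      ← Finset.mul_sum, hy', mul_smul_comm, Nat.cast_succ, add_smul, one_smul, add_comm]

/-- Contracting the product dg_i ∧ α gives the trace m from the first factor, minus the number
operator p from the second. -/
theorem IsFrame.sum_iota_koszul (h : IsFrame g v) {m : ℕ} (tr : ∑ i, v i (g i) = (m : B)) {p : ℕ}
    {α : Forms R B} (hα : α ∈ ⋀[B]^p (Ω[B⁄R])) :
    ∑ i, iota (v i) (dOne (g i) * α) = ((m : R) - p) • α := by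
  simp only [iota_dOne_mul, Finset.sum_sub_distrib, ← Finset.sum_smul, tr, h.sum_koszul_iota hα,
    sub_smul]
  congr 1
  rw [← map_natCast (algebraMap R B) m, algebraMap_smul]

end Forms

end DCrit

end

noncomputable section

namespace DCrit

/-! ## Top forms and operators of order zero -/

/-! ### Homogeneous components of an exterior algebra -/

section Components

variable {B : Type v} [CommRing B] {M : Type w} [AddCommGroup M] [Module B M]

variable (B M) in
/-- The projection of an exterior algebra onto its part of degree `q`. -/
abbrev extProj (q : ℕ) : ExteriorAlgebra B M →ₗ[B] ExteriorAlgebra B M :=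
  GradedAlgebra.proj (fun q => ⋀[B]^q M) q

theorem extProj_mem (q : ℕ) (a : ExteriorAlgebra B M) : extProj B M q a ∈ ⋀[B]^q M :=
  (DirectSum.decompose (fun q => ⋀[B]^q M) a q).2

theorem extProj_same {q : ℕ} {a : ExteriorAlgebra B M} (ha : a ∈ ⋀[B]^q M) :
    extProj B M q a = a := DirectSum.decompose_of_mem_same (fun q => ⋀[B]^q M) ha

theorem extProj_ne {p q : ℕ} {a : ExteriorAlgebra B M} (ha : a ∈ ⋀[B]^p M) (h : p ≠ q) :
    extProj B M q a = 0 := DirectSum.decompose_of_mem_ne (fun q => ⋀[B]^q M) ha h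

theorem eq_sum_extProj (a : ExteriorAlgebra B M) :
    ∃ s : Finset ℕ, a = ∑ q ∈ s, extProj B M q a := by
  classical
  exact ⟨_, (DirectSum.sum_support_decompose (fun q => ⋀[B]^q M) a).symm⟩

theorem eq_zero_of_extProj {a : ExteriorAlgebra B M} (h : ∀ q, extProj B M q a = 0) : a = 0 := by
  obtain ⟨s, hs⟩ := eq_sum_extProj a
  rw [hs]; exact Finset.sum_eq_zero fun q _ => h q

theorem exists_algebraMap_eq {a : ExteriorAlgebra B M} (h : a ∈ ⋀[B]^0 M) :
    ∃ b, algebraMap B (ExteriorAlgebra B M) b = a := by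
  change a ∈ LinearMap.range (ExteriorAlgebra.ι B) ^ 0 at h
  rwa [pow_zero, Submodule.mem_one] at h

end Components

/-! ### Frames, duality with top forms, and the line bundle -/

section Top

variable {R : Type u} [CommRing R] {B : Type v} [CommRing B] [Algebra R B]

variable (R B) in
/-- A frame whose canonical element of `T ⊗ Ω¹` has trace `m`, as is the case when `Ω¹` is
projective of rank `m`. -/
structure Frame (m : ℕ) where
  /-- the number of functions -/
  r : ℕ
  /-- the functions -/
  g : Fin r → B
  /-- the vector fields -/
  v : Fin r → Derivation R B B
  isFrame : IsFrame g v
  trace : ∑ i, v i (g i) = (m : B)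

variable {m : ℕ}

/-- `P` and `Q`, of degree `j`, are adjoint for the wedge product pairing with values in `Ω^m`. -/
def Adjoint (m : ℕ) (j : ℤ) (P Q : Op R B) : Prop :=
  ∀ p q : ℕ, (p : ℤ) + j + q = m → ∀ α ∈ ⋀[B]^p (Ω[B⁄R]), ∀ β ∈ ⋀[B]^q (Ω[B⁄R]),
    P α * β = (j * (p + 1)).negOnePow • (α * Q β)

/-- A crude bound from the number of generators of Ω¹, which may exceed m. It only serves to start
the descending induction in `forms_eq_zero`. -/
theorem exteriorPower_eq_bot (F : Frame R B m) {p : ℕ} (hp : F.r < p) {α : Forms R B}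
    (hα : α ∈ ⋀[B]^p (Ω[B⁄R])) : α = 0 := by
  have hs : Submodule.span B (Set.range fun i => KaehlerDifferential.D R B (F.g i)) = ⊤ := by
    rw [eq_top_iff]
    intro θ _
    rw [F.isFrame.expand θ]
    exact Submodule.sum_mem _ fun i _ => Submodule.smul_mem _ _ (Submodule.subset_span ⟨i, rfl⟩)
  have h := exteriorPower.ιMulti_family_span_fixedDegree_of_span (n := p) B hs
  have : IsEmpty (Set.powersetCard (Fin F.r) p) := by
    refine ⟨fun s => ?_⟩
    have h1 := Finset.card_le_univ (s : Finset (Fin F.r))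
    rw [Set.powersetCard.card_eq s, Fintype.card_fin] at h1
    omega
  rw [Set.range_eq_empty, Submodule.span_empty] at h
  rw [← h] at hα
  simpa using hα

theorem top_sum (F : Frame R B m) {p n : ℕ} (h : p + n = m) {α : Forms R B}
    (hα : α ∈ ⋀[B]^p (Ω[B⁄R])) : ∑ i, iota (F.v i) (dOne (F.g i) * α) = (n : R) • α := by
  rw [F.isFrame.sum_iota_koszul F.trace hα, ← h]
  push_cast
  rw [add_sub_cancel_left]

theorem adjoint_mulOp (b : B) : Adjoint m 0 (mulOp (R := R) b) (mulOp b) := by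
  intro p q h α hα β hβ
  simp [mulOp_apply]

/-- Adjointness is used for each factor in turn. The hypotheses on degrees cover the cases in which
an intermediate form would have negative degree and so vanishes. -/
theorem Adjoint.mul {i j : ℤ} {P P' Q Q' : Op R B} (h : Adjoint m i P P')
    (h' : Adjoint m j Q Q') (hP' : Raises (B := B) i P') (hQ : Raises (B := B) j Q) :
    Adjoint m (i + j) (P * Q) ((i * j).negOnePow • (Q' * P')) := by
  intro p q e α hα β hβ
  have key : (P * Q) α * β = (i * (p + j + 1)).negOnePow • (Q α * P' β) := by
    by_cases h0 : (p : ℤ) + j < 0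
    · rw [Module.End.mul_apply, (hQ p α hα).2 h0, map_zero, zero_mul, zero_mul, smul_zero]
    · obtain ⟨n, hn⟩ := Int.eq_ofNat_of_zero_le (not_lt.1 h0)
      rw [Module.End.mul_apply, h n q (by rw [← hn, ← e]; ring) _ ((hQ p α hα).1 n hn.symm) β hβ,
        hn]
  have key2 : Q α * P' β = (j * (p + 1)).negOnePow • (α * Q' (P' β)) := by
    by_cases h0 : (q : ℤ) + i < 0
    · rw [(hP' q β hβ).2 h0, map_zero, mul_zero, mul_zero, smul_zero]
    · obtain ⟨n, hn⟩ := Int.eq_ofNat_of_zero_le (not_lt.1 h0)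
      exact h' p n (by rw [← hn, ← e]; ring) α hα _ ((hP' q β hβ).1 n hn.symm)
  rw [key, key2, smul_smul, ← Int.negOnePow_add, LinearMap.smul_apply, mul_smul_comm, smul_smul,
    ← Int.negOnePow_add, Module.End.mul_apply]
  congr 2
  ring

theorem degree_zero_comm {γ β : Forms R B} (h : γ ∈ ⋀[B]^0 (Ω[B⁄R])) : γ * β = β * γ := by
  obtain ⟨b, rfl⟩ := exists_algebraMap_eq h
  exact Algebra.commutes b β

theorem opOf_mem {q p n : ℕ} (h : p + q = n) {a : Polyvectors R B}
    (ha : a ∈ ⋀[B]^q (Derivation R B B)) {α : Forms R B} (hα : α ∈ ⋀[B]^n (Ω[B⁄R])) :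
    opOf a α ∈ ⋀[B]^p (Ω[B⁄R]) :=
  (raises_opOf ha n α hα).1 p (by omega)

theorem exists_degree_zero {γ : Forms R B} (h : γ ∈ ⋀[B]^0 (Ω[B⁄R])) :
    γ = algebraMap B (Forms R B) (ExteriorAlgebra.algebraMapInv γ) := by
  obtain ⟨b, rfl⟩ := exists_algebraMap_eq h
  rw [ExteriorAlgebra.algebraMap_leftInverse (Ω[B⁄R]) b]

theorem OrdLT.smul_apply {j : ℤ} {P : Op R B} (hP : OrdLT 1 j P) (b : B) (α : Forms R B) :
    P (b • α) = b • P α := by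
  have h : gComm j 0 P (mulOp b) = 0 := hP.gComm_mulOp b
  rw [gComm, mul_zero, Int.negOnePow_zero, one_smul, sub_eq_zero] at h
  have := LinearMap.congr_fun h α
  simpa only [Module.End.mul_apply, mulOp_apply] using this

theorem OrdLT.iota_apply {j : ℤ} {P : Op R B} (hP : OrdLT 1 j P) (v : Derivation R B B)
    (α : Forms R B) : P (iota v α) = (j * -1).negOnePow • iota v (P α) := by
  have h : gComm j (-1) P (iota v) = 0 := hP.gComm_iota v
  rw [gComm, sub_eq_zero] at h
  exact LinearMap.congr_fun h α

theorem polyDiff_mem (b : B) {q : ℕ} {a : Polyvectors R B}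
    (ha : a ∈ ⋀[B]^(q + 1) (Derivation R B B)) : polyDiff R B b a ∈ ⋀[B]^q (Derivation R B B) :=
  (contractLeft_mem_exteriorPower _ ha).1 q rfl

theorem lineBundleMap_tmul (a : Polyvectors R B) (κ : ⋀[B]^m (Ω[B⁄R])) :
    lineBundleMap R B m (a ⊗ₜ κ) = opOf a κ := rfl

variable [Algebra ℚ R]

/-- Descending induction on the degree p: dg_i ∧ α vanishes by induction, so (m - p) α = Σ
ι_{v_i}(dg_i ∧ α) = 0, and m - p is invertible. -/
theorem forms_eq_zero (F : Frame R B m) {p : ℕ} (hp : m < p) {α : Forms R B}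
    (hα : α ∈ ⋀[B]^p (Ω[B⁄R])) : α = 0 := by
  have key : ∀ n p, m < p → F.r < p + n → ∀ α ∈ ⋀[B]^p (Ω[B⁄R]), α = 0 := by
    intro n
    induction n with
    | zero => exact fun p _ h α hα => exteriorPower_eq_bot F h hα
    | succ n ih =>
      intro p hp h α hα
      have h1 := F.isFrame.sum_iota_koszul F.trace hα
      have h2 : ∀ i, dOne (F.g i) * α = 0 := fun i =>
        ih (1 + p) (by omega) (by omega) _ (mul_mem_exteriorPower (dOne_mem _) hα)
      simp only [h2, map_zero, Finset.sum_const_zero] at h1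
      obtain ⟨k, rfl⟩ := Nat.exists_eq_add_of_lt hp
      refine eq_zero_of_natCast_smul (R := R) (n := k + 1) (by omega) ?_
      have : ((m : R) - ((m + k + 1 : ℕ) : R)) = -((k + 1 : ℕ) : R) := by push_cast; ring
      rw [this, neg_smul] at h1
      exact neg_eq_zero.1 h1.symm
  exact key F.r p hp (by omega) α hα

theorem dOne_mul_top (F : Frame R B m) {κ : Forms R B} (hκ : κ ∈ ⋀[B]^m (Ω[B⁄R])) (b : B) :
    dOne b * κ = 0 :=
  forms_eq_zero F (by omega) (mul_mem_exteriorPower (dOne_mem b) hκ)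

/-- Top forms generate `Ω^*` under contractions. -/
theorem mem_of_top (F : Frame R B m) (S : Submodule B (Forms R B))
    (top : ∀ κ ∈ ⋀[B]^m (Ω[B⁄R]), κ ∈ S) (hι : ∀ v, ∀ α ∈ S, iota v α ∈ S) (α : Forms R B) :
    α ∈ S := by
  -- Descending induction on the degree p = m - n, through (n + 1) α = Σ ι_{v_i}(dg_i ∧ α) in the
  -- inductive step.
  have key : ∀ n p, p + n = m → ∀ α ∈ ⋀[B]^p (Ω[B⁄R]), α ∈ S := by
    intro n
    induction n with
    | zero => intro p h; obtain rfl : p = m := by omega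
              exact top
    | succ n ih =>
      intro p h α hα
      refine mem_of_natCast_smul_mem (R := R) (n := n + 1) (p := (· ∈ S)) (by omega)
        (fun r x hx => ?_) ?_
      · rw [← algebraMap_smul B r x]; exact S.smul_mem _ hx
      · rw [← top_sum F h hα]
        exact S.sum_mem fun i _ => hι _ _
          (ih (1 + p) (by omega) _ (mul_mem_exteriorPower (dOne_mem _) hα))
  induction α using DirectSum.Decomposition.inductionOn (fun p => ⋀[B]^p (Ω[B⁄R])) with
  | zero => exact S.zero_mem
  | @homogeneous p a =>
    rcases lt_or_ge m p with h | h
    · rw [forms_eq_zero F h a.2]; exact S.zero_mem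
    · exact key (m - p) p (by omega) _ a.2
  | add a b ha hb => exact S.add_mem ha hb

/-- The forms annihilated by `b` are stable under contractions, so once they contain the top forms
they contain `1`. -/
theorem eq_zero_of_smul_top (F : Frame R B m) {b : B}
    (h : ∀ κ ∈ ⋀[B]^m (Ω[B⁄R]), b • κ = 0) : b = 0 := by
  have h1 : (1 : Forms R B) ∈ LinearMap.ker (LinearMap.lsmul B (Forms R B) b) :=
    mem_of_top F _ h (fun v α hα => by
      have hα' : b • α = 0 := hα
      change b • iota v α = 0
      rw [← iota_smul_apply, hα', map_zero]) 1
  have h2 : b • (1 : Forms R B) = 0 := h1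
  rwa [← Algebra.algebraMap_eq_smul_one, ExteriorAlgebra.algebraMap_eq_zero_iff] at h2

theorem eq_zero_of_iota (F : Frame R B m) {q : ℕ} (hq : q ≠ 0) {γ : Forms R B}
    (hγ : γ ∈ ⋀[B]^q (Ω[B⁄R])) (h : ∀ v, iota v γ = 0) : γ = 0 := by
  refine eq_zero_of_natCast_smul (R := R) hq ?_
  rw [← F.isFrame.sum_koszul_iota hγ]
  exact Finset.sum_eq_zero fun i _ => by rw [h, mul_zero]

/-- The wedge product pairing of forms of complementary degrees is non-degenerate. -/
theorem pairing_nondegenerate (F : Frame R B m) {p q : ℕ} (hpq : p + q = m) {γ : Forms R B}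
    (hγ : γ ∈ ⋀[B]^q (Ω[B⁄R])) (h : ∀ α ∈ ⋀[B]^p (Ω[B⁄R]), α * γ = 0) : γ = 0 := by
  induction q generalizing p γ with
  | zero =>
    obtain ⟨b, rfl⟩ := exists_algebraMap_eq hγ
    obtain rfl : p = m := by omega
    rw [eq_zero_of_smul_top F (b := b) (fun κ hκ => by
      rw [Algebra.smul_def, Algebra.commutes]; exact h κ hκ), map_zero]
  | succ q ih =>
    refine eq_zero_of_iota F (by omega) hγ fun v => ?_
    refine ih (p := p + 1) (by omega) ((raises_iota v (q + 1) γ hγ).1 q (by push_cast; ring))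
      fun α hα => ?_
    -- The product has degree m + 1. Contracting this zero form moves ι_v from γ to α, and ι_v α has
    -- the degree of the hypothesis.
    have h1 : α * γ = 0 := forms_eq_zero F (p := p + 1 + (q + 1)) (by omega)
      (mul_mem_exteriorPower hα hγ)
    have h2 := iota_mul v α γ
    rw [h1, map_zero, h _ ((raises_iota v (p + 1) α hα).1 p (by push_cast; ring)), zero_add,
      involute_of_mem hα, smul_mul_assoc] at h2
    rw [← negOnePow_smul_smul (((p + 1 : ℕ) : ℤ)) (α * iota v γ), ← h2, smul_zero]

/-- Contraction is an odd derivation, and it is applied to a product of degree m + 1, which is zero.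
-/
theorem adjoint_iota (F : Frame R B m) (v : Derivation R B B) :
    Adjoint m (-1) (iota v) (iota v) := by
  intro p q h α hα β hβ
  have h1 : α * β = 0 := forms_eq_zero F (p := p + q) (by omega) (mul_mem_exteriorPower hα hβ)
  have h2 := iota_mul v α β
  rw [h1, map_zero, involute_of_mem hα, smul_mul_assoc] at h2
  rw [eq_neg_of_add_eq_zero_left h2.symm, ← Units.neg_smul, ← Int.negOnePow_succ]
  congr 1
  rw [neg_one_mul, Int.negOnePow_neg]

theorem adjoint_opOf (F : Frame R B m) {q : ℕ} {a : Polyvectors R B}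
    (ha : a ∈ ⋀[B]^q (Derivation R B B)) : Adjoint m (-q) (opOf a) (opOf a) := by
  induction ha using Submodule.pow_induction_on_left' with
  | algebraMap r => rw [opOf_algebraMap]; simpa using adjoint_mulOp r
  | add x y i hx hy hx' hy' =>
    intro p q h α hα β hβ
    rw [opOf_add, LinearMap.add_apply, add_mul, hx' p q h α hα β hβ, hy' p q h α hα β hβ,
      LinearMap.add_apply, mul_add α, smul_add]
  | mem_mul x hx i y hy hy' =>
    obtain ⟨v, rfl⟩ := hx
    have h := (adjoint_iota F v).mul hy' (raises_iota v) (raises_opOf hy)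
    have e : opOf (ExteriorAlgebra.ι B v * y) = (-1 * -(i : ℤ)).negOnePow • (opOf y * iota v) := by
      have := graded_comm (ι_mem (B := B) v) hy
      rw [this, opOf_units_smul, opOf_mul, iota]
      simp
    rw [← e, iota, ← opOf_mul, show -1 + -(i : ℤ) = -((i.succ : ℕ) : ℤ) by push_cast; ring] at h
    exact h

/-- This expresses that K_Y has rank one. It is adjointness for p = q = m, where the sign exponent
-m(m + 1) is even. -/
theorem opOf_top_exchange (F : Frame R B m) {a : Polyvectors R B}
    (ha : a ∈ ⋀[B]^m (Derivation R B B)) {κ κ' : Forms R B} (hκ : κ ∈ ⋀[B]^m (Ω[B⁄R]))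
    (hκ' : κ' ∈ ⋀[B]^m (Ω[B⁄R])) : opOf a κ * κ' = opOf a κ' * κ := by
  rw [adjoint_opOf F ha m m (by ring) κ hκ κ' hκ',
    degree_zero_comm (opOf_mem (zero_add m) ha hκ'),
    Int.negOnePow_even _ (by simpa using Int.even_mul_succ_self (m : ℤ)), one_smul]

/-- Iterating α = (1/(p + 1)) Σ dg_i ∧ ι_{v_i} α gives products of vector fields and products of
dg_i, divided by p!, which behave as dual families although Ω^p is only projective. -/
theorem exists_dual_families (F : Frame R B m) (p : ℕ) :
    ∃ (s : Type) (_ : Fintype s) (x : s → Polyvectors R B) (τ : s → Forms R B),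
      (∀ l, x l ∈ ⋀[B]^p (Derivation R B B)) ∧ (∀ l, τ l ∈ ⋀[B]^p (Ω[B⁄R])) ∧
      ∀ α ∈ ⋀[B]^p (Ω[B⁄R]), α = ∑ l, opOf (x l) α * τ l := by
  induction p with
  | zero =>
    refine ⟨Unit, inferInstance, fun _ => 1, fun _ => 1, fun _ => ?_, fun _ => ?_, fun α _ => ?_⟩
    · rw [← map_one (algebraMap B _)]; exact algebraMap_mem 1
    · rw [← map_one (algebraMap B _)]; exact algebraMap_mem 1
    · simp [opOf]
  | succ p ih =>
    obtain ⟨s, hs, x, τ, hx, hτ, h⟩ := ih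
    obtain ⟨c, hc⟩ := exists_natCast_mul_eq_one R (Nat.succ_ne_zero p)
    refine ⟨Fin F.r × s, inferInstance, fun l => x l.2 * ExteriorAlgebra.ι B (F.v l.1),
      fun l => c • (dOne (F.g l.1) * τ l.2), fun l => mul_mem_exteriorPower (hx l.2) (ι_mem _),
      fun l => ?_, fun α hα => ?_⟩
    · change c • (dOne (F.g l.1) * τ l.2) ∈ _
      rw [← algebraMap_smul B c, add_comm p 1]
      exact Submodule.smul_mem _ _ (mul_mem_exteriorPower (dOne_mem _) (hτ l.2))
    · have e1 := F.isFrame.sum_koszul_iota hα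
      have hi : ∀ i, iota (F.v i) α ∈ ⋀[B]^p (Ω[B⁄R]) := fun i =>
        (raises_iota _ _ _ hα).1 p (by push_cast; ring)
      rw [Fintype.sum_prod_type]
      have e2 : ∀ i, ∑ l, opOf (x l * ExteriorAlgebra.ι B (F.v i)) α *
          (c • (dOne (F.g i) * τ l)) = c • (dOne (F.g i) * iota (F.v i) α) := by
        intro i
        conv_rhs => rw [h _ (hi i), Finset.mul_sum, Finset.smul_sum]
        refine Finset.sum_congr rfl fun l _ => ?_
        rw [mul_smul_comm, opOf_mul, Module.End.mul_apply, ← mul_assoc, ← mul_assoc, ← iota,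
          degree_zero_comm (opOf_mem (zero_add p) (hx l) (hi i))]
      simp only [e2]
      rw [← Finset.smul_sum, e1, smul_smul, hc, one_smul]

/-- The scalar is the trace of `T` for the dual families: T κ = Σ (x_l ⌟ κ) T τ_l, and the exchange
law turns each term into (x_l ⌟ T τ_l) κ. -/
theorem exists_scalar_of_top (F : Frame R B m) {T : Op R B}
    (hT : ∀ (b : B) α, T (b • α) = b • T α)
    (h : ∀ κ ∈ ⋀[B]^m (Ω[B⁄R]), T κ ∈ ⋀[B]^m (Ω[B⁄R])) :
    ∃ c : B, ∀ κ ∈ ⋀[B]^m (Ω[B⁄R]), T κ = c • κ := by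
  obtain ⟨s, hs, x, τ, hx, hτ, e⟩ := exists_dual_families F m
  refine ⟨∑ l, ExteriorAlgebra.algebraMapInv (opOf (x l) (T (τ l))), fun κ hκ => ?_⟩
  conv_lhs => rw [e κ hκ, map_sum]
  rw [Finset.sum_smul]
  refine Finset.sum_congr rfl fun l _ => ?_
  have e1 := opOf_mem (zero_add m) (hx l) hκ
  have e2 := opOf_mem (zero_add m) (hx l) (h _ (hτ l))
  rw [Algebra.smul_def, ← exists_degree_zero e2,
    opOf_top_exchange F (hx l) (h _ (hτ l)) hκ, exists_degree_zero e1, ← Algebra.smul_def, hT,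
    Algebra.smul_def]

/-- Induction on q: each dg_i ∧ T is given by a polyvector a_i of degree q, and (q + 1) T = Σ
ι_{v_i}(dg_i ∧ T) reconstructs `T` from Σ v_i a_i. -/
theorem exists_polyvector_of_top (F : Frame R B m) {q p : ℕ} (hpq : p + q = m) {T : Op R B}
    (hT : ∀ (b : B) α, T (b • α) = b • T α)
    (h : ∀ κ ∈ ⋀[B]^m (Ω[B⁄R]), T κ ∈ ⋀[B]^p (Ω[B⁄R])) :
    ∃ a ∈ ⋀[B]^q (Derivation R B B), ∀ κ ∈ ⋀[B]^m (Ω[B⁄R]), T κ = opOf a κ := by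
  induction q generalizing p T with
  | zero =>
    obtain rfl : p = m := by omega
    obtain ⟨c, hc⟩ := exists_scalar_of_top F hT h
    exact ⟨algebraMap B _ c, algebraMap_mem c, fun κ hκ => by
      rw [hc κ hκ, opOf_algebraMap, mulOp_apply]⟩
  | succ q ih =>
    have h1 : ∀ i, ∃ a ∈ ⋀[B]^q (Derivation R B B), ∀ κ ∈ ⋀[B]^m (Ω[B⁄R]),
        (koszul (F.g i) * T : Op R B) κ = opOf a κ := fun i => ih (p := 1 + p) (by omega)
      (fun b α => by rw [Module.End.mul_apply, Module.End.mul_apply, hT, koszul_apply, koszul_apply,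
                        mul_smul_comm])
      (fun κ hκ => mul_mem_exteriorPower (dOne_mem _) (h κ hκ))
    choose a ha hTa using h1
    obtain ⟨c, hc⟩ := exists_natCast_mul_eq_one R (Nat.succ_ne_zero q)
    refine ⟨algebraMap R B c • ∑ i, ExteriorAlgebra.ι B (F.v i) * a i,
      Submodule.smul_mem _ _ (Submodule.sum_mem _ fun i _ => ?_), fun κ hκ => ?_⟩
    · rw [add_comm q 1]; exact mul_mem_exteriorPower (ι_mem _) (ha i)
    · have e := top_sum F hpq (h κ hκ)
      rw [algebraMap_smul, opOf_smul', opOf_sum, LinearMap.smul_apply, LinearMap.sum_apply]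
      have e2 : ∀ i, opOf (ExteriorAlgebra.ι B (F.v i) * a i) κ =
          iota (F.v i) (dOne (F.g i) * T κ) := fun i => by
        rw [opOf_mul, Module.End.mul_apply, ← hTa i κ hκ]; rfl
      simp only [e2]
      rw [e, smul_smul, hc, one_smul]

/-- The kernel of an operator of order zero is stable under functions and contractions, so it is
everything as soon as it contains the top forms. -/
theorem OrdLT.ext_top (F : Frame R B m) {i j : ℤ} {P Q : Op R B} (hP : OrdLT 1 i P)
    (hQ : OrdLT 1 j Q) (hij : i = j) (h : ∀ κ ∈ ⋀[B]^m (Ω[B⁄R]), P κ = Q κ) : P = Q := by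
  subst hij
  have hd := hP.sub hQ
  rw [← sub_eq_zero]
  ext α
  let S : Submodule B (Forms R B) :=
    { carrier := {α | (P - Q) α = 0}
      add_mem' := fun {a b} ha hb => by
        change (P - Q) (a + b) = 0
        rw [map_add, show (P - Q) a = 0 from ha, show (P - Q) b = 0 from hb, add_zero]
      zero_mem' := map_zero _
      smul_mem' := fun b α hα => by
        change (P - Q) (b • α) = 0
        rw [hd.smul_apply, show (P - Q) α = 0 from hα, smul_zero] }
  refine mem_of_top F S (fun κ hκ => ?_) (fun v α hα => ?_) α
  · change (P - Q) κ = 0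
    rw [LinearMap.sub_apply, h κ hκ, sub_self]
  · change (P - Q) (iota v α) = 0
    rw [hd.iota_apply, show (P - Q) α = 0 from hα, map_zero, smul_zero]

/-- Operators of order zero are given by polyvector fields. -/
theorem OrdLT.exists_opOf (F : Frame R B m) {j : ℤ} {P : Op R B} (hP : OrdLT 1 j P) :
    ∃ (q : ℕ) (a : Polyvectors R B), a ∈ ⋀[B]^q (Derivation R B B) ∧ P = opOf a ∧
      (-(q : ℤ) = j ∨ P = 0) := by
  have hz : (∀ κ ∈ ⋀[B]^m (Ω[B⁄R]), P κ = 0) → P = 0 := fun h =>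
    hP.ext_top F (OrdLT.zero 1 j) rfl h
  -- The zero operator is homogeneous of every degree, including those in which there are no
  -- polyvectors; hence the alternative `P = 0` in the conclusion.
  have trivial_case : P = 0 → ∃ (q : ℕ) (a : Polyvectors R B), a ∈ ⋀[B]^q (Derivation R B B) ∧
      P = opOf a ∧ (-(q : ℤ) = j ∨ P = 0) := fun h => ⟨0, 0, zero_mem _, by rw [opOf_zero, h], Or.inr h⟩
  by_cases h1 : (m : ℤ) + j < 0
  · exact trivial_case (hz fun κ hκ => (hP.1 m κ hκ).2 h1)
  by_cases h2 : 0 < j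
  · refine trivial_case (hz fun κ hκ => ?_)
    obtain ⟨n, hn⟩ := Int.eq_ofNat_of_zero_le (not_lt.1 h1)
    exact forms_eq_zero F (by omega) ((hP.1 m κ hκ).1 n hn.symm)
  obtain ⟨q, hq⟩ := Int.eq_ofNat_of_zero_le (show 0 ≤ -j by omega)
  obtain ⟨p, hp⟩ := Int.eq_ofNat_of_zero_le (not_lt.1 h1)
  obtain ⟨a, ha, e⟩ := exists_polyvector_of_top F (q := q) (p := p) (by omega) hP.smul_apply
    (fun κ hκ => (hP.1 m κ hκ).1 p hp.symm)
  exact ⟨q, a, ha, hP.ext_top F (OrdLT.of_opOf ha) (by omega) e, Or.inl (by omega)⟩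

/-! ### Faithfulness of the action of polyvector fields -/

/-- The contraction of `a` with dg_i acts as a commutator with `opOf a`, so it acts as zero and
vanishes by induction. The number operator on polyvectors then recovers `a`. -/
theorem eq_zero_of_opOf_of_mem (F : Frame R B m) {q : ℕ} {a : Polyvectors R B}
    (ha : a ∈ ⋀[B]^q (Derivation R B B)) (h : opOf a = 0) : a = 0 := by
  induction q generalizing a with
  | zero =>
    obtain ⟨b, rfl⟩ := exists_algebraMap_eq ha
    have h1 := LinearMap.congr_fun h 1
    rw [opOf_algebraMap, mulOp_apply, LinearMap.zero_apply,
      ← Algebra.algebraMap_eq_smul_one, ExteriorAlgebra.algebraMap_eq_zero_iff] at h1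
    rw [h1, map_zero]
  | succ q ih =>
    refine eq_zero_of_natCast_smul (R := R) (Nat.succ_ne_zero q) ?_
    rw [← F.isFrame.sum_ι_polyDiff ha]
    refine Finset.sum_eq_zero fun i _ => ?_
    rw [ih (polyDiff_mem _ ha) (by rw [← gComm_koszul_opOf _ ha, h, gComm_zero_right]), mul_zero]

/-- Components of different degrees send top forms to different degrees, so they act separately as
zero; components of degree above m act as zero anyway. -/
theorem eq_zero_of_opOf_top (F : Frame R B m) {a : Polyvectors R B}
    (h : ∀ κ ∈ ⋀[B]^m (Ω[B⁄R]), opOf a κ = 0) : a = 0 := by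
  refine eq_zero_of_extProj fun q => ?_
  have hq := extProj_mem q a
  refine eq_zero_of_opOf_of_mem F hq ?_
  refine (OrdLT.of_opOf hq).ext_top F (OrdLT.zero 1 (-q)) rfl fun κ hκ => ?_
  by_cases hqm : m < q
  · exact (raises_opOf hq m κ hκ).2 (by omega)
  · obtain ⟨p, hp⟩ := Nat.exists_eq_add_of_le (not_lt.1 hqm)
    obtain ⟨s, hs⟩ := eq_sum_extProj a
    have h1 := congrArg (extProj B (Ω[B⁄R]) p) (h κ hκ)
    rw [hs, opOf_sum, LinearMap.sum_apply, map_sum, map_zero] at h1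
    by_cases hqs : q ∈ s
    · rw [Finset.sum_eq_single_of_mem q hqs, extProj_same (opOf_mem (by omega) hq hκ)] at h1
      · exact h1
      · intro q' _ hne
        have hq' := extProj_mem q' a
        by_cases hqm' : m < q'
        · rw [(raises_opOf hq' m κ hκ).2 (by omega), map_zero]
        · exact extProj_ne (opOf_mem (p := m - q') (by omega) hq' hκ) (by omega)
    · have : extProj B (Derivation R B B) q a = 0 := by
        conv_lhs => rw [hs, map_sum]
        refine Finset.sum_eq_zero fun q' hq' => extProj_ne (extProj_mem q' a) ?_
        rintro rfl; exact hqs hq'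
      rw [this, opOf_zero]

theorem opOf_injective (F : Frame R B m) {a b : Polyvectors R B} (h : opOf a = opOf b) :
    a = b := by
  rw [← sub_eq_zero]
  refine eq_zero_of_opOf_top F fun κ _ => ?_
  rw [opOf_sub, h, sub_self, LinearMap.zero_apply]

/-! ### The line bundle -/

theorem lineBundleMap_surjective (F : Frame R B m) :
    Function.Surjective (lineBundleMap R B m) := by
  intro α
  refine mem_of_top F (LinearMap.range (lineBundleMap R B m)) (fun κ hκ => ?_) ?_ α
  · exact ⟨1 ⊗ₜ ⟨κ, hκ⟩, by rw [lineBundleMap_tmul]; simp [opOf]⟩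
  · rintro v _ ⟨z, rfl⟩
    induction z with
    | zero => rw [map_zero, map_zero]; exact zero_mem _
    | tmul a κ =>
      exact ⟨(ExteriorAlgebra.ι B v * a) ⊗ₜ κ, by
        rw [lineBundleMap_tmul, lineBundleMap_tmul, opOf_mul]; rfl⟩
    | add x y hx hy => rw [map_add, map_add]; exact add_mem hx hy

/-- Dual families give z = Σ c_l(z) ⊗ τ_l. If `z` maps to zero then each c_l(z) kills the top forms,
and is zero because polyvectors act faithfully on them. -/
theorem lineBundleMap_injective (F : Frame R B m) :
    Function.Injective (lineBundleMap R B m) := by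
  rw [injective_iff_map_eq_zero]
  intro z hz
  obtain ⟨s, hs, x, τ, hx, hτ, e⟩ := exists_dual_families F m
  let c : s → Polyvectors R B ⊗[B] (⋀[B]^m (Ω[B⁄R])) →ₗ[B] Polyvectors R B := fun l =>
    TensorProduct.lift (LinearMap.flip ((LinearMap.lsmul B (Polyvectors R B)) ∘ₗ
      (ExteriorAlgebra.algebraMapInv (R := B) (M := Ω[B⁄R])).toLinearMap ∘ₗ
        act R B (x l) ∘ₗ (⋀[B]^m (Ω[B⁄R])).subtype))
  have hc : ∀ l a κ, c l (a ⊗ₜ κ) = ExteriorAlgebra.algebraMapInv (opOf (x l) κ) • a :=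
    fun l a κ => rfl
  have h1 : ∀ z, z = ∑ l, c l z ⊗ₜ[B] (⟨τ l, hτ l⟩ : ⋀[B]^m (Ω[B⁄R])) := by
    intro z
    induction z with
    | zero => simp
    | tmul a κ =>
      simp only [hc, TensorProduct.smul_tmul]
      rw [← TensorProduct.tmul_sum]
      congr 1
      ext
      conv_lhs => rw [e κ κ.2]
      rw [AddSubmonoidClass.coe_finsetSum]
      refine Finset.sum_congr rfl fun l _ => ?_
      rw [Submodule.coe_smul, Algebra.smul_def,
        ← exists_degree_zero (opOf_mem (zero_add m) (hx l) κ.2)]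
    | add y z hy hz =>
      simp only [map_add, TensorProduct.add_tmul, Finset.sum_add_distrib]
      rw [← hy, ← hz]
  -- For z = a ⊗ κ' the two sides are a applied to (x_l ⌟ κ') κ and to (x_l ⌟ κ) κ', which agree by
  -- the exchange law.
  have h2 : ∀ l κ, κ ∈ ⋀[B]^m (Ω[B⁄R]) → ∀ z, opOf (c l z) κ =
      ExteriorAlgebra.algebraMapInv (opOf (x l) κ) • lineBundleMap R B m z := by
    intro l κ hκ z
    induction z with
    | zero => simp [opOf_zero]
    | tmul a κ' =>
      have e1 := opOf_mem (zero_add m) (hx l) hκ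
      have e2 := opOf_mem (zero_add m) (hx l) κ'.2
      rw [hc, opOf_smul, Module.End.mul_apply, mulOp_apply, lineBundleMap_tmul]
      have l1 : ∀ (b : B) α, b • opOf a α = opOf a (b • α) := fun b α =>
        (map_smul (act R B a) b α).symm
      rw [l1, l1, Algebra.smul_def, Algebra.smul_def, ← exists_degree_zero e1,
        ← exists_degree_zero e2, opOf_top_exchange F (hx l) κ'.2 hκ]
    | add y z hy hz => rw [map_add, opOf_add, LinearMap.add_apply, hy, hz, map_add, smul_add]
  rw [h1 z]
  refine Finset.sum_eq_zero fun l _ => ?_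
  rw [eq_zero_of_opOf_top F (a := c l z) (fun κ hκ => by rw [h2 l κ hκ, hz, smul_zero]),
    TensorProduct.zero_tmul]

/-- On a top form κ the second term of the commutator of df ∧ with `a` drops out, because df ∧ κ has
degree m + 1. -/
theorem lineBundleMap_polyDiff (F : Frame R B m) (f : B) (a : Polyvectors R B)
    (κ : ⋀[B]^m (Ω[B⁄R])) :
    lineBundleMap R B m (polyDiff R B f a ⊗ₜ κ) = koszul f (lineBundleMap R B m (a ⊗ₜ κ)) := by
  rw [lineBundleMap_tmul, lineBundleMap_tmul]
  induction a using DirectSum.Decomposition.inductionOn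
    (fun p => ⋀[B]^p (Derivation R B B)) with
  | zero => simp [opOf_zero]
  | homogeneous a =>
    rw [← gComm_koszul_opOf f a.2, gComm, LinearMap.sub_apply, LinearMap.smul_apply,
      Module.End.mul_apply, Module.End.mul_apply, koszul_apply f (κ : Forms R B), dOne_mul_top F κ.2, map_zero,
      smul_zero, sub_zero]
  | add a b ha hb => rw [map_add, opOf_add, opOf_add, LinearMap.add_apply, ha, hb,
      LinearMap.add_apply, map_add]

end Top

end DCrit

end

noncomputable section

namespace DCrit

/-! ## Commutators and transposes of differential operators -/

/-! ### Derivations modulo a submodule -/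

section Approximation

variable {R : Type u} [CommRing R] {B : Type v} [CommRing B] [Algebra R B]

/-- A map which is a derivation modulo `N` is determined modulo `N` by its values on a frame. -/
theorem IsFrame.approx_derivation {r : ℕ} {g : Fin r → B} {v : Fin r → Derivation R B B}
    (h : IsFrame g v) {M : Type w} [AddCommGroup M] [Module B M] [Module R M] [IsScalarTower R B M]
    (N : Submodule B M) (δ : B →ₗ[R] M)
    (hδ : ∀ a b, δ (a * b) - (a • δ b + b • δ a) ∈ N) (b : B) :
    δ b - ∑ i, v i b • δ (g i) ∈ N := by
  -- Modulo `N` the map is a genuine derivation, to which the frame expansion applies.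
  let D : Derivation R B (M ⧸ N) := Derivation.mk' (N.mkQ.restrictScalars R ∘ₗ δ) fun a b => by
    have := (Submodule.Quotient.mk_eq_zero N).2 (hδ a b)
    rw [Submodule.Quotient.mk_sub, sub_eq_zero, Submodule.Quotient.mk_add,
      Submodule.Quotient.mk_smul, Submodule.Quotient.mk_smul] at this
    exact this
  have e : ∀ b, D b = N.mkQ (δ b) := fun b => rfl
  have := h.derivation_apply D b
  rw [← Submodule.ker_mkQ N, LinearMap.mem_ker, map_sub, map_sum, ← e, this, sub_eq_zero]
  exact Finset.sum_congr rfl fun i _ => by rw [map_smul, e]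

end Approximation

/-! ### Differential operators over the base and total divergences -/

section BaseOrder

variable {R : Type u} [CommRing R] {B : Type v} [CommRing B] [Algebra R B] {m : ℕ}

theorem BaseOrdLT.zero (k : ℕ) : BaseOrdLT k (0 : Op R B) := by
  induction k with
  | zero => rfl
  | succ k ih => intro b; simpa using ih

theorem BaseOrdLT.add {k : ℕ} {P Q : Op R B} (hP : BaseOrdLT k P) (hQ : BaseOrdLT k Q) :
    BaseOrdLT k (P + Q) := by
  induction k generalizing P Q with
  | zero => rw [show P = 0 from hP, show Q = 0 from hQ, add_zero]; rfl
  | succ k ih =>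
    intro b
    have := ih (hP b) (hQ b)
    rwa [show (P + Q) * mulOp b - mulOp b * (P + Q) = P * mulOp b - mulOp b * P +
      (Q * mulOp b - mulOp b * Q) by noncomm_ring]

/-- Left and right multiplication by linear operators preserve the order. -/
theorem BaseOrdLT.mul_linear {k : ℕ} {P S T : Op R B} (hP : BaseOrdLT k P)
    (hS : ∀ b, S * mulOp b = mulOp b * S) (hT : ∀ b, T * mulOp b = mulOp b * T) :
    BaseOrdLT k (S * P * T) := by
  induction k generalizing P with
  | zero => rw [show P = 0 from hP]; simp; rfl
  | succ k ih =>
    intro b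
    have := ih (hP b)
    rwa [show S * P * T * mulOp b - mulOp b * (S * P * T) =
      S * (P * mulOp b - mulOp b * P) * T by
        rw [mul_assoc (S * P), hT, ← mul_assoc (mulOp b), ← mul_assoc (mulOp b), ← hS]
        noncomm_ring]

theorem mulOp_comm (b c : B) : mulOp (R := R) b * mulOp c = mulOp c * mulOp b := by
  rw [← mulOp_mul, mul_comm, mulOp_mul]

theorem BaseOrdLT.linear_mul {k : ℕ} {P S : Op R B} (hP : BaseOrdLT k P)
    (hS : ∀ b, S * mulOp b = mulOp b * S) : BaseOrdLT k (S * P) := by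
  simpa using hP.mul_linear hS (T := 1) (fun b => by rw [one_mul, mul_one])

theorem BaseOrdLT.smul {k : ℕ} {P : Op R B} (hP : BaseOrdLT k P) (r : R) :
    BaseOrdLT k (r • P) := by
  rw [← mulOp_algebraMap]; exact hP.linear_mul fun _ => mulOp_comm _ _

theorem BaseOrdLT.units_smul {k : ℕ} {P : Op R B} (hP : BaseOrdLT k P) (ε : ℤˣ) :
    BaseOrdLT k (ε • P) := by
  rcases Int.units_eq_one_or ε with rfl | rfl
  · simpa using hP
  · have := hP.smul (-1)
    rw [neg_one_smul] at this
    simpa using this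

theorem BaseOrdLT.succ {k : ℕ} {P : Op R B} (hP : BaseOrdLT k P) : BaseOrdLT (k + 1) P := by
  induction k generalizing P with
  | zero => rw [show P = 0 from hP]; exact BaseOrdLT.zero _
  | succ k ih => exact fun b => ih (hP b)

theorem BaseOrdLT.mono {k l : ℕ} {P : Op R B} (hP : BaseOrdLT k P) (h : k ≤ l) :
    BaseOrdLT l P := by
  induction h with
  | refl => exact hP
  | step _ ih => exact ih.succ

theorem BaseOrdLT.mul {k l : ℕ} {P Q : Op R B} (hP : BaseOrdLT (k + 1) P)
    (hQ : BaseOrdLT (l + 1) Q) : BaseOrdLT (k + l + 1) (P * Q) := by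
  obtain ⟨n, hn⟩ : ∃ n, n = k + l := ⟨_, rfl⟩
  induction n using Nat.strong_induction_on generalizing k l P Q with
  | _ n ih =>
  intro b
  rw [show P * Q * mulOp b - mulOp b * (P * Q) = P * (Q * mulOp b - mulOp b * Q) +
    (P * mulOp b - mulOp b * P) * Q by noncomm_ring]
  refine BaseOrdLT.add ?_ ?_
  · cases l with
    | zero =>
      rw [show Q * mulOp b - mulOp b * Q = 0 from hQ b, mul_zero]; exact BaseOrdLT.zero _
    | succ l => exact ih (k + l) (by omega) hP (hQ b) rfl
  · cases k with
    | zero =>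
      rw [show P * mulOp b - mulOp b * P = 0 from hP b, zero_mul]; exact BaseOrdLT.zero _
    | succ k => exact (ih (k + l) (by omega) (hP b) hQ rfl).mono (by omega)

variable (R B) in
/-- The `B`-module of operators of order `< k` over `B`. -/
def baseSub (k : ℕ) : Submodule B (Op R B) where
  carrier := {P | BaseOrdLT k P}
  add_mem' := BaseOrdLT.add
  zero_mem' := BaseOrdLT.zero k
  smul_mem' b P hP := by
    change BaseOrdLT _ _
    rw [smul_op]; exact BaseOrdLT.linear_mul hP fun _ => mulOp_comm _ _

theorem mulOp_smul (r : R) (b : B) : mulOp (R := R) (r • b) = r • mulOp b := by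
  ext α; simp [mulOp_apply]

theorem op_mul_rsmul (r : R) (P Q : Op R B) : P * (r • Q) = r • (P * Q) := mul_smul_comm r P Q

/-- The commutator of `S` with functions. -/
def baseComm (S : Op R B) : B →ₗ[R] Op R B where
  toFun b := S * mulOp b - mulOp b * S
  map_add' b c := by rw [mulOp_add]; noncomm_ring
  map_smul' r b := by
    rw [mulOp_smul, op_mul_rsmul, smul_mul_assoc, ← smul_sub, RingHom.id_apply]

theorem baseComm_apply (S : Op R B) (b : B) : baseComm S b = S * mulOp b - mulOp b * S := rfl

theorem baseComm_comm (S : Op R B) (b c : B) :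
    baseComm (baseComm S b) c = baseComm (baseComm S c) b := by
  have h := mulOp_comm (R := R) b c
  have h1 : S * mulOp b * mulOp c = S * mulOp c * mulOp b := by rw [mul_assoc, h, mul_assoc]
  have h2 : mulOp b * (mulOp c * S) = mulOp c * (mulOp b * S) := by
    rw [← mul_assoc, h, mul_assoc]
  simp only [baseComm_apply, sub_mul, mul_sub, h1, h2, mul_assoc]
  abel

/-- As a function of b, the commutator with `S` is a derivation up to a double commutator, which has
order two less than `S`. This makes `IsFrame.approx_derivation` applicable. -/
theorem baseComm_mul (S : Op R B) (a b : B) :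
    baseComm S (a * b) = mulOp a * baseComm S b + mulOp b * baseComm S a +
      baseComm (baseComm S a) b := by
  simp only [baseComm_apply, mulOp_mul]; noncomm_ring

theorem IsFrame.baseComm_approx {r : ℕ} {g : Fin r → B} {v : Fin r → Derivation R B B}
    (h : IsFrame g v) {k : ℕ} {S : Op R B} (hS : BaseOrdLT (k + 2) S) (b : B) :
    BaseOrdLT k (baseComm S b - ∑ i, mulOp (v i b) * baseComm S (g i)) := by
  have := h.approx_derivation (baseSub R B k) (baseComm S) (fun a b => by
    rw [baseComm_mul, smul_op, smul_op, add_sub_cancel_left]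
    exact hS a b) b
  simp only [smul_op] at this
  exact this

/-- The Euler operator on differential operators over `B`. -/
def baseEuler (F : Frame R B m) (S : Op R B) : Op R B :=
  ∑ i, lieOp (F.v i) * baseComm S (F.g i)

/-- The symbol of `S` is homogeneous of degree k, and this is Euler's identity for it. In the
induction, the commutator with b acts on `S` inside the sum, and on L_{v_i} to give v_i(b); the
latter contributes one more copy of [S, b]. -/
theorem baseEuler_approx (F : Frame R B m) {k : ℕ} {S : Op R B} (hS : BaseOrdLT (k + 1) S) :
    BaseOrdLT k (baseEuler F S - (k : R) • S) := by
  induction k generalizing S with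
  | zero =>
    have : baseEuler F S = 0 := Finset.sum_eq_zero fun i _ => by
      rw [show baseComm S (F.g i) = 0 from hS _, mul_zero]
    rw [this, Nat.cast_zero, zero_smul, sub_zero]; rfl
  | succ k ih =>
    intro b
    have e : (baseEuler F S - ((k + 1 : ℕ) : R) • S) * mulOp b -
        mulOp b * (baseEuler F S - ((k + 1 : ℕ) : R) • S) =
        (baseEuler F (baseComm S b) - (k : R) • baseComm S b) +
        (-1 : R) • (baseComm S b - ∑ i, mulOp (F.v i b) * baseComm S (F.g i)) := by
      have e1 : ∀ i, lieOp (F.v i) * baseComm S (F.g i) * mulOp b -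
          mulOp b * (lieOp (F.v i) * baseComm S (F.g i)) =
          lieOp (F.v i) * baseComm (baseComm S b) (F.g i) +
            mulOp (F.v i b) * baseComm S (F.g i) := fun i => by
        have := lieOp_mul_mulOp (F.v i) b
        rw [← baseComm_comm, baseComm_apply (baseComm S _), mul_sub, ← mul_assoc (lieOp _) (mulOp b),
          this]
        noncomm_ring
      rw [sub_mul, mul_sub, baseEuler, Finset.sum_mul, Finset.mul_sum, sub_sub_sub_comm,
        ← Finset.sum_sub_distrib, Finset.sum_congr rfl fun i _ => e1 i, Finset.sum_add_distrib,
        baseEuler, smul_mul_assoc, op_mul_rsmul, ← smul_sub, ← baseComm_apply, Nat.cast_succ,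
        add_smul, one_smul, neg_one_smul]
      abel
    rw [e]
    exact (ih (hS b)).add ((F.isFrame.baseComm_approx hS b).smul _)

theorem Raises.baseComm {S : Op R B} {n : ℕ} (hS : ∀ α, S α ∈ ⋀[B]^n (Ω[B⁄R])) (b : B)
    (α : Forms R B) : baseComm S b α ∈ ⋀[B]^n (Ω[B⁄R]) := by
  rw [baseComm_apply, LinearMap.sub_apply, Module.End.mul_apply, Module.End.mul_apply]
  refine sub_mem (hS _) ?_
  rw [mulOp_apply]; exact Submodule.smul_mem _ _ (hS α)

theorem extProj_deRham (n : ℕ) (α : Forms R B) :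
    extProj B (Ω[B⁄R]) (n + 1) (deRham R B α) = deRham R B (extProj B (Ω[B⁄R]) n α) := by
  induction α using DirectSum.Decomposition.inductionOn (fun p => ⋀[B]^p (Ω[B⁄R])) with
  | zero => simp
  | @homogeneous i a =>
    by_cases h : i = n
    · subst h; rw [extProj_same a.2, extProj_same (deRham_mem a.2)]
    · rw [extProj_ne a.2 h, extProj_ne (deRham_mem a.2) (by omega), map_zero]
  | add a b ha hb => simp only [map_add, ha, hb]

theorem extProj_zero_deRham (α : Forms R B) : extProj B (Ω[B⁄R]) 0 (deRham R B α) = 0 := by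
  induction α using DirectSum.Decomposition.inductionOn (fun p => ⋀[B]^p (Ω[B⁄R])) with
  | zero => simp
  | @homogeneous i a => exact extProj_ne (deRham_mem a.2) (by omega)
  | add a b ha hb => simp only [map_add, ha, hb, add_zero]

variable [Algebra ℚ R]

/-- A total divergence which is linear over `B` vanishes. -/
theorem divergence_eq_zero (F : Frame R B m) {n k : ℕ} (hn : n + 1 = m) {S : Op R B}
    (hS : BaseOrdLT k S) (hS' : ∀ α, S α ∈ ⋀[B]^n (Ω[B⁄R]))
    (h : ∀ b, deRham R B * S * mulOp b = mulOp b * (deRham R B * S)) : deRham R B * S = 0 := by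
  induction k generalizing S with
  | zero => rw [show S = 0 from hS, mul_zero]
  | succ k ih =>
    -- This is the linearity of dS, tested on the functions g_i.
    have e1 : ∀ i, deRham R B * baseComm S (F.g i) + koszul (F.g i) * S = 0 := fun i => by
      have := h (F.g i)
      rw [← sub_eq_zero] at this
      rw [← this, baseComm_apply, mul_sub, ← mul_assoc, ← mul_assoc (deRham R B) (mulOp _),
        deRham_mul_mulOp]
      noncomm_ring
    -- The values of `S` have degree m - 1, where the operator Σ ι_{v_i} dg_i is the identity.
    have e2 : ∑ i, iota (F.v i) * (koszul (F.g i) * S) = S := by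
      ext α
      rw [LinearMap.sum_apply]
      exact (top_sum F hn (hS' α)).trans (by simp)
    -- Substituting dg_i S = -d[S, g_i] cancels the part ι_{v_i} d of each Lie derivative, so that
    -- only an exact expression remains.
    have e3 : baseEuler F S + S = deRham R B * ∑ i, iota (F.v i) * baseComm S (F.g i) := by
      conv_lhs => rw [← e2]
      rw [baseEuler, ← Finset.sum_add_distrib, Finset.mul_sum, e2]
      refine Finset.sum_congr rfl fun i _ => ?_
      rw [eq_neg_of_add_eq_zero_right (e1 i), lieOp]
      noncomm_ring
    have e4 : deRham R B * (baseEuler F S + S) = 0 := by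
      rw [e3, ← mul_assoc, deRham_sq, zero_mul]
    -- `T` has lower order, and dT = -(k + 1) dS is still linear over B, so the induction applies to
    -- `T`.
    set T := baseEuler F S - (k : R) • S with hT
    have e5 : deRham R B * T = -(((k + 1 : ℕ) : R) • (deRham R B * S)) := by
      rw [hT, mul_sub, op_mul_rsmul, Nat.cast_succ, add_smul, one_smul]
      rw [mul_add] at e4
      rw [eq_neg_of_add_eq_zero_left e4]; abel
    have e6 : deRham R B * T = 0 := by
      refine ih (baseEuler_approx F hS) (fun α => ?_) (fun b => ?_)
      · rw [hT, LinearMap.sub_apply, baseEuler, LinearMap.sum_apply]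
        refine sub_mem (Submodule.sum_mem _ fun i _ => ?_) ?_
        · exact (raises_lieOp (F.v i) n _ (Raises.baseComm hS' (F.g i) α)).1 n (by simp)
        · rw [LinearMap.smul_apply, ← algebraMap_smul B]
          exact Submodule.smul_mem _ _ (hS' α)
      · rw [e5, neg_mul, mul_neg, smul_mul_assoc, h, op_mul_rsmul]
    rw [e6, eq_comm, neg_eq_zero] at e5
    exact eq_zero_of_natCast_smul (R := R) (Nat.succ_ne_zero k) e5

/-- Two transposes of the same operator are equal. -/
theorem IsTranspose.eq_zero (F : Frame R B m) {j : ℤ} {Q : Op R B} (hQ : Raises (B := B) j Q)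
    (h : IsTranspose m j 0 Q) : Q = 0 := by
  refine op_ext fun q β hβ => ?_
  rw [LinearMap.zero_apply]
  by_cases h0 : (q : ℤ) + j < 0
  · exact (hQ q β hβ).2 h0
  obtain ⟨q', hq'⟩ := Int.eq_ofNat_of_zero_le (not_lt.1 h0)
  have hQβ : Q β ∈ ⋀[B]^q' (Ω[B⁄R]) := (hQ q β hβ).1 q' hq'.symm
  by_cases hm : m < q'
  · exact forms_eq_zero F hm hQβ
  obtain ⟨p, hp⟩ := Nat.exists_eq_add_of_le (not_lt.1 hm)
  refine pairing_nondegenerate F (p := p) (by omega) hQβ fun α hα => ?_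
  obtain ⟨k, S, hS, e⟩ := h p q (by omega) β hβ
  set ε := (j * (p + 1)).negOnePow
  let pr : ∀ n, Op R B := fun n => (extProj B (Ω[B⁄R]) n).restrictScalars R
  have hpr : ∀ n b, pr n * mulOp b = mulOp b * pr n := fun n b => by
    ext x
    change extProj B (Ω[B⁄R]) n (mulOp b x) = mulOp b (extProj B (Ω[B⁄R]) n x)
    rw [mulOp_apply, mulOp_apply, map_smul]
  -- With zero as the first operator, the adjunction formula says that α ∧ Qβ is a total divergence.
  -- The projections to degrees p and m make this an identity for all forms x, with a left side
  -- linear over B.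
  have e' : ∀ x, extProj B (Ω[B⁄R]) p x * Q β =
      -(ε • extProj B (Ω[B⁄R]) m (deRham R B (S (extProj B (Ω[B⁄R]) p x)))) := fun x => by
    have := e _ (extProj_mem p x)
    rw [LinearMap.zero_apply, zero_mul] at this
    rw [eq_neg_of_add_eq_zero_right this.symm]
    have hmem : extProj B (Ω[B⁄R]) p x * Q β ∈ ⋀[B]^m (Ω[B⁄R]) := by
      rw [hp, add_comm q' p]; exact mul_mem_exteriorPower (extProj_mem p x) hQβ
    rcases Int.units_eq_one_or ε with h1 | h1 <;> rw [h1] <;>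
    · simp only [one_smul, Units.neg_smul, neg_neg, map_neg]
      rw [extProj_same hmem]
  -- The projected divergence is linear over B, so `divergence_eq_zero` applies.
  have e0 : ∀ n, n + 1 = m → deRham R B * (pr n * S * pr p) = 0 := fun n hn => by
    refine divergence_eq_zero F hn (hS.mul_linear (hpr _) (hpr _)) (fun x => extProj_mem _ _) ?_
    have key : ∀ x, (deRham R B * (pr n * S * pr p)) x =
        -(ε • (extProj B (Ω[B⁄R]) p x * Q β)) := fun x => by
      rw [e' x, ← hn, extProj_deRham]
      simp only [smul_neg, neg_neg, smul_smul]
      rw [Int.units_mul_self, one_smul]; rfl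
    intro b
    ext x
    rw [Module.End.mul_apply, key, Module.End.mul_apply, key, mulOp_apply, mulOp_apply, map_smul,
      smul_mul_assoc, smul_neg, smul_comm]
  rw [← extProj_same hα, e']
  -- For m = 0 there are no forms of degree m - 1, so the component of degree m of an exact form is
  -- zero.
  rcases m with _ | n
  · rw [extProj_zero_deRham, smul_zero, neg_zero]
  · rw [extProj_deRham]
    have := LinearMap.congr_fun (e0 n rfl) α
    change deRham R B (extProj B (Ω[B⁄R]) n (S (extProj B (Ω[B⁄R]) p α))) = 0 at this
    rw [this, smul_zero, neg_zero]

end BaseOrder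

/-! ### Transposes and their effect on symbols -/

section Transpose

variable {R : Type u} [CommRing R] {B : Type v} [CommRing B] [Algebra R B] {m : ℕ}

theorem Adjoint.isTranspose {j : ℤ} {P Q : Op R B} (h : Adjoint m j P Q) : IsTranspose m j P Q :=
  fun p q e β hβ => ⟨0, 0, rfl, fun α hα => by
    rw [h p q e α hα β hβ, LinearMap.zero_apply, map_zero, add_zero]⟩

theorem IsTranspose.add {j : ℤ} {P P' Q Q' : Op R B} (h : IsTranspose m j P Q)
    (h' : IsTranspose m j P' Q') : IsTranspose m j (P + P') (Q + Q') := fun p q e β hβ => by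
  obtain ⟨k, S, hS, e1⟩ := h p q e β hβ
  obtain ⟨k', S', hS', e2⟩ := h' p q e β hβ
  refine ⟨k + k', S + S', (hS.mono (by omega)).add (hS'.mono (by omega)), fun α hα => ?_⟩
  rw [LinearMap.add_apply, LinearMap.add_apply, LinearMap.add_apply, add_mul, mul_add α, map_add,
    e1 α hα, e2 α hα, smul_add]
  abel

theorem IsTranspose.smul {j : ℤ} {P Q : Op R B} (h : IsTranspose m j P Q) (r : R) :
    IsTranspose m j (r • P) (r • Q) := fun p q e β hβ => by
  obtain ⟨k, S, hS, e1⟩ := h p q e β hβ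
  refine ⟨k, r • S, hS.smul r, fun α hα => ?_⟩
  rw [LinearMap.smul_apply, LinearMap.smul_apply, LinearMap.smul_apply, smul_mul_assoc,
    mul_smul_comm, map_smul, e1 α hα, smul_add, smul_comm]

theorem IsTranspose.neg {j : ℤ} {P Q : Op R B} (h : IsTranspose m j P Q) :
    IsTranspose m j (-P) (-Q) := by
  have := h.smul (-1)
  rwa [neg_one_smul, neg_one_smul] at this

theorem IsTranspose.sub {j : ℤ} {P P' Q Q' : Op R B} (h : IsTranspose m j P Q)
    (h' : IsTranspose m j P' Q') : IsTranspose m j (P - P') (Q - Q') := by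
  rw [sub_eq_add_neg, sub_eq_add_neg]; exact h.add h'.neg

theorem IsTranspose.units_smul {j : ℤ} {P Q : Op R B} (h : IsTranspose m j P Q) (ε : ℤˣ) :
    IsTranspose m j (ε • P) (ε • Q) := by
  rcases Int.units_eq_one_or ε with h | h <;> rw [h]
  · simpa using ‹IsTranspose m j P Q›
  · simpa using IsTranspose.neg ‹_›

theorem IsTranspose.zero (j : ℤ) : IsTranspose m j (0 : Op R B) 0 :=
  Adjoint.isTranspose fun p q _ α _ β _ => by simp

theorem IsTranspose.congr {i j : ℤ} {P Q : Op R B} (h : IsTranspose m i P Q) (e : i = j) :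
    IsTranspose m j P Q := e ▸ h

theorem isTranspose_koszul (b : B) : IsTranspose m 1 (koszul (R := R) b) (-koszul b) :=
  Adjoint.isTranspose fun p q _ α hα β hβ => by
    rw [koszul_apply, LinearMap.neg_apply, koszul_apply, dOne_mul, involute_of_mem hα, one_mul,
      Int.negOnePow_succ, smul_mul_assoc, mul_neg, Units.neg_smul, smul_neg, neg_neg, smul_mul_assoc, mul_assoc]

/-- The graded Leibniz rule for d(α ∧ β), with right multiplication by β as the operator under the
divergence. -/
theorem isTranspose_deRham : IsTranspose m 1 (deRham R B) (deRham R B) := fun p q _ β hβ =>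
  ⟨1, LinearMap.mulRight R β, fun b => by
    change (_ : Op R B) = 0
    rw [sub_eq_zero]
    ext α
    change mulOp b α * β = mulOp b (α * β)
    rw [mulOp_apply, mulOp_apply, smul_mul_assoc], fun α hα => by
    rw [LinearMap.mulRight_apply, deRham_mul, involute_of_mem hα, one_mul, Int.negOnePow_succ,
      Units.neg_smul, smul_mul_assoc]
    abel⟩

/-- The pairing couples Ω^p with Ω^{m-p}, so a sequence antisymmetric under p ↔ m - p gives an
anti-self-transpose operator. This is why the weight is centred at m/2. -/
theorem isTranspose_degreeScale {c : ℕ → R} (hc : ∀ p q : ℕ, p + q = m → c p = -c q) :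
    IsTranspose m 0 (degreeScale (B := B) c) (-degreeScale c) :=
  Adjoint.isTranspose fun p q e α hα β hβ => by
    rw [LinearMap.neg_apply, degreeScale_apply c hα, degreeScale_apply c hβ, hc p q (by omega)]
    simp

variable [Algebra ℚ R]

theorem isTranspose_opOf (F : Frame R B m) {q : ℕ} {a : Polyvectors R B}
    (ha : a ∈ ⋀[B]^q (Derivation R B B)) : IsTranspose m (-q) (opOf a) (opOf a) :=
  (adjoint_opOf F ha).isTranspose

theorem isTranspose_iota (F : Frame R B m) (v : Derivation R B B) :
    IsTranspose m (-1) (iota v) (iota v) := (adjoint_iota F v).isTranspose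

/-- The two divergences add up, the first being precomposed with `Q`; the bound `l` keeps it a
differential operator. If Q α lies outside the degrees 0, …, m then so does P' β, by
complementarity, and both sides vanish. -/
theorem IsTranspose.mul (F : Frame R B m) {i j : ℤ} {l : ℕ} {P P' Q Q' : Op R B}
    (h : IsTranspose m i P P') (h' : IsTranspose m j Q Q') (hP' : Raises (B := B) i P')
    (hQ : Raises (B := B) j Q) (hl : BaseOrdLT l Q) :
    IsTranspose m (i + j) (P * Q) ((i * j).negOnePow • (Q' * P')) := by
  intro p q e β hβ
  by_cases h0 : (p : ℤ) + j < 0 ∨ (m : ℤ) < p + j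
  · have hQ0 : ∀ α ∈ ⋀[B]^p (Ω[B⁄R]), Q α = 0 := fun α hα => by
      rcases h0 with h0 | h0
      · exact (hQ p α hα).2 h0
      · obtain ⟨r, hr⟩ := Int.eq_ofNat_of_zero_le (a := p + j) (by omega)
        exact forms_eq_zero F (p := r) (by omega) ((hQ p α hα).1 r hr.symm)
    have hP0 : P' β = 0 := by
      rcases h0 with h0 | h0
      · obtain ⟨r, hr⟩ := Int.eq_ofNat_of_zero_le (a := q + i) (by omega)
        exact forms_eq_zero F (p := r) (by omega) ((hP' q β hβ).1 r hr.symm)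
      · exact (hP' q β hβ).2 (by omega)
    refine ⟨0, 0, rfl, fun α hα => ?_⟩
    rw [Module.End.mul_apply, hQ0 α hα, map_zero, zero_mul, LinearMap.zero_apply, map_zero,
      add_zero]
    have : ((i * j).negOnePow • (Q' * P') : Op R B) β = 0 := by
      change (i * j).negOnePow • Q' (P' β) = 0
      rw [hP0, map_zero, smul_zero]
    rw [this, mul_zero, smul_zero]
  · rw [not_or, not_lt, not_lt] at h0
    obtain ⟨p', hp'⟩ := Int.eq_ofNat_of_zero_le h0.1
    obtain ⟨q', hq'⟩ := Int.eq_ofNat_of_zero_le (a := q + i) (by omega)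
    have hPβ : P' β ∈ ⋀[B]^q' (Ω[B⁄R]) := (hP' q β hβ).1 q' hq'.symm
    obtain ⟨k, S, hS, e1⟩ := h p' q (by omega) β hβ
    obtain ⟨k', S', hS', e2⟩ := h' p q' (by omega) (P' β) hPβ
    refine ⟨k + l + k' + 1, S * Q + (i * (p' + 1)).negOnePow • S', ?_, fun α hα => ?_⟩
    · refine BaseOrdLT.add ?_ ?_
      · exact (hS.succ.mul hl.succ).mono (by omega)
      · exact (hS'.mono (by omega)).units_smul _
    · have hQα : Q α ∈ ⋀[B]^p' (Ω[B⁄R]) := (hQ p α hα).1 p' hp'.symm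
      have e3 : ((i * j).negOnePow • (Q' * P') : Op R B) β = (i * j).negOnePow • Q' (P' β) := rfl
      have e4 : (S * Q + (i * (p' + 1)).negOnePow • S' : Op R B) α =
        S (Q α) + (i * (p' + 1)).negOnePow • S' α := rfl
      have e5 : ∀ (ε : ℤˣ) x, deRham R B (ε • x) = ε • deRham R B x := fun ε x => by
        rcases Int.units_eq_one_or ε with h | h <;> rw [h] <;> simp
      have e6 : ((i + j) * (p + 1)).negOnePow * (i * j).negOnePow =
          (i * (p' + 1)).negOnePow * (j * (p + 1)).negOnePow := by
        rw [← Int.negOnePow_add, ← Int.negOnePow_add, Int.negOnePow_eq_iff]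
        have hp'' : (p' : ℤ) = p + j := hp'.symm
        rw [hp'']
        exact ⟨0, by ring⟩
      rw [Module.End.mul_apply, e1 _ hQα, e2 α hα, e3, e4, map_add, e5, smul_add, smul_smul,
        mul_smul_comm, smul_smul, e6]
      abel

/-- Transposition reverses products of two odd operators with a minus sign, so up to that sign it
exchanges d ι_v and ι_v d. -/
theorem isTranspose_lieOp (F : Frame R B m) (v : Derivation R B B) :
    IsTranspose m 0 (lieOp v) (-lieOp v) := by
  have h1 := isTranspose_deRham.mul F (isTranspose_iota F v) raises_deRham (raises_iota v)
    (ordLT_iota v).base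
  have h2 := (isTranspose_iota F v).mul F isTranspose_deRham (raises_iota v) raises_deRham
    ordLT_deRham.base
  have := (h1.congr (j := 0) (by norm_num)).add (h2.congr (j := 0) (by norm_num))
  simpa [lieOp, add_comm] using this

theorem IsTranspose.unique (F : Frame R B m) {j : ℤ} {P Q Q' : Op R B} (h : IsTranspose m j P Q)
    (h' : IsTranspose m j P Q') (hQ : Raises (B := B) j Q) (hQ' : Raises (B := B) j Q') :
    Q = Q' := by
  have := h.sub h'
  rw [sub_self] at this
  exact sub_eq_zero.1 (IsTranspose.eq_zero F (hQ.sub hQ') this)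

/-- The commutator has order one less than the product. If one operator has order zero it is a
polyvector field, and this is the definition of order; the general case follows by the graded Jacobi
identity. -/
theorem OrdLT.gComm (F : Frame R B m) {k l : ℕ} {i j : ℤ} {P Q : Op R B}
    (hP : OrdLT (k + 1) i P) (hQ : OrdLT (l + 1) j Q) : OrdLT (k + l) (i + j) (gComm i j P Q) := by
  obtain ⟨n, hn⟩ : ∃ n, n = k + l := ⟨_, rfl⟩
  have base : ∀ {k i j} {P Q : Op R B}, OrdLT (k + 1) i P → OrdLT 1 j Q →
      OrdLT k (i + j) (DCrit.gComm i j P Q) := fun {k i j P Q} hP hQ => by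
    obtain ⟨q, a, ha, rfl, rfl | h0⟩ := hQ.exists_opOf F
    · exact hP.2 q a ha
    · rw [h0, gComm_zero_right]; exact OrdLT.zero _ _
  induction n generalizing k l i j P Q with
  | zero =>
    obtain ⟨rfl, rfl⟩ : k = 0 ∧ l = 0 := by omega
    exact base hP hQ
  | succ n ih =>
    rcases l with _ | l
    · exact base hP hQ
    rcases k with _ | k
    · rw [gComm_symm]
      exact (((base hQ hP).congr (add_comm _ _)).units_smul _).neg.mono (by omega)
    rw [← hn]
    refine ⟨hP.1.gComm hQ.1, fun q a ha => ?_⟩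
    rw [gComm_jacobi']
    refine OrdLT.add ?_ (OrdLT.units_smul ?_ _)
    · exact ((ih hP (hQ.2 q a ha) (by omega)).congr (by ring)).mono (by omega)
    · exact ((ih (hP.2 q a ha) hQ (by omega)).congr (by ring)).mono (by omega)

/-- Transposition is an anti-automorphism which fixes `O_X`, so each commutator with `O_X` changes
the sign once. -/
theorem IsTranspose.gComm_opOf (F : Frame R B m) {k : ℕ} {j : ℤ} {P P' : Op R B}
    (h : IsTranspose m j P P') (hP : OrdLT k j P) (hP' : Raises (B := B) j P') {q : ℕ}
    {a : Polyvectors R B} (ha : a ∈ ⋀[B]^q (Derivation R B B)) :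
    IsTranspose m (j + -q) (gComm j (-q) P (opOf a)) (-gComm j (-q) P' (opOf a)) := by
  have h1 := h.mul F (isTranspose_opOf F ha) hP' (raises_opOf ha) (OrdLT.of_opOf ha).base
  have h2 := (isTranspose_opOf F ha).mul F h (raises_opOf ha) hP.raises hP.base
  have := h1.sub ((h2.congr (add_comm _ _)).units_smul (j * -q).negOnePow)
  rw [smul_smul, mul_comm (-(q : ℤ)) j, Int.units_mul_self, one_smul] at this
  rwa [gComm, gComm, neg_sub]

/-- Operators of order `k` whose transpose has the sign opposite to that of the transposed symbol
are of order `k - 1`. -/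
theorem OrdLT.of_isTranspose (F : Frame R B m) {k : ℕ} {j : ℤ} {P : Op R B}
    (hP : OrdLT (k + 1) j P) (h : IsTranspose m j P (((k : ℤ) + 1).negOnePow • P)) :
    OrdLT k j P := by
  induction k generalizing j P with
  | zero =>
    -- An operator of order zero is a polyvector field, hence its own transpose. By hypothesis the
    -- transpose is also -P, so 2P = 0.
    have h' : IsTranspose m j P P := by
      obtain ⟨q, a, ha, rfl, rfl | h0⟩ := hP.exists_opOf F
      · exact isTranspose_opOf F ha
      · rw [h0]; exact IsTranspose.zero j
    have e := h.unique F h' (hP.1.units_smul _) hP.1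
    have e2 : ((2 : ℕ) : R) • P = 0 := by
      simp only [CharP.cast_eq_zero, zero_add, Int.negOnePow_one, Units.neg_smul, one_smul] at e
      rw [Nat.cast_two, two_smul]
      nth_rewrite 1 [← e]
      simp
    exact eq_zero_of_natCast_smul (R := R) two_ne_zero e2
  | succ k ih =>
    refine ⟨hP.1, fun q a ha => ih (hP.2 q a ha) ?_⟩
    have := h.gComm_opOf F hP (hP.1.units_smul _) ha
    rw [gComm_units_smul_left, ← Units.neg_smul, ← Int.negOnePow_succ] at this
    have e : ((k : ℤ) + 1).negOnePow = (((k + 1 : ℕ) : ℤ) + 1 + 1).negOnePow := by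
      rw [Int.negOnePow_eq_iff]; push_cast; ring_nf; exact ⟨-1, by ring⟩
    rw [e]
    exact this

end Transpose

end DCrit

end

noncomputable section

namespace DCrit

/-! ## The Euler identity for differential operators -/

section Euler

variable {R : Type u} [CommRing R] {B : Type v} [CommRing B] [Algebra R B] {m : ℕ}

theorem gComm_mulOp_eq (j : ℤ) (P : Op R B) (b : B) : gComm j 0 P (mulOp b) = baseComm P b := by
  simp [gComm, baseComm_apply]

theorem OrdLT.baseComm {k : ℕ} {j : ℤ} {P : Op R B} (hP : OrdLT (k + 1) j P) (b : B) :
    OrdLT k j (baseComm P b) := by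
  rw [← gComm_mulOp_eq j]; exact hP.gComm_mulOp b

theorem OrdLT.iota_mul {k : ℕ} {j : ℤ} {P : Op R B} (hP : OrdLT k j P) (v : Derivation R B B) :
    OrdLT k (j - 1) (iota v * P) := (hP.opOf_mul (ι_mem v)).congr (by push_cast; ring)

theorem IsFrame.gComm_approx {r : ℕ} {g : Fin r → B} {v : Fin r → Derivation R B B}
    (h : IsFrame g v) {k : ℕ} {j : ℤ} {P : Op R B} (hP : OrdLT (k + 2) j P) (b : B) :
    OrdLT k j (DCrit.baseComm P b - ∑ i, mulOp (v i b) * DCrit.baseComm P (g i)) := by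
  have := h.approx_derivation (ordSub R B k j) (DCrit.baseComm P) (fun a b => by
    rw [baseComm_mul, smul_op, smul_op, add_sub_cancel_left]
    exact (hP.baseComm a).baseComm b) b
  simp only [smul_op] at this
  exact this

theorem derivation_sum_apply {r : ℕ} (w : Fin r → Derivation R B B) (b : B) :
    (∑ i, w i) b = ∑ i, w i b := by
  rw [← Derivation.coeFnAddMonoidHom_apply, map_sum, Finset.sum_apply]; rfl

theorem Frame.derivation_ext (F : Frame R B m) {w w' : Derivation R B B}
    (h : ∀ i, w (F.g i) = w' (F.g i)) : w = w' := by
  rw [F.isFrame.derivation_eq w, F.isFrame.derivation_eq w']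
  exact Finset.sum_congr rfl fun i _ => by rw [h]

/-- The vector fields `∑_i u(v_l(g_i)) v_i`. -/
def frameDefect (F : Frame R B m) (u : Derivation R B B) (l : Fin F.r) : Derivation R B B :=
  ∑ i, u (F.v l (F.g i)) • F.v i

/-- The matrix E = (v_a(g_b)) is idempotent. For U = u(E), differentiation of E² = E gives U = EU +
UE and so EUE = 0, and the entries of EUE are the coefficients in question. -/
theorem sum_smul_frameDefect (F : Frame R B m) (u : Derivation R B B) (n : Fin F.r) :
    ∑ l, F.v n (F.g l) • frameDefect F u l = 0 := by
  refine F.derivation_ext fun k => ?_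
  have e : ∀ a b, F.v a (F.g b) = ∑ l, F.v a (F.g l) * F.v l (F.g b) := fun a b => by
    rw [F.isFrame.derivation_apply (F.v a) (F.g b)]
    exact Finset.sum_congr rfl fun l _ => mul_comm _ _
  simp only [derivation_sum_apply, Derivation.zero_apply, Derivation.smul_apply, frameDefect,
    smul_eq_mul]
  let E : Matrix (Fin F.r) (Fin F.r) B := Matrix.of fun a b => F.v a (F.g b)
  let U : Matrix (Fin F.r) (Fin F.r) B := Matrix.of fun a b => u (F.v a (F.g b))
  have hE : E * E = E := by ext a b; rw [Matrix.mul_apply]; exact (e a b).symm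
  have hU : U = E * U + U * E := by
    ext a b
    rw [Matrix.add_apply, Matrix.mul_apply, Matrix.mul_apply, ← Finset.sum_add_distrib]
    change u (F.v a (F.g b)) = _
    rw [e a b, map_sum]
    refine Finset.sum_congr rfl fun l _ => ?_
    rw [Derivation.leibniz, smul_eq_mul, smul_eq_mul, mul_comm (F.v l (F.g b))]
    rfl
  have h0 : E * U * E = 0 := by
    have h1 : E * U * E = E * (E * U + U * E) * E := by rw [← hU]
    have h2 : E * (E * U + U * E) * E = E * U * E + E * U * E := by
      rw [mul_add, add_mul, ← mul_assoc, hE, ← mul_assoc, mul_assoc (E * U) E E, hE]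
    rw [h2] at h1
    exact left_eq_add.1 h1
  have h1 := congrFun (congrFun h0 n) k
  rw [mul_assoc, Matrix.mul_apply] at h1
  rw [← show (0 : Matrix (Fin F.r) (Fin F.r) B) n k = 0 from rfl, ← h1]
  exact Finset.sum_congr rfl fun l _ => by rw [Matrix.mul_apply]; rfl

/-- The frame expansion of the Lie bracket. The defect is the price of a frame which need not be a
basis: it vanishes when the functions v_l(g_i) are constant. -/
theorem lie_eq (F : Frame R B m) (u : Derivation R B B) (l : Fin F.r) :
    ⁅F.v l, u⁆ = ∑ i, F.v l (u (F.g i)) • F.v i - frameDefect F u l := by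
  conv_lhs => rw [F.isFrame.derivation_eq ⁅F.v l, u⁆]
  rw [frameDefect, ← Finset.sum_sub_distrib]
  exact Finset.sum_congr rfl fun i _ => by rw [Derivation.commutator_apply, sub_smul]

/-- By `sum_smul_frameDefect` one may subtract Σ v_n(g_l) [P, g_n] from [P, g_l] without changing
the sum, and the difference has order two less than `P`. -/
theorem ordLT_sum_frameDefect (F : Frame R B m) (u : Derivation R B B) {k : ℕ} {j : ℤ}
    {P : Op R B} (hP : OrdLT (k + 2) j P) :
    OrdLT k (j - 1) (∑ l, iota (frameDefect F u l) * baseComm P (F.g l)) := by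
  have e : ∑ l, iota (frameDefect F u l) * baseComm P (F.g l) =
      ∑ l, iota (frameDefect F u l) *
        (baseComm P (F.g l) - ∑ n, mulOp (F.v n (F.g l)) * baseComm P (F.g n)) := by
    simp only [mul_sub, Finset.mul_sum, Finset.sum_sub_distrib]
    rw [eq_comm, sub_eq_self, Finset.sum_comm]
    refine Finset.sum_eq_zero fun n _ => ?_
    have := congrArg iota (sum_smul_frameDefect F u n)
    rw [iota_sum] at this
    have h2 : ∑ l, iota (frameDefect F u l) * (mulOp (F.v n (F.g l)) * baseComm P (F.g n)) =
      (∑ l, iota (F.v n (F.g l) • frameDefect F u l)) * baseComm P (F.g n) := by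
      rw [Finset.sum_mul]
      refine Finset.sum_congr rfl fun l _ => ?_
      rw [iota_smul, ← mul_assoc, iota_mul_mulOp]
    rw [h2, this, ← zero_smul B (0 : Derivation R B B), iota_smul, mulOp_zero, zero_mul, zero_mul]
  rw [e]
  exact OrdLT.sum fun l _ => (F.isFrame.gComm_approx hP _).iota_mul _

/-- Up to lower order [P, u(g_i)] = Σ v_l(u(g_i)) [P, g_l]. These are the coefficients of the Lie
brackets in `lie_eq`, apart from the defects, which were just estimated. -/
theorem ordLT_sum_lie (F : Frame R B m) (u : Derivation R B B) {k : ℕ} {j : ℤ}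
    {P : Op R B} (hP : OrdLT (k + 2) j P) :
    OrdLT k (j - 1) (∑ l, iota ⁅F.v l, u⁆ * baseComm P (F.g l) -
      ∑ i, iota (F.v i) * baseComm P (u (F.g i))) := by
  have e : ∑ l, iota ⁅F.v l, u⁆ * baseComm P (F.g l) -
      ∑ i, iota (F.v i) * baseComm P (u (F.g i)) =
      -(∑ i, iota (F.v i) * (baseComm P (u (F.g i)) -
        ∑ l, mulOp (F.v l (u (F.g i))) * baseComm P (F.g l))) -
        ∑ l, iota (frameDefect F u l) * baseComm P (F.g l) := by
    have h1 : ∀ l, iota ⁅F.v l, u⁆ * baseComm P (F.g l) =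
        (∑ i, iota (F.v i) * (mulOp (F.v l (u (F.g i))) * baseComm P (F.g l))) -
          iota (frameDefect F u l) * baseComm P (F.g l) := fun l => by
      rw [lie_eq, sub_eq_add_neg, iota_add, iota_sum, ← neg_one_smul B, iota_smul, add_mul,
        Finset.sum_mul, sub_eq_add_neg]
      have hn : ∀ S : Op R B, mulOp (-1) * S = -S := fun S => by
        ext α
        simp [mulOp_apply]
      rw [mul_assoc (mulOp _), hn]
      congr 1
      refine Finset.sum_congr rfl fun i _ => ?_
      rw [iota_smul, ← mul_assoc, iota_mul_mulOp]
    simp only [h1, mul_sub, Finset.mul_sum, Finset.sum_sub_distrib]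
    rw [Finset.sum_comm]
    abel
  rw [e]
  exact (OrdLT.sum fun i _ => (F.isFrame.gComm_approx hP _).iota_mul _).neg.sub
    (ordLT_sum_frameDefect F u hP)

/-- The Euler operator on differential operators of degree `j`. -/
def euler (F : Frame R B m) (j : ℤ) (P : Op R B) : Op R B :=
  ∑ i, (lieOp (F.v i) * baseComm P (F.g i) + koszul (F.g i) * gComm (-1) j (iota (F.v i)) P)

theorem Raises.euler (F : Frame R B m) {j : ℤ} {P : Op R B} (hP : Raises (B := B) j P) :
    Raises (B := B) j (euler F j P) := by
  refine Finset.sum_induction _ (Raises (B := B) j) (fun _ _ => Raises.add) Raises.zero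
    fun i _ => ?_
  refine Raises.add ?_ ?_
  · rw [← gComm_mulOp_eq j]
    exact ((raises_lieOp _).mul (hP.gComm (raises_mulOp _))).congr (by ring)
  · exact ((raises_koszul _).mul ((raises_iota _).gComm hP)).congr (by ring)

theorem gComm_iota_iota (v w : Derivation R B B) : gComm (-1) (-1) (iota v) (iota w) = 0 :=
  gComm_opOf_opOf (p := 1) (q := 1) (ι_mem v) (ι_mem w)

theorem gComm_iota_mulOp (v : Derivation R B B) (b : B) :
    gComm (-1) 0 (iota v) (mulOp b) = 0 := by simp [gComm, iota_mul_mulOp]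

theorem gComm_mulOp_iota (v : Derivation R B B) (b : B) :
    gComm 0 (-1) (mulOp b) (iota v) = 0 := by simp [gComm, iota_mul_mulOp]

theorem gComm_mulOp_mulOp (b c : B) : gComm 0 0 (mulOp (R := R) b) (mulOp c) = 0 := by
  simp [gComm, mulOp_comm b c]

/-- Since `X` commutes with functions and with the contractions of the frame, the Jacobi identity
carries it into the inner brackets. The extra terms come from its commutators with L_{v_i} and dg_i.
-/
theorem gComm_euler (F : Frame R B m) {j e : ℤ} (P X : Op R B)
    (h1 : ∀ i, gComm (-1) e (iota (F.v i)) X = 0) (h2 : ∀ b, gComm 0 e (mulOp b) X = 0) :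
    gComm j e (euler F j P) X = euler F (j + e) (gComm j e P X) +
      ∑ i, ((j * e).negOnePow • (gComm 0 e (lieOp (F.v i)) X * baseComm P (F.g i)) +
        ((-1 + j) * e).negOnePow •
          (gComm 1 e (koszul (F.g i)) X * gComm (-1) j (iota (F.v i)) P)) := by
  rw [euler, gComm_sum_left, euler, ← Finset.sum_add_distrib]
  refine Finset.sum_congr rfl fun i _ => ?_
  have e1 : gComm j e (lieOp (F.v i) * baseComm P (F.g i)) X =
      lieOp (F.v i) * baseComm (gComm j e P X) (F.g i) +
        (j * e).negOnePow • (gComm 0 e (lieOp (F.v i)) X * baseComm P (F.g i)) := by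
    have h3 := gComm_jacobi' j 0 e P (mulOp (F.g i)) X
    rw [h2, gComm_zero_right, zero_add, zero_mul, Int.negOnePow_zero, one_smul, gComm_mulOp_eq,
      gComm_mulOp_eq, add_zero] at h3
    have h4 := gComm_mul_left 0 j e (lieOp (F.v i)) (baseComm P (F.g i)) X
    rw [zero_add, h3] at h4
    exact h4
  have e2 : gComm j e (koszul (F.g i) * gComm (-1) j (iota (F.v i)) P) X =
      koszul (F.g i) * gComm (-1) (j + e) (iota (F.v i)) (gComm j e P X) +
        ((-1 + j) * e).negOnePow •
          (gComm 1 e (koszul (F.g i)) X * gComm (-1) j (iota (F.v i)) P) := by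
    have h3 := gComm_jacobi' (-1) j e (iota (F.v i)) P X
    rw [h1, gComm_zero_left, smul_zero, add_zero] at h3
    have h4 := gComm_mul_left 1 (-1 + j) e (koszul (F.g i)) (gComm (-1) j (iota (F.v i)) P) X
    rw [h3, add_neg_cancel_left] at h4
    exact h4
  rw [gComm_add_left, e1, e2]
  abel

/-- The sum is the number operator, p on Ω^p, so its commutator with an operator measures the degree
of that operator. -/
theorem gComm_number (F : Frame R B m) {j : ℤ} {P : Op R B} (hP : Raises (B := B) j P) :
    gComm 0 j (∑ i, koszul (F.g i) * iota (F.v i)) P = j • P := by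
  refine op_ext fun p α hα => ?_
  have hN : ∀ q : ℕ, ∀ β ∈ ⋀[B]^q (Ω[B⁄R]),
      (∑ i, koszul (F.g i) * iota (F.v i) : Op R B) β = (q : R) • β := fun q β hβ => by
    rw [LinearMap.sum_apply]; exact F.isFrame.sum_koszul_iota hβ
  rw [gComm, zero_mul, Int.negOnePow_zero, one_smul, LinearMap.sub_apply, Module.End.mul_apply,
    Module.End.mul_apply, hN p α hα, map_smul, LinearMap.smul_apply]
  by_cases h0 : (p : ℤ) + j < 0
  · rw [(hP p α hα).2 h0]; simp
  · obtain ⟨q, hq⟩ := Int.eq_ofNat_of_zero_le (not_lt.1 h0)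
    rw [hN q _ ((hP p α hα).1 q hq.symm), ← sub_smul, ← Int.cast_smul_eq_zsmul R]
    congr 1
    have : (q : ℤ) = p + j := hq.symm
    rw [← Int.cast_natCast q, this]; push_cast; ring

theorem euler_eq_zero (F : Frame R B m) {j : ℤ} {P : Op R B} (hP : OrdLT 1 j P) :
    euler F j P = 0 := by
  refine Finset.sum_eq_zero fun i _ => ?_
  have h : gComm j (-1) P (iota (F.v i)) = 0 := hP.gComm_iota _
  rw [show baseComm P (F.g i) = 0 from hP.baseComm _, gComm_symm, h]
  simp

/-- An operator of order `k` is an eigenvector of the Euler operator, up to lower order. -/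
theorem euler_approx (F : Frame R B m) {k : ℕ} {j : ℤ} {P : Op R B} (hP : OrdLT (k + 1) j P) :
    OrdLT k j (euler F j P - (k : R) • P) := by
  induction k generalizing j P with
  | zero => rw [euler_eq_zero F hP, Nat.cast_zero, zero_smul, sub_zero]; rfl
  | succ k ih =>
    -- The order of the error is tested on functions, as in `baseEuler_approx`, and on contractions,
    -- where the derivatives of the frame have to be controlled.
    refine ordLT_succ ((Raises.euler F hP.1).sub (hP.smul _).raises) (fun b => ?_) (fun u => ?_)
    · rw [gComm_sub_left, gComm_smul_left, gComm_euler F P _ (fun i => gComm_iota_mulOp _ _)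
        (fun c => gComm_mulOp_mulOp _ _)]
      simp only [gComm_lieOp_mulOp, gComm_koszul_mulOp, mul_zero, Int.negOnePow_zero, one_smul,
        zero_mul, add_zero]
      simp only [gComm_mulOp_eq]
      have h1 := ih (hP.baseComm b)
      have h2 := (F.isFrame.gComm_approx hP b).neg
      have := h1.add h2
      convert this using 1
      rw [Nat.cast_succ, add_smul, one_smul]
      abel
    · rw [gComm_sub_left, gComm_smul_left, gComm_euler F P _ (fun i => gComm_iota_iota _ _)
        (fun c => gComm_mulOp_iota _ _)]
      simp only [gComm_lieOp_iota, gComm_koszul_iota]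
      have h1 := ih (hP.gComm_iota u)
      set ε : ℤˣ := (j * -1).negOnePow with hε
      have s2 : ((-1 + j) * -1).negOnePow = -ε := by
        rw [hε, ← Int.negOnePow_succ]; congr 1; ring
      rw [s2]
      -- Expanding u = Σ u(g_i) v_i also brings in commutators of `P` with the coefficients u(g_i).
      -- They cancel the Lie bracket terms of `gComm_euler` up to the error in `ordLT_sum_lie`, and
      -- the remaining double commutators are of lower order.
      have hu : gComm (-1) j (iota u) P = ∑ i, mulOp (u (F.g i)) * gComm (-1) j (iota (F.v i)) P -
          ∑ i, iota (F.v i) * baseComm P (u (F.g i)) -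
          ε • ∑ i, gComm j (-1) (baseComm P (u (F.g i))) (iota (F.v i)) := by
        conv_lhs => rw [F.isFrame.derivation_eq u, iota_sum]
        rw [gComm_sum_left, Finset.smul_sum, ← Finset.sum_sub_distrib, ← Finset.sum_sub_distrib]
        refine Finset.sum_congr rfl fun i _ => ?_
        have h3 := gComm_mul_left 0 (-1) j (mulOp (u (F.g i))) (iota (F.v i)) P
        rw [zero_add, ← iota_smul, gComm_symm 0 j, gComm_mulOp_eq, zero_mul, Int.negOnePow_zero,
          one_smul, mul_comm (-1) j, ← hε] at h3
        rw [h3, gComm, mul_comm (-1) j, ← hε, gComm, ← hε]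
        rcases Int.units_eq_one_or ε with h | h <;> rw [h]
        · simp only [one_smul]; noncomm_ring
        · simp only [Units.neg_smul, one_smul]; noncomm_ring
      have hs : gComm j (-1) P (iota u) = -(ε • gComm (-1) j (iota u) P) := gComm_symm _ _ _ _
      have h2 := (ordLT_sum_lie F u hP).units_smul ε
      have h3 : OrdLT k (j - 1) (∑ i, gComm j (-1) (baseComm P (u (F.g i))) (iota (F.v i))) :=
        OrdLT.sum fun i _ => (hP.baseComm _).gComm_iota _
      have := (h1.add h2).sub h3
      convert this using 1
      rw [Nat.cast_succ, add_smul, one_smul, add_sub_assoc, add_sub_assoc, sub_add_eq_sub_sub_swap]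
      nth_rewrite 2 [hs]
      rw [hu, Finset.sum_add_distrib, ← Finset.smul_sum, ← Finset.smul_sum]
      rcases Int.units_eq_one_or ε with h | h <;> rw [h] <;>
        simp only [Units.neg_smul, one_smul] <;> abel_nf

variable [Algebra ℚ R]

/-- Induction on the order: operators are generated by polyvectors, Lie derivatives and
multiplication by exact one-forms. -/
theorem OrdLT.induction (F : Frame R B m) {p : ℕ → ℤ → Op R B → Prop}
    (opOf : ∀ (q : ℕ), ∀ a ∈ ⋀[B]^q (Derivation R B B), p 0 (-q) (opOf a))
    (zero : ∀ j, p 0 j 0) (succ : ∀ k j P, p k j P → p (k + 1) j P)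
    (add : ∀ k j P Q, p k j P → p k j Q → p k j (P + Q))
    (smul : ∀ k j P (r : R), p k j P → p k j (r • P))
    (lie : ∀ k j P i, p k j P → p (k + 1) j (lieOp (F.v i) * P))
    (koszul : ∀ k j P i, p k j P → p (k + 1) (1 + j) (koszul (F.g i) * P))
    {k : ℕ} {j : ℤ} {P : Op R B} (hP : OrdLT (k + 1) j P) : p k j P := by
  induction k generalizing j P with
  | zero =>
    obtain ⟨q, a, ha, rfl, rfl | h0⟩ := hP.exists_opOf F
    · exact opOf q a ha
    · rw [h0]; exact zero j
  | succ k ih =>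
    -- The inner commutators in `euler F j P` have lower order. Subtracting the error term of
    -- `euler_approx` leaves (k + 1) P, and k + 1 is invertible.
    have h1 : p (k + 1) j (euler F j P) := by
      have z : p (k + 1) j 0 := by have := succ _ _ _ (ih (OrdLT.zero (k + 1) j)); exact this
      refine Finset.sum_induction _ (p (k + 1) j) (fun _ _ => add _ _ _ _) z fun i _ => ?_
      refine add _ _ _ _ (lie _ _ _ i (ih (hP.baseComm _))) ?_
      have h2 : p k (-1 + j) (DCrit.gComm (-1) j (iota (F.v i)) P) := ih (by
        rw [gComm_symm]
        exact (((hP.gComm_iota _).units_smul _).neg).congr (by ring))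
      have h3 := koszul _ _ _ i h2
      rwa [add_neg_cancel_left] at h3
    have h2 := add _ _ _ _ h1 (smul _ _ _ (-1) (succ _ _ _ (ih (euler_approx F hP))))
    rw [neg_one_smul, neg_sub, add_sub_cancel] at h2
    exact mem_of_natCast_smul_mem (R := R) (p := p (k + 1) j) (Nat.succ_ne_zero k) (fun r x h => smul _ _ _ r h) h2

/-- A second form of the Euler identity. -/
theorem euler_approx' (F : Frame R B m) {k : ℕ} {j : ℤ} {P : Op R B} (hP : OrdLT (k + 1) j P) :
    OrdLT k j (∑ i, (lieOp (F.v i) * baseComm P (F.g i) +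
      iota (F.v i) * gComm 1 j (koszul (F.g i)) P) - ((k : ℤ) - j) • P) := by
  have h1 := euler_approx F hP
  -- Replacing dg_i [ι_{v_i}, P] by ι_{v_i} [dg_i, P] costs these double commutators, which are of
  -- lower order, and the commutator of the number operator with `P`, which is jP. Hence the
  -- eigenvalue k - j.
  have h2 : OrdLT k j (∑ i, (-j).negOnePow •
      gComm (1 + j) (-1) (gComm 1 j (koszul (F.g i)) P) (iota (F.v i))) :=
    OrdLT.sum fun i _ => by
      have := (ordLT_koszul (F.g i)).gComm F (k := 1) hP
      rw [add_comm 1 k] at this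
      exact ((this.gComm_iota _).units_smul _).congr (by ring)
  have h3 := gComm_number F hP.1
  have e : ∀ i, gComm 0 j (koszul (F.g i) * iota (F.v i)) P =
      koszul (F.g i) * gComm (-1) j (iota (F.v i)) P -
        iota (F.v i) * gComm 1 j (koszul (F.g i)) P + (-j).negOnePow •
      gComm (1 + j) (-1) (gComm 1 j (koszul (F.g i)) P) (iota (F.v i)) := fun i => by
    have h4 := gComm_mul_left 1 (-1) j (koszul (F.g i)) (iota (F.v i)) P
    rw [show (1 : ℤ) + -1 = 0 by norm_num] at h4
    have s2 : ((1 + j) * -1).negOnePow = -(-j).negOnePow := by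
      rw [← Int.negOnePow_succ, Int.negOnePow_eq_iff]; exact ⟨-1, by ring⟩
    rw [h4, show ∀ X Y : Op R B, gComm (1 + j) (-1) X Y = X * Y - ((1 + j) * -1).negOnePow • (Y * X)
      from fun _ _ => rfl, s2, neg_one_mul]
    rcases Int.units_eq_one_or (-j).negOnePow with h | h <;> rw [h]
    · simp only [Units.neg_smul, one_smul]; noncomm_ring
    · simp only [Units.neg_smul, one_smul, neg_neg]; noncomm_ring
  rw [gComm_sum_left, Finset.sum_congr rfl fun i _ => e i, Finset.sum_add_distrib,
    Finset.sum_sub_distrib] at h3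
  have := h1.add h2
  convert this using 1
  rw [sub_smul, ← h3, euler, Finset.sum_add_distrib, Finset.sum_add_distrib, natCast_zsmul,
    ← Nat.cast_smul_eq_nsmul R]
  abel

end Euler

end DCrit

end

noncomputable section

namespace DCrit

/-! ## Operators representing the canonical exact symplectic structure -/

section Classical

variable {R : Type u} [CommRing R] {B : Type v} [CommRing B] [Algebra R B] {m : ℕ}

theorem symbolBracket_function (P : Op R B) (q : ℕ) (b : B) (a : Polyvectors R B) :
    symbolBracket P 0 q (algebraMap B _ b) a = gComm 1 (-q) (baseComm P b) (opOf a) := by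
  rw [symbolBracket, opOf_algebraMap, Nat.cast_zero, sub_zero, neg_zero, gComm_mulOp_eq]

theorem symbolBracket_vector (P : Op R B) (q : ℕ) (v : Derivation R B B) (a : Polyvectors R B) :
    symbolBracket P 1 q (ExteriorAlgebra.ι B v) a =
      gComm 0 (-q) (gComm 1 (-1) P (iota v)) (opOf a) := by
  rw [symbolBracket, Nat.cast_one, sub_self]; rfl

theorem baseComm_deRham (b : B) : baseComm (deRham R B) b = koszul b := by
  rw [← gComm_mulOp_eq 1, gComm_deRham_mulOp]

/-- The trace of a frame does not depend on the frame. -/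
theorem Frame.trace_eq (F : Frame R B m) {r : ℕ} {g : Fin r → B} {v : Fin r → Derivation R B B}
    (h : IsFrame g v) : ∑ i, v i (g i) = (m : B) := by
  rw [← F.trace]
  have e1 : ∀ i, v i (g i) = ∑ l, F.v l (g i) • v i (F.g l) := fun i =>
    F.isFrame.derivation_apply (v i) (g i)
  have e2 : ∀ l, F.v l (F.g l) = ∑ i, v i (F.g l) • F.v l (g i) := fun l =>
    h.derivation_apply (F.v l) (F.g l)
  rw [Finset.sum_congr rfl fun i _ => e1 i, Finset.sum_congr rfl fun i _ => e2 i, Finset.sum_comm]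
  exact Finset.sum_congr rfl fun l _ => Finset.sum_congr rfl fun i _ => mul_comm _ _

/-- A frame with arbitrary functions. -/
def Frame.change (F : Frame R B m) {r : ℕ} {g : Fin r → B} {v : Fin r → Derivation R B B}
    (h : IsFrame g v) : Frame R B m := ⟨r, g, v, h, F.trace_eq h⟩

theorem opOf_graded_comm {e : ℤ} {ξ : Module.End R (Polyvectors R B)} (hξ : Raises (B := B) (-e) ξ)
    {r q : ℕ} {x a : Polyvectors R B} (hx : x ∈ ⋀[B]^r (Derivation R B B))
    (ha : a ∈ ⋀[B]^q (Derivation R B B)) :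
    opOf (ξ x) * opOf a = ((r - e) * q).negOnePow • (opOf a * opOf (ξ x)) := by
  by_cases h0 : (r : ℤ) + -e < 0
  · rw [(hξ r x hx).2 h0, opOf_zero, zero_mul, mul_zero, smul_zero]
  · obtain ⟨s, hs⟩ := Int.eq_ofNat_of_zero_le (not_lt.1 h0)
    rw [← opOf_mul, graded_comm ((hξ r x hx).1 s hs.symm) ha, opOf_units_smul, opOf_mul,
      show (s : ℤ) = r + -e from hs.symm, ← sub_eq_add_neg]

/-- For `P = d` the brackets are {v, a} = [L_v, a] and {g, a} = [dg ∧, a]. The identity for ξ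
follows on functions from the frame, on vector fields from u = Σ u(g_i) v_i, and in general from the
Leibniz rules in `a`. -/
theorem representsExact_bracket (F : Frame R B m) {e : ℤ} {ξ : Module.End R (Polyvectors R B)}
    (hξ : IsGradedDer e ξ) {q : ℕ} {a : Polyvectors R B} (ha : a ∈ ⋀[B]^q (Derivation R B B)) :
    opOf (ξ a) = ∑ i, (opOf (ξ (algebraMap B _ (F.g i))) *
        gComm 0 (-q) (lieOp (F.v i)) (opOf a) +
      opOf (ξ (ExteriorAlgebra.ι B (F.v i))) * gComm 1 (-q) (koszul (F.g i)) (opOf a)) := by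
  have hB : ∀ b, ξ (algebraMap B _ b) = ∑ i, F.v i b • ξ (algebraMap B _ (F.g i)) := fun b => by
    let D : Derivation R B (Polyvectors R B) := Derivation.mk'
      { toFun := fun b => ξ (algebraMap B _ b)
        map_add' := fun b c => by rw [map_add, map_add]
        map_smul' := fun r b => by
          rw [RingHom.id_apply, ← map_smul, Algebra.algebraMap_eq_smul_one,
            Algebra.algebraMap_eq_smul_one, smul_assoc] }
      fun b c => by
        change ξ (algebraMap B _ (b * c)) = b • ξ (algebraMap B _ c) + c • ξ (algebraMap B _ b)
        rw [map_mul, hξ.2 0 _ (algebraMap_mem b), Nat.cast_zero, mul_zero, Int.negOnePow_zero,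
          one_smul, Algebra.smul_def, Algebra.smul_def, ← Algebra.commutes c, add_comm]
    exact F.isFrame.derivation_apply D b
  have hB' : ∀ b, opOf (ξ (algebraMap B _ b)) =
      ∑ i, mulOp (F.v i b) * opOf (ξ (algebraMap B _ (F.g i))) := fun b => by
    rw [hB, opOf_sum]; exact Finset.sum_congr rfl fun i _ => opOf_smul _ _
  have hgen : ∀ u, opOf (ξ (ExteriorAlgebra.ι B u)) =
      ∑ i, (opOf (ξ (algebraMap B _ (F.g i))) * gComm 0 (-1) (lieOp (F.v i)) (iota u) +
        opOf (ξ (ExteriorAlgebra.ι B (F.v i))) * gComm 1 (-1) (koszul (F.g i)) (iota u)) := by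
    intro u
    simp only [gComm_lieOp_iota, gComm_koszul_iota]
    have h1 : ξ (ExteriorAlgebra.ι B u) = ∑ i, (ξ (algebraMap B _ (u (F.g i))) *
        ExteriorAlgebra.ι B (F.v i) + u (F.g i) • ξ (ExteriorAlgebra.ι B (F.v i))) := by
      conv_lhs => rw [F.isFrame.derivation_eq u, map_sum, map_sum]
      refine Finset.sum_congr rfl fun i _ => ?_
      rw [map_smul, Algebra.smul_def, hξ.2 0 _ (algebraMap_mem _), Nat.cast_zero, mul_zero,
        Int.negOnePow_zero, one_smul, Algebra.smul_def]
    have h2 : ∀ i, opOf (ξ (ExteriorAlgebra.ι B (F.v i))) * mulOp (u (F.g i)) =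
        mulOp (u (F.g i)) * opOf (ξ (ExteriorAlgebra.ι B (F.v i))) := fun i => by
      rw [← opOf_algebraMap, ← opOf_mul, ← opOf_mul, Algebra.commutes]
    -- The frame expansion of ξ(g_l) reduces this to the linear relations between the defects in
    -- `sum_smul_frameDefect`.
    have h3 : ∑ l, opOf (ξ (algebraMap B _ (F.g l))) * iota (frameDefect F u l) = 0 := by
      rw [Finset.sum_congr rfl fun l _ => by rw [hB' (F.g l)]]
      simp only [Finset.sum_mul]
      rw [Finset.sum_comm]
      refine Finset.sum_eq_zero fun n _ => ?_
      have h4 := congrArg iota (sum_smul_frameDefect F u n)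
      rw [iota_sum, ← zero_smul B (0 : Derivation R B B), iota_smul, mulOp_zero, zero_mul] at h4
      have h5 := congrArg (opOf (ξ (algebraMap B _ (F.g n))) * ·) h4
      simp only [mul_zero, Finset.mul_sum] at h5
      rw [← h5]
      refine Finset.sum_congr rfl fun l _ => ?_
      rw [iota_smul, ← mul_assoc, ← opOf_algebraMap, ← opOf_mul, ← opOf_mul, Algebra.commutes]
    have hn : ∀ v w : Derivation R B B, iota (v - w) = iota v - iota w := fun v w => by
      rw [iota, map_sub, opOf_sub]; rfl
    have h6 : ∀ l, opOf (ξ (algebraMap B _ (F.g l))) * iota ⁅F.v l, u⁆ =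
        (∑ i, mulOp (F.v l (u (F.g i))) * opOf (ξ (algebraMap B _ (F.g l))) * iota (F.v i)) -
          opOf (ξ (algebraMap B _ (F.g l))) * iota (frameDefect F u l) := fun l => by
      rw [lie_eq, hn, mul_sub, iota_sum, Finset.mul_sum]
      congr 1
      refine Finset.sum_congr rfl fun i _ => ?_
      rw [iota_smul, ← mul_assoc, ← opOf_algebraMap, ← opOf_mul, ← opOf_mul, Algebra.commutes]
    simp only [h2, h6, h1, opOf_sum, opOf_add, opOf_mul, opOf_smul, Finset.sum_add_distrib,
      Finset.sum_sub_distrib, h3, sub_zero]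
    congr 1
    rw [Finset.sum_comm]
    refine Finset.sum_congr rfl fun i _ => ?_
    rw [hB', Finset.sum_mul]; rfl
  induction ha using Submodule.pow_induction_on_left' with
  | algebraMap b =>
    simp only [opOf_algebraMap, Nat.cast_zero, neg_zero, gComm_lieOp_mulOp, gComm_koszul_mulOp,
      mul_zero, add_zero]
    rw [hB']
    refine Finset.sum_congr rfl fun i _ => ?_
    rw [← opOf_algebraMap, ← opOf_mul, ← opOf_mul, Algebra.commutes]
  | add x y i hx hy hx' hy' =>
    simp only [map_add, opOf_add, hx', hy', gComm_add_right, mul_add, ← Finset.sum_add_distrib]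
    exact Finset.sum_congr rfl fun i _ => by abel
  | mem_mul x hx i y hy hy' =>
    obtain ⟨u, rfl⟩ := hx
    rw [hξ.2 1 _ (ι_mem u), opOf_add, opOf_mul, opOf_units_smul, opOf_mul, hgen, hy',
      Finset.sum_mul, Finset.mul_sum, Finset.smul_sum, ← Finset.sum_add_distrib]
    refine Finset.sum_congr rfl fun l _ => ?_
    have e0 : (-((i.succ : ℕ) : ℤ)) = -1 + -(i : ℤ) := by push_cast; ring
    have c1 := opOf_graded_comm hξ.1 (algebraMap_mem (F.g l)) (ι_mem u)
    have c2 := opOf_graded_comm hξ.1 (ι_mem (F.v l)) (ι_mem u)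
    have s1 : ((((0 : ℕ) : ℤ) - e) * (1 : ℕ)).negOnePow = e.negOnePow := by
      rw [Int.negOnePow_eq_iff]; exact ⟨-e, by push_cast; ring⟩
    have s2 : ((((1 : ℕ) : ℤ) - e) * (1 : ℕ)).negOnePow = -e.negOnePow := by
      rw [← Int.negOnePow_succ, Int.negOnePow_eq_iff]; exact ⟨-e, by push_cast; ring⟩
    have s3 : (e * ((1 : ℕ) : ℤ)).negOnePow = e.negOnePow := by simp
    rw [s1] at c1
    rw [s2] at c2
    rw [s3, opOf_mul, e0, gComm_mul_right, gComm_mul_right]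
    simp only [zero_mul, Int.negOnePow_zero, one_smul, one_mul]
    change opOf (ξ _) * iota u = _ • (iota u * _) at c1
    change opOf (ξ _) * iota u = _ • (iota u * _) at c2
    change _ = opOf (ξ _) * (gComm 0 (-1) (lieOp (F.v l)) (iota u) * opOf y + iota u * _) +
      opOf (ξ _) * (gComm 1 (-1) (koszul (F.g l)) (iota u) * opOf y +
        (-1 : ℤ).negOnePow • (iota u * _))
    change _ + e.negOnePow • (iota u * _) = _
    have s4 : (-1 : ℤ).negOnePow = -1 := by simp
    rw [s4, mul_add, mul_add, Units.neg_smul, one_smul, mul_add (opOf _) _ (-_), mul_neg,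
      ← mul_assoc (opOf _) (iota u), ← mul_assoc (opOf _) (iota u), c1, c2]
    rcases Int.units_eq_one_or e.negOnePow with h | h <;> rw [h]
    · simp only [Units.neg_smul, one_smul]; noncomm_ring
    · simp only [Units.neg_smul, one_smul, neg_neg]; noncomm_ring

theorem isGradedDer_of_homogeneous {e : ℤ} {ξ : Module.End R (Polyvectors R B)}
    (h : Raises (B := B) (-e) ξ)
    (h' : ∀ p q : ℕ, ∀ a ∈ ⋀[B]^p (Derivation R B B), ∀ b ∈ ⋀[B]^q (Derivation R B B),
      ξ (a * b) = ξ a * b + (e * p).negOnePow • (a * ξ b)) : IsGradedDer e ξ := by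
  refine ⟨h, fun q a ha b => ?_⟩
  induction b using DirectSum.Decomposition.inductionOn
    (fun p => ⋀[B]^p (Derivation R B B)) with
  | zero => simp
  | homogeneous x => exact h' _ _ _ ha _ x.2
  | add x y hx hy => rw [mul_add, map_add, map_add, hx, hy, mul_add, mul_add, smul_add]; abel

/-- The commutator with L_w preserves `O_X`, since it sends functions to functions and contractions
to contractions by Cartan's formula. -/
theorem exists_lie_polyvector (w : Derivation R B B) {q : ℕ} {a : Polyvectors R B}
    (ha : a ∈ ⋀[B]^q (Derivation R B B)) : ∃ x ∈ ⋀[B]^q (Derivation R B B),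
      opOf x = lieOp w * opOf a - opOf a * lieOp w := by
  induction ha using Submodule.pow_induction_on_left' with
  | algebraMap b =>
    refine ⟨_, algebraMap_mem (w b), ?_⟩
    rw [opOf_algebraMap, opOf_algebraMap, lieOp_mul_mulOp, add_sub_cancel_right]
  | add x y i hx hy hx' hy' =>
    obtain ⟨x', h1, e1⟩ := hx'
    obtain ⟨y', h2, e2⟩ := hy'
    exact ⟨_, add_mem h1 h2, by rw [opOf_add, e1, e2, opOf_add]; noncomm_ring⟩
  | mem_mul x hx i y hy hy' =>
    obtain ⟨u, rfl⟩ := hx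
    obtain ⟨y', h2, e2⟩ := hy'
    refine ⟨ExteriorAlgebra.ι B ⁅w, u⁆ * y + ExteriorAlgebra.ι B u * y', add_mem ?_ ?_, ?_⟩
    · rw [Nat.succ_eq_one_add]; exact mul_mem_exteriorPower (ι_mem _) hy
    · rw [Nat.succ_eq_one_add]; exact mul_mem_exteriorPower (ι_mem _) h2
    · rw [opOf_add, opOf_mul, opOf_mul, opOf_mul, e2]
      have := lieOp_mul_iota w u
      change iota ⁅w, u⁆ * opOf y + iota u * _ = lieOp w * (iota u * opOf y) - iota u * opOf y * _
      rw [← mul_assoc, this]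
      noncomm_ring

variable [Algebra ℚ R]

variable (B) in
/-- The operator acting on `Ω^p` as multiplication by `m/2 - p`. -/
def weightOp (m : ℕ) : Op R B := degreeScale fun p => algebraMap ℚ R ((m : ℚ) / 2 - p)

theorem weightOp_apply {p : ℕ} {α : Forms R B} (hα : α ∈ ⋀[B]^p (Ω[B⁄R])) :
    weightOp B m α = algebraMap ℚ R ((m : ℚ) / 2 - p) • α := degreeScale_apply _ hα

/-- The weight m/2 - p drops by j under an operator of degree j; the constant m/2 plays no role in
the commutator. -/
theorem gComm_weightOp {j : ℤ} {P : Op R B} (hP : Raises (B := B) j P) :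
    gComm 0 j (weightOp B m) P = -(j • P) := by
  refine op_ext fun p α hα => ?_
  rw [gComm, zero_mul, Int.negOnePow_zero, one_smul, LinearMap.sub_apply, Module.End.mul_apply,
    Module.End.mul_apply, weightOp_apply hα, map_smul, LinearMap.neg_apply, LinearMap.smul_apply]
  by_cases h0 : (p : ℤ) + j < 0
  · rw [(hP p α hα).2 h0]; simp
  · obtain ⟨q, hq⟩ := Int.eq_ofNat_of_zero_le (not_lt.1 h0)
    rw [weightOp_apply ((hP p α hα).1 q hq.symm), ← sub_smul, ← Int.cast_smul_eq_zsmul R,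
      ← neg_smul]
    congr 1
    have : (q : ℚ) = p + j := by exact_mod_cast hq.symm
    rw [← map_sub, this, ← map_intCast (algebraMap ℚ R), ← map_neg]
    congr 1
    ring

theorem raises_weightOp : Raises (B := B) 0 (weightOp (R := R) B m) := fun p α hα =>
  ⟨fun q hq => by
    obtain rfl : q = p := by omega
    rw [weightOp_apply hα, ← algebraMap_smul B]; exact Submodule.smul_mem _ _ hα, fun h => by omega⟩

theorem ordLT_weightOp : OrdLT 2 0 (weightOp (R := R) B m) :=
  ordLT_succ raises_weightOp
    (fun b => by rw [gComm_weightOp (raises_mulOp b), zero_smul, neg_zero]; exact OrdLT.zero _ _)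
    (fun v => by
      rw [gComm_weightOp (raises_iota v), neg_smul, one_smul, neg_neg]; exact ordLT_iota v)

theorem isTranspose_weightOp : IsTranspose m 0 (weightOp (R := R) B m) (-weightOp B m) :=
  isTranspose_degreeScale fun p q h => by
    rw [← map_neg]
    congr 1
    rw [← h]; push_cast; ring

/-- The de Rham differential represents the canonical exact symplectic structure. -/
theorem representsExact_deRham (F : Frame R B m) :
    RepresentsExact (deRham R B) (weightOp B m) := by
  refine ⟨ordLT_deRham, ordLT_weightOp, fun r g v h q a ha => ⟨fun e ξ hξ => ?_, ?_⟩⟩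
  · have := representsExact_bracket (F.change h) hξ ha
    simp only [symbolBracket_function, symbolBracket_vector, baseComm_deRham, gComm_deRham_iota]
    exact this
  · simp only [symbolBracket_function, baseComm_deRham, gComm_koszul_opOf _ ha, ← opOf_mul,
      ← opOf_sum]
    rw [h.sum_ι_polyDiff ha, gComm_weightOp (raises_opOf ha), opOf_smul', neg_smul, neg_neg,
      natCast_zsmul, Nat.cast_smul_eq_nsmul]

/-- Polyvectors act faithfully, so the identity may be checked on operators, where it is the Leibniz
rule for the commutator with db ∧. -/
theorem isGradedDer_polyDiff (F : Frame R B m) (b : B) :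
    IsGradedDer 1 ((polyDiff R B b).restrictScalars R) := by
  refine isGradedDer_of_homogeneous (fun p α hα => ⟨fun q hq => ?_, fun h => ?_⟩)
    fun p q x hx y hy => opOf_injective F ?_
  · exact (contractLeft_mem_exteriorPower _ hα).1 q (by omega)
  · exact (contractLeft_mem_exteriorPower _ hα).2 (by omega)
  · change opOf (polyDiff R B b (x * y)) = opOf (polyDiff R B b x * y + _ • (x * polyDiff R B b y))
    rw [← gComm_koszul_opOf b (mul_mem_exteriorPower hx hy), opOf_add, opOf_mul, opOf_mul,
      opOf_units_smul, opOf_mul, ← gComm_koszul_opOf b hx, ← gComm_koszul_opOf b hy,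
      show (-((p + q : ℕ) : ℤ)) = -p + -q by push_cast; ring, gComm_mul_right]
    congr 2
    rw [Int.negOnePow_eq_iff]; exact ⟨-p, by ring⟩

/-- The Lie derivative of polyvector fields. -/
theorem exists_gradedDer_lie (F : Frame R B m) (w : Derivation R B B) :
    ∃ ξ : Module.End R (Polyvectors R B), IsGradedDer 0 ξ ∧
      ∀ a, opOf (ξ a) = lieOp w * opOf a - opOf a * lieOp w := by
  have h : ∀ a : Polyvectors R B, ∃ x, opOf x = lieOp w * opOf a - opOf a * lieOp w := fun a => by
    induction a using DirectSum.Decomposition.inductionOn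
      (fun p => ⋀[B]^p (Derivation R B B)) with
    | zero => exact ⟨0, by rw [opOf_zero, mul_zero, zero_mul, sub_zero]⟩
    | homogeneous x => obtain ⟨y, _, hy⟩ := exists_lie_polyvector w x.2; exact ⟨y, hy⟩
    | add x y hx hy =>
      obtain ⟨x', e1⟩ := hx
      obtain ⟨y', e2⟩ := hy
      exact ⟨x' + y', by rw [opOf_add, e1, e2, opOf_add]; noncomm_ring⟩
  choose ξ hξ using h
  let L : Module.End R (Polyvectors R B) :=
    { toFun := ξ
      map_add' := fun x y => opOf_injective F (by
        rw [opOf_add, hξ, hξ, hξ, opOf_add]; noncomm_ring)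
      map_smul' := fun r x => opOf_injective F (by
        rw [RingHom.id_apply, opOf_smul', hξ, hξ, opOf_smul', op_mul_rsmul, smul_mul_assoc,
          smul_sub]) }
  refine ⟨L, isGradedDer_of_homogeneous (fun p a ha => ⟨fun q hq => ?_, fun h => by omega⟩)
    fun p q x hx y hy => opOf_injective F ?_, hξ⟩
  · obtain rfl : q = p := by omega
    obtain ⟨x, hx, e⟩ := exists_lie_polyvector w ha
    have : L a = x := opOf_injective F ((hξ a).trans e.symm)
    rw [this]; exact hx
  · change opOf (ξ (x * y)) = opOf (ξ x * y + _ • (x * ξ y))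
    rw [zero_mul, Int.negOnePow_zero, one_smul, opOf_add, opOf_mul, opOf_mul, hξ, hξ, hξ, opOf_mul]
    noncomm_ring

/-- The defining identity is tested on the contraction with db, which kills functions and sends v_i
to v_i(b). The resulting sum Σ v_i(b) {g_i, a} is {b, a}, because the symbol is a derivation in b.
-/
theorem RepresentsExact.bracket_function (F : Frame R B m) {P Q : Op R B}
    (h : RepresentsExact P Q) (b : B) {q : ℕ} {a : Polyvectors R B}
    (ha : a ∈ ⋀[B]^q (Derivation R B B)) :
    gComm 1 (-q) (baseComm P b) (opOf a) = opOf (polyDiff R B b a) := by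
  have h1 := ((h.2.2 F.r F.g F.v F.isFrame q a ha).1 1 _ (isGradedDer_polyDiff F b))
  simp only [symbolBracket_function, LinearMap.coe_restrictScalars, polyDiff_algebraMap, opOf_zero,
    zero_mul, zero_add] at h1
  have h2 : ∀ v, polyDiff R B b (ExteriorAlgebra.ι B v) = algebraMap B _ (v b) := fun v => by
    have := polyDiff_ι_mul b v 1
    rw [mul_one] at this
    rw [this, ← map_one (algebraMap B (Polyvectors R B)), polyDiff_algebraMap, mul_zero, sub_zero,
      map_one, Algebra.algebraMap_eq_smul_one]
  rw [h1]
  have hP : OrdLT 3 1 P := h.1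
  have h3 : gComm 1 (-q) (baseComm P b - ∑ i, mulOp (F.v i b) * baseComm P (F.g i)) (opOf a) = 0 :=
    (F.isFrame.gComm_approx (k := 1) hP b).2 q a ha
  rw [gComm_sub_left, gComm_sum_left, sub_eq_zero] at h3
  rw [h3]
  refine Finset.sum_congr rfl fun i _ => ?_
  have h4 := gComm_mul_left 0 1 (-q) (mulOp (F.v i b)) (baseComm P (F.g i)) (opOf a)
  have h5 : gComm 0 (-q) (mulOp (F.v i b)) (opOf a) = 0 := by
    rw [← opOf_algebraMap]; simpa using gComm_opOf_opOf (algebraMap_mem (F.v i b)) ha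
  rw [zero_add, h5, zero_mul, smul_zero, add_zero] at h4
  rw [h4, h2, opOf_algebraMap]

/-- The symbols of operators representing the exact symplectic structure are unique. -/
theorem RepresentsExact.unique (F : Frame R B m) {P Q : Op R B} (h : RepresentsExact P Q) :
    OrdLT 2 1 (P - deRham R B) ∧ OrdLT 1 0 (Q - weightOp B m) := by
  have hd := representsExact_deRham F
  have hb : ∀ (b : B) (q : ℕ), ∀ a ∈ ⋀[B]^q (Derivation R B B),
      gComm 1 (-q) (baseComm (P - deRham R B) b) (opOf a) = 0 := fun b q a ha => by
    have e : baseComm (P - deRham R B) b = baseComm P b - baseComm (deRham R B) b := by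
      simp only [baseComm_apply]; noncomm_ring
    rw [e, gComm_sub_left, h.bracket_function F b ha, hd.bracket_function F b ha, sub_self]
  have hW : OrdLT 3 1 (P - deRham R B) := OrdLT.sub (k := 3) h.1 hd.1
  refine ⟨ordLT_succ hW.raises (fun b => ?_) (fun w => ⟨(hW.raises.gComm (raises_iota w)), ?_⟩), ?_⟩
  · rw [gComm_mulOp_eq]
    exact ⟨(hW.baseComm b).raises, hb b⟩
  · intro q a ha
    -- The Lie derivative along w sends g_i to w(g_i). As the brackets of functions already agree,
    -- the defining identities of `P` and of d give equal sums Σ w(g_i) {v_i, a}.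
    obtain ⟨ξ, hξ, e⟩ := exists_gradedDer_lie F w
    have e1 := ((h.2.2 F.r F.g F.v F.isFrame q a ha).1 0 _ hξ)
    have e2 := ((hd.2.2 F.r F.g F.v F.isFrame q a ha).1 0 _ hξ)
    have h0 : ∀ b, opOf (ξ (algebraMap B _ b)) = mulOp (w b) := fun b => by
      rw [e, opOf_algebraMap, lieOp_mul_mulOp, add_sub_cancel_right]
    rw [e2] at e1
    simp only [symbolBracket_function, symbolBracket_vector, h.bracket_function F _ ha,
      hd.bracket_function F _ ha, Finset.sum_add_distrib, add_left_inj, h0] at e1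
    -- Writing w = Σ w(g_i) v_i reduces the bracket with w to brackets with the v_i; the terms with
    -- [P - d, w(g_i)] do not contribute to the symbol.
    have e3 : gComm 1 (-1) (P - deRham R B) (iota w) =
        ∑ i, (baseComm (P - deRham R B) (w (F.g i)) * iota (F.v i) +
          mulOp (w (F.g i)) * gComm 1 (-1) (P - deRham R B) (iota (F.v i))) := by
      have : iota w = ∑ i, mulOp (w (F.g i)) * iota (F.v i) := by
        conv_lhs => rw [F.isFrame.derivation_eq w, iota_sum]
        exact Finset.sum_congr rfl fun i _ => iota_smul _ _
      rw [this, gComm, Finset.mul_sum, Finset.sum_mul, Finset.smul_sum, ← Finset.sum_sub_distrib]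
      refine Finset.sum_congr rfl fun i _ => ?_
      have h4 := gComm_mul_right 1 0 (-1) (P - deRham R B) (mulOp (w (F.g i))) (iota (F.v i))
      rw [zero_add, gComm_mulOp_eq, mul_zero, Int.negOnePow_zero, one_smul] at h4
      rw [← h4, gComm]
    change gComm (1 - 1) (-q) _ _ = 0
    rw [sub_self, e3, gComm_sum_left]
    have e4 : ∀ i, gComm 0 (-q) (baseComm (P - deRham R B) (w (F.g i)) * iota (F.v i) +
          mulOp (w (F.g i)) * gComm 1 (-1) (P - deRham R B) (iota (F.v i))) (opOf a) =
        mulOp (w (F.g i)) * gComm 0 (-q) (gComm 1 (-1) P (iota (F.v i))) (opOf a) -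
        mulOp (w (F.g i)) * gComm 0 (-q) (gComm 1 (-1) (deRham R B) (iota (F.v i))) (opOf a) := by
      intro i
      have h4 := gComm_mul_left 1 (-1) (-q) (baseComm (P - deRham R B) (w (F.g i)))
        (iota (F.v i)) (opOf a)
      have h5 : gComm (-1) (-q) (iota (F.v i)) (opOf a) = 0 := gComm_opOf_opOf (ι_mem _) ha
      rw [hb _ q a ha, h5, mul_zero, zero_mul, smul_zero, add_zero] at h4
      have h6 := gComm_mul_left 0 0 (-q) (mulOp (w (F.g i)))
        (gComm 1 (-1) (P - deRham R B) (iota (F.v i))) (opOf a)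
      have h7 : gComm 0 (-q) (mulOp (w (F.g i))) (opOf a) = 0 := by
        rw [← opOf_algebraMap]; simpa using gComm_opOf_opOf (algebraMap_mem (w (F.g i))) ha
      rw [h7, zero_mul, zero_mul, smul_zero, add_zero, add_zero, gComm_sub_left 1, gComm_sub_left 0,
        mul_sub] at h6
      rw [show (1 : ℤ) + -1 = 0 by norm_num] at h4
      rw [gComm_add_left, h4, zero_add, gComm_sub_left 1, mul_sub, h6, mul_sub]
    rw [Finset.sum_congr rfl fun i _ => e4 i, Finset.sum_sub_distrib, e1, sub_self]
  · refine ⟨((show OrdLT 2 0 Q from h.2.1).sub ordLT_weightOp).raises, fun q a ha => ?_⟩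
    have e1 := (h.2.2 F.r F.g F.v F.isFrame q a ha).2
    have e2 := (hd.2.2 F.r F.g F.v F.isFrame q a ha).2
    simp only [symbolBracket_function, h.bracket_function F _ ha] at e1
    simp only [symbolBracket_function, hd.bracket_function F _ ha] at e2
    rw [gComm_sub_left, e1, e2, sub_self]
    rfl

end Classical

end DCrit

end

noncomputable section

namespace DCrit

/-! ## Maurer--Cartan equations in filtered algebras with a contraction -/

/-- A graded Lie subalgebra, with a complete filtration `𝔤`, of a differential algebra `S` with a
derivation `E`, an odd element `Q` with `Q² = 0` and an even element `D` with `[Q, D] = E Q`, and a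
contraction `h` for which `E + [D, -] - [[Q, -] + ∂, h]` acts as `k - 1` on the `k`th graded
piece. -/
structure MCData (R : Type u) [CommRing R] (S : Type v) [Ring S] [Algebra R S] where
  /-- the parity automorphism -/
  σ : S →ₗ[R] S
  /-- the differential -/
  der : S →ₗ[R] S
  /-- the even derivation -/
  E : S →ₗ[R] S
  /-- the contraction -/
  h : S →ₗ[R] S
  /-- the odd element -/
  Q : S
  /-- the even element -/
  D : S
  /-- the filtration of the part of degree `J` -/
  𝔤 : ℕ → ℤ → Submodule R S
  der_mul : ∀ x y, der (x * y) = der x * y + σ x * der y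
  der_der : ∀ x, der (der x) = 0
  E_mul : ∀ x y, E (x * y) = E x * y + x * E y
  E_der : ∀ x, E (der x) = der (E x)
  σ_Q : σ Q = -Q
  der_Q : der Q = 0
  Q_mul_Q : Q * Q = 0
  σ_D : σ D = D
  der_D : der D = 0
  comm_Q_D : Q * D - D * Q = E Q
  σ_eq : ∀ k J, ∀ x ∈ 𝔤 k J, σ x = J.negOnePow • x
  mono : ∀ k J, 𝔤 (k + 1) J ≤ 𝔤 k J
  bracket : ∀ k l J J', ∀ x ∈ 𝔤 k J, ∀ y ∈ 𝔤 l J',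
    x * y - (J * J').negOnePow • (y * x) ∈ 𝔤 (k + l) (J + J')
  der_mem : ∀ k J, ∀ x ∈ 𝔤 k J, der x ∈ 𝔤 k (J + 1)
  h_mem : ∀ k J, ∀ x ∈ 𝔤 k J, h x ∈ 𝔤 k (J - 1)
  Q_mem : Q ∈ 𝔤 0 1
  euler : ∀ k J, ∀ x ∈ 𝔤 k J,
    E x + (D * x - x * D) - (Q * h x - σ (h x) * Q + der (h x)) - h (Q * x - σ x * Q + der x) -
      ((k : R) - 1) • x ∈ 𝔤 (k + 1) J
  separated : ∀ J x, (∀ n, x ∈ 𝔤 (n + 2) J) → x = 0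
  complete : ∀ J (x : ℕ → S), (∀ n, x (n + 1) - x n ∈ 𝔤 (n + 2) J) →
    ∃ y, ∀ n, y - x n ∈ 𝔤 (n + 2) J

namespace MCData

variable {R : Type u} [CommRing R] {S : Type v} [Ring S] [Algebra R S] (M : MCData R S)

/-- The twisted differential. -/
def d (x : S) : S := M.Q * x - M.σ x * M.Q + M.der x

/-- The operator `E + [D, -] - [d, h]`. -/
def A (x : S) : S := M.E x + (M.D * x - x * M.D) - M.d (M.h x) - M.h (M.d x)

/-- The Maurer--Cartan equations for `(Q + x, D + y)`. -/
def IsMC (x y : S) : Prop :=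
  (M.Q + x) * (M.Q + x) + M.der (M.Q + x) = 0 ∧
  (M.Q + x) * (M.D + y) - (M.D + y) * (M.Q + x) + M.der (M.D + y) = M.E (M.Q + x)

/-- The right hand side of the fixed point equation. -/
def Φ (u x : S) : S := M.d u + (x * (u + M.h x) - (u + M.h x) * x) + M.h (x * x)

variable {M} {k l : ℕ} {J J' : ℤ} {x y u : S}

theorem d_add (x y : S) : M.d (x + y) = M.d x + M.d y := by
  simp only [d, map_add]; noncomm_ring

theorem d_smul (r : R) (x : S) : M.d (r • x) = r • M.d x := by
  simp only [d, map_smul, mul_smul_comm, smul_mul_assoc, smul_sub, smul_add]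

theorem d_neg (x : S) : M.d (-x) = -M.d x := by
  have := M.d_smul (-1) x
  rwa [neg_one_smul, neg_one_smul] at this

theorem A_sub (x y : S) : M.A (x - y) = M.A x - M.A y := by
  simp only [A, sub_eq_add_neg x y, d_add, d_neg, map_add, map_neg]; noncomm_ring

theorem A_smul (r : R) (x : S) : M.A (r • x) = r • M.A x := by
  simp only [A, d_smul, map_smul, mul_smul_comm, smul_mul_assoc, smul_sub, smul_add]

theorem mono' (h : k ≤ l) (hx : x ∈ M.𝔤 l J) : x ∈ M.𝔤 k J := by
  induction h with
  | refl => exact hx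
  | step _ ih => exact ih (M.mono _ _ hx)

theorem d_mem (hx : x ∈ M.𝔤 k J) : M.d x ∈ M.𝔤 k (J + 1) := by
  have := M.bracket 0 k 1 J _ M.Q_mem x hx
  rw [zero_add, add_comm, one_mul] at this
  rw [d, M.σ_eq k J x hx, smul_mul_assoc]
  exact add_mem this (M.der_mem _ _ _ hx)

theorem A_approx (hx : x ∈ M.𝔤 k J) : M.A x - ((k : R) - 1) • x ∈ M.𝔤 (k + 1) J :=
  M.euler k J x hx

theorem A_mem (hx : x ∈ M.𝔤 k J) : M.A x ∈ M.𝔤 k J := by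
  have := add_mem (M.mono _ _ (A_approx hx)) (Submodule.smul_mem _ ((k : R) - 1) hx)
  rwa [sub_add_cancel] at this

theorem bracket_even (hx : x ∈ M.𝔤 k J) (hy : y ∈ M.𝔤 l 0) :
    x * y - y * x ∈ M.𝔤 (k + l) J := by
  have := M.bracket k l J 0 x hx y hy
  simpa using this

theorem bracket_odd (hx : x ∈ M.𝔤 k 1) (hy : y ∈ M.𝔤 l 1) :
    x * y + y * x ∈ M.𝔤 (k + l) 2 := by
  have := M.bracket k l 1 1 x hx y hy
  simpa using this

/-- The Maurer--Cartan equations read d x = -x² and E x + [D, x] = d y + [x, y]. They are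
substituted in the definition of A, and d y - d(h x) = d u. -/
theorem IsMC.fixed_point (h : M.IsMC x y) (hx : x ∈ M.𝔤 2 1) (hy : y ∈ M.𝔤 2 0) :
    M.A x = M.Φ (y - M.h x) x := by
  obtain ⟨h1, h2⟩ := h
  have s1 : M.σ x = -x := by simpa using M.σ_eq _ _ _ hx
  have s0 : M.σ y = y := by simpa using M.σ_eq _ _ _ hy
  rw [map_add, M.der_Q, zero_add, add_mul, mul_add, mul_add, M.Q_mul_Q, zero_add] at h1
  rw [map_add, map_add, M.der_D, zero_add, ← M.comm_Q_D, ← sub_eq_zero] at h2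
  have e1 : M.d x = -(x * x) := by
    rw [d, s1, eq_neg_iff_add_eq_zero, ← h1]
    noncomm_ring
  have e2 : M.E x + (M.D * x - x * M.D) = M.d y + (x * y - y * x) := by
    rw [d, s0, ← sub_eq_zero, ← neg_eq_zero, ← h2]
    noncomm_ring
  rw [A, e1, e2, Φ, sub_eq_add_neg y, d_add, d_neg, map_neg, neg_add_cancel_right]
  abel

variable [Algebra ℚ R]

/-- Only brackets are known to respect the filtration, so the difference of squares is written as
half the anticommutator of x + y and x - y. -/
theorem sq_sub_sq_mem (hx : x ∈ M.𝔤 l 1) (hy : y ∈ M.𝔤 l 1) (h : x - y ∈ M.𝔤 k 1) :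
    x * x - y * y ∈ M.𝔤 (l + k) 2 := by
  have := bracket_odd (add_mem hx hy) h
  refine mem_of_natCast_smul_mem (R := R) (n := 2) two_ne_zero
    (p := fun z => z ∈ M.𝔤 (l + k) 2) (fun r z hz => Submodule.smul_mem _ r hz) ?_
  rw [Nat.cast_two, two_smul]
  convert this using 1
  noncomm_ring

theorem sq_mem (hx : x ∈ M.𝔤 l 1) : x * x ∈ M.𝔤 (l + l) 2 := by
  have := sq_sub_sq_mem hx (zero_mem _) (k := l) (y := 0) (by rwa [sub_zero])
  rwa [mul_zero, sub_zero] at this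

/-- Since u, x and y lie in 𝔤_2, every term of the difference contains a bracket with an element of
positive filtration. So Φ is contracting for the filtration. -/
theorem Φ_sub_mem (hu : u ∈ M.𝔤 2 0) (hx : x ∈ M.𝔤 2 1) (hy : y ∈ M.𝔤 2 1)
    (h : x - y ∈ M.𝔤 k 1) : M.Φ u x - M.Φ u y ∈ M.𝔤 (k + 1) 1 := by
  have e : M.Φ u x - M.Φ u y = ((x - y) * (u + M.h x) - (u + M.h x) * (x - y)) +
      (y * M.h (x - y) - M.h (x - y) * y) + M.h (x * x - y * y) := by
    simp only [Φ, map_sub]; noncomm_ring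
  rw [e]
  have hx' : M.h x ∈ M.𝔤 2 0 := M.h_mem _ _ _ hx
  have h' : M.h (x - y) ∈ M.𝔤 k 0 := M.h_mem _ _ _ h
  refine add_mem (add_mem ?_ ?_) ?_
  · exact mono' (by omega) (bracket_even h (add_mem hu hx'))
  · exact mono' (by omega) (bracket_even hy h')
  · exact mono' (by omega) (M.h_mem _ _ _ (sq_sub_sq_mem hx hy h))

/-- Successive approximation: on 𝔤_{n+2} the operator A is n + 1 modulo 𝔤_{n+3}, so subtracting the
error divided by n + 1 improves it by one step. -/
theorem exists_fixed_point (hu : u ∈ M.𝔤 2 0) : ∃ x ∈ M.𝔤 2 1, M.A x = M.Φ u x := by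
  choose c hc using fun n : ℕ => exists_natCast_mul_eq_one R (Nat.succ_ne_zero n)
  let X : ℕ → S := fun n => Nat.rec 0 (fun n x => x - c n • (M.A x - M.Φ u x)) n
  have hX : ∀ n, X (n + 1) = X n - c n • (M.A (X n) - M.Φ u (X n)) := fun n => rfl
  have key : ∀ n, X n ∈ M.𝔤 2 1 ∧ M.A (X n) - M.Φ u (X n) ∈ M.𝔤 (n + 2) 1 := by
    intro n
    induction n with
    | zero =>
      refine ⟨zero_mem _, ?_⟩
      have e : M.A (X 0) - M.Φ u (X 0) = -M.d u := by
        change M.A 0 - M.Φ u 0 = _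
        have := M.A_sub 0 0
        simp only [sub_self] at this
        rw [this, Φ]; simp
      rw [e]; exact neg_mem (d_mem hu)
    | succ n ih =>
      obtain ⟨h1, h2⟩ := ih
      set z := M.A (X n) - M.Φ u (X n) with hz
      have h3 : X (n + 1) ∈ M.𝔤 2 1 := by
        rw [hX]; exact sub_mem h1 (Submodule.smul_mem _ _ (mono' (by omega) h2))
      refine ⟨h3, ?_⟩
      have h4 : X (n + 1) - X n ∈ M.𝔤 (n + 2) 1 := by
        rw [hX, sub_sub_cancel_left]; exact neg_mem (Submodule.smul_mem _ _ h2)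
      have h5 := Φ_sub_mem hu h3 h1 h4
      have h6 := Submodule.smul_mem _ (c n) (A_approx h2)
      have e : M.A (X (n + 1)) - M.Φ u (X (n + 1)) =
          -(c n • (M.A z - (((n + 2 : ℕ) : R) - 1) • z)) -
            (M.Φ u (X (n + 1)) - M.Φ u (X n)) := by
        have : M.A (X (n + 1)) = M.A (X n) - c n • M.A z := by
          conv_lhs => rw [hX, A_sub, A_smul]
        have h7 : c n * (((n + 2 : ℕ) : R) - 1) = 1 := by
          refine Eq.trans ?_ (hc n)
          push_cast; ring
        rw [this, smul_sub, smul_smul, h7, one_smul]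
        nth_rewrite 3 [hz]
        abel
      rw [e]
      exact sub_mem (neg_mem h6) h5
  obtain ⟨y, hy⟩ := M.complete 1 X fun n => by
    rw [hX, sub_sub_cancel_left]; exact neg_mem (Submodule.smul_mem _ _ (key n).2)
  have hy2 : y ∈ M.𝔤 2 1 := by
    have := add_mem (hy 0) (key 0).1
    rwa [sub_add_cancel] at this
  refine ⟨y, hy2, sub_eq_zero.1 (M.separated 1 _ fun n => ?_)⟩
  have e : M.A y - M.Φ u y = M.A (y - X n) + (M.A (X n) - M.Φ u (X n)) -
      (M.Φ u y - M.Φ u (X n)) := by rw [A_sub]; abel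
  rw [e]
  exact sub_mem (add_mem (A_mem (hy n)) (key n).2)
    (M.mono _ _ (Φ_sub_mem hu hy2 (key n).1 (hy n)))

/-- If the difference z of two solutions lies in 𝔤_{n+2}, then A z lies in 𝔤_{n+3}, while A z is (n
+ 1) z modulo 𝔤_{n+3}. Hence z lies in 𝔤_{n+3}. -/
theorem fixed_point_unique (hu : u ∈ M.𝔤 2 0) (hx : x ∈ M.𝔤 2 1) (hy : y ∈ M.𝔤 2 1)
    (ex : M.A x = M.Φ u x) (ey : M.A y = M.Φ u y) : x = y := by
  refine sub_eq_zero.1 (M.separated 1 _ fun n => ?_)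
  induction n with
  | zero => exact sub_mem hx hy
  | succ n ih =>
    have h1 := Φ_sub_mem hu hx hy ih
    have h2 := A_approx ih
    rw [A_sub, ex, ey] at h2
    have h3 := sub_mem h1 h2
    rw [sub_sub_cancel] at h3
    refine mem_of_natCast_smul_mem (R := R) (n := n + 1) (Nat.succ_ne_zero n)
      (p := fun z => z ∈ M.𝔤 (n + 1 + 2) 1) (fun r z hz => Submodule.smul_mem _ r hz) ?_
    convert h3 using 2
    push_cast; ring

/-- Solutions of the fixed point equation satisfy the Maurer--Cartan equations. -/
theorem isMC_of_fixed_point (hu : u ∈ M.𝔤 2 0) (hx : x ∈ M.𝔤 2 1) (e : M.A x = M.Φ u x) :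
    M.IsMC x (u + M.h x) := by
  have hhx : M.h x ∈ M.𝔤 2 0 := M.h_mem _ _ _ hx
  set y := u + M.h x with hy
  have hy2 : y ∈ M.𝔤 2 0 := add_mem hu hhx
  -- The curvatures c₁ and c₂ are the defects of the two Maurer--Cartan equations.
  set c₁ := x * x + M.d x with hc₁
  set c₂ := M.d y + (x * y - y * x) - (M.E x + (M.D * x - x * M.D)) with hc₂
  have hc₁m : c₁ ∈ M.𝔤 2 2 := add_mem (mono' (by omega) (sq_mem hx)) (d_mem hx)
  have s1 : M.σ x = -x := by simpa using M.σ_eq _ _ _ hx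
  have s0 : M.σ y = y := by simpa using M.σ_eq _ _ _ hy2
  have sc : M.σ c₁ = c₁ := by
    have := M.σ_eq _ _ _ hc₁m
    rwa [Int.negOnePow_even 2 ⟨1, rfl⟩, one_smul] at this
  -- The fixed point equation says exactly this, so it is enough to show that c₁ vanishes.
  have e21 : c₂ = -M.h c₁ := by
    have : M.E x + (M.D * x - x * M.D) = M.A x + M.d (M.h x) + M.h (M.d x) := by rw [A]; abel
    rw [hc₂, this, e, Φ, ← hy, hc₁, map_add, hy, d_add]
    abel
  have sc2 : M.σ c₂ = -c₂ := by
    have h1 : c₂ ∈ M.𝔤 2 1 := by rw [e21]; exact neg_mem (M.h_mem _ _ _ hc₁m)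
    simpa using M.σ_eq _ _ _ h1
  have hQ : ∀ z, M.Q * (M.Q * z) = 0 := fun z => by rw [← mul_assoc, M.Q_mul_Q, zero_mul]
  -- The Bianchi identities for the two curvatures, obtained by expanding all products.
  have d1 : M.d c₁ = -(x * c₁ - c₁ * x) := by
    have ec : c₁ = x * x + M.Q * x + x * M.Q + M.der x := by rw [hc₁, d, s1]; noncomm_ring
    rw [d, sc, ec]
    simp only [map_add, M.der_mul, M.der_der, M.der_Q, s1, M.σ_Q, mul_add, add_mul, mul_assoc, hQ,
      M.Q_mul_Q, zero_mul, mul_zero, add_zero, zero_add, neg_mul]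
    abel
  have d2 : M.d c₂ = (c₁ * M.D - M.D * c₁) + (c₁ * y - y * c₁) - (x * c₂ + c₂ * x) - M.E c₁ := by
    have ec : c₁ = x * x + M.Q * x + x * M.Q + M.der x := by rw [hc₁, d, s1]; noncomm_ring
    have ec2 : c₂ = M.Q * y - y * M.Q + M.der y + (x * y - y * x) -
        (M.E x + (M.D * x - x * M.D)) := by rw [hc₂, d, s0]
    rw [d, sc2, ec, ec2]
    simp only [map_add, map_sub, M.der_mul, M.der_der, M.der_Q, M.der_D, M.E_mul, M.E_der, s1, s0,
      M.σ_Q, M.σ_D, ← M.comm_Q_D, mul_add, add_mul, mul_sub, sub_mul, mul_assoc, hQ, M.Q_mul_Q,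
      zero_mul, mul_zero, add_zero, zero_add, neg_mul, neg_sub]
    abel
  -- All terms on the right are brackets with x or y, hence lie deeper in the filtration than c₁. On
  -- the left A acts as k - 1 with k ≥ 2, so c₁ lies in every step of the filtration.
  have key : M.A c₁ = (c₁ * y - y * c₁) + (x * M.h c₁ + M.h c₁ * x) + M.h (x * c₁ - c₁ * x) := by
    have e3 : M.d (M.h c₁) = -M.d c₂ := by rw [e21, d_neg, neg_neg]
    rw [A, e3, d1, d2, e21, map_neg]
    noncomm_ring
  have hz : c₁ = 0 := by
    refine M.separated 2 _ fun n => ?_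
    induction n with
    | zero => exact hc₁m
    | succ n ih =>
      have h1 : M.A c₁ ∈ M.𝔤 (n + 2 + 1) 2 := by
        rw [key]
        have hh := M.h_mem _ _ _ ih
        refine add_mem (add_mem (mono' (by omega) (bracket_even ih hy2)) ?_) ?_
        · exact mono' (by omega) (bracket_odd hx hh)
        · have := M.h_mem _ _ _ (M.bracket 2 (n + 2) 1 2 x hx c₁ ih)
          rw [one_mul, Int.negOnePow_even 2 ⟨1, rfl⟩, one_smul] at this
          exact mono' (by omega) this
      have h3 := sub_mem h1 (A_approx ih)
      rw [sub_sub_cancel] at h3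
      refine mem_of_natCast_smul_mem (R := R) (n := n + 1) (Nat.succ_ne_zero n)
        (p := fun z => z ∈ M.𝔤 (n + 1 + 2) 2) (fun r z hz => Submodule.smul_mem _ r hz) ?_
      convert h3 using 2
      push_cast; ring
  have hz2 : c₂ = 0 := by rw [e21, hz, map_zero, neg_zero]
  refine ⟨?_, ?_⟩
  · rw [map_add, M.der_Q, zero_add, add_mul, mul_add, mul_add, M.Q_mul_Q, zero_add, ← hz, hc₁, d, s1]
    noncomm_ring
  · rw [map_add M.E, map_add M.der M.D, M.der_D, zero_add, ← M.comm_Q_D, ← sub_eq_zero, ← hz2, hc₂, d, s0]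
    noncomm_ring

end MCData

end DCrit

end

noncomputable section

namespace DCrit

/-! ## Extension of differential operators -/

section Pullback

variable {R : Type u} [CommRing R] {B : Type v} [CommRing B] [Algebra R B] {C : Type w} [CommRing C]
  [Algebra R C] (φ : B →ₐ[R] C)

theorem formsMap_algebraMap (b : B) :
    formsMap φ (algebraMap B _ b) = algebraMap C _ (φ b) := by
  let : Algebra B C := φ.toRingHom.toAlgebra
  have : IsScalarTower R B C := IsScalarTower.of_algebraMap_eq' φ.comp_algebraMap.symm
  simp only [formsMap, AlgHom.restrictScalars_apply]
  rw [AlgHom.commutes]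
  rfl

theorem formsMap_dOne (b : B) : formsMap φ (dOne b) = dOne (φ b) := by
  let : Algebra B C := φ.toRingHom.toAlgebra
  have : IsScalarTower R B C := IsScalarTower.of_algebraMap_eq' φ.comp_algebraMap.symm
  refine (ExteriorAlgebra.lift_ι_apply B _ _ _).trans ?_
  change ExteriorAlgebra.ι C (KaehlerDifferential.map R R B C (KaehlerDifferential.D R B b)) = _
  rw [KaehlerDifferential.map_D]
  rfl

theorem formsMap_smul (b : B) (α : Forms R B) :
    formsMap φ (b • α) = φ b • formsMap φ α := by
  rw [Algebra.smul_def, map_mul, formsMap_algebraMap, Algebra.smul_def]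

theorem formsMap_deRham (α : Forms R B) :
    formsMap φ (deRham R B α) = deRham R C (formsMap φ α) := by
  induction α using forms_induction with
  | one => rw [deRham_one, map_zero, map_one, deRham_one]
  | add x y hx hy => simp only [map_add, hx, hy]
  | smul b x hx =>
    rw [deRham_smul, map_add, map_mul, formsMap_dOne, formsMap_smul, formsMap_smul, deRham_smul, hx]
  | wedge b x hx =>
    rw [deRham_dOne_mul, map_neg, map_mul, map_mul, formsMap_dOne, deRham_dOne_mul, hx]

theorem formsMap_inv (α : Forms R B) : formsMap φ (inv R B α) = inv R C (formsMap φ α) := by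
  induction α using forms_induction with
  | one => simp only [map_one]
  | add x y hx hy => simp only [map_add, hx, hy]
  | smul b x hx => rw [map_smul, formsMap_smul, formsMap_smul, map_smul, hx]
  | wedge b x hx =>
    simp only [map_mul, hx, dOne, CliffordAlgebra.involute_ι, map_neg]
    change -formsMap φ (dOne b) * _ = inv R C (formsMap φ (dOne b)) * _
    rw [formsMap_dOne, dOne, CliffordAlgebra.involute_ι]

theorem formsMap_iota {v : Derivation R B B} {w : Derivation R C C}
    (h : ∀ b, w (φ b) = φ (v b)) (α : Forms R B) :
    formsMap φ (iota v α) = iota w (formsMap φ α) := by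
  induction α using forms_induction with
  | one => rw [iota_one, map_zero, map_one, iota_one]
  | add x y hx hy => simp only [map_add, hx, hy]
  | smul b x hx => rw [iota_smul_apply, formsMap_smul, formsMap_smul, iota_smul_apply, hx]
  | wedge b x hx =>
    rw [iota_dOne_mul, map_sub, map_mul, map_mul, formsMap_dOne, formsMap_smul, iota_dOne_mul, h, hx]

theorem formsMap_ι_mem (θ : Ω[B⁄R]) : formsMap φ (ExteriorAlgebra.ι B θ) ∈ ⋀[C]^1 (Ω[C⁄R]) := by
  induction θ using omega_induction with
  | D b =>
    change formsMap φ (dOne b) ∈ _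
    rw [formsMap_dOne]; exact dOne_mem _
  | zero => rw [map_zero, map_zero]; exact zero_mem _
  | add x y hx hy => rw [map_add, map_add]; exact add_mem hx hy
  | smul b x hx => rw [map_smul, formsMap_smul]; exact Submodule.smul_mem _ _ hx

theorem formsMap_mem {p : ℕ} {α : Forms R B} (hα : α ∈ ⋀[B]^p (Ω[B⁄R])) :
    formsMap φ α ∈ ⋀[C]^p (Ω[C⁄R]) := by
  induction hα using Submodule.pow_induction_on_left' with
  | algebraMap b => rw [formsMap_algebraMap]; exact algebraMap_mem _
  | add x y i hx hy hx' hy' => rw [map_add]; exact add_mem hx' hy'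
  | mem_mul x hx i y hy hy' =>
    obtain ⟨θ, rfl⟩ := hx
    rw [map_mul, Nat.succ_eq_one_add]
    exact mul_mem_exteriorPower (formsMap_ι_mem φ θ) hy'

theorem formsMap_comp {D : Type*} [CommRing D] [Algebra R D] (ψ : C →ₐ[R] D) (α : Forms R B) :
    formsMap (ψ.comp φ) α = formsMap ψ (formsMap φ α) := by
  induction α using forms_induction with
  | one => simp only [map_one]
  | add x y hx hy => simp only [map_add, hx, hy]
  | smul b x hx => rw [formsMap_smul, formsMap_smul, formsMap_smul, hx]; rfl
  | wedge b x hx => rw [map_mul, map_mul, map_mul, hx, formsMap_dOne, formsMap_dOne, formsMap_dOne]; rfl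

theorem formsMap_id (α : Forms R B) : formsMap (AlgHom.id R B) α = α := by
  induction α using forms_induction with
  | one => simp only [map_one]
  | add x y hx hy => simp only [map_add, hx, hy]
  | smul b x hx => rw [formsMap_smul, hx]; rfl
  | wedge b x hx => rw [map_mul, formsMap_dOne, hx]; rfl

/-- The operator `Q` on `Ω_C` extends the operator `P` on `Ω_B`. -/
def Extends (P : Op R B) (Q : Op R C) : Prop :=
  Q ∘ₗ (formsMap φ).toLinearMap = (formsMap φ).toLinearMap ∘ₗ P

variable {φ}

theorem extends_iff {P : Op R B} {Q : Op R C} :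
    Extends φ P Q ↔ ∀ α, Q (formsMap φ α) = formsMap φ (P α) :=
  ⟨fun h α => LinearMap.congr_fun h α, fun h => LinearMap.ext h⟩

namespace Extends

variable {P P' : Op R B} {Q Q' : Op R C}

theorem mul (h : Extends φ P Q) (h' : Extends φ P' Q') : Extends φ (P * P') (Q * Q') := by
  rw [extends_iff] at *
  intro α
  rw [Module.End.mul_apply, h', h, Module.End.mul_apply]

theorem add (h : Extends φ P Q) (h' : Extends φ P' Q') : Extends φ (P + P') (Q + Q') := by
  rw [extends_iff] at *
  intro α
  rw [LinearMap.add_apply, h', h, LinearMap.add_apply, map_add]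

theorem smul (h : Extends φ P Q) (r : R) : Extends φ (r • P) (r • Q) := by
  rw [extends_iff] at *
  intro α
  rw [LinearMap.smul_apply, h, LinearMap.smul_apply, map_smul]

theorem neg (h : Extends φ P Q) : Extends φ (-P) (-Q) := by
  have := h.smul (-1)
  rwa [neg_one_smul, neg_one_smul] at this

theorem sub (h : Extends φ P Q) (h' : Extends φ P' Q') : Extends φ (P - P') (Q - Q') := by
  rw [sub_eq_add_neg, sub_eq_add_neg]; exact h.add h'.neg

theorem units_smul (h : Extends φ P Q) (ε : ℤˣ) : Extends φ (ε • P) (ε • Q) := by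
  rcases Int.units_eq_one_or ε with h' | h' <;> rw [h']
  · simpa using h
  · simpa using h.neg

theorem zero : Extends φ (0 : Op R B) (0 : Op R C) := by
  rw [extends_iff]; intro α; simp

theorem one : Extends φ (1 : Op R B) (1 : Op R C) := by
  rw [extends_iff]; intro α; simp

theorem pow (h : Extends φ P Q) (n : ℕ) : Extends φ (P ^ n) (Q ^ n) := by
  induction n with
  | zero => simpa using Extends.one
  | succ n ih => rw [pow_succ, pow_succ]; exact ih.mul h

theorem mulOp (b : B) : Extends φ (DCrit.mulOp b) (DCrit.mulOp (φ b)) := by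
  rw [extends_iff]; intro α; rw [mulOp_apply, mulOp_apply, formsMap_smul]

theorem koszul (b : B) : Extends φ (DCrit.koszul b) (DCrit.koszul (φ b)) := by
  rw [extends_iff]; intro α; rw [koszul_apply, koszul_apply, map_mul, formsMap_dOne]

theorem deRham : Extends φ (DCrit.deRham R B) (DCrit.deRham R C) := by
  rw [extends_iff]; intro α; rw [formsMap_deRham]

theorem parity : Extends φ (DCrit.parity R B) (DCrit.parity R C) := by
  rw [extends_iff]; intro α; exact (formsMap_inv φ α).symm

theorem iota {v : Derivation R B B} {w : Derivation R C C} (h : ∀ b, w (φ b) = φ (v b)) :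
    Extends φ (DCrit.iota v) (DCrit.iota w) := by
  rw [extends_iff]; intro α; exact (formsMap_iota φ h α).symm

theorem lieOp {v : Derivation R B B} {w : Derivation R C C} (h : ∀ b, w (φ b) = φ (v b)) :
    Extends φ (DCrit.lieOp v) (DCrit.lieOp w) :=
  (deRham.mul (iota h)).add ((iota h).mul deRham)

theorem degreeScale (c : ℕ → R) :
    Extends φ (DCrit.degreeScale (B := B) c) (DCrit.degreeScale (B := C) c) := by
  rw [extends_iff]
  intro α
  induction α using DirectSum.Decomposition.inductionOn (fun p => ⋀[B]^p (Ω[B⁄R])) with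
  | zero => simp
  | homogeneous a =>
    rw [degreeScale_apply c a.2, degreeScale_apply c (formsMap_mem φ a.2), map_smul]
  | add a b ha hb => simp only [map_add, ha, hb]

end Extends

variable {m : ℕ}

variable (φ m) in
/-- A frame of `B` which extends along `φ : B → C`, as it does for open immersions. -/
structure FrameExtension where
  /-- the frame of `B` -/
  frame : Frame R B m
  /-- the extended vector fields -/
  w : Fin frame.r → Derivation R C C
  w_apply : ∀ i b, w i (φ b) = φ (frame.v i b)
  isFrame : IsFrame (fun i => φ (frame.g i)) w

namespace FrameExtension

/-- The frame of `C`. -/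
def target (T : FrameExtension φ m) : Frame R C m :=
  ⟨T.frame.r, fun i => φ (T.frame.g i), T.w, T.isFrame, by
    simp only [T.w_apply, ← map_sum, T.frame.trace, map_natCast]⟩

/-- Every exact one-form on C is a combination of the pulled back dg_i, because the frame extends.
-/
theorem span_range (T : FrameExtension φ m) : Submodule.span C (Set.range (formsMap φ)) = ⊤ := by
  rw [eq_top_iff]
  rintro α -
  induction α using forms_induction with
  | one => exact Submodule.subset_span ⟨1, map_one _⟩
  | add x y hx hy => exact add_mem hx hy
  | smul b x hx => exact Submodule.smul_mem _ _ hx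
  | wedge c x hx =>
    have e : (dOne c : Forms R C) = ∑ i, T.w i c • formsMap φ (dOne (T.frame.g i)) := by
      rw [dOne, T.isFrame c, map_sum]
      exact Finset.sum_congr rfl fun i _ => by rw [map_smul, formsMap_dOne]; rfl
    rw [e, Finset.sum_mul]
    refine Submodule.sum_mem _ fun i _ => ?_
    rw [smul_mul_assoc]
    refine Submodule.smul_mem _ _ ?_
    induction hx using Submodule.span_induction with
    | mem y hy =>
      obtain ⟨α, rfl⟩ := hy
      rw [← map_mul]; exact Submodule.subset_span ⟨_, rfl⟩
    | zero => rw [mul_zero]; exact zero_mem _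
    | add y z _ _ hy hz => rw [mul_add]; exact add_mem hy hz
    | smul c y _ hy => rw [mul_smul_comm]; exact Submodule.smul_mem _ _ hy

/-- A vector field u = Σ u(g_i) v_i extends as Σ φ(u(g_i)) w_i, and polyvectors extend as products.
-/
theorem exists_opOf (T : FrameExtension φ m) {q : ℕ} {a : Polyvectors R B} (ha : a ∈ ⋀[B]^q (Derivation R B B)) :
    ∃ c ∈ ⋀[C]^q (Derivation R C C), Extends φ (opOf a) (opOf c) := by
  induction ha using Submodule.pow_induction_on_left' with
  | algebraMap b =>
    exact ⟨_, algebraMap_mem (φ b), by rw [opOf_algebraMap, opOf_algebraMap]; exact Extends.mulOp b⟩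
  | add x y i hx hy hx' hy' =>
    obtain ⟨x', h1, e1⟩ := hx'
    obtain ⟨y', h2, e2⟩ := hy'
    exact ⟨_, add_mem h1 h2, by rw [opOf_add, opOf_add]; exact e1.add e2⟩
  | mem_mul x hx i y hy hy' =>
    obtain ⟨u, rfl⟩ := hx
    obtain ⟨y', h2, e2⟩ := hy'
    refine ⟨ExteriorAlgebra.ι C (∑ i, φ (u (T.frame.g i)) • T.w i) * y', ?_, ?_⟩
    · rw [Nat.succ_eq_one_add]; exact mul_mem_exteriorPower (ι_mem _) h2
    · rw [opOf_mul, opOf_mul]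
      refine Extends.mul (Extends.iota fun b => ?_) e2
      rw [derivation_sum_apply, T.frame.isFrame.derivation_apply u b, map_sum]
      refine Finset.sum_congr rfl fun i _ => ?_
      rw [Derivation.smul_apply, T.w_apply, smul_eq_mul, smul_eq_mul, map_mul, mul_comm]

variable [Algebra ℚ R]

/-- Differential operators are determined by their restriction to `Ω_B`. -/
theorem eq_zero (T : FrameExtension φ m) {k : ℕ} {Q : Op R C} (hQ : BaseOrdLT k Q)
    (h : Q ∘ₗ (formsMap φ).toLinearMap = 0) : Q = 0 := by
  induction k generalizing Q with
  | zero => exact hQ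
  | succ k ih =>
    -- These commutators have lower order and vanish on the image of Ω_B, so they are zero by
    -- induction. Then the Euler operator of `Q` vanishes, and Euler's identity lowers the order of
    -- `Q`.
    have hc : ∀ i, baseComm Q (T.target.g i) = 0 := fun i => by
      refine ih (hQ _) (LinearMap.ext fun α => ?_)
      have h1 : ∀ α, Q (formsMap φ α) = 0 := LinearMap.congr_fun h
      change Q (mulOp (φ _) (formsMap φ α)) - mulOp (φ _) (Q (formsMap φ α)) = 0
      rw [h1, map_zero, sub_zero, mulOp_apply, ← formsMap_smul, h1]
    have he : baseEuler T.target Q = 0 := Finset.sum_eq_zero fun i _ => by rw [hc, mul_zero]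
    have h2 := baseEuler_approx T.target hQ
    rw [he, zero_sub] at h2
    -- For order zero the Euler eigenvalue is zero and gives nothing. Instead `Q` is linear over C,
    -- and the image of Ω_B spans Ω_C.
    rcases k with _ | k
    · have hl : ∀ (c : C) α, Q (c • α) = c • Q α := fun c α => by
        have h3 : baseComm Q c = 0 := hQ c
        have := LinearMap.congr_fun (sub_eq_zero.1 h3) α
        simpa only [Module.End.mul_apply, mulOp_apply] using this
      ext α
      have hα : α ∈ Submodule.span C (Set.range (formsMap φ)) := by
        rw [T.span_range]; trivial
      induction hα using Submodule.span_induction with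
      | mem y hy => obtain ⟨β, rfl⟩ := hy; exact LinearMap.congr_fun h β
      | zero => rw [map_zero, map_zero]
      | add y z _ _ hy hz => rw [map_add, map_add, hy, hz]
      | smul c y _ hy =>
        rw [hl, hy, LinearMap.zero_apply, LinearMap.zero_apply, smul_zero]
    · refine eq_zero_of_natCast_smul (R := R) (Nat.succ_ne_zero k) (neg_eq_zero.1 (ih h2 ?_))
      refine LinearMap.ext fun α => ?_
      have h1 : Q (formsMap φ α) = 0 := LinearMap.congr_fun h α
      change -(((k + 1 : ℕ) : R) • Q (formsMap φ α)) = 0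
      rw [h1, smul_zero, neg_zero]

theorem extends_unique (T : FrameExtension φ m) {k : ℕ} {j : ℤ} {P : Op R B} {Q Q' : Op R C} (hQ : OrdLT k j Q)
    (hQ' : OrdLT k j Q') (h : Extends φ P Q) (h' : Extends φ P Q') : Q = Q' := by
  have := h.sub h'
  rw [sub_self] at this
  exact sub_eq_zero.1 (T.eq_zero (hQ.sub hQ').base (this.trans (by simp)))

/-- Differential operators extend, together with their transposes. -/
theorem exists_extends (T : FrameExtension φ m) {k : ℕ} {j : ℤ} {P : Op R B} (hP : OrdLT (k + 1) j P) :
    ∃ (Q : Op R C) (P' : Op R B) (Q' : Op R C), OrdLT (k + 1) j Q ∧ OrdLT (k + 1) j P' ∧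
      OrdLT (k + 1) j Q' ∧ Extends φ P Q ∧ Extends φ P' Q' ∧ IsTranspose m j P P' ∧
      IsTranspose m j Q Q' := by
  -- The inductive step for a product with L_{v_i} or dg_i. The transposes are constructed along
  -- with the extensions, and their existence for all operators is part of the conclusion.
  have hmul : ∀ {k i j} {P P' S S' : Op R B} {Q Q' U U' : Op R C},
      OrdLT 2 i S → OrdLT 2 i S' → OrdLT 2 i U → OrdLT 2 i U' → Extends φ S U → Extends φ S' U' →
      IsTranspose m i S S' → IsTranspose m i U U' →
      OrdLT (k + 1) j P → OrdLT (k + 1) j Q → OrdLT (k + 1) j P' → OrdLT (k + 1) j Q' →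
      Extends φ P Q → Extends φ P' Q' → IsTranspose m j P P' → IsTranspose m j Q Q' →
      ∃ (V : Op R C) (P' : Op R B) (Q' : Op R C), OrdLT (k + 1 + 1) (i + j) V ∧
        OrdLT (k + 1 + 1) (i + j) P' ∧ OrdLT (k + 1 + 1) (i + j) Q' ∧ Extends φ (S * P) V ∧
        Extends φ P' Q' ∧ IsTranspose m (i + j) (S * P) P' ∧ IsTranspose m (i + j) V Q' := by
    intro k i j P P' S S' Q Q' U U' s1 s2 s3 s4 e1 e2 t1 t2 o1 o2 o3 o4 f1 f2 t3 t4
    refine ⟨U * Q, _, _, (s3.mul o2).mono (by omega),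
      (((o3.mul s2).congr (add_comm _ _)).units_smul _).mono (by omega),
      (((o4.mul s4).congr (add_comm _ _)).units_smul _).mono (by omega), e1.mul f1,
      (f2.mul e2).units_smul (i * j).negOnePow, t1.mul T.frame t3 s2.raises o1.raises o1.base,
      t2.mul T.target t4 s4.raises o2.raises o2.base⟩
  refine (OrdLT.induction T.frame (p := fun k j P => OrdLT (k + 1) j P ∧
    ∃ (Q : Op R C) (P' : Op R B) (Q' : Op R C), OrdLT (k + 1) j Q ∧ OrdLT (k + 1) j P' ∧
      OrdLT (k + 1) j Q' ∧ Extends φ P Q ∧ Extends φ P' Q' ∧ IsTranspose m j P P' ∧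
      IsTranspose m j Q Q') ?_ ?_ ?_ ?_ ?_ ?_ ?_ hP).2
  · intro q a ha
    obtain ⟨c, hc, e⟩ := T.exists_opOf ha
    exact ⟨OrdLT.of_opOf ha, _, _, _, OrdLT.of_opOf hc, OrdLT.of_opOf ha, OrdLT.of_opOf hc, e, e,
      isTranspose_opOf T.frame ha, isTranspose_opOf T.target hc⟩
  · exact fun j => ⟨OrdLT.zero _ _, 0, 0, 0, OrdLT.zero _ _, OrdLT.zero _ _, OrdLT.zero _ _,
      Extends.zero, Extends.zero, IsTranspose.zero j, IsTranspose.zero j⟩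
  · rintro k j P ⟨h0, Q, P', Q', h1, h2, h3, h⟩
    exact ⟨h0.succ, Q, P', Q', h1.succ, h2.succ, h3.succ, h⟩
  · rintro k j P S ⟨h0, Q, P', Q', h1, h2, h3, h4, h5, h6, h7⟩
      ⟨k0, U, S', U', k1, k2, k3, k4, k5, k6, k7⟩
    exact ⟨h0.add k0, _, _, _, h1.add k1, h2.add k2, h3.add k3, h4.add k4, h5.add k5, h6.add k6,
      h7.add k7⟩
  · rintro k j P r ⟨h0, Q, P', Q', h1, h2, h3, h4, h5, h6, h7⟩
    exact ⟨h0.smul r, _, _, _, h1.smul r, h2.smul r, h3.smul r, h4.smul r, h5.smul r, h6.smul r,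
      h7.smul r⟩
  · rintro k j P i ⟨h0, Q, P', Q', h1, h2, h3, h4, h5, h6, h7⟩
    have hv : ∀ b, T.w i (φ b) = φ (T.frame.v i b) := T.w_apply i
    have := hmul (ordLT_lieOp (T.frame.v i)) (ordLT_lieOp (T.frame.v i)).neg
      (ordLT_lieOp (T.w i)) (ordLT_lieOp (T.w i)).neg (Extends.lieOp hv) (Extends.lieOp hv).neg
      (isTranspose_lieOp T.frame _) (isTranspose_lieOp T.target _) h0 h1 h2 h3 h4 h5 h6 h7
    rw [zero_add] at this
    exact ⟨(((ordLT_lieOp (T.frame.v i)).mul h0).congr (zero_add j)).mono (by omega), this⟩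
  · rintro k j P i ⟨h0, Q, P', Q', h1, h2, h3, h4, h5, h6, h7⟩
    exact ⟨((ordLT_koszul (T.frame.g i)).mul h0).mono (by omega),
      hmul (ordLT_koszul (T.frame.g i)) (ordLT_koszul (T.frame.g i)).neg
      (ordLT_koszul (φ (T.frame.g i))) (ordLT_koszul _).neg (Extends.koszul _)
      (Extends.koszul _).neg (isTranspose_koszul _) (isTranspose_koszul _) h0 h1 h2 h3 h4 h5 h6 h7⟩

/-- Self-dual operators extend to self-dual operators. -/
theorem exists_extends_selfDual (T : FrameExtension φ m) {i k j : ℤ} {P : Op R B}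
    (hP : P ∈ SelfDualCoeff m i j) (hk : P ∈ DX k j) :
    ∃ Q : Op R C, Q ∈ SelfDualCoeff m i j ∧ Q ∈ DX k j ∧ Extends φ P Q := by
  have key : ∀ l : ℕ, OrdLT l j P → ∃ Q : Op R C, OrdLT l j Q ∧ Extends φ P Q ∧
      IsTranspose m j Q ((i + 1).negOnePow • Q) := by
    rintro (_ | l) hl
    · rw [show P = 0 from hl]
      exact ⟨0, rfl, Extends.zero, by rw [smul_zero]; exact IsTranspose.zero j⟩
    · obtain ⟨Q, P', Q', h1, h2, h3, h4, h5, h6, h7⟩ := T.exists_extends hl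
      have e1 : P' = (i + 1).negOnePow • P := h6.unique T.frame hP.2 h2.raises (hl.units_smul _).raises
      subst e1
      -- Both sides extend the same operator over B, by `e1`, so uniqueness of extensions makes the
      -- extension self-dual.
      have e2 : Q' = (i + 1).negOnePow • Q :=
        T.extends_unique h3 (h1.units_smul _) h5 (h4.units_smul _)
      exact ⟨Q, h1, h4, e2 ▸ h7⟩
  -- The extension is made with the smaller of the two order bounds and satisfies the larger one
  -- automatically.
  rcases le_total (i + 1 + 1).toNat (k + 1).toNat with hle | hle
  · obtain ⟨Q, h1, h2, h3⟩ := key _ hP.1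
    exact ⟨Q, ⟨h1, h3⟩, OrdLT.mono h1 hle, h2⟩
  · obtain ⟨Q, h1, h2, h3⟩ := key _ hk
    exact ⟨Q, ⟨OrdLT.mono h1 hle, h3⟩, h1, h2⟩

end FrameExtension

end Pullback

end DCrit

end

noncomputable section

namespace DCrit

/-! ## Forms on simplices -/

/-! ### Homogeneous bases of polynomial forms -/

section FormsBasis

variable {R : Type u} [CommRing R]

/-- If `A` and `Ω[A⁄R]` are free then so is `Ω^*`, with a homogeneous basis. -/
theorem exists_forms_basis_of_free (A : Type u) [CommRing A] [Algebra R A] [Module.Free R A]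
    [Module.Free A (Ω[A⁄R])] :
    ∃ (κ : Type u) (deg : κ → ℕ) (b : Module.Basis κ R (Forms R A)),
      (∀ i, b i ∈ ⋀[A]^(deg i) (Ω[A⁄R])) ∧
      ∀ q, ∀ η ∈ ⋀[A]^q (Ω[A⁄R]), ∀ i, deg i ≠ q → b.repr η i = 0 := by
  classical
  let V : ℕ → Submodule R (Forms R A) := fun q => (⋀[A]^q (Ω[A⁄R])).restrictScalars R
  have hV : DirectSum.IsInternal V :=
    (DirectSum.Decomposition.isInternal (fun q => ⋀[A]^q (Ω[A⁄R])) :)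
  have hf : ∀ q, Module.Free R (V q) := fun q => by
    have : Module.Free R (⋀[A]^q (Ω[A⁄R])) := Module.Free.trans (R := R) (S := A)
    exact this
  let b := hV.collectedBasis fun q => Module.Free.chooseBasis R (V q)
  refine ⟨_, Sigma.fst, b, fun i => (hV.collectedBasis_mem _ i :), fun q η hη i hi => ?_⟩
  exact hV.collectedBasis_repr_of_mem_ne _ (Ne.symm hi) hη

variable (R) in
/-- The barycentric coordinates. -/
def bary {n : ℕ} (i : Fin (n + 1)) : SimplexRing R n := Ideal.Quotient.mk _ (MvPolynomial.X i)

theorem sum_bary {n : ℕ} : ∑ i : Fin (n + 1), bary R i = 1 := by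
  simp only [bary]
  rw [← map_sum, ← map_one (Ideal.Quotient.mk _), ← sub_eq_zero, ← map_sub]
  exact Ideal.Quotient.eq_zero_iff_mem.mpr (Ideal.subset_span rfl)

theorem simplexRing_hom_ext {n : ℕ} {A : Type*} [CommRing A] [Algebra R A]
    {φ ψ : SimplexRing R n →ₐ[R] A} (h : ∀ i, φ (bary R i) = ψ (bary R i)) : φ = ψ :=
  Ideal.Quotient.algHom_ext _ (MvPolynomial.algHom_ext h)

variable (R) in
/-- The coordinates `t_1, …, t_n` on the simplex. -/
def simplexToPoly (n : ℕ) : SimplexRing R n →ₐ[R] MvPolynomial (Fin n) R :=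
  Ideal.Quotient.liftₐ _
    (MvPolynomial.aeval (Fin.cons (1 - ∑ i, MvPolynomial.X i) MvPolynomial.X))
    (by
      intro a ha
      have h : Ideal.span {(∑ i, MvPolynomial.X i - 1 : MvPolynomial (Fin (n + 1)) R)} ≤
          RingHom.ker (MvPolynomial.aeval (R := R)
            (Fin.cons (1 - ∑ i, MvPolynomial.X i) MvPolynomial.X :
              Fin (n + 1) → MvPolynomial (Fin n) R)) := by
        rw [Ideal.span_le, Set.singleton_subset_iff]
        simp [Fin.sum_univ_succ]
      exact h ha)

theorem simplexToPoly_bary {n : ℕ} (i : Fin (n + 1)) : simplexToPoly R n (bary R i) =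
    (Fin.cons (1 - ∑ i, MvPolynomial.X i) MvPolynomial.X : Fin (n + 1) → MvPolynomial (Fin n) R) i := by
  rw [simplexToPoly, bary]
  exact (Ideal.Quotient.liftₐ_apply _ _ _ _).trans (by simp)

variable (R) in
/-- Functions on the simplex are polynomials in the coordinates `t_1, …, t_n`. -/
def simplexRingEquiv (n : ℕ) : SimplexRing R n ≃ₐ[R] MvPolynomial (Fin n) R :=
  AlgEquiv.ofAlgHom (simplexToPoly R n) (MvPolynomial.aeval fun i => bary R i.succ)
    (MvPolynomial.algHom_ext fun i => by
      rw [AlgHom.comp_apply, MvPolynomial.aeval_X, simplexToPoly_bary, Fin.cons_succ]; rfl)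
    (simplexRing_hom_ext fun i => by
      have h := sum_bary (R := R) (n := n)
      rw [Fin.sum_univ_succ] at h
      rw [AlgHom.comp_apply, simplexToPoly_bary, AlgHom.id_apply]
      refine Fin.cases ?_ (fun j => ?_) i
      · simp only [Fin.cons_zero, map_sub, map_one, map_sum, MvPolynomial.aeval_X]
        exact (eq_sub_of_add_eq h).symm
      · simp only [Fin.cons_succ, MvPolynomial.aeval_X])

/-- Eliminating t_0 identifies functions on the simplex with a polynomial ring, whose differentials
are free. A basis is needed because the spaces of operators carry no flatness hypothesis over R, and
membership is tested on coefficients. -/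
theorem exists_simplexForms_basis (n : ℕ) :
    ∃ (κ : Type u) (deg : κ → ℕ) (b : Module.Basis κ R (SimplexForms R n)),
      (∀ i, b i ∈ ⋀[SimplexRing R n]^(deg i) (Ω[SimplexRing R n⁄R])) ∧
      ∀ q, ∀ η ∈ ⋀[SimplexRing R n]^q (Ω[SimplexRing R n⁄R]), ∀ i, deg i ≠ q → b.repr η i = 0 := by
  have : Module.Free (MvPolynomial (Fin n) R) (Ω[MvPolynomial (Fin n) R⁄R]) :=
    Module.Free.of_basis (KaehlerDifferential.mvPolynomialBasis R (Fin n))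
  obtain ⟨κ, deg, b, h1, h2⟩ := exists_forms_basis_of_free (R := R) (MvPolynomial (Fin n) R)
  let e := simplexRingEquiv R n
  let E : Forms R (MvPolynomial (Fin n) R) ≃ₗ[R] SimplexForms R n :=
    LinearEquiv.ofLinearMap (formsMap e.symm.toAlgHom).toLinearMap (formsMap e.toAlgHom).toLinearMap
      (LinearMap.ext fun α => by
        change formsMap e.symm.toAlgHom (formsMap e.toAlgHom α) = α
        rw [← formsMap_comp, show e.symm.toAlgHom.comp e.toAlgHom = AlgHom.id R _ from
          e.symm_comp, formsMap_id])
      (LinearMap.ext fun α => by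
        change formsMap e.toAlgHom (formsMap e.symm.toAlgHom α) = α
        rw [← formsMap_comp, show e.toAlgHom.comp e.symm.toAlgHom = AlgHom.id R _ from
          e.comp_symm, formsMap_id])
  refine ⟨κ, deg, b.map E, fun i => ?_, fun q η hη i hi => ?_⟩
  · rw [Module.Basis.map_apply]
    exact formsMap_mem _ (h1 i)
  · rw [Module.Basis.map_repr]
    exact h2 q _ (formsMap_mem e.toAlgHom hη) i hi

end FormsBasis

/-! ### Coefficients of operators in a basis of forms -/

section Coordinates

variable {R : Type u} [CommRing R] {B : Type v} [CommRing B] [Algebra R B] {n k : ℕ}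

theorem parity_mul_parity : parity R B * parity R B = 1 :=
  LinearMap.ext fun α => CliffordAlgebra.involute_involute α

theorem parity_pow_mul_parity_pow (q : ℕ) : parity R B ^ q * parity R B ^ q = 1 := by
  rw [← (Commute.refl (parity R B)).mul_pow, parity_mul_parity, one_pow]

variable (R B) in
/-- A linear functional on forms on the simplex, extended to operators with coefficients. -/
def evalForm (φ : SimplexForms R n →ₗ[R] R) : FormOp R B n →ₗ[R] Op R B :=
  (TensorProduct.rid R (Op R B)).toLinearMap ∘ₗ LinearMap.lTensor (Op R B) φ

theorem evalForm_pureOp (φ : SimplexForms R n →ₗ[R] R) (P : Op R B) (η : SimplexForms R n) :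
    evalForm R B φ (pureOp P η) = φ η • P := by
  change TensorProduct.rid R (Op R B) (LinearMap.lTensor (Op R B) φ (P ⊗ₜ η)) = _
  rw [LinearMap.lTensor_tmul, TensorProduct.rid_tmul]

theorem formOp_induction {p : FormOp R B n → Prop} (zero : p 0)
    (pure : ∀ P η, p (pureOp P η)) (add : ∀ x y, p x → p y → p (x + y)) (x : FormOp R B n) : p x :=
  TensorProduct.induction_on x zero pure add

/-- Expansion in a basis of the space of forms. -/
theorem exists_expansion {κ : Type*} (b : Module.Basis κ R (SimplexForms R n)) (x : FormOp R B n) :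
    ∃ s : Finset κ, x = ∑ i ∈ s, pureOp (evalForm R B (b.coord i) x) (b i) := by
  classical
  have key : ∃ c : κ →₀ Op R B, x = c.sum fun i P => pureOp P (b i) :=
    ⟨TensorProduct.equivFinsuppOfBasisRight b x, by
      have := (TensorProduct.equivFinsuppOfBasisRight b).symm_apply_apply x
      rw [TensorProduct.equivFinsuppOfBasisRight_symm_apply] at this
      exact this.symm⟩
  obtain ⟨c, hc⟩ := key
  have h : ∀ i, evalForm R B (b.coord i) x = c i := fun i => by
    rw [hc, Finsupp.sum, map_sum]
    simp only [evalForm_pureOp, Module.Basis.coord_apply, Module.Basis.repr_self]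
    rw [Finset.sum_eq_single i]
    · simp
    · intro j _ hj; rw [Finsupp.single_eq_of_ne hj.symm, zero_smul]
    · intro hi; rw [Finsupp.notMem_support_iff.1 hi, smul_zero]
  exact ⟨c.support, by simp only [h]; exact hc⟩

/-- `tensorForms` for a graded space of operators which consists of submodules. -/
abbrev tens (V : ℤ → Submodule R (Op R B)) (J : ℤ) : Submodule R (FormOp R B n) :=
  tensorForms (fun j => (V j : Set (Op R B))) J

theorem pureOp_mem {V : ℤ → Set (Op R B)} {J : ℤ} {q : ℕ} {P : Op R B} (hP : P ∈ V (J - q))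
    {η : SimplexForms R n} (hη : η ∈ ⋀[SimplexRing R n]^q (Ω[SimplexRing R n⁄R])) :
    pureOp (P * parity R B ^ q) η ∈ tensorForms V J :=
  Submodule.subset_span ⟨q, P, hP, η, hη, rfl⟩

theorem tens_induction {V : ℤ → Set (Op R B)} {J : ℤ}
    {p : (x : FormOp R B n) → x ∈ tensorForms V J → Prop} (zero : p 0 (zero_mem _))
    (pure : ∀ q : ℕ, ∀ P, ∀ hP : P ∈ V (J - q), ∀ η,
      ∀ hη : η ∈ ⋀[SimplexRing R n]^q (Ω[SimplexRing R n⁄R]),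
      p (pureOp (P * parity R B ^ q) η) (pureOp_mem hP hη))
    (add : ∀ x y hx hy, p x hx → p y hy → p (x + y) (add_mem hx hy))
    (smul : ∀ (r : R) x hx, p x hx → p (r • x) (Submodule.smul_mem _ r hx))
    {x : FormOp R B n} (hx : x ∈ tensorForms V J) : p x hx := by
  induction hx using Submodule.span_induction with
  | mem x hx => obtain ⟨q, P, hP, η, hη, rfl⟩ := hx; exact pure q P hP η hη
  | zero => exact zero
  | add x y hx hy hx' hy' => exact add x y hx hy hx' hy'
  | smul r x hx hx' => exact smul r x hx hx'

theorem pureOp_one_mem {V : ℤ → Set (Op R B)} {J : ℤ} {P : Op R B} (hP : P ∈ V J) :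
    (pureOp P 1 : FormOp R B n) ∈ tensorForms V J := by
  have h : (1 : SimplexForms R n) ∈ ⋀[SimplexRing R n]^0 (Ω[SimplexRing R n⁄R]) := SetLike.GradedOne.one_mem
  have := pureOp_mem (V := V) (J := J) (q := 0) (by simpa using hP) h
  simpa using this

/-- Next to a d-form the operator carries d factors of the parity operator, by the Koszul sign rule.
As parity is an involution, multiplying by it d more times recovers the original coefficient. -/
theorem tens_coord {V : ℤ → Submodule R (Op R B)} {J : ℤ} {x : FormOp R B n} (hx : x ∈ tens V J)
    {φ : SimplexForms R n →ₗ[R] R} {d : ℕ}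
    (hφ : ∀ q, ∀ η ∈ ⋀[SimplexRing R n]^q (Ω[SimplexRing R n⁄R]), d ≠ q → φ η = 0) :
    evalForm R B φ x * parity R B ^ d ∈ V (J - d) := by
  induction hx using tens_induction with
  | zero => rw [map_zero, zero_mul]; exact zero_mem _
  | add x y _ _ hx hy => rw [map_add, add_mul]; exact add_mem hx hy
  | smul r x _ hx => rw [map_smul, smul_mul_assoc]; exact Submodule.smul_mem _ _ hx
  | pure q P hP η hη =>
    rw [evalForm_pureOp]
    by_cases h : d = q
    · subst h
      rw [smul_mul_assoc, mul_assoc, parity_pow_mul_parity_pow, mul_one]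
      exact Submodule.smul_mem _ _ hP
    · rw [hφ q η hη h, zero_smul, zero_mul]; exact zero_mem _

theorem mem_tens {V : ℤ → Submodule R (Op R B)} {J : ℤ} {κ : Type*} {deg : κ → ℕ}
    {b : Module.Basis κ R (SimplexForms R n)}
    (hb : ∀ i, b i ∈ ⋀[SimplexRing R n]^(deg i) (Ω[SimplexRing R n⁄R])) {x : FormOp R B n}
    (hx : ∀ i, evalForm R B (b.coord i) x * parity R B ^ deg i ∈ V (J - deg i)) :
    x ∈ tens V J := by
  obtain ⟨s, hs⟩ := exists_expansion b x
  rw [hs]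
  refine Submodule.sum_mem _ fun i _ => ?_
  have := pureOp_mem (V := fun j => (V j : Set (Op R B))) (hx i) (hb i)
  rwa [mul_assoc, parity_pow_mul_parity_pow, mul_one] at this

/-- Membership in `tensorForms` can be tested coefficientwise. -/
theorem tens_of_forall {V V' W : ℤ → Submodule R (Op R B)} {J : ℤ}
    (h : ∀ j P, P ∈ V j → P ∈ V' j → P ∈ W j) {x : FormOp R B n} (hx : x ∈ tens V J)
    (hx' : x ∈ tens V' J) : x ∈ tens W J := by
  obtain ⟨κ, deg, b, h1, h2⟩ := exists_simplexForms_basis (R := R) n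
  refine mem_tens h1 fun i => h _ _ ?_ ?_
  · exact tens_coord hx fun q η hη hd => h2 q η hη i hd
  · exact tens_coord hx' fun q η hη hd => h2 q η hη i hd

/-- Forms on the simplex are free over R, so injectivity of `F` on the coefficients, with parity
taken into account, passes to the tensor product. -/
theorem tens_eq_zero {V : ℤ → Submodule R (Op R B)} {J : ℤ} {M : Type*} [AddCommGroup M] [Module R M]
    (F : Op R B →ₗ[R] M) (h : ∀ (d : ℕ) (j : ℤ), ∀ P ∈ V j, F (P * parity R B ^ d) = 0 → P = 0)
    {x : FormOp R B n} (hx : x ∈ tens V J) (hF : LinearMap.rTensor (SimplexForms R n) F x = 0) :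
    x = 0 := by
  obtain ⟨κ, deg, b, h1, h2⟩ := exists_simplexForms_basis (R := R) n
  obtain ⟨s, hs⟩ := exists_expansion b x
  rw [hs]
  refine Finset.sum_eq_zero fun i _ => ?_
  have e1 := tens_coord hx (φ := b.coord i) fun q η hη hd => h2 q η hη i hd
  have e2 : F (evalForm R B (b.coord i) x) = 0 := by
    have key : F ∘ₗ evalForm R B (b.coord i) = (TensorProduct.rid R M).toLinearMap ∘ₗ
        LinearMap.lTensor M (b.coord i) ∘ₗ LinearMap.rTensor (SimplexForms R n) F :=
      TensorProduct.ext' fun P η => by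
        change F (evalForm R B (b.coord i) (pureOp P η)) = TensorProduct.rid R M
          (LinearMap.lTensor M (b.coord i) (LinearMap.rTensor (SimplexForms R n) F (P ⊗ₜ η)))
        rw [evalForm_pureOp, LinearMap.rTensor_tmul, LinearMap.lTensor_tmul,
          TensorProduct.rid_tmul, map_smul]
    refine (LinearMap.congr_fun key x).trans ?_
    change TensorProduct.rid R M (LinearMap.lTensor M (b.coord i)
      (LinearMap.rTensor (SimplexForms R n) F x)) = 0
    rw [hF, map_zero, map_zero]
  have e3 := h (deg i) _ _ e1 (by rw [mul_assoc, parity_pow_mul_parity_pow, mul_one, e2])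
  have e4 : evalForm R B (b.coord i) x = 0 := by
    rw [← mul_one (evalForm R B (b.coord i) x), ← parity_pow_mul_parity_pow (deg i), ← mul_assoc,
      e3, zero_mul]
  rw [e4]
  exact TensorProduct.zero_tmul _ _

end Coordinates

/-! ### Restriction to faces and extension from the boundary -/

section Faces

variable {R : Type u} [CommRing R] {B : Type v} [CommRing B] [Algebra R B] {n k l : ℕ}

theorem simplexPull_bary (θ : Fin (k + 1) → Fin (n + 1)) (i : Fin (n + 1)) :
    simplexPull R θ (bary R i) = ∑ j with θ j = i, bary R j := by
  simp only [bary]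
  rw [simplexPull, ← map_sum]
  exact (Ideal.Quotient.liftₐ_apply _ _ _ _).trans (by simp)

theorem simplexPull_id : simplexPull R (id : Fin (n + 1) → Fin (n + 1)) = AlgHom.id R _ :=
  simplexRing_hom_ext fun i => by
    rw [simplexPull_bary, AlgHom.id_apply]
    simp [Finset.filter_eq']

theorem simplexPull_comp (θ : Fin (k + 1) → Fin (n + 1)) (θ' : Fin (l + 1) → Fin (k + 1)) :
    simplexPull R (θ ∘ θ') = (simplexPull R θ').comp (simplexPull R θ) :=
  simplexRing_hom_ext fun i => by
    rw [AlgHom.comp_apply, simplexPull_bary, simplexPull_bary, map_sum]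
    simp only [simplexPull_bary]
    rw [← Finset.sum_biUnion]
    · refine Finset.sum_congr (Finset.ext fun j => by simp) fun _ _ => rfl
    · intro x _ y _ hxy
      refine Finset.disjoint_left.2 fun a ha hb => hxy ?_
      rw [← (Finset.mem_filter.1 ha).2, ← (Finset.mem_filter.1 hb).2]

variable (R B) in
/-- Restriction of operators with coefficients in forms along a map of simplices. -/
def pull (θ : Fin (k + 1) → Fin (n + 1)) : FormOp R B n →ₐ[R] FormOp R B k :=
  Algebra.TensorProduct.map (AlgHom.id R (Op R B)) (formsMap (simplexPull R θ))

theorem pull_pureOp (θ : Fin (k + 1) → Fin (n + 1)) (P : Op R B) (η : SimplexForms R n) :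
    pull R B θ (pureOp P η) = pureOp P (formsMap (simplexPull R θ) η) :=
  Algebra.TensorProduct.map_tmul _ _ _ _

theorem pull_id (x : FormOp R B n) : pull R B id x = x := by
  induction x using formOp_induction with
  | zero => rw [map_zero]
  | add x y hx hy => rw [map_add, hx, hy]
  | pure P η => rw [pull_pureOp, simplexPull_id, formsMap_id]

theorem pull_comp (θ : Fin (k + 1) → Fin (n + 1)) (θ' : Fin (l + 1) → Fin (k + 1))
    (x : FormOp R B n) : pull R B (θ ∘ θ') x = pull R B θ' (pull R B θ x) := by
  induction x using formOp_induction with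
  | zero => simp only [map_zero]
  | add x y hx hy => simp only [map_add, hx, hy]
  | pure P η => rw [pull_pureOp, pull_pureOp, pull_pureOp, simplexPull_comp, formsMap_comp]

theorem pull_mem (θ : Fin (k + 1) → Fin (n + 1)) {V : ℤ → Set (Op R B)} {J : ℤ} {x : FormOp R B n}
    (hx : x ∈ tensorForms V J) : pull R B θ x ∈ tensorForms V J := by
  induction hx using tens_induction with
  | zero => rw [map_zero]; exact zero_mem _
  | add x y _ _ hx hy => rw [map_add]; exact add_mem hx hy
  | smul r x _ hx => rw [map_smul]; exact Submodule.smul_mem _ _ hx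
  | pure q P hP η hη => rw [pull_pureOp]; exact pureOp_mem hP (formsMap_mem _ hη)

theorem pureOp_mul_pureOp (P Q : Op R B) (η ζ : SimplexForms R n) :
    pureOp P η * pureOp Q ζ = pureOp (P * Q) (η * ζ) := Algebra.TensorProduct.tmul_mul_tmul _ _ _ _

theorem pureOp_sum {κ : Type*} (s : Finset κ) (P : Op R B) (η : κ → SimplexForms R n) :
    pureOp P (∑ i ∈ s, η i) = ∑ i ∈ s, pureOp P (η i) := TensorProduct.tmul_sum _ _ _

variable (R B) in
/-- Multiplication by a function on the simplex. -/
def simplexFun (t : SimplexRing R n) : FormOp R B n := pureOp 1 (algebraMap _ _ t)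

theorem simplexFun_mul_mem (t : SimplexRing R n) {V : ℤ → Set (Op R B)} {J : ℤ} {x : FormOp R B n}
    (hx : x ∈ tensorForms V J) : simplexFun R B t * x ∈ tensorForms V J := by
  induction hx using tens_induction with
  | zero => rw [mul_zero]; exact zero_mem _
  | add x y _ _ hx hy => rw [mul_add]; exact add_mem hx hy
  | smul r x _ hx => rw [mul_smul_comm]; exact Submodule.smul_mem _ _ hx
  | pure q P hP η hη =>
    rw [simplexFun, pureOp_mul_pureOp, one_mul, ← Algebra.smul_def]
    exact pureOp_mem hP (Submodule.smul_mem _ _ hη)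

theorem pull_simplexFun (θ : Fin (k + 1) → Fin (n + 1)) (t : SimplexRing R n) :
    pull R B θ (simplexFun R B t) = simplexFun R B (simplexPull R θ t) := by
  rw [simplexFun, pull_pureOp, formsMap_algebraMap]; rfl

theorem simplexFun_one : simplexFun R B (1 : SimplexRing R n) = 1 := by
  rw [simplexFun, map_one]; rfl

theorem simplexFun_zero : simplexFun R B (0 : SimplexRing R n) = 0 := by
  rw [simplexFun, map_zero]; exact TensorProduct.tmul_zero _ _

theorem simplexFun_sum {κ : Type*} (s : Finset κ) (t : κ → SimplexRing R n) :
    simplexFun R B (∑ i ∈ s, t i) = ∑ i ∈ s, simplexFun R B (t i) := by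
  simp only [simplexFun, map_sum, pureOp_sum]

theorem exists_succAbove_comp {θ : Fin (k + 1) ↪o Fin (n + 2)} {i : Fin (n + 2)}
    (h : ∀ j, θ j ≠ i) : ∃ θ' : Fin (k + 1) ↪o Fin (n + 1), ∀ j, i.succAbove (θ' j) = θ j := by
  choose θ' hθ' using fun j => Fin.exists_succAbove_eq (h j)
  refine ⟨OrderEmbedding.ofStrictMono θ' fun a b hab => ?_, hθ'⟩
  rw [← (Fin.strictMono_succAbove i).lt_iff_lt, hθ', hθ']
  exact θ.strictMono hab

/-- The extension of a form on a face to the whole simplex. -/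
def extendFace (i : Fin (n + 2)) (x : FormOp R B n) : FormOp R B (n + 1) :=
  ∑ j, simplexFun R B (bary R (i.succAbove j)) *
    pull R B (i.insertNth j id : Fin (n + 2) → Fin (n + 1)) x

theorem extendFace_mem (i : Fin (n + 2)) {V : ℤ → Set (Op R B)} {J : ℤ} {x : FormOp R B n}
    (hx : x ∈ tensorForms V J) : extendFace i x ∈ tensorForms V J :=
  Submodule.sum_mem _ fun _ _ => simplexFun_mul_mem _ (pull_mem _ hx)

/-- The collapse sending the vertex i to j is a retraction onto the face, and the barycentric
coordinates which weight these retractions sum to one there. -/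
theorem pull_extendFace_same (i : Fin (n + 2)) (x : FormOp R B n) :
    pull R B i.succAbove (extendFace i x) = x := by
  have h1 : ∀ j : Fin (n + 1), simplexPull R i.succAbove (bary R (i.succAbove j)) = bary R j :=
    fun j => by
      rw [simplexPull_bary]
      simp [Finset.filter_eq']
  have h2 : ∀ j : Fin (n + 1), (i.insertNth j id : Fin (n + 2) → Fin (n + 1)) ∘ i.succAbove = id :=
    fun j => funext fun a => by simp
  simp only [extendFace, map_sum, map_mul, pull_simplexFun, h1, ← pull_comp, h2, pull_id]
  rw [← Finset.sum_mul, ← simplexFun_sum, sum_bary, simplexFun_one, one_mul]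

/-- If the form vanishes on the part of its face opposite the vertex a, then the extension vanishes
on the whole face opposite a. Thus it does not disturb prescribed values there. -/
theorem pull_extendFace_ne {i a : Fin (n + 2)} (hia : a ≠ i) {x : FormOp R B n}
    (hx : ∀ (k : ℕ) (θ : Fin (k + 1) ↪o Fin (n + 1)), (∀ j, i.succAbove (θ j) ≠ a) →
      pull R B θ x = 0) : pull R B a.succAbove (extendFace i x) = 0 := by
  obtain ⟨b, rfl⟩ := Fin.exists_succAbove_eq hia
  simp only [extendFace, map_sum, map_mul, pull_simplexFun]
  refine Finset.sum_eq_zero fun j _ => ?_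
  -- The term with j = b has the coordinate of the vertex a as a factor, which is zero on the face
  -- opposite a.
  by_cases hj : j = b
  · subst hj
    have : simplexPull R (i.succAbove j).succAbove (bary R (i.succAbove j)) = 0 := by
      rw [simplexPull_bary]
      exact Finset.sum_eq_zero fun c hc => (Fin.succAbove_ne _ _ (Finset.mem_filter.1 hc).2).elim
    rw [this, simplexFun_zero, zero_mul]
  · rcases n with _ | n
    · exact (hj ((Fin.fin_one_eq_zero j).trans (Fin.fin_one_eq_zero b).symm)).elim
    -- For j ≠ b the collapse avoids the vertex b on the face opposite a, so it factors through the
    -- face of the smaller simplex on which x vanishes.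
    · have h1 : ∀ c : Fin (n + 2), ((i.insertNth j id : Fin (n + 3) → Fin (n + 2)) ∘
          (i.succAbove b).succAbove) c ≠ b := fun c hc => by
        have h2 := Fin.succAbove_ne (i.succAbove b) c
        rw [Function.comp_apply] at hc
        rcases Fin.eq_self_or_eq_succAbove i ((i.succAbove b).succAbove c) with h3 | ⟨d, h3⟩
        · rw [h3, Fin.insertNth_apply_same] at hc; exact hj hc
        · rw [h3, Fin.insertNth_apply_succAbove] at hc
          rw [h3] at h2
          exact h2 (by rw [show d = b from hc])
      choose θ hθ using fun c => Fin.exists_succAbove_eq (h1 c)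
      have e : (i.insertNth j id : Fin (n + 3) → Fin (n + 2)) ∘ (i.succAbove b).succAbove =
          b.succAbove ∘ θ := funext fun c => (hθ c).symm
      rw [← pull_comp, e, pull_comp]
      have := hx n (Fin.succAboveOrderEmb b) fun c hc =>
        Fin.succAbove_ne b c (Fin.succAbove_right_injective hc)
      rw [show pull R B b.succAbove x = 0 from this, map_zero, mul_zero]

/-- Forms extend from the boundary of a simplex. -/
theorem exists_extension {V : ℤ → Set (Op R B)} {J : ℤ} (a : Fin (n + 2) → FormOp R B n)
    (ha : ∀ i, a i ∈ tensorForms V J)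
    (hc : ∀ (i i' : Fin (n + 2)) (k : ℕ) (θ θ' : Fin (k + 1) ↪o Fin (n + 1)),
      (∀ j, i.succAbove (θ j) = i'.succAbove (θ' j)) → pull R B θ (a i) = pull R B θ' (a i')) :
    ∃ x : FormOp R B (n + 1), x ∈ tensorForms V J ∧ ∀ i, pull R B (Fin.succAbove i) x = a i := by
  classical
  have key : ∀ s : Finset (Fin (n + 2)), ∃ x : FormOp R B (n + 1), x ∈ tensorForms V J ∧
      ∀ i ∈ s, pull R B (Fin.succAbove i) x = a i := fun s => by
    induction s using Finset.induction_on with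
    | empty => exact ⟨0, zero_mem _, fun i hi => by simp at hi⟩
    | insert i s hi ih =>
      obtain ⟨x, h1, h2⟩ := ih
      -- Faces are corrected one at a time. The correction on the face i vanishes where that face
      -- meets the earlier ones, by compatibility, so the earlier values are unchanged.
      refine ⟨x + extendFace i (a i - pull R B i.succAbove x),
        add_mem h1 (extendFace_mem i (sub_mem (ha i) (pull_mem _ h1))), fun l hl => ?_⟩
      rw [map_add]
      rcases Finset.mem_insert.1 hl with rfl | hl
      · rw [pull_extendFace_same, add_sub_cancel]
      · rw [pull_extendFace_ne (fun h : l = i => hi (h ▸ hl)), add_zero, h2 l hl]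
        intro k θ hθ
        obtain ⟨θ', hθ'⟩ := exists_succAbove_comp (θ := θ.trans (Fin.succAboveOrderEmb i)) hθ
        have e : i.succAbove ∘ θ = l.succAbove ∘ θ' := funext fun j => (hθ' j).symm
        rw [map_sub, ← pull_comp, e, pull_comp, h2 l hl, sub_eq_zero]
        exact hc i l k θ θ' fun j => (hθ' j).symm
  obtain ⟨x, h1, h2⟩ := key Finset.univ
  exact ⟨x, h1, fun i => h2 i (Finset.mem_univ i)⟩

end Faces

end DCrit

end

noncomputable section

namespace DCrit

/-! ## The differential algebra of operators with coefficients in forms -/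

section FormOps

variable {R : Type u} [CommRing R] {B : Type v} [CommRing B] [Algebra R B] {n k : ℕ}

theorem Raises.parity_mul {j : ℤ} {P : Op R B} (hP : Raises (B := B) j P) :
    parity R B * P = j.negOnePow • (P * parity R B) := by
  refine op_ext fun p α hα => ?_
  change inv R B (P α) = j.negOnePow • P (inv R B α)
  rw [involute_of_mem hα, P.map_smul_of_tower, smul_smul]
  rcases lt_or_ge ((p : ℤ) + j) 0 with h | h
  · rw [(hP p α hα).2 h, map_zero, smul_zero]
  · obtain ⟨q, hq⟩ := Int.eq_ofNat_of_zero_le h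
    rw [involute_of_mem ((hP p α hα).1 q hq.symm), ← hq, Int.negOnePow_add, mul_comm]

theorem Raises.parity_pow_mul {j : ℤ} {P : Op R B} (hP : Raises (B := B) j P) (q : ℕ) :
    parity R B ^ q * P = (q * j).negOnePow • (P * parity R B ^ q) := by
  induction q with
  | zero => simp
  | succ q ih =>
    rw [pow_succ', mul_assoc, ih, mul_smul_comm, ← mul_assoc, hP.parity_mul, smul_mul_assoc,
      smul_smul, mul_assoc, Nat.cast_succ, add_mul, one_mul, Int.negOnePow_add]

variable (R B) in
/-- Conjugation by the parity operator. -/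
def conjParity : Op R B →ₐ[R] Op R B :=
  AlgHom.ofLinearMap
    (LinearMap.mulLeft R (parity R B) ∘ₗ LinearMap.mulRight R (parity R B))
    (by simpa using parity_mul_parity)
    (fun P Q => by
      simp only [LinearMap.comp_apply, LinearMap.mulLeft_apply, LinearMap.mulRight_apply]
      have h : ∀ z : Op R B, parity R B * (parity R B * z) = z := fun z => by
        rw [← mul_assoc, parity_mul_parity, one_mul]
      simp only [mul_assoc, h])

variable (R B n) in
/-- The parity automorphism. -/
def formSign : FormOp R B n →ₐ[R] FormOp R B n :=
  Algebra.TensorProduct.map (conjParity R B) ((inv R (SimplexRing R n)).restrictScalars R)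

theorem formSign_pureOp (P : Op R B) (η : SimplexForms R n) :
    formSign R B n (pureOp P η) = pureOp (parity R B * (P * parity R B)) (inv R _ η) :=
  Algebra.TensorProduct.map_tmul _ _ _ _

theorem smul_pureOp (r : R) (P : Op R B) (η : SimplexForms R n) :
    r • pureOp P η = pureOp (r • P) η := (TensorProduct.smul_tmul' r P η).symm

theorem add_pureOp (P Q : Op R B) (η : SimplexForms R n) :
    pureOp (P + Q) η = pureOp P η + pureOp Q η := TensorProduct.add_tmul _ _ _

theorem neg_pureOp (P : Op R B) (η : SimplexForms R n) :
    pureOp (-P) η = -pureOp P η := TensorProduct.neg_tmul _ _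

theorem pureOp_neg (P : Op R B) (η : SimplexForms R n) :
    pureOp P (-η) = -pureOp P η := TensorProduct.tmul_neg _ _

theorem sub_pureOp (P Q : Op R B) (η : SimplexForms R n) :
    pureOp (P - Q) η = pureOp P η - pureOp Q η := TensorProduct.sub_tmul _ _ _

theorem pureOp_add (P : Op R B) (η ζ : SimplexForms R n) :
    pureOp P (η + ζ) = pureOp P η + pureOp P ζ := TensorProduct.tmul_add _ _ _

theorem zero_pureOp (η : SimplexForms R n) : pureOp (0 : Op R B) η = 0 := TensorProduct.zero_tmul _ _

theorem pureOp_zero (P : Op R B) : pureOp P (0 : SimplexForms R n) = 0 := TensorProduct.tmul_zero _ _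

theorem sum_pureOp {κ : Type*} (s : Finset κ) (P : κ → Op R B) (η : SimplexForms R n) :
    pureOp (∑ i ∈ s, P i) η = ∑ i ∈ s, pureOp (P i) η := TensorProduct.sum_tmul _ _ _

theorem units_smul_pureOp (ε : ℤˣ) (P : Op R B) (η : SimplexForms R n) :
    ε • pureOp P η = pureOp (ε • P) η := by
  rcases Int.units_eq_one_or ε with rfl | rfl
  · rw [one_smul, one_smul]
  · rw [Units.neg_smul, Units.neg_smul, one_smul, one_smul, neg_pureOp]

theorem pureOp_units_smul (ε : ℤˣ) (P : Op R B) (η : SimplexForms R n) :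
    pureOp P (ε • η) = pureOp (ε • P) η := by
  rcases Int.units_eq_one_or ε with rfl | rfl
  · rw [one_smul, one_smul]
  · rw [Units.neg_smul, Units.neg_smul, one_smul, one_smul, neg_pureOp, pureOp_neg]

theorem simplexDiff_pureOp (P : Op R B) (η : SimplexForms R n) :
    simplexDiff (pureOp P η) = pureOp (parity R B * P) (deRham R _ η) := by
  change pureOp (parity R B) 1 * pureOp P (deRham R _ η) = _
  rw [pureOp_mul_pureOp, one_mul]

theorem simplexDiff_smul (r : R) (x : FormOp R B n) : simplexDiff (r • x) = r • simplexDiff x := by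
  induction x using formOp_induction with
  | zero => rw [smul_zero, map_zero, smul_zero]
  | add x y hx hy => rw [smul_add, map_add, hx, hy, map_add, smul_add]
  | pure P η =>
    rw [smul_pureOp, simplexDiff_pureOp, simplexDiff_pureOp, smul_pureOp, op_mul_rsmul]

theorem simplexDiff_simplexDiff (x : FormOp R B n) : simplexDiff (simplexDiff x) = 0 := by
  induction x using formOp_induction with
  | zero => rw [map_zero, map_zero]
  | add x y hx hy => rw [map_add, map_add, hx, hy, add_zero]
  | pure P η =>
    rw [simplexDiff_pureOp, simplexDiff_pureOp,
      show deRham R _ (deRham R _ η) = 0 from LinearMap.congr_fun deRham_sq η, pureOp_zero]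

theorem simplexDiff_mul (x y : FormOp R B n) :
    simplexDiff (x * y) = simplexDiff x * y + formSign R B n x * simplexDiff y := by
  induction x using formOp_induction with
  | zero => simp only [zero_mul, map_zero, add_zero]
  | add x x' hx hx' => rw [add_mul, map_add, hx, hx', map_add, map_add, add_mul, add_mul]; abel
  | pure P η =>
    induction y using formOp_induction with
    | zero => simp only [mul_zero, map_zero, add_zero]
    | add y y' hy hy' => rw [mul_add, map_add, hy, hy', map_add, mul_add, mul_add]; abel
    | pure Q ζ =>
      have h : ∀ z : Op R B, parity R B * (parity R B * z) = z := fun z => by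
        rw [← mul_assoc, parity_mul_parity, one_mul]
      simp only [pureOp_mul_pureOp, simplexDiff_pureOp, formSign_pureOp, deRham_mul, pureOp_add,
        mul_assoc, h]

theorem simplexDiff_const (P : Op R B) : simplexDiff (pureOp P 1 : FormOp R B n) = 0 := by
  rw [simplexDiff_pureOp, deRham_one, pureOp_zero]

theorem pull_simplexDiff (θ : Fin (k + 1) → Fin (n + 1)) (x : FormOp R B n) :
    pull R B θ (simplexDiff x) = simplexDiff (pull R B θ x) := by
  induction x using formOp_induction with
  | zero => simp only [map_zero]
  | add x y hx hy => simp only [map_add, hx, hy]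
  | pure P η =>
    rw [simplexDiff_pureOp, pull_pureOp, pull_pureOp, simplexDiff_pureOp, formsMap_deRham]

theorem pull_formSign (θ : Fin (k + 1) → Fin (n + 1)) (x : FormOp R B n) :
    pull R B θ (formSign R B n x) = formSign R B k (pull R B θ x) := by
  induction x using formOp_induction with
  | zero => simp only [map_zero]
  | add x y hx hy => simp only [map_add, hx, hy]
  | pure P η => rw [formSign_pureOp, pull_pureOp, pull_pureOp, formSign_pureOp, formsMap_inv]

theorem pull_const (θ : Fin (k + 1) → Fin (n + 1)) (P : Op R B) :
    pull R B θ (pureOp P 1) = pureOp P 1 := by rw [pull_pureOp, map_one]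

theorem parity_mul_pow_mul_parity {j : ℤ} {P : Op R B} (hP : Raises (B := B) j P) (q : ℕ) :
    parity R B * (P * parity R B ^ q) = j.negOnePow • (P * parity R B ^ (q + 1)) := by
  rw [← mul_assoc, hP.parity_mul, smul_mul_assoc, mul_assoc, ← pow_succ']

/-- Next to a q-form the operator has degree J - q, so the signs of the two factors multiply to the
sign of the total degree. -/
theorem formSign_of_mem {V : ℤ → Set (Op R B)} (hV : ∀ j, ∀ P ∈ V j, Raises (B := B) j P) {J : ℤ}
    {x : FormOp R B n} (hx : x ∈ tensorForms V J) : formSign R B n x = J.negOnePow • x := by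
  induction hx using tens_induction with
  | zero => rw [map_zero, smul_zero]
  | add x y _ _ hx hy => rw [map_add, hx, hy, smul_add]
  | smul r x _ hx => rw [map_smul, hx, smul_comm]
  | pure q P hP η hη =>
    have e : parity R B * (P * parity R B ^ q * parity R B) =
        (J - q).negOnePow • (P * parity R B ^ q) := by
      rw [mul_assoc, ← pow_succ, parity_mul_pow_mul_parity (hV _ _ hP), pow_succ, pow_succ,
        mul_assoc (parity R B ^ q), parity_mul_parity, mul_one]
    rw [formSign_pureOp, e, involute_of_mem hη, pureOp_units_smul, units_smul_pureOp, smul_smul,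
      ← Int.negOnePow_add, add_sub_cancel]

theorem simplexDiff_mem {V : ℤ → Set (Op R B)} (hV : ∀ j, ∀ P ∈ V j, Raises (B := B) j P) {J : ℤ}
    {x : FormOp R B n} (hx : x ∈ tensorForms V J) : simplexDiff x ∈ tensorForms V (J + 1) := by
  induction hx using tens_induction with
  | zero => rw [map_zero]; exact zero_mem _
  | add x y _ _ hx hy => rw [map_add]; exact add_mem hx hy
  | smul r x _ hx => rw [simplexDiff_smul]; exact Submodule.smul_mem _ _ hx
  | pure q P hP η hη =>
    rw [simplexDiff_pureOp, parity_mul_pow_mul_parity (hV _ _ hP), ← units_smul_pureOp]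
    refine negOnePow_smul_mem (S := (tensorForms V (J + 1)).toAddSubgroup) _ ?_
    exact pureOp_mem (by rwa [Nat.cast_succ, add_sub_add_right_eq_sub]) (deRham_mem hη)

theorem tens_units_smul {V : ℤ → Set (Op R B)} {J : ℤ} (ε : ℤˣ) {x : FormOp R B n}
    (hx : x ∈ tensorForms V J) : ε • x ∈ tensorForms V J := by
  rcases Int.units_eq_one_or ε with rfl | rfl
  · rwa [one_smul]
  · rw [Units.neg_smul, one_smul]; exact neg_mem hx

/-- Graded commutators of operators with coefficients in forms. -/
theorem tens_gComm {V V' W : ℤ → Set (Op R B)} (hV : ∀ j, ∀ P ∈ V j, Raises (B := B) j P)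
    (hV' : ∀ j, ∀ P ∈ V' j, Raises (B := B) j P)
    (h : ∀ j j', ∀ P ∈ V j, ∀ P' ∈ V' j', gComm j j' P P' ∈ W (j + j')) {J J' : ℤ}
    {x y : FormOp R B n} (hx : x ∈ tensorForms V J) (hy : y ∈ tensorForms V' J') :
    x * y - (J * J').negOnePow • (y * x) ∈ tensorForms W (J + J') := by
  induction hx using tens_induction with
  | zero => rw [zero_mul, mul_zero, smul_zero, sub_zero]; exact zero_mem _
  | add x x' _ _ hx hx' =>
    rw [add_mul, mul_add, smul_add, add_sub_add_comm]; exact add_mem hx hx'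
  | smul r x _ hx =>
    rw [smul_mul_assoc, mul_smul_comm, smul_comm, ← smul_sub]; exact Submodule.smul_mem _ _ hx
  | pure q P hP η hη =>
    induction hy using tens_induction with
    | zero => rw [zero_mul, mul_zero, smul_zero, sub_zero]; exact zero_mem _
    | add x x' _ _ hx hx' =>
      rw [add_mul, mul_add, smul_add, add_sub_add_comm]; exact add_mem hx hx'
    | smul r x _ hx =>
      rw [smul_mul_assoc, mul_smul_comm, smul_comm, ← smul_sub]; exact Submodule.smul_mem _ _ hx
    | pure q' P' hP' η' hη' =>
      have e1 : P * parity R B ^ q * (P' * parity R B ^ q') =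
          (q * (J' - q')).negOnePow • (P * P' * parity R B ^ (q + q')) := by
        rw [mul_assoc, ← mul_assoc (parity R B ^ q), (hV' _ _ hP').parity_pow_mul, smul_mul_assoc,
          mul_smul_comm, mul_assoc, mul_assoc, pow_add]
      have e2 : P' * parity R B ^ q' * (P * parity R B ^ q) =
          (q' * (J - q)).negOnePow • (P' * P * parity R B ^ (q + q')) := by
        rw [mul_assoc, ← mul_assoc (parity R B ^ q'), (hV _ _ hP).parity_pow_mul, smul_mul_assoc,
          mul_smul_comm, mul_assoc, mul_assoc, add_comm q, pow_add]
      have key : pureOp (P * parity R B ^ q) η * pureOp (P' * parity R B ^ q') η' -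
          (J * J').negOnePow • (pureOp (P' * parity R B ^ q') η' * pureOp (P * parity R B ^ q) η) =
          (q * (J' - q')).negOnePow •
            pureOp (gComm (J - q) (J' - q') P P' * parity R B ^ (q + q')) (η * η') := by
        rw [pureOp_mul_pureOp, pureOp_mul_pureOp, e1, e2, graded_comm hη' hη, pureOp_units_smul,
          units_smul_pureOp, units_smul_pureOp, ← sub_pureOp, smul_smul, smul_smul, gComm, sub_mul,
          smul_sub, smul_mul_assoc, smul_smul]
        congr 3
        rw [← Int.negOnePow_add, ← Int.negOnePow_add, ← Int.negOnePow_add, Int.negOnePow_eq_iff]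
        exact ⟨q' * J, by ring⟩
      rw [key]
      refine tens_units_smul _ (pureOp_mem ?_ (mul_mem_exteriorPower hη hη'))
      have := h _ _ P hP P' hP'
      rwa [show J - q + (J' - q') = J + J' - (q + q' : ℕ) by push_cast; ring] at this

/-- The combination `C x + (-1)^J x C` for an operator `C` of degree `-1`. -/
theorem tens_odd_anticomm {V W : ℤ → Set (Op R B)} {C : Op R B}
    (hC : Raises (B := B) (-1) C)
    (h : ∀ j, ∀ P ∈ V j, C * P + j.negOnePow • (P * C) ∈ W (j - 1)) {J : ℤ}
    {x : FormOp R B n} (hx : x ∈ tensorForms V J) :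
    pureOp C 1 * x + J.negOnePow • (x * pureOp C 1) ∈ tensorForms W (J - 1) := by
  induction hx using tens_induction with
  | zero => rw [zero_mul, mul_zero, smul_zero, add_zero]; exact zero_mem _
  | add x x' _ _ hx hx' =>
    rw [add_mul, mul_add, smul_add, add_add_add_comm]; exact add_mem hx hx'
  | smul r x _ hx =>
    rw [smul_mul_assoc, mul_smul_comm, smul_comm, ← smul_add]; exact Submodule.smul_mem _ _ hx
  | pure q P hP η hη =>
    have key : pureOp C 1 * pureOp (P * parity R B ^ q) η +
        J.negOnePow • (pureOp (P * parity R B ^ q) η * pureOp C 1) =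
        pureOp ((C * P + (J - q).negOnePow • (P * C)) * parity R B ^ q) η := by
      rw [pureOp_mul_pureOp, pureOp_mul_pureOp, one_mul, mul_one, mul_assoc P, hC.parity_pow_mul,
        mul_smul_comm, units_smul_pureOp, ← add_pureOp, smul_smul, add_mul, smul_mul_assoc,
        mul_assoc C, mul_assoc P]
      congr 4
      rw [← Int.negOnePow_add, Int.negOnePow_eq_iff]
      exact ⟨0, by ring⟩
    rw [key]
    refine pureOp_mem ?_ hη
    have := h _ P hP
    rwa [show J - q - 1 = J - 1 - q by ring] at this

theorem tens_eq_bot {V : ℤ → Set (Op R B)} (hV : ∀ j, ∀ P ∈ V j, P = 0) {J : ℤ} {x : FormOp R B n}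
    (hx : x ∈ tensorForms V J) : x = 0 := by
  induction hx using tens_induction with
  | zero => rfl
  | add x y _ _ hx hy => rw [hx, hy, add_zero]
  | smul r x _ hx => rw [hx, smul_zero]
  | pure q P hP η hη => rw [hV _ P hP, zero_mul, zero_pureOp]

theorem tens_mono {V W : ℤ → Set (Op R B)} (h : ∀ j, ∀ P ∈ V j, P ∈ W j) {J : ℤ} {x : FormOp R B n}
    (hx : x ∈ tensorForms V J) : x ∈ tensorForms W J := by
  induction hx using tens_induction with
  | zero => exact zero_mem _
  | add x y _ _ hx hy => exact add_mem hx hy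
  | smul r x _ hx => exact Submodule.smul_mem _ _ hx
  | pure q P hP η hη => exact pureOp_mem (h _ P hP) hη

end FormOps

/-! ### Laurent series -/

section Series

variable {A : Type w} [Ring A]

theorem exists_lower_bound (x : HahnSeries ℤ A) : ∃ N : ℤ, ∀ i < N, x.coeff i = 0 := by
  by_cases h : x = 0
  · exact ⟨0, fun i _ => by rw [h]; rfl⟩
  · exact ⟨x.order, fun i hi => HahnSeries.coeff_eq_zero_of_lt_order hi⟩

theorem exists_lower_bound₂ (x y : HahnSeries ℤ A) :
    ∃ N : ℤ, (∀ i < N, x.coeff i = 0) ∧ ∀ i < N, y.coeff i = 0 := by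
  obtain ⟨N, hN⟩ := exists_lower_bound x
  obtain ⟨N', hN'⟩ := exists_lower_bound y
  exact ⟨min N N', fun i hi => hN i (lt_of_lt_of_le hi (min_le_left _ _)),
    fun i hi => hN' i (lt_of_lt_of_le hi (min_le_right _ _))⟩

/-- The antidiagonal in the definition of the product depends on the supports. A common interval
allows coefficients of different series to be compared term by term. -/
theorem coeff_mul_eq_sum {x y : HahnSeries ℤ A} {N : ℤ} (hx : ∀ i < N, x.coeff i = 0)
    (hy : ∀ i < N, y.coeff i = 0) (i : ℤ) :
    (x * y).coeff i = ∑ a ∈ Finset.Icc N (i - N), x.coeff a * y.coeff (i - a) := by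
  classical
  rw [HahnSeries.coeff_mul]
  have hx' : ∀ a, x.coeff a ≠ 0 → N ≤ a := fun a h => not_lt.1 fun h' => h (hx a h')
  have hy' : ∀ a, y.coeff a ≠ 0 → N ≤ a := fun a h => not_lt.1 fun h' => h (hy a h')
  refine Finset.sum_bij_ne_zero (fun p _ _ => p.1) ?_ ?_ ?_ ?_
  · intro p hp hne
    have e : p.1 + p.2 = i := by simp_all
    have h1 := hx' p.1 (left_ne_zero_of_mul hne)
    have h2 := hy' p.2 (right_ne_zero_of_mul hne)
    exact Finset.mem_Icc.2 ⟨h1, by omega⟩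
  · intro p hp hne q hq hne' h
    have e : p.1 + p.2 = i := by simp_all
    have e' : q.1 + q.2 = i := by simp_all
    exact Prod.ext h (by omega)
  · intro a ha hne
    refine ⟨(a, i - a), ?_, hne, rfl⟩
    have h1 := left_ne_zero_of_mul hne
    have h2 := right_ne_zero_of_mul hne
    simp_all
  · intro p hp hne
    have e : p.1 + p.2 = i := by simp_all
    rw [← e, add_sub_cancel_left]

theorem coeff_mul_eq_sum' {x y : HahnSeries ℤ A} {N : ℤ} (hx : ∀ i < N, x.coeff i = 0)
    (hy : ∀ i < N, y.coeff i = 0) (i : ℤ) :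
    (x * y).coeff i = ∑ a ∈ Finset.Icc N (i - N), x.coeff (i - a) * y.coeff a := by
  rw [coeff_mul_eq_sum hx hy]
  refine Finset.sum_nbij' (fun a => i - a) (fun a => i - a) ?_ ?_ ?_ ?_ ?_
  · intro a ha; simp only [Finset.mem_Icc] at ha ⊢; omega
  · intro a ha; simp only [Finset.mem_Icc] at ha ⊢; omega
  · intro a _; ring
  · intro a _; ring
  · intro a _; rw [sub_sub_cancel]

end Series

end DCrit

end

noncomputable section

namespace DCrit

/-! ## Approximate Euler identities with coefficients in forms -/

section Approximation

variable {R : Type u} [CommRing R] {B : Type v} [CommRing B] [Algebra R B] {m n : ℕ}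

variable (R B) in
/-- The operators in `F_k D_X(L)` of degree `j`, as an `R`-module. -/
def dxSub (k j : ℤ) : Submodule R (Op R B) where
  carrier := DX k j
  add_mem' h h' := OrdLT.add h h'
  zero_mem' := OrdLT.zero _ _
  smul_mem' r _ h := OrdLT.smul h r

theorem mem_dxSub {k j : ℤ} {P : Op R B} : P ∈ dxSub R B k j ↔ OrdLT (k + 1).toNat j P := Iff.rfl

theorem const_mul_pureOp (C P : Op R B) (q : ℕ) (η : SimplexForms R n) :
    pureOp C 1 * pureOp (P * parity R B ^ q) η = pureOp (C * P * parity R B ^ q) η := by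
  rw [pureOp_mul_pureOp, one_mul, mul_assoc]

theorem pureOp_mul_const {C : Op R B} (hC : Raises (B := B) 0 C) (P : Op R B) (q : ℕ)
    (η : SimplexForms R n) :
    pureOp (P * parity R B ^ q) η * pureOp C 1 = pureOp (P * C * parity R B ^ q) η := by
  rw [pureOp_mul_pureOp, mul_one, mul_assoc, hC.parity_pow_mul, mul_zero, Int.negOnePow_zero,
    one_smul, mul_assoc]

theorem pureOp_mul_odd {C : Op R B} {e : ℤ} (hC : Raises (B := B) e C) (he : Odd e) (P : Op R B)
    (q : ℕ) (J : ℤ) (η : SimplexForms R n) :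
    J.negOnePow • (pureOp (P * parity R B ^ q) η * pureOp C 1) =
      pureOp ((J - q).negOnePow • (P * C) * parity R B ^ q) η := by
  rw [pureOp_mul_pureOp, mul_one, mul_assoc, hC.parity_pow_mul, mul_smul_comm, units_smul_pureOp,
    smul_smul, smul_mul_assoc, mul_assoc]
  congr 2
  obtain ⟨s, rfl⟩ := he
  rw [← Int.negOnePow_add, Int.negOnePow_eq_iff]
  exact ⟨q * s + q, by ring⟩

/-- A tool to pass from an identity for operators of each degree to operators with coefficients in
forms; the degree seen by the operator is the total degree minus the form degree. -/
theorem tens_map {V W : ℤ → Set (Op R B)} {J : ℤ} (T : FormOp R B n →ₗ[R] FormOp R B n)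
    (u : ℤ → Op R B → Op R B) (hu : ∀ j, ∀ P ∈ V j, u j P ∈ W j)
    (hT : ∀ (q : ℕ) P η, T (pureOp (P * parity R B ^ q) η) = pureOp (u (J - q) P * parity R B ^ q) η)
    {x : FormOp R B n} (hx : x ∈ tensorForms V J) : T x ∈ tensorForms W J := by
  induction hx using tens_induction with
  | zero => rw [map_zero]; exact zero_mem _
  | add x y _ _ hx hy => rw [map_add]; exact add_mem hx hy
  | smul r x _ hx => rw [map_smul]; exact Submodule.smul_mem _ _ hx
  | pure q P hP η hη => rw [hT]; exact pureOp_mem (hu _ P hP) hη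

variable [Algebra ℚ R]

variable (R) in
/-- The number `1 / 2`. -/
def half : R := algebraMap ℚ R (1 / 2)

theorem half_add_half : half R + half R = 1 := by
  rw [half, ← map_add, ← map_one (algebraMap ℚ R)]; norm_num

theorem half_smul_add {M : Type*} [AddCommGroup M] [Module R M] (x : M) :
    half R • (x + x) = x := by rw [smul_add, ← add_smul, half_add_half, one_smul]

theorem half_sum_smul {ι : Type*} (s : Finset ι) {M : Type*} [AddCommGroup M] [Module R M]
    (a b c : ι → M) (h : ∀ i, a i = b i + b i + c i) :
    half R • ∑ i ∈ s, a i = ∑ i ∈ s, b i + half R • ∑ i ∈ s, c i := by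
  simp only [h, Finset.sum_add_distrib]
  rw [smul_add, half_smul_add]

/-- The terms of the Euler identity which involve `f` cancel up to lower order. -/
theorem approx_function (F : Frame R B m) (f : B) {w j : ℤ} {P : Op R B} (hP : P ∈ dxSub R B w j) :
    half R • ∑ i, (mulOp (F.v i f) * (mulOp (F.g i) * P - P * mulOp (F.g i)) +
      (mulOp (F.g i) * P - P * mulOp (F.g i)) * mulOp (F.v i f)) - (mulOp f * P - P * mulOp f) ∈
      dxSub R B (w - 2) j := by
  -- The order is stated with a truncated bound so that negative w is covered as well.
  have h1 : OrdLT ((w - 1).toNat + 2) j P := OrdLT.mono hP (by omega)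
  have h2 : OrdLT (w - 1).toNat j
      ((baseComm P f - ∑ i, mulOp (F.v i f) * baseComm P (F.g i)) +
        half R • ∑ i, -baseComm (baseComm P (F.g i)) (F.v i f)) :=
    (F.isFrame.gComm_approx h1 f).add (OrdLT.smul (OrdLT.sum fun i _ =>
      OrdLT.neg (OrdLT.baseComm (OrdLT.baseComm h1 _) _)) _)
  have h3 := half_sum_smul (R := R) Finset.univ (fun i => (mulOp (F.v i f) *
    (mulOp (F.g i) * P - P * mulOp (F.g i)) +
      (mulOp (F.g i) * P - P * mulOp (F.g i)) * mulOp (F.v i f)))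
    (fun i => -(mulOp (F.v i f) * baseComm P (F.g i)))
    (fun i => -baseComm (baseComm P (F.g i)) (F.v i f)) (fun i => by
      simp only [baseComm_apply]; noncomm_ring)
  rw [mem_dxSub, h3]
  refine OrdLT.mono (?_ : OrdLT (w - 1).toNat j _) (by omega)
  convert h2 using 1
  rw [Finset.sum_neg_distrib, baseComm_apply P f]
  abel

/-- The remaining terms of the Euler identity. -/
theorem approx_euler (F : Frame R B m) {a w j : ℤ} {k : ℕ} (haw : w = a + 1 - k) {P : Op R B}
    (hP : P ∈ dxSub R B w j) :
    a • P + (weightOp B m * P - P * weightOp B m) +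
      half R • ∑ i, (lieOp (F.v i) * (mulOp (F.g i) * P - P * mulOp (F.g i)) +
        (mulOp (F.g i) * P - P * mulOp (F.g i)) * lieOp (F.v i) -
        iota (F.v i) * (koszul (F.g i) * P - j.negOnePow • (P * koszul (F.g i))) -
        (j + 1).negOnePow • ((koszul (F.g i) * P - j.negOnePow • (P * koszul (F.g i))) *
          iota (F.v i))) -
      ((k : R) - 1) • P ∈ dxSub R B (w - 1) j := by
  rcases lt_or_ge w 0 with hw | hw
  · have h0 : P = 0 := by
      have h := mem_dxSub.1 hP
      rwa [show (w + 1).toNat = 0 by omega] at h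
    rw [h0]
    simp
  obtain ⟨K, rfl⟩ := Int.eq_ofNat_of_zero_le hw
  have hP' : OrdLT (K + 1) j P := hP
  rw [mem_dxSub, show ((K : ℤ) - 1 + 1).toNat = K by omega]
  have hN : weightOp B m * P - P * weightOp B m = -(j • P) := by
    rw [← gComm_weightOp hP'.raises, DCrit.gComm, zero_mul, Int.negOnePow_zero, one_smul]
  have hW : ∀ i, koszul (F.g i) * P - j.negOnePow • (P * koszul (F.g i)) =
      DCrit.gComm 1 j (koszul (F.g i)) P := fun i => by rw [DCrit.gComm, one_mul]
  simp only [hW]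
  have hWo : ∀ i, OrdLT (K + 1) (1 + j) (DCrit.gComm 1 j (koszul (F.g i)) P) := fun i => by
    have := OrdLT.gComm F (ordLT_koszul (F.g i)) hP'
    rwa [add_comm 1 K] at this
  have h1 : ∀ i, OrdLT K j (DCrit.gComm j 0 (baseComm P (F.g i)) (lieOp (F.v i))) := fun i => by
    have hb := OrdLT.baseComm hP' (F.g i)
    rcases K with _ | K
    · rw [show baseComm P (F.g i) = 0 from hb, gComm_zero_left]; exact OrdLT.zero _ _
    · exact (OrdLT.gComm F hb (ordLT_lieOp (F.v i))).congr (add_zero j)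
  have h2 : ∀ i, OrdLT K j (DCrit.gComm (-1) (1 + j) (iota (F.v i))
      (DCrit.gComm 1 j (koszul (F.g i)) P)) := fun i => by
    have := OrdLT.gComm F (ordLT_iota (F.v i)) (hWo i)
    rw [zero_add] at this
    exact this.congr (by ring)
  -- Replacing each symmetrised product by twice the ordered product costs one more commutator,
  -- which lowers the order.
  have h3 := half_sum_smul (R := R) Finset.univ _
    (fun i => -(lieOp (F.v i) * baseComm P (F.g i) +
      iota (F.v i) * DCrit.gComm 1 j (koszul (F.g i)) P))
    (fun i => -DCrit.gComm j 0 (baseComm P (F.g i)) (lieOp (F.v i)) +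
      DCrit.gComm (-1) (1 + j) (iota (F.v i)) (DCrit.gComm 1 j (koszul (F.g i)) P))
    (fun i => show (lieOp (F.v i) * (mulOp (F.g i) * P - P * mulOp (F.g i)) +
        (mulOp (F.g i) * P - P * mulOp (F.g i)) * lieOp (F.v i) -
        iota (F.v i) * DCrit.gComm 1 j (koszul (F.g i)) P -
        (j + 1).negOnePow • (DCrit.gComm 1 j (koszul (F.g i)) P * iota (F.v i))) = _ by
      set W := DCrit.gComm 1 j (koszul (F.g i)) P
      simp only [DCrit.gComm, baseComm_apply, mul_zero, Int.negOnePow_zero, one_smul]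
      rw [show ((-1 : ℤ) * (1 + j)).negOnePow = (j + 1).negOnePow from
        (Int.negOnePow_eq_iff _ _).2 ⟨-(j + 1), by ring⟩]
      generalize (j + 1).negOnePow • (W * iota (F.v i)) = U
      noncomm_ring)
  rw [hN, h3]
  -- The sum contributes -(w - j), the commutator with the weight operator -j, and ħ∂_ħ contributes
  -- a. The total is a - w = k - 1.
  have h4 := euler_approx' F hP'
  have h5 : OrdLT K j (-(∑ i, (lieOp (F.v i) * baseComm P (F.g i) +
      iota (F.v i) * DCrit.gComm 1 j (koszul (F.g i)) P) - ((K : ℤ) - j) • P) +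
      half R • ∑ i, (-DCrit.gComm j 0 (baseComm P (F.g i)) (lieOp (F.v i)) +
      DCrit.gComm (-1) (1 + j) (iota (F.v i)) (DCrit.gComm 1 j (koszul (F.g i)) P))) :=
    h4.neg.add (OrdLT.smul (OrdLT.sum fun i _ => (h1 i).neg.add (h2 i)) _)
  convert h5 using 1
  have h6 : ((k : R) - 1) • P = ((k : ℤ) - 1) • P := by
    rw [sub_smul, sub_smul, Nat.cast_smul_eq_nsmul, natCast_zsmul, one_smul, one_smul]
  rw [h6, Finset.sum_neg_distrib, haw]
  module

theorem tens_approx_function (F : Frame R B m) (f : B) {w J : ℤ} {x : FormOp R B n}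
    (hx : x ∈ tens (dxSub R B w) J) :
    half R • ∑ i, (pureOp (mulOp (F.v i f)) 1 * (pureOp (mulOp (F.g i)) 1 * x -
        x * pureOp (mulOp (F.g i)) 1) +
      (pureOp (mulOp (F.g i)) 1 * x - x * pureOp (mulOp (F.g i)) 1) * pureOp (mulOp (F.v i f)) 1) -
      (pureOp (mulOp f) 1 * x - x * pureOp (mulOp f) 1) ∈ tens (dxSub R B (w - 2)) J := by
  let l : Op R B → FormOp R B n →ₗ[R] FormOp R B n := fun P => LinearMap.mulLeft R (pureOp P 1)
  let r : Op R B → FormOp R B n →ₗ[R] FormOp R B n := fun P => LinearMap.mulRight R (pureOp P 1)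
  have := tens_map (half R • ∑ i, (l (mulOp (F.v i f)) ∘ₗ (l (mulOp (F.g i)) - r (mulOp (F.g i))) +
    r (mulOp (F.v i f)) ∘ₗ (l (mulOp (F.g i)) - r (mulOp (F.g i)))) - (l (mulOp f) - r (mulOp f)))
    _ (fun j P hP => approx_function F f hP) (fun q P η => by
      simp only [LinearMap.sub_apply, LinearMap.smul_apply, LinearMap.sum_apply,
        LinearMap.add_apply, LinearMap.comp_apply, l, r, LinearMap.mulLeft_apply,
        LinearMap.mulRight_apply, const_mul_pureOp, pureOp_mul_const (raises_mulOp _),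
        ← sub_pureOp, ← sub_mul, ← add_pureOp, ← add_mul, ← sum_pureOp, ← Finset.sum_mul,
        smul_pureOp, ← smul_mul_assoc]) hx
  simpa only [LinearMap.sub_apply, LinearMap.smul_apply, LinearMap.sum_apply,
    LinearMap.add_apply, LinearMap.comp_apply, l, r, LinearMap.mulLeft_apply,
    LinearMap.mulRight_apply] using this

theorem tens_approx_euler (F : Frame R B m) {a w J : ℤ} {k : ℕ} (haw : w = a + 1 - k)
    {x : FormOp R B n} (hx : x ∈ tens (dxSub R B w) J) :
    a • x + (pureOp (weightOp B m) 1 * x - x * pureOp (weightOp B m) 1) +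
      half R • ∑ i, (pureOp (lieOp (F.v i)) 1 * (pureOp (mulOp (F.g i)) 1 * x -
          x * pureOp (mulOp (F.g i)) 1) +
        (pureOp (mulOp (F.g i)) 1 * x - x * pureOp (mulOp (F.g i)) 1) * pureOp (lieOp (F.v i)) 1 -
        pureOp (iota (F.v i)) 1 * (pureOp (koszul (F.g i)) 1 * x -
          J.negOnePow • (x * pureOp (koszul (F.g i)) 1)) -
        (J + 1).negOnePow • ((pureOp (koszul (F.g i)) 1 * x -
          J.negOnePow • (x * pureOp (koszul (F.g i)) 1)) * pureOp (iota (F.v i)) 1)) -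
      ((k : R) - 1) • x ∈ tens (dxSub R B (w - 1)) J := by
  let l : Op R B → FormOp R B n →ₗ[R] FormOp R B n := fun P => LinearMap.mulLeft R (pureOp P 1)
  let r : Op R B → FormOp R B n →ₗ[R] FormOp R B n := fun P => LinearMap.mulRight R (pureOp P 1)
  let W := fun i => l (koszul (F.g i)) - J.negOnePow • r (koszul (F.g i))
  let T := a • LinearMap.id + (l (weightOp B m) - r (weightOp B m)) +
    half R • ∑ i, (l (lieOp (F.v i)) ∘ₗ (l (mulOp (F.g i)) - r (mulOp (F.g i))) +
      r (lieOp (F.v i)) ∘ₗ (l (mulOp (F.g i)) - r (mulOp (F.g i))) - l (iota (F.v i)) ∘ₗ W i -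
      (J + 1).negOnePow • r (iota (F.v i)) ∘ₗ W i) - ((k : R) - 1) • LinearMap.id
  have := tens_map T _ (fun j P hP => approx_euler F haw hP) (fun q P η => by
      have e : J + 1 - q = J - q + 1 := by ring
      have hz : ∀ (a : ℤ) (P : Op R B), a • pureOp P η = pureOp (a • P) η := fun a P => by
        rw [← Int.cast_smul_eq_zsmul R, smul_pureOp, Int.cast_smul_eq_zsmul]
      simp only [T, W, LinearMap.sub_apply, LinearMap.smul_apply, LinearMap.sum_apply,
        LinearMap.add_apply, LinearMap.comp_apply, LinearMap.id_apply, l, r,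
        LinearMap.mulLeft_apply, LinearMap.mulRight_apply, const_mul_pureOp,
        pureOp_mul_const (raises_mulOp _), pureOp_mul_const (raises_lieOp _),
        pureOp_mul_const raises_weightOp, pureOp_mul_odd (raises_koszul _) odd_one,
        ← sub_pureOp, ← sub_mul, ← add_pureOp, ← add_mul, hz, smul_pureOp, ← smul_mul_assoc,
        pureOp_mul_odd (raises_iota _) (by decide : Odd (-1 : ℤ)), e, ← sum_pureOp,
        ← Finset.sum_mul]) hx
  simpa only [T, W, LinearMap.sub_apply, LinearMap.smul_apply, LinearMap.sum_apply,
    LinearMap.add_apply, LinearMap.comp_apply, LinearMap.id_apply, l, r, LinearMap.mulLeft_apply,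
    LinearMap.mulRight_apply] using this

end Approximation

end DCrit

end

noncomputable section

namespace DCrit

/-! ## Laurent series of operators with coefficients in forms -/

section SeriesOps

/-- A ring homomorphism applied to the coefficients of a series. -/
def seriesMap {A A' : Type*} [Ring A] [Ring A'] (φ : A →+* A') :
    HahnSeries ℤ A →+* HahnSeries ℤ A' where
  toFun x := x.map φ
  map_one' := by
    ext i
    rw [HahnSeries.map_coeff]
    by_cases h : i = 0
    · subst h; simp [HahnSeries.coeff_one]
    · simp [HahnSeries.coeff_one, h]
  map_zero' := by ext i; simp
  map_add' x y := by ext i; simp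
  map_mul' x y := by
    ext i
    obtain ⟨N, hx, hy⟩ := exists_lower_bound₂ x y
    have hx' : ∀ i < N, (x.map φ).coeff i = 0 := fun i hi => by
      rw [HahnSeries.map_coeff, hx i hi, map_zero]
    have hy' : ∀ i < N, (y.map φ).coeff i = 0 := fun i hi => by
      rw [HahnSeries.map_coeff, hy i hi, map_zero]
    rw [HahnSeries.map_coeff, coeff_mul_eq_sum hx hy, coeff_mul_eq_sum hx' hy', map_sum]
    simp only [map_mul, HahnSeries.map_coeff]

theorem coeff_units_smul {A : Type*} [Ring A] (ε : ℤˣ) (x : HahnSeries ℤ A) (i : ℤ) :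
    (ε • x).coeff i = ε • x.coeff i := by
  rcases Int.units_eq_one_or ε with rfl | rfl
  · rw [one_smul, one_smul]
  · rw [Units.neg_smul, Units.neg_smul, one_smul, one_smul]; rfl

variable {R : Type u} [CommRing R] {B : Type v} [CommRing B] [Algebra R B] {n k : ℕ}

theorem coeff_term (i : ℤ) (P : Op R B) (a : ℤ) :
    (term i P : QSeries R B n).coeff a = if a = i then pureOp P 1 else 0 := by
  rw [term]
  split_ifs with h
  · rw [h, HahnSeries.coeff_single_same]
  · rw [HahnSeries.coeff_single_of_ne h]

theorem term_mul_term (i j : ℤ) (P Q : Op R B) :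
    (term i P * term j Q : QSeries R B n) = term (i + j) (P * Q) := by
  rw [term, term, HahnSeries.single_mul_single, pureOp_mul_pureOp, mul_one]; rfl

theorem term_add (i : ℤ) (P Q : Op R B) :
    (term i (P + Q) : QSeries R B n) = term i P + term i Q := by
  ext a
  rw [HahnSeries.coeff_add, coeff_term, coeff_term, coeff_term]
  split_ifs
  · exact add_pureOp _ _ _
  · rw [add_zero]

theorem term_neg (i : ℤ) (P : Op R B) : (term i (-P) : QSeries R B n) = -term i P := by
  ext a
  rw [HahnSeries.coeff_neg, coeff_term, coeff_term]
  split_ifs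
  · exact neg_pureOp _ _
  · rw [neg_zero]

theorem term_sub (i : ℤ) (P Q : Op R B) :
    (term i (P - Q) : QSeries R B n) = term i P - term i Q := by
  rw [sub_eq_add_neg, term_add, term_neg, sub_eq_add_neg]

theorem term_zero (i : ℤ) : (term i 0 : QSeries R B n) = 0 := by
  rw [term, zero_pureOp, map_zero]

theorem coeff_term_mul (i : ℤ) (P : Op R B) (x : QSeries R B n) (a : ℤ) :
    (term i P * x).coeff a = pureOp P 1 * x.coeff (a - i) := HahnSeries.coeff_single_mul

theorem coeff_mul_term (i : ℤ) (P : Op R B) (x : QSeries R B n) (a : ℤ) :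
    (x * term i P).coeff a = x.coeff (a - i) * pureOp P 1 := HahnSeries.coeff_mul_single

variable (R B n) in
/-- The differential of `Ω(Δ^n)`, applied to the coefficients. -/
def seriesDiff : QSeries R B n →ₗ[R] QSeries R B n where
  toFun x := x.map simplexDiff
  map_add' x y := by ext i; simp
  map_smul' r x := by ext i; simp [simplexDiff_smul]

variable (R B n) in
/-- The parity automorphism, applied to the coefficients. -/
def seriesSign : QSeries R B n →ₗ[R] QSeries R B n where
  toFun x := seriesMap (formSign R B n).toRingHom x
  map_add' x y := map_add _ _ _
  map_smul' r x := by
    ext i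
    exact (formSign R B n).map_smul_of_tower r (x.coeff i)

variable (R B n) in
/-- The derivation `ħ ∂/∂ħ` as a linear map. -/
def hbarLin : QSeries R B n →ₗ[R] QSeries R B n where
  toFun x := hbarDer x
  map_add' x y := by
    ext i
    exact smul_add i (x.coeff i) (y.coeff i)
  map_smul' r x := by
    ext i
    exact smul_comm i r (x.coeff i)

theorem coeff_seriesDiff (x : QSeries R B n) (i : ℤ) :
    (seriesDiff R B n x).coeff i = simplexDiff (x.coeff i) := rfl

theorem coeff_seriesSign (x : QSeries R B n) (i : ℤ) :
    (seriesSign R B n x).coeff i = formSign R B n (x.coeff i) := rfl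

theorem coeff_hbarLin (x : QSeries R B n) (i : ℤ) : (hbarLin R B n x).coeff i = i • x.coeff i := rfl

theorem seriesSign_mul (x y : QSeries R B n) :
    seriesSign R B n (x * y) = seriesSign R B n x * seriesSign R B n y :=
  map_mul (seriesMap (formSign R B n).toRingHom) x y

theorem formSign_formSign (x : FormOp R B n) : formSign R B n (formSign R B n x) = x := by
  induction x using formOp_induction with
  | zero => simp only [map_zero]
  | add x y hx hy => simp only [map_add, hx, hy]
  | pure P η =>
    have h : ∀ z : Op R B, parity R B * (parity R B * z) = z := fun z => by
      rw [← mul_assoc, parity_mul_parity, one_mul]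
    rw [formSign_pureOp, formSign_pureOp]
    simp only [mul_assoc, h, parity_mul_parity, mul_one]
    rw [CliffordAlgebra.involute_involute]

theorem inv_deRham {A : Type*} [CommRing A] [Algebra R A] (η : Forms R A) :
    deRham R A (inv R A η) = -inv R A (deRham R A η) := by
  induction η using DirectSum.Decomposition.inductionOn (fun p => ⋀[A]^p (Ω[A⁄R])) with
  | zero => simp only [map_zero, neg_zero]
  | add x y hx hy => simp only [map_add, hx, hy, neg_add]
  | homogeneous a =>
    rw [involute_of_mem a.2, involute_of_mem (deRham_mem a.2), Nat.cast_succ, Int.negOnePow_succ,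
      Units.neg_smul, neg_neg, (deRham R A).map_smul_of_tower]

theorem simplexDiff_formSign (x : FormOp R B n) :
    simplexDiff (formSign R B n x) = -formSign R B n (simplexDiff x) := by
  induction x using formOp_induction with
  | zero => simp only [map_zero, neg_zero]
  | add x y hx hy => simp only [map_add, hx, hy, neg_add]
  | pure P η =>
    rw [formSign_pureOp, simplexDiff_pureOp, simplexDiff_pureOp, formSign_pureOp, inv_deRham,
      pureOp_neg]
    simp only [mul_assoc]

theorem seriesSign_seriesSign (x : QSeries R B n) : seriesSign R B n (seriesSign R B n x) = x := by
  ext i; exact formSign_formSign _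

theorem seriesDiff_seriesSign (x : QSeries R B n) :
    seriesDiff R B n (seriesSign R B n x) = -seriesSign R B n (seriesDiff R B n x) := by
  ext i; exact simplexDiff_formSign _

theorem seriesDiff_mul (x y : QSeries R B n) :
    seriesDiff R B n (x * y) = seriesDiff R B n x * y + seriesSign R B n x * seriesDiff R B n y := by
  ext i
  obtain ⟨N, hx, hy⟩ := exists_lower_bound₂ x y
  have h1 : ∀ i < N, (seriesDiff R B n x).coeff i = 0 := fun i hi => by
    rw [coeff_seriesDiff, hx i hi, map_zero]
  have h2 : ∀ i < N, (seriesDiff R B n y).coeff i = 0 := fun i hi => by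
    rw [coeff_seriesDiff, hy i hi, map_zero]
  have h3 : ∀ i < N, (seriesSign R B n x).coeff i = 0 := fun i hi => by
    rw [coeff_seriesSign, hx i hi, map_zero]
  rw [HahnSeries.coeff_add, coeff_seriesDiff, coeff_mul_eq_sum hx hy, coeff_mul_eq_sum h1 hy,
    coeff_mul_eq_sum h3 h2, map_sum, ← Finset.sum_add_distrib]
  exact Finset.sum_congr rfl fun a _ => simplexDiff_mul _ _

theorem seriesDiff_seriesDiff (x : QSeries R B n) : seriesDiff R B n (seriesDiff R B n x) = 0 := by
  ext i; exact simplexDiff_simplexDiff _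

theorem hbarLin_mul (x y : QSeries R B n) :
    hbarLin R B n (x * y) = hbarLin R B n x * y + x * hbarLin R B n y := by
  ext i
  obtain ⟨N, hx, hy⟩ := exists_lower_bound₂ x y
  have h1 : ∀ i < N, (hbarLin R B n x).coeff i = 0 := fun i hi => by
    rw [coeff_hbarLin, hx i hi, smul_zero]
  have h2 : ∀ i < N, (hbarLin R B n y).coeff i = 0 := fun i hi => by
    rw [coeff_hbarLin, hy i hi, smul_zero]
  rw [HahnSeries.coeff_add, coeff_hbarLin, coeff_mul_eq_sum hx hy, coeff_mul_eq_sum h1 hy,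
    coeff_mul_eq_sum hx h2, Finset.smul_sum, ← Finset.sum_add_distrib]
  refine Finset.sum_congr rfl fun a _ => ?_
  rw [coeff_hbarLin, coeff_hbarLin, smul_mul_assoc, mul_smul_comm, ← add_smul, add_sub_cancel]

theorem hbarLin_seriesDiff (x : QSeries R B n) :
    hbarLin R B n (seriesDiff R B n x) = seriesDiff R B n (hbarLin R B n x) := by
  ext i; exact (map_zsmul simplexDiff i (x.coeff i)).symm

theorem seriesDiff_term (i : ℤ) (P : Op R B) : seriesDiff R B n (term i P) = 0 := by
  ext a
  rw [coeff_seriesDiff, coeff_term]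
  split_ifs
  · rw [simplexDiff_const]; rfl
  · rw [map_zero]; rfl

theorem seriesSign_term (i : ℤ) {j : ℤ} {P : Op R B} (hP : Raises (B := B) j P) :
    seriesSign R B n (term i P) = j.negOnePow • term i P := by
  ext a
  rw [coeff_seriesSign, coeff_units_smul, coeff_term]
  split_ifs
  · rw [formSign_pureOp, map_one, units_smul_pureOp, ← mul_assoc, hP.parity_mul, smul_mul_assoc,
      mul_assoc, parity_mul_parity, mul_one]
  · rw [map_zero, smul_zero]

theorem hbarLin_term (i : ℤ) (P : Op R B) :
    hbarLin R B n (term i P) = i • term i P := by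
  ext a
  rw [coeff_hbarLin]
  change _ = i • (term i P : QSeries R B n).coeff a
  rw [coeff_term]
  split_ifs with h
  · rw [h]
  · rw [smul_zero, smul_zero]

end SeriesOps

/-- The commutator of a twisted differential with a contraction. -/
theorem contraction_identity {S : Type*} [Ring S] (σ δ : S →+ S)
    (hσ : ∀ x y, σ (x * y) = σ x * σ y) (hδ : ∀ x y, δ (x * y) = δ x * y + σ x * δ y)
    (hσσ : ∀ x, σ (σ x) = x) (hδσ : ∀ x, δ (σ x) = -σ (δ x)) {Q γ ι : S} (hQ : σ Q = -Q)
    (hγ : σ γ = γ) (hι : σ ι = -ι) (hγ' : δ γ = 0) (hι' : δ ι = 0) (x : S) :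
    (Q * (ι * (γ * x - x * γ) + σ (γ * x - x * γ) * ι) -
        σ (ι * (γ * x - x * γ) + σ (γ * x - x * γ) * ι) * Q +
        δ (ι * (γ * x - x * γ) + σ (γ * x - x * γ) * ι)) +
      (ι * (γ * (Q * x - σ x * Q + δ x) - (Q * x - σ x * Q + δ x) * γ) +
        σ (γ * (Q * x - σ x * Q + δ x) - (Q * x - σ x * Q + δ x) * γ) * ι) =
    (Q * ι + ι * Q) * (γ * x - x * γ) + (γ * x - x * γ) * (Q * ι + ι * Q) -
      ι * ((Q * γ - γ * Q) * x - σ x * (Q * γ - γ * Q)) -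
      σ ((Q * γ - γ * Q) * x - σ x * (Q * γ - γ * Q)) * ι := by
  simp only [map_add, map_sub, hσ, hδ, hσσ, hδσ, hQ, hγ, hι, hγ', hι', mul_add, add_mul, mul_sub,
    sub_mul, neg_mul, mul_neg, mul_assoc, mul_zero, zero_mul]
  abel

end DCrit

end

noncomputable section

namespace DCrit

/-! ## The Maurer--Cartan data of an affine chart -/

/-! ### The self-dual filtration and the contraction -/

section Filtration

variable {R : Type u} [CommRing R] {B : Type v} [CommRing B] [Algebra R B] {m n : ℕ}

variable (R B) in
/-- Self-dual coefficients of `ħ^i` which are of order at most `k`. -/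
def selfDualSub (m : ℕ) (i k j : ℤ) : Submodule R (Op R B) where
  carrier := {P | P ∈ SelfDualCoeff m i j ∧ P ∈ DX k j}
  add_mem' := fun {P Q} h h' => ⟨⟨OrdLT.add h.1.1 h'.1.1, by
    rw [smul_add]; exact h.1.2.add h'.1.2⟩, OrdLT.add h.2 h'.2⟩
  zero_mem' := ⟨⟨OrdLT.zero _ _, by rw [smul_zero]; exact IsTranspose.zero j⟩, OrdLT.zero _ _⟩
  smul_mem' r P h := ⟨⟨OrdLT.smul h.1.1 r, by rw [smul_comm]; exact h.1.2.smul r⟩, OrdLT.smul h.2 r⟩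

theorem raises_of_mem_selfDualSub {i k j : ℤ} {P : Op R B} (h : P ∈ selfDualSub R B m i k j) :
    Raises (B := B) j P := OrdLT.raises h.2

variable (R B n) in
/-- The filtration of the self-dual part of `∏ ħ^i F_{i+1} D_X(L) ⊗ Ω(Δ^n)`, in degree `J`. -/
def filt (m k : ℕ) (J : ℤ) : Submodule R (QSeries R B n) where
  carrier := {x | ∀ i, x.coeff i ∈ tens (selfDualSub R B m i (i + 1 - k)) J}
  add_mem' h h' i := add_mem (h i) (h' i)
  zero_mem' _ := zero_mem _
  smul_mem' r _ h i := Submodule.smul_mem _ r (h i)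

variable {k l : ℕ} {J J' : ℤ}

theorem term_mem_filt {i : ℤ} {P : Op R B} (h : P ∈ selfDualSub R B m i (i + 1 - k) J) :
    (term i P : QSeries R B n) ∈ filt R B n m k J := fun a => by
  rw [coeff_term]
  split_ifs with ha
  · subst ha; exact pureOp_one_mem h
  · exact zero_mem _

theorem seriesSign_filt {x : QSeries R B n} (hx : x ∈ filt R B n m k J) :
    seriesSign R B n x = J.negOnePow • x := by
  ext i
  rw [coeff_seriesSign, coeff_units_smul]
  exact formSign_of_mem (fun j P hP => raises_of_mem_selfDualSub hP) (hx i)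

theorem filt_mono {x : QSeries R B n} (h : k ≤ l) (hx : x ∈ filt R B n m l J) :
    x ∈ filt R B n m k J := fun i =>
  tens_mono (fun j P (hP : P ∈ selfDualSub R B m i (i + 1 - l) j) =>
    show P ∈ selfDualSub R B m i (i + 1 - k) j from ⟨hP.1, OrdLT.mono hP.2 (by omega)⟩) (hx i)

theorem seriesDiff_filt {x : QSeries R B n} (hx : x ∈ filt R B n m k J) :
    seriesDiff R B n x ∈ filt R B n m k (J + 1) := fun i =>
  simplexDiff_mem (fun _ _ hP => raises_of_mem_selfDualSub hP) (hx i)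

theorem hbarLin_filt {x : QSeries R B n} (hx : x ∈ filt R B n m k J) :
    hbarLin R B n x ∈ filt R B n m k J := fun i => by
  rw [coeff_hbarLin]; exact zsmul_mem (hx i) i

theorem mulOp_mem_selfDual (b : B) : mulOp (R := R) b ∈ selfDualSub R B m (-1) (-1 + 1 - (0 : ℕ)) 0 :=
  have h : OrdLT 1 0 (mulOp (R := R) b) := ordLT_mulOp b
  ⟨⟨h, by simpa using (adjoint_mulOp b).isTranspose⟩, h⟩

theorem koszul_mem_selfDual (b : B) : koszul (R := R) b ∈ selfDualSub R B m 0 (0 + 1 - (0 : ℕ)) 1 :=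
  have h : OrdLT 2 1 (koszul (R := R) b) := ordLT_koszul b
  ⟨⟨h, by simpa using isTranspose_koszul b⟩, h⟩

theorem deRham_mem_selfDual : deRham R B ∈ selfDualSub R B m 1 (1 + 1 - (0 : ℕ)) 1 :=
  have h : OrdLT 3 1 (deRham R B) := ordLT_deRham
  ⟨⟨h, by
    rw [Int.negOnePow_even (1 + 1) ⟨1, rfl⟩, one_smul]; exact isTranspose_deRham⟩, h⟩

theorem filt_separated {x : QSeries R B n} (hx : ∀ k, x ∈ filt R B n m (k + 2) J) : x = 0 := by
  ext i
  refine tens_eq_bot (fun j P hP => ?_) (hx i.toNat i)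
  have h : OrdLT _ j P := hP.2
  rwa [show (i + 1 - ((i.toNat + 2 : ℕ) : ℤ) + 1).toNat = 0 by omega] at h

/-- For these i the order bound i + 1 - k is negative, and only zero has negative order. -/
theorem coeff_eq_zero_of_filt {x : QSeries R B n} (hx : x ∈ filt R B n m k J) {i : ℤ}
    (hi : i + 2 ≤ k) : x.coeff i = 0 :=
  tens_eq_bot (fun j P hP => by
    have h : OrdLT _ j P := hP.2
    rwa [show (i + 1 - (k : ℤ) + 1).toNat = 0 by omega] at h) (hx i)

/-- The coefficient of ħ^i is constant from the stage `i.toNat` on, because elements of 𝔤_{k+2} have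
no coefficients with i ≤ k. The limit takes each coefficient at that stage. -/
theorem filt_complete (x : ℕ → QSeries R B n) (hx : ∀ k, x (k + 1) - x k ∈ filt R B n m (k + 2) J) :
    ∃ y, ∀ k, y - x k ∈ filt R B n m (k + 2) J := by
  have h1 : ∀ a b, a ≤ b → x b - x a ∈ filt R B n m (a + 2) J := by
    intro a b hab
    induction b, hab using Nat.le_induction with
    | base => rw [sub_self]; exact zero_mem _
    | succ b hab ih =>
      rw [← sub_add_sub_cancel]
      exact add_mem (filt_mono (by omega) (hx b)) ih
  have hbdd : BddBelow (Function.support fun i : ℤ => (x i.toNat).coeff i) := by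
    obtain ⟨N, hN⟩ := exists_lower_bound (x 0)
    refine ⟨min N 0, fun i hi => ?_⟩
    by_contra hlt
    rw [not_le, lt_min_iff] at hlt
    refine hi ?_
    change (x i.toNat).coeff i = 0
    rw [show i.toNat = 0 by omega]
    exact hN i hlt.1
  refine ⟨HahnSeries.ofSuppBddBelow _ hbdd, fun k i => ?_⟩
  rw [HahnSeries.coeff_sub, HahnSeries.coeff_ofSuppBddBelow]
  rcases le_total k i.toNat with h | h
  · exact h1 _ _ h i
  · have h2 := coeff_eq_zero_of_filt (i := i) (h1 _ _ h) (by push_cast; omega)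
    rw [HahnSeries.coeff_sub, sub_eq_zero] at h2
    rw [← h2, sub_self]
    exact zero_mem _

variable [Algebra ℚ R]

/-- Graded commutators respect the self-duality condition. -/
theorem IsTranspose.gComm (F : Frame R B m) {a b i j : ℤ} {k l : ℕ} {P P' : Op R B}
    (hP : OrdLT k i P) (hP' : OrdLT l j P') (h : IsTranspose m i P ((a + 1).negOnePow • P))
    (h' : IsTranspose m j P' ((b + 1).negOnePow • P')) :
    IsTranspose m (i + j) (DCrit.gComm i j P P')
      ((a + b + 1).negOnePow • DCrit.gComm i j P P') := by
  have h1 := h.mul F h' (hP.units_smul _).raises hP'.raises hP'.base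
  have h2 := (h'.mul F h (hP'.units_smul _).raises hP.raises hP.base).congr (add_comm j i)
  have h3 := h1.sub (h2.units_smul (i * j).negOnePow)
  have e : (i * j).negOnePow • ((b + 1).negOnePow • P' * (a + 1).negOnePow • P) -
      (i * j).negOnePow • (j * i).negOnePow • ((a + 1).negOnePow • P * (b + 1).negOnePow • P') =
      (a + b + 1).negOnePow • DCrit.gComm i j P P' := by
    rw [mul_comm j i, negOnePow_smul_smul, DCrit.gComm]
    simp only [smul_mul_assoc, mul_smul_comm, smul_smul]
    simp only [smul_sub, smul_smul, ← Int.negOnePow_add]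
    rw [show ((i * j + (a + 1 + (b + 1))).negOnePow : ℤˣ) = -(a + b + 1 + i * j).negOnePow by
        rw [← Int.negOnePow_succ, Int.negOnePow_eq_iff]; exact ⟨0, by ring⟩,
      show ((b + 1 + (a + 1)).negOnePow : ℤˣ) = -(a + b + 1).negOnePow by
        rw [← Int.negOnePow_succ, Int.negOnePow_eq_iff]; exact ⟨0, by ring⟩]
    simp only [Units.neg_smul]
    abel
  rw [← e]
  exact h3

/-- The commutator loses one order, which matches the shift in the bounds a + 1 - k and b + 1 - l,
so the filtration is multiplicative for brackets. Its transpose sign is the one required at ħ^{a+b}.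
-/
theorem selfDualSub_gComm (F : Frame R B m) {a b j j' : ℤ} {k l : ℕ} {P P' : Op R B}
    (h : P ∈ selfDualSub R B m a (a + 1 - k) j) (h' : P' ∈ selfDualSub R B m b (b + 1 - l) j') :
    gComm j j' P P' ∈ selfDualSub R B m (a + b) (a + b + 1 - (k + l : ℕ)) (j + j') := by
  have h0 := h.1.2.gComm F h.1.1 h'.1.1 h'.1.2
  have key : ∀ c d : ℤ, P ∈ DX c j → P' ∈ DX d j' → gComm j j' P P' ∈ DX (c + d - 1) (j + j') := by
    intro c d hc hd
    rcases lt_or_ge c 0 with hc0 | hc0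
    · have e : P = 0 := by
        change OrdLT (c + 1).toNat j P at hc
        rwa [show (c + 1).toNat = 0 by omega] at hc
      rw [e, gComm_zero_left]; exact OrdLT.zero _ _
    rcases lt_or_ge d 0 with hd0 | hd0
    · have e : P' = 0 := by
        change OrdLT (d + 1).toNat j' P' at hd
        rwa [show (d + 1).toNat = 0 by omega] at hd
      rw [e, gComm_zero_right]; exact OrdLT.zero _ _
    obtain ⟨c, rfl⟩ := Int.eq_ofNat_of_zero_le hc0
    obtain ⟨d, rfl⟩ := Int.eq_ofNat_of_zero_le hd0
    have := OrdLT.gComm F (k := c) (l := d) hc hd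
    change OrdLT _ _ _
    exact OrdLT.mono this (by omega)
  refine ⟨⟨?_, h0⟩, ?_⟩
  · have := key _ _ h.1.1 h'.1.1
    rwa [show a + 1 + (b + 1) - 1 = a + b + 1 by ring] at this
  · have := key _ _ h.2 h'.2
    rwa [show a + 1 - k + (b + 1 - l) - 1 = a + b + 1 - (k + l : ℕ) by push_cast; ring] at this

/-- This is the combination with the sign opposite to the graded commutator. Transposition exchanges
its two terms, so the contraction preserves self-duality; as ι_v has order zero, the order does not
grow. -/
theorem selfDualSub_iota (F : Frame R B m) (v : Derivation R B B) {i k j : ℤ} {P : Op R B}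
    (h : P ∈ selfDualSub R B m i k j) :
    iota v * P + j.negOnePow • (P * iota v) ∈ selfDualSub R B m i k (j - 1) := by
  have key : ∀ c : ℤ, P ∈ DX c j → iota v * P + j.negOnePow • (P * iota v) ∈ DX c (j - 1) := by
    intro c hc
    rcases lt_or_ge c 0 with hc0 | hc0
    · have e : P = 0 := by
        change OrdLT (c + 1).toNat j P at hc
        rwa [show (c + 1).toNat = 0 by omega] at hc
      rw [e, mul_zero, zero_mul, smul_zero, add_zero]; exact OrdLT.zero _ _
    obtain ⟨c, rfl⟩ := Int.eq_ofNat_of_zero_le hc0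
    change OrdLT (c + 1) j P at hc
    change OrdLT (c + 1) (j - 1) _
    have h1 := OrdLT.mul (ordLT_iota v) hc
    have h2 := OrdLT.mul hc (ordLT_iota v)
    rw [zero_add] at h1
    exact (h1.congr (by ring)).add ((h2.congr (by ring)).units_smul _)
  refine ⟨⟨key _ h.1.1, ?_⟩, key _ h.2⟩
  have hP := h.1.2
  have h1 := (isTranspose_iota F v).mul F hP (raises_iota v) h.1.1.raises (OrdLT.base h.1.1)
  have h2 := hP.mul F (isTranspose_iota F v) (OrdLT.units_smul h.1.1 _).raises (raises_iota v)
    (ordLT_iota v).base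
  have h3 := (h1.congr (by ring : -1 + j = j - 1)).add
    ((h2.congr (by ring : j + -1 = j - 1)).units_smul j.negOnePow)
  convert h3 using 1
  rw [mul_neg_one, neg_one_mul, Int.negOnePow_neg, negOnePow_smul_smul, smul_mul_assoc,
    mul_smul_comm, smul_add, smul_comm, add_comm]

theorem filt_bracket (F : Frame R B m) {x y : QSeries R B n} (hx : x ∈ filt R B n m k J)
    (hy : y ∈ filt R B n m l J') :
    x * y - (J * J').negOnePow • (y * x) ∈ filt R B n m (k + l) (J + J') := fun i => by
  obtain ⟨N, h1, h2⟩ := exists_lower_bound₂ x y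
  rw [HahnSeries.coeff_sub, coeff_units_smul, coeff_mul_eq_sum h1 h2, coeff_mul_eq_sum' h2 h1,
    Finset.smul_sum, ← Finset.sum_sub_distrib]
  refine Submodule.sum_mem _ fun a _ => ?_
  refine tens_gComm (fun j P hP => raises_of_mem_selfDualSub hP)
    (fun j P hP => raises_of_mem_selfDualSub hP) (fun j j' P hP P' hP' => ?_) (hx a) (hy (i - a))
  have := selfDualSub_gComm F hP hP'
  rwa [add_sub_cancel] at this

theorem weightOp_mem_selfDual : weightOp B m ∈ selfDualSub R B m 0 (0 + 1 - (0 : ℕ)) 0 :=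
  have h : OrdLT 2 0 (weightOp (R := R) B m) := ordLT_weightOp
  ⟨⟨h, by simpa using isTranspose_weightOp⟩, h⟩

/-- The contraction of the Maurer--Cartan data given by a frame. -/
def contraction (F : Frame R B m) : QSeries R B n →ₗ[R] QSeries R B n :=
  -half R • ∑ i, (LinearMap.mulLeft R (term 0 (iota (F.v i))) +
    LinearMap.mulRight R (term 0 (iota (F.v i))) ∘ₗ seriesSign R B n) ∘ₗ
    (LinearMap.mulLeft R (term (-1) (mulOp (F.g i))) -
      LinearMap.mulRight R (term (-1) (mulOp (F.g i))))

theorem contraction_apply (F : Frame R B m) (x : QSeries R B n) :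
    contraction F x = -(half R • ∑ i, (term 0 (iota (F.v i)) *
        (term (-1) (mulOp (F.g i)) * x - x * term (-1) (mulOp (F.g i))) +
      seriesSign R B n (term (-1) (mulOp (F.g i)) * x - x * term (-1) (mulOp (F.g i))) *
        term 0 (iota (F.v i)))) := by
  rw [contraction, LinearMap.smul_apply, LinearMap.sum_apply, neg_smul]
  rfl

theorem filt_mulOp (F : Frame R B m) (b : B) {x : QSeries R B n} (hx : x ∈ filt R B n m k J) :
    term (-1) (mulOp b) * x - x * term (-1) (mulOp b) ∈ filt R B n m k J := by
  have := filt_bracket F (term_mem_filt (n := n) (mulOp_mem_selfDual b)) hx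
  rwa [zero_mul, Int.negOnePow_zero, one_smul, zero_add, zero_add] at this

theorem contraction_filt (F : Frame R B m) {x : QSeries R B n} (hx : x ∈ filt R B n m k J) :
    contraction F x ∈ filt R B n m k (J - 1) := by
  rw [contraction_apply]
  refine neg_mem (Submodule.smul_mem _ _ (Submodule.sum_mem _ fun a _ => ?_))
  have hy := filt_mulOp F (F.g a) hx
  rw [seriesSign_filt hy]
  intro i
  rw [smul_mul_assoc, HahnSeries.coeff_add, coeff_units_smul, coeff_term_mul, coeff_mul_term, sub_zero]
  exact tens_odd_anticomm (raises_iota _) (fun j P hP => selfDualSub_iota F _ hP) (hy i)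

end Filtration

/-! ### The explicit solution and the homotopy -/

section Data

variable {R : Type u} [CommRing R] {B : Type v} [CommRing B] [Algebra R B] {m n : ℕ}

/-- The twisted de Rham differential `df + ħ d`. -/
def twisted (f : B) (n : ℕ) : QSeries R B n := term 0 (koszul f) + explicitDelta n

theorem seriesSign_twisted (f : B) : seriesSign R B n (twisted f n) = -twisted f n := by
  rw [twisted, map_add, seriesSign_term 0 (raises_koszul f), explicitDelta,
    seriesSign_term 1 raises_deRham]
  simp [add_comm]

theorem twisted_mul_twisted (f : B) : twisted (R := R) f n * twisted f n = 0 := by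
  simp only [twisted, explicitDelta, add_mul, mul_add, term_mul_term, koszul_sq, deRham_sq, term_zero,
    deRham_mul_koszul, term_neg]
  simp

theorem seriesDiff_twisted (f : B) : seriesDiff R B n (twisted f n) = 0 := by
  rw [twisted, map_add, explicitDelta, seriesDiff_term, seriesDiff_term, add_zero]

theorem twisted_mem (f : B) : twisted f n ∈ filt R B n m 0 1 :=
  add_mem (term_mem_filt (koszul_mem_selfDual f)) (term_mem_filt deRham_mem_selfDual)

variable [Algebra ℚ R]

theorem seriesSign_explicitD (f : B) :
    seriesSign R B n (explicitD m f n) = explicitD m f n := by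
  rw [explicitD, map_sub, seriesSign_term (-1) (raises_mulOp f)]
  change seriesSign R B n (term 0 (weightOp B m)) - _ = _
  rw [seriesSign_term 0 raises_weightOp, Int.negOnePow_zero, one_smul, one_smul]
  rfl

theorem weightOp_comm {j : ℤ} {P : Op R B} (hP : Raises (B := B) j P) :
    weightOp B m * P = P * weightOp B m - j • P := by
  have := gComm_weightOp (m := m) hP
  rw [gComm, zero_mul, Int.negOnePow_zero, one_smul, sub_eq_iff_eq_add] at this
  rw [this]; abel

/-- With N the weight operator, [ħd, N] = ħd and [df, N] = df, while [ħd, -ħ⁻¹f] = -df. The sum is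
ħd. -/
theorem twisted_comm_explicitD (f : B) :
    twisted (R := R) f n * explicitD m f n - explicitD m f n * twisted f n =
      hbarLin R B n (twisted f n) := by
  have e : explicitD m f n = term 0 (weightOp (R := R) B m) - term (-1) (mulOp f) := rfl
  rw [e, twisted, explicitDelta, map_add, hbarLin_term, hbarLin_term]
  simp only [add_mul, mul_add, mul_sub, sub_mul, term_mul_term, weightOp_comm raises_deRham,
    weightOp_comm (raises_koszul f), deRham_mul_mulOp, koszul_mul_mulOp, term_sub, term_add]
  simp only [one_smul, zero_smul]
  norm_num
  abel

theorem explicitD_mem (f : B) : explicitD m f n ∈ filt R B n m 0 0 :=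
  sub_mem (term_mem_filt weightOp_mem_selfDual) (term_mem_filt (mulOp_mem_selfDual f))

theorem seriesDiff_explicitD (f : B) : seriesDiff R B n (explicitD m f n) = 0 := by
  rw [explicitD, map_sub, seriesDiff_term, seriesDiff_term, sub_zero]

/-- The commutator with the twisted differential turns ι_{v_i} into v_i(f) + ħL_{v_i}, and ħ⁻¹g_i
into dg_i. It remains to insert these in `contraction_identity`. -/
theorem contraction_homotopy (F : Frame R B m) (f : B) (x : QSeries R B n) :
    (twisted f n * contraction F x - seriesSign R B n (contraction F x) * twisted f n +
        seriesDiff R B n (contraction F x)) +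
      contraction F (twisted f n * x - seriesSign R B n x * twisted f n + seriesDiff R B n x) =
    -(half R • ∑ i, ((term 0 (mulOp (F.v i f)) + term 1 (lieOp (F.v i))) *
        (term (-1) (mulOp (F.g i)) * x - x * term (-1) (mulOp (F.g i))) +
      (term (-1) (mulOp (F.g i)) * x - x * term (-1) (mulOp (F.g i))) *
        (term 0 (mulOp (F.v i f)) + term 1 (lieOp (F.v i))) -
      term 0 (iota (F.v i)) * (term 0 (koszul (F.g i)) * x -
        seriesSign R B n x * term 0 (koszul (F.g i))) -
      seriesSign R B n (term 0 (koszul (F.g i)) * x - seriesSign R B n x * term 0 (koszul (F.g i))) *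
        term 0 (iota (F.v i)))) := by
  have h1 : ∀ i, twisted f n * term 0 (iota (F.v i)) + term 0 (iota (F.v i)) * twisted f n =
      term 0 (mulOp (F.v i f)) + term 1 (lieOp (F.v i)) := fun i => by
    simp only [twisted, explicitDelta, add_mul, mul_add, term_mul_term, iota_mul_koszul, lieOp,
      term_add, term_sub]
    norm_num
    abel
  have h2 : ∀ i, twisted f n * term (-1) (mulOp (F.g i)) - term (-1) (mulOp (F.g i)) * twisted f n =
      (term 0 (koszul (F.g i)) : QSeries R B n) := fun i => by
    simp only [twisted, explicitDelta, add_mul, mul_add, term_mul_term, deRham_mul_mulOp,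
      koszul_mul_mulOp, term_add]
    norm_num
  rw [contraction_apply, contraction_apply, map_neg, map_neg, map_smul, map_smul, map_sum, map_sum,
    mul_neg, neg_mul, mul_smul_comm, smul_mul_assoc, Finset.mul_sum, Finset.sum_mul]
  rw [show ∀ a b c d : QSeries R B n, -(half R • a) - -(half R • b) + -(half R • c) +
    -(half R • d) = -(half R • (a - b + c + d)) from fun a b c d => by
      simp only [smul_add, smul_sub]; abel]
  rw [← Finset.sum_sub_distrib, ← Finset.sum_add_distrib, ← Finset.sum_add_distrib]
  congr 2
  refine Finset.sum_congr rfl fun i _ => ?_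
  have := contraction_identity (seriesSign R B n).toAddMonoidHom (seriesDiff R B n).toAddMonoidHom
    seriesSign_mul seriesDiff_mul seriesSign_seriesSign seriesDiff_seriesSign
    (seriesSign_twisted f) (γ := term (-1) (mulOp (F.g i)))
    (by simpa using seriesSign_term (-1) (raises_mulOp (F.g i)))
    (ι := term 0 (iota (F.v i))) (by simpa using seriesSign_term 0 (raises_iota (F.v i)))
    (seriesDiff_term _ _) (seriesDiff_term _ _) x
  rw [h1, h2] at this
  exact this

/-- The crucial eigenvalue computation. Self-duality and order i + 1 - k follow because every
ingredient preserves 𝔤_k; the drop by one more order is read off coefficient by coefficient. -/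
theorem contraction_euler (F : Frame R B m) (f : B) {k : ℕ} {J : ℤ} {x : QSeries R B n}
    (hx : x ∈ filt R B n m k J) :
    hbarLin R B n x + (explicitD m f n * x - x * explicitD m f n) -
        (twisted f n * contraction F x - seriesSign R B n (contraction F x) * twisted f n +
          seriesDiff R B n (contraction F x)) -
        contraction F (twisted f n * x - seriesSign R B n x * twisted f n + seriesDiff R B n x) -
      ((k : R) - 1) • x ∈ filt R B n m (k + 1) J := by
  have hd : ∀ {J : ℤ} {z : QSeries R B n}, z ∈ filt R B n m k J →
      twisted f n * z - seriesSign R B n z * twisted f n + seriesDiff R B n z ∈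
        filt R B n m k (J + 1) := fun {J z} hz => by
    have := filt_bracket F (twisted_mem f) hz
    rw [one_mul, zero_add, add_comm] at this
    rw [seriesSign_filt hz, smul_mul_assoc]
    exact add_mem this (seriesDiff_filt hz)
  have hmem : hbarLin R B n x + (explicitD m f n * x - x * explicitD m f n) -
        (twisted f n * contraction F x - seriesSign R B n (contraction F x) * twisted f n +
          seriesDiff R B n (contraction F x)) -
        contraction F (twisted f n * x - seriesSign R B n x * twisted f n + seriesDiff R B n x) -
      ((k : R) - 1) • x ∈ filt R B n m k J := by
    refine sub_mem (sub_mem (sub_mem (add_mem (hbarLin_filt hx) ?_) ?_) ?_) (Submodule.smul_mem _ _ hx)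
    · have := filt_bracket F (explicitD_mem f) hx
      rwa [zero_mul, Int.negOnePow_zero, one_smul, zero_add, zero_add] at this
    · have := hd (contraction_filt F hx)
      rwa [sub_add_cancel] at this
    · have := contraction_filt F (hd hx)
      rwa [add_sub_cancel_right] at this
  intro a
  have hdx : ∀ b : ℤ, x.coeff b ∈ tens (dxSub R B (b + 1 - k)) J := fun b =>
    tens_mono (fun j P hP => hP.2) (hx b)
  have e1 := tens_approx_euler F (a := a) (k := k) rfl (hdx a)
  -- The terms involving f carry ħ⁻¹, so the coefficient of ħ^{a+1} enters here. It has order one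
  -- higher, and this is compensated by the stronger cancellation.
  have e2 := tens_approx_function F f (hdx (a + 1))
  rw [show a + 1 + 1 - (k : ℤ) - 2 = a + 1 - k - 1 by ring] at e2
  have e3 := add_mem e1 e2
  refine tens_of_forall (V := selfDualSub R B m a (a + 1 - k)) (V' := dxSub R B (a + 1 - k - 1))
    (W := selfDualSub R B m a (a + 1 - (k + 1 : ℕ))) (fun j P h h' => ⟨h.1, ?_⟩) (hmem a) ?_
  · change P ∈ dxSub R B (a + 1 - (k + 1 : ℕ)) j
    rw [Nat.cast_succ, ← sub_sub]; exact h'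
  · have hκ : ∀ i, term 0 (koszul (F.g i)) * x - J.negOnePow • (x * term 0 (koszul (F.g i))) ∈
        filt R B n m k (J + 1) := fun i => by
      have := filt_bracket F (term_mem_filt (n := n) (koszul_mem_selfDual (F.g i))) hx
      rwa [one_mul, zero_add, add_comm] at this
    rw [sub_sub _ (_ + _) (contraction F _), contraction_homotopy, seriesSign_filt hx]
    simp only [smul_mul_assoc, seriesSign_filt (hκ _)]
    have e : explicitD m f n = term 0 (weightOp (R := R) B m) - term (-1) (mulOp f) := rfl
    rw [e]
    convert e3 using 1
    simp only [HahnSeries.coeff_sub, HahnSeries.coeff_add, HahnSeries.coeff_smul,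
      HahnSeries.coeff_sum, coeff_hbarLin, add_mul, sub_mul, mul_add, mul_sub, coeff_term_mul,
      coeff_mul_term, sub_zero, sub_neg_eq_add, sub_add_cancel]
    simp only [Finset.sum_add_distrib, Finset.sum_sub_distrib, smul_add, smul_sub]
    abel

/-- The Maurer--Cartan data of an affine chart. -/
def quantData (F : Frame R B m) (f : B) (n : ℕ) : MCData R (QSeries R B n) where
  σ := seriesSign R B n
  der := seriesDiff R B n
  E := hbarLin R B n
  h := contraction F
  Q := twisted f n
  D := explicitD m f n
  𝔤 := filt R B n m
  der_mul := seriesDiff_mul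
  der_der := seriesDiff_seriesDiff
  E_mul := hbarLin_mul
  E_der := hbarLin_seriesDiff
  σ_Q := seriesSign_twisted f
  der_Q := seriesDiff_twisted f
  Q_mul_Q := twisted_mul_twisted f
  σ_D := seriesSign_explicitD f
  der_D := seriesDiff_explicitD f
  comm_Q_D := twisted_comm_explicitD f
  σ_eq _ _ _ hx := seriesSign_filt hx
  mono _ _ _ hx := filt_mono (Nat.le_succ _) hx
  bracket _ _ _ _ _ hx _ hy := filt_bracket F hx hy
  der_mem _ _ _ hx := seriesDiff_filt hx
  h_mem _ _ _ hx := contraction_filt F hx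
  Q_mem := twisted_mem f
  euler _ _ _ hx := contraction_euler F f hx
  separated _ _ hx := filt_separated hx
  complete _ x hx := filt_complete x hx

end Data

end DCrit

end

noncomputable section

namespace DCrit

/-! ## Filling of boundaries over an affine chart -/

/-! ### Quantisations as Maurer--Cartan elements -/

section Quantisation

variable {R : Type u} [CommRing R] {B : Type v} [CommRing B] [Algebra R B] {m n k : ℕ}

theorem coeff_mem_tens_selfDual {i J : ℤ} {x : QSeries R B n} (hx : x ∈ filt R B n m k J) :
    x.coeff i ∈ tensorForms (SelfDualCoeff m i) J := tens_mono (fun _ _ hP => hP.1) (hx i)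

theorem tens_selfDual_inter {i l J : ℤ} {x : FormOp R B n}
    (h : x ∈ tensorForms (SelfDualCoeff m i) J) (h' : x ∈ tensorForms (DX l) J) :
    x ∈ tens (selfDualSub R B m i l) J := by
  refine tens_of_forall (V := selfDualSub R B m i (i + 1)) (V' := dxSub R B l)
    (W := selfDualSub R B m i l) (fun j P h h' => ⟨h.1, h'⟩) ?_ h'
  exact tens_mono (fun j P (hP : P ∈ SelfDualCoeff m i j) =>
    show P ∈ selfDualSub R B m i (i + 1) j from ⟨hP, hP.1⟩) h

variable [Algebra ℚ R]

/-- Self-duality forces the order of the coefficients to drop. -/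
theorem filt_two_of_filt_one (F : Frame R B m) {J : ℤ} {x : QSeries R B n}
    (hx : x ∈ filt R B n m 1 J) : x ∈ filt R B n m 2 J := fun i =>
  tens_mono (fun j P (hP : P ∈ selfDualSub R B m i (i + 1 - (1 : ℕ)) j) =>
    show P ∈ selfDualSub R B m i (i + 1 - (2 : ℕ)) j from by
      refine ⟨hP.1, ?_⟩
      have h : OrdLT _ j P := hP.2
      change OrdLT _ j P
      -- For negative i both bounds force the coefficient to vanish. For i = K the order is at most
      -- K, and self-duality prescribes the sign (-1)^{K+1} for the transpose, against (-1)^K for a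
      -- symbol of order K.
      rcases lt_or_ge i 0 with hi | hi
      · rw [show (i + 1 - ((1 : ℕ) : ℤ) + 1).toNat = 0 by omega] at h
        rwa [show (i + 1 - ((2 : ℕ) : ℤ) + 1).toNat = 0 by omega]
      · obtain ⟨K, rfl⟩ := Int.eq_ofNat_of_zero_le hi
        rw [show ((K : ℤ) + 1 - ((1 : ℕ) : ℤ) + 1).toNat = K + 1 by omega] at h
        rw [show ((K : ℤ) + 1 - ((2 : ℕ) : ℤ) + 1).toNat = K by omega]
        exact OrdLT.of_isTranspose F h hP.1.2) (hx i)

theorem isMC_iff (F : Frame R B m) (f : B) (x : QSeries R B n × QSeries R B n) :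
    (quantData F f n).IsMC (x.1 - explicitDelta n) (x.2 - explicitD m f n) ↔
      (term 0 (koszul f) + x.1) * (term 0 (koszul f) + x.1) + x.1.map simplexDiff = 0 ∧
      (term 0 (koszul f) + x.1) * x.2 - x.2 * (term 0 (koszul f) + x.1) +
        x.2.map simplexDiff = hbarDer x.1 := by
  have e1 : twisted f n + (x.1 - explicitDelta n) = term 0 (koszul f) + x.1 := by
    rw [twisted]; abel
  have e2 : explicitD m f n + (x.2 - explicitD m f n) = x.2 := by abel
  have e3 : seriesDiff R B n (term 0 (koszul f) + x.1) = x.1.map simplexDiff := by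
    rw [map_add, seriesDiff_term, zero_add]; rfl
  have e4 : hbarLin R B n (term 0 (koszul f) + x.1) = hbarDer x.1 := by
    rw [map_add, hbarLin_term, zero_smul, zero_add]; rfl
  change (twisted f n + (x.1 - explicitDelta n)) * (twisted f n + (x.1 - explicitDelta n)) +
      seriesDiff R B n (twisted f n + (x.1 - explicitDelta n)) = 0 ∧
    (twisted f n + (x.1 - explicitDelta n)) * (explicitD m f n + (x.2 - explicitD m f n)) -
      (explicitD m f n + (x.2 - explicitD m f n)) * (twisted f n + (x.1 - explicitDelta n)) +
      seriesDiff R B n (explicitD m f n + (x.2 - explicitD m f n)) =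
      hbarLin R B n (twisted f n + (x.1 - explicitDelta n)) ↔ _
  rw [e1, e2, e3, e4]
  rfl

/-- Quantisations are Maurer--Cartan elements which deform the explicit one. -/
theorem isQuantisation_iff (F : Frame R B m) (f : B) (x : QSeries R B n × QSeries R B n) :
    IsQuantisation m f x ↔ x.1 - explicitDelta n ∈ filt R B n m 2 1 ∧
      x.2 - explicitD m f n ∈ filt R B n m 2 0 ∧
      (quantData F f n).IsMC (x.1 - explicitDelta n) (x.2 - explicitD m f n) := by
  have hΔ : (explicitDelta n : QSeries R B n) ∈ filt R B n m 0 1 := term_mem_filt deRham_mem_selfDual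
  have hD := explicitD_mem (R := R) (n := n) (m := m) f
  constructor
  · intro h
    obtain ⟨P, Q, hPQ, h1, h2⟩ := h.classical
    obtain ⟨u1, u2⟩ := hPQ.unique F
    -- The classical condition and the uniqueness of the symbols lower the order by one, which gives
    -- 𝔤_1 only. The second step comes from self-duality.
    refine ⟨filt_two_of_filt_one F fun i => ?_, filt_two_of_filt_one F fun i => ?_,
      (isMC_iff F f x).2 ⟨h.square_zero, h.connection⟩⟩
    · have e : x.1 - explicitDelta n = (x.1 - term 1 P) + term 1 (P - deRham R B) := by
        rw [term_sub]; simp only [explicitDelta]; abel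
      refine tens_selfDual_inter ?_ ?_
      · exact sub_mem (h.coeff_fst i).2 (coeff_mem_tens_selfDual hΔ)
      · rw [Nat.cast_one, add_sub_cancel_right, e]
        refine add_mem (h1 i) ?_
        rw [coeff_term]
        split_ifs with hi
        · subst hi; exact pureOp_one_mem u1
        · exact zero_mem _
    · have e : x.2 - explicitD m f n = (x.2 - (term 0 Q - term (-1) (mulOp f))) +
          term 0 (Q - weightOp B m) := by
        rw [term_sub]; simp only [explicitD, weightOp]; abel
      refine tens_selfDual_inter ?_ ?_
      · exact sub_mem (h.coeff_snd i) (coeff_mem_tens_selfDual hD)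
      · rw [Nat.cast_one, add_sub_cancel_right, e]
        refine add_mem (h2 i) ?_
        rw [coeff_term]
        split_ifs with hi
        · subst hi; exact pureOp_one_mem u2
        · exact zero_mem _
  · rintro ⟨h1, h2, h3⟩
    have h4 := (isMC_iff F f x).1 h3
    refine ⟨fun i => ⟨fun hi => ?_, ?_⟩, fun i => ?_, h4.1, h4.2,
      deRham R B, weightOp B m, representsExact_deRham F, fun i => ?_, fun i => ?_⟩
    -- Elements of 𝔤_2 have no coefficients with i ≤ 0, and ħd has none either.
    · have e := coeff_eq_zero_of_filt h1 (i := i) (by push_cast; omega)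
      rw [HahnSeries.coeff_sub, explicitDelta, coeff_term, if_neg (by omega), sub_zero] at e
      exact e
    · have := add_mem (coeff_mem_tens_selfDual (i := i) h1) (coeff_mem_tens_selfDual (i := i) hΔ)
      rwa [HahnSeries.coeff_sub, sub_add_cancel] at this
    · have := add_mem (coeff_mem_tens_selfDual (i := i) h2) (coeff_mem_tens_selfDual (i := i) hD)
      rwa [HahnSeries.coeff_sub, sub_add_cancel] at this
    · exact tens_mono (fun j P (hP : P ∈ selfDualSub R B m i (i + 1 - (2 : ℕ)) j) =>
        OrdLT.mono hP.2 (by omega)) (h1 i)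
    · exact tens_mono (fun j P (hP : P ∈ selfDualSub R B m i (i + 1 - (2 : ℕ)) j) =>
        OrdLT.mono hP.2 (by omega)) (h2 i)

/-- The explicit quantisation. -/
theorem isQuantisation_explicit (F : Frame R B m) (f : B) (n : ℕ) :
    IsQuantisation (R := R) m f (explicitDelta n, explicitD m f n) := by
  rw [isQuantisation_iff F]
  refine ⟨by rw [sub_self]; exact zero_mem _, by rw [sub_self]; exact zero_mem _, ?_⟩
  rw [sub_self, sub_self]
  change (twisted f n + 0) * (twisted f n + 0) + seriesDiff R B n (twisted f n + 0) = 0 ∧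
    (twisted f n + 0) * (explicitD m f n + 0) - (explicitD m f n + 0) * (twisted f n + 0) +
      seriesDiff R B n (explicitD m f n + 0) = hbarLin R B n (twisted f n + 0)
  rw [add_zero, add_zero, twisted_mul_twisted, seriesDiff_twisted, seriesDiff_explicitD, add_zero,
    add_zero, twisted_comm_explicitD]
  exact ⟨rfl, rfl⟩

end Quantisation

/-! ### Restriction of series to faces -/

section Pull

variable {R : Type u} [CommRing R] {B : Type v} [CommRing B] [Algebra R B] {m n k l : ℕ}

variable (R B) in
/-- Restriction of series along a map of simplices. -/
def pullSeries (θ : Fin (k + 1) → Fin (n + 1)) : QSeries R B n →+* QSeries R B k :=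
  seriesMap (pull R B θ).toRingHom

theorem coeff_pullSeries (θ : Fin (k + 1) → Fin (n + 1)) (x : QSeries R B n) (i : ℤ) :
    (pullSeries R B θ x).coeff i = pull R B θ (x.coeff i) := rfl

theorem pullSeries_smul (θ : Fin (k + 1) → Fin (n + 1)) (r : R) (x : QSeries R B n) :
    pullSeries R B θ (r • x) = r • pullSeries R B θ x := by
  ext i; exact (pull R B θ).map_smul_of_tower r (x.coeff i)

theorem pullSeries_id (x : QSeries R B n) : pullSeries R B id x = x := by
  ext i; exact pull_id _

theorem pullSeries_comp (θ : Fin (k + 1) → Fin (n + 1)) (θ' : Fin (l + 1) → Fin (k + 1))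
    (x : QSeries R B n) : pullSeries R B (θ ∘ θ') x = pullSeries R B θ' (pullSeries R B θ x) := by
  ext i; exact pull_comp θ θ' _

theorem pullSeries_term (θ : Fin (k + 1) → Fin (n + 1)) (i : ℤ) (P : Op R B) :
    pullSeries R B θ (term i P) = term i P := by
  ext a
  rw [coeff_pullSeries, coeff_term, coeff_term]
  split_ifs
  · rw [pull_const]
  · rw [map_zero]

theorem pullSeries_seriesDiff (θ : Fin (k + 1) → Fin (n + 1)) (x : QSeries R B n) :
    pullSeries R B θ (seriesDiff R B n x) = seriesDiff R B k (pullSeries R B θ x) := by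
  ext i; exact pull_simplexDiff θ _

theorem pullSeries_seriesSign (θ : Fin (k + 1) → Fin (n + 1)) (x : QSeries R B n) :
    pullSeries R B θ (seriesSign R B n x) = seriesSign R B k (pullSeries R B θ x) := by
  ext i; exact pull_formSign θ _

theorem pullSeries_hbarLin (θ : Fin (k + 1) → Fin (n + 1)) (x : QSeries R B n) :
    pullSeries R B θ (hbarLin R B n x) = hbarLin R B k (pullSeries R B θ x) := by
  ext i; exact map_zsmul (pull R B θ) i _

theorem pullSeries_filt (θ : Fin (k + 1) → Fin (n + 1)) {l : ℕ} {J : ℤ} {x : QSeries R B n}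
    (hx : x ∈ filt R B n m l J) : pullSeries R B θ x ∈ filt R B k m l J := fun i => pull_mem θ (hx i)

theorem pullSeries_explicitDelta (θ : Fin (k + 1) → Fin (n + 1)) :
    pullSeries R B θ (explicitDelta n) = explicitDelta k := pullSeries_term θ _ _

theorem pullSeries_twisted (θ : Fin (k + 1) → Fin (n + 1)) (f : B) :
    pullSeries R B θ (twisted f n) = twisted f k := by
  rw [twisted, map_add, pullSeries_explicitDelta, pullSeries_term, twisted]

variable [Algebra ℚ R]

theorem pullSeries_explicitD (θ : Fin (k + 1) → Fin (n + 1)) (f : B) :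
    pullSeries R B θ (explicitD m f n) = explicitD m f k := by
  rw [explicitD, map_sub, pullSeries_term, pullSeries_term, explicitD]

theorem pullSeries_contraction (F : Frame R B m) (θ : Fin (k + 1) → Fin (n + 1))
    (x : QSeries R B n) :
    pullSeries R B θ (contraction F x) = contraction F (pullSeries R B θ x) := by
  rw [contraction_apply, contraction_apply]
  simp only [map_neg, pullSeries_smul, map_sum, map_add, map_mul, map_sub, pullSeries_seriesSign,
    pullSeries_term]

theorem pullSeries_A (F : Frame R B m) (f : B) (θ : Fin (k + 1) → Fin (n + 1))
    (x : QSeries R B n) :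
    pullSeries R B θ ((quantData F f n).A x) = (quantData F f k).A (pullSeries R B θ x) := by
  simp only [MCData.A, MCData.d, quantData, map_sub, map_add, map_mul, pullSeries_contraction,
    pullSeries_seriesDiff, pullSeries_seriesSign, pullSeries_hbarLin, pullSeries_twisted,
    pullSeries_explicitD]

theorem pullSeries_Φ (F : Frame R B m) (f : B) (θ : Fin (k + 1) → Fin (n + 1))
    (u x : QSeries R B n) :
    pullSeries R B θ ((quantData F f n).Φ u x) =
      (quantData F f k).Φ (pullSeries R B θ u) (pullSeries R B θ x) := by
  simp only [MCData.Φ, MCData.d, quantData, map_sub, map_add, map_mul, pullSeries_contraction,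
    pullSeries_seriesDiff, pullSeries_seriesSign, pullSeries_twisted]

end Pull

/-! ### Filling boundaries of simplices -/

section Fill

variable {R : Type u} [CommRing R] {B : Type v} [CommRing B] [Algebra R B] {m n k : ℕ}

/-- Any choice of coefficients with these order bounds is a Laurent series, since negative orders
force all coefficients below k - 2 to vanish. -/
theorem exists_series {J : ℤ} {c : ℤ → FormOp R B n}
    (hc : ∀ i, c i ∈ tens (selfDualSub R B m i (i + 1 - k)) J) :
    ∃ x ∈ filt R B n m k J, ∀ i, x.coeff i = c i := by
  have hbdd : BddBelow (Function.support c) := by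
    refine ⟨k - 2, fun i hi => ?_⟩
    by_contra hlt
    refine hi (tens_eq_bot (fun j P hP => ?_) (hc i))
    have h : OrdLT _ j P := hP.2
    rwa [show (i + 1 - (k : ℤ) + 1).toNat = 0 by omega] at h
  exact ⟨HahnSeries.ofSuppBddBelow c hbdd, hc, fun i => rfl⟩

/-- Compatible series on the faces of a simplex extend to the simplex. -/
theorem exists_series_extension {J : ℤ} (u : Fin (n + 2) → QSeries R B n)
    (hu : ∀ l, u l ∈ filt R B n m k J)
    (hc : ∀ (i i' : Fin (n + 2)) (k : ℕ) (θ θ' : Fin (k + 1) ↪o Fin (n + 1)),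
      (∀ j, i.succAbove (θ j) = i'.succAbove (θ' j)) →
      pullSeries R B θ (u i) = pullSeries R B θ' (u i')) :
    ∃ x ∈ filt R B (n + 1) m k J, ∀ i : Fin (n + 2), pullSeries R B i.succAbove x = u i := by
  have hext : ∀ i : ℤ, ∃ c : FormOp R B (n + 1), c ∈ tens (selfDualSub R B m i (i + 1 - k)) J ∧
      ∀ l : Fin (n + 2), pull R B l.succAbove c = (u l).coeff i := fun i =>
    exists_extension (fun l => (u l).coeff i) (fun l => hu l i) fun l l' k θ θ' h =>
      congrArg (fun z => HahnSeries.coeff z i) (hc l l' k θ θ' h)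
  choose c hc1 hc2 using hext
  obtain ⟨U, hU, hUc⟩ := exists_series hc1
  refine ⟨U, hU, fun l => ?_⟩
  ext i
  rw [coeff_pullSeries, hUc, hc2]

variable [Algebra ℚ R]

theorem exists_quantData_fixed_point (F : Frame R B m) (f : B) {u : QSeries R B n}
    (hu : u ∈ filt R B n m 2 0) : ∃ x ∈ filt R B n m 2 1,
      (quantData F f n).A x = (quantData F f n).Φ u x ∧
      (quantData F f n).IsMC x (u + contraction F x) := by
  obtain ⟨x, hx, e⟩ := (quantData F f n).exists_fixed_point hu
  exact ⟨x, hx, e, MCData.isMC_of_fixed_point hu hx e⟩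

theorem eq_of_quantData (F : Frame R B m) (f : B) {u x a b : QSeries R B n}
    (hu : u ∈ filt R B n m 2 0) (hx : x ∈ filt R B n m 2 1)
    (e : (quantData F f n).A x = (quantData F f n).Φ u x) (ha : a ∈ filt R B n m 2 1)
    (hb : b ∈ filt R B n m 2 0) (h : (quantData F f n).IsMC a b)
    (hab : u = b - contraction F a) : x = a := by
  subst hab
  exact (quantData F f n).fixed_point_unique hu hx ha e (MCData.IsMC.fixed_point h ha hb)

theorem sub_contraction_filt (F : Frame R B m) {a b : QSeries R B n}
    (ha : a ∈ filt R B n m 2 1) (hb : b ∈ filt R B n m 2 0) :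
    b - contraction F a ∈ filt R B n m 2 0 := by
  have h := contraction_filt F ha
  rw [sub_self] at h
  exact sub_mem hb h

theorem add_contraction_filt (F : Frame R B m) {a b : QSeries R B n}
    (ha : a ∈ filt R B n m 2 1) (hb : b ∈ filt R B n m 2 0) :
    b + contraction F a ∈ filt R B n m 2 0 := by
  have h := contraction_filt F ha
  rw [sub_self] at h
  exact add_mem hb h

/-- Compatible quantisations on the faces of a simplex extend to the simplex. -/
theorem exists_fill (F : Frame R B m) (f : B) (a : Fin (n + 2) → QSeries R B n × QSeries R B n)
    (ha : ∀ l, IsQuantisation m f (a l))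
    (hc : ∀ (i i' : Fin (n + 2)) (k : ℕ) (θ θ' : Fin (k + 1) ↪o Fin (n + 1)),
      (∀ j, i.succAbove (θ j) = i'.succAbove (θ' j)) →
      pullSeries R B θ (a i).1 = pullSeries R B θ' (a i').1 ∧
      pullSeries R B θ (a i).2 = pullSeries R B θ' (a i').2) :
    ∃ x : QSeries R B (n + 1) × QSeries R B (n + 1), IsQuantisation m f x ∧
      ∀ i : Fin (n + 2), pullSeries R B i.succAbove x.1 = (a i).1 ∧
        pullSeries R B i.succAbove x.2 = (a i).2 := by
  have ha' : ∀ l, ((a l).1 - explicitDelta n ∈ filt R B n m 2 1 ∧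
      (a l).2 - explicitD m f n ∈ filt R B n m 2 0) ∧
      (quantData F f n).IsMC ((a l).1 - explicitDelta n) ((a l).2 - explicitD m f n) := fun l =>
    and_assoc.2 ((isQuantisation_iff F f (a l)).1 (ha l))
  -- The coordinate u = y - h(x) is free of equations, so the prescribed values on the faces can be
  -- extended linearly.
  obtain ⟨u, hu'⟩ : ∃ u : Fin (n + 2) → QSeries R B n, ∀ l, u l =
      ((a l).2 - explicitD m f n) - contraction F ((a l).1 - explicitDelta n) := ⟨_, fun _ => rfl⟩
  have hu : ∀ l, u l ∈ filt R B n m 2 0 := fun l => by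
    rw [hu']
    exact sub_contraction_filt F (ha' l).1.1 (ha' l).1.2
  obtain ⟨U, hU, hpU⟩ := exists_series_extension u hu fun l l' k θ θ' h => by
    obtain ⟨h1, h2⟩ := hc l l' k θ θ' h
    have key : ∀ (l : Fin (n + 2)) (θ : Fin (k + 1) ↪o Fin (n + 1)), pullSeries R B θ (u l) =
        (pullSeries R B θ (a l).2 - explicitD m f k) -
          contraction F (pullSeries R B θ (a l).1 - explicitDelta k) := fun l θ => by
      rw [hu', map_sub, map_sub, pullSeries_contraction, map_sub, pullSeries_explicitDelta,
        pullSeries_explicitD]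
    rw [key, key, h1, h2]
  obtain ⟨X, hX, eX, hMC⟩ := exists_quantData_fixed_point F f hU
  -- The fixed point equation is compatible with restriction to faces, so the restriction of the
  -- solution and the given solution solve the same equation, and uniqueness identifies them.
  have hpX : ∀ l : Fin (n + 2), pullSeries R B l.succAbove X = (a l).1 - explicitDelta n := fun l => by
    refine eq_of_quantData F f (hu l) (pullSeries_filt _ hX) ?_ (ha' l).1.1 (ha' l).1.2 (ha' l).2 (hu' l)
    rw [← pullSeries_A, eX, pullSeries_Φ, hpU]
  refine ⟨(X + explicitDelta (n + 1), U + contraction F X + explicitD m f (n + 1)), ?_, fun l => ?_⟩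
  · rw [isQuantisation_iff F]
    dsimp only
    rw [add_sub_cancel_right, add_sub_cancel_right]
    exact ⟨hX, add_contraction_filt F hX hU, hMC⟩
  · dsimp only
    rw [map_add, hpX, pullSeries_explicitDelta, sub_add_cancel, map_add, map_add, hpU,
      pullSeries_contraction, hpX, pullSeries_explicitD]
    refine ⟨rfl, ?_⟩
    rw [hu']
    abel

end Fill

end DCrit

end

noncomputable section

namespace DCrit

/-! ## Restriction of quantisations -/

section Restriction

variable {R : Type u} [CommRing R] {B : Type v} [CommRing B] [Algebra R B]
  {C : Type w} [CommRing C] [Algebra R C] (φ : B →ₐ[R] C) {m n k : ℕ}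

/-- Operators over `C` as operators on the image of forms over `B`. -/
def preRestrict (n : ℕ) :
    FormOp R C n →ₗ[R] (Forms R B →ₗ[R] Forms R C) ⊗[R] SimplexForms R n :=
  LinearMap.rTensor (SimplexForms R n) (LinearMap.lcomp R (Forms R C) (formsMap φ).toLinearMap)

/-- Operators over `B` followed by pull-back of forms to `C`. -/
def postRestrict (n : ℕ) :
    FormOp R B n →ₗ[R] (Forms R B →ₗ[R] Forms R C) ⊗[R] SimplexForms R n :=
  LinearMap.rTensor (SimplexForms R n) (LinearMap.compRight R (formsMap φ).toLinearMap)

theorem preRestrict_pureOp (P : Op R C) (η : SimplexForms R n) :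
    preRestrict φ n (pureOp P η) = (P ∘ₗ (formsMap φ).toLinearMap) ⊗ₜ[R] η := rfl

theorem postRestrict_pureOp (P : Op R B) (η : SimplexForms R n) :
    postRestrict φ n (pureOp P η) = ((formsMap φ).toLinearMap ∘ₗ P) ⊗ₜ[R] η := rfl

/-- `x` extends `y` along `φ`. -/
def FormRel (y : FormOp R B n) (x : FormOp R C n) : Prop := preRestrict φ n x = postRestrict φ n y

/-- Composition from the left. -/
def leftAct (n : ℕ) : FormOp R C n →ₗ[R] ((Forms R B →ₗ[R] Forms R C) ⊗[R] SimplexForms R n) →ₗ[R]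
    (Forms R B →ₗ[R] Forms R C) ⊗[R] SimplexForms R n :=
  TensorProduct.map₂ (LinearMap.llcomp R (Forms R B) (Forms R C) (Forms R C))
    (LinearMap.mul R (SimplexForms R n))

/-- Composition from the right. -/
def rightAct (n : ℕ) : ((Forms R B →ₗ[R] Forms R C) ⊗[R] SimplexForms R n) →ₗ[R] FormOp R B n →ₗ[R]
    (Forms R B →ₗ[R] Forms R C) ⊗[R] SimplexForms R n :=
  TensorProduct.map₂ (LinearMap.llcomp R (Forms R B) (Forms R B) (Forms R C))
    (LinearMap.mul R (SimplexForms R n))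

theorem leftAct_pureOp (P : Op R C) (η : SimplexForms R n) (g : Forms R B →ₗ[R] Forms R C)
    (ζ : SimplexForms R n) :
    leftAct n (pureOp P η) (g ⊗ₜ[R] ζ) = (P ∘ₗ g) ⊗ₜ[R] (η * ζ) := rfl

theorem rightAct_pureOp (P : Op R B) (η : SimplexForms R n) (g : Forms R B →ₗ[R] Forms R C)
    (ζ : SimplexForms R n) :
    rightAct n (g ⊗ₜ[R] ζ) (pureOp P η) = (g ∘ₗ P) ⊗ₜ[R] (ζ * η) := rfl

theorem preRestrict_mul (x x' : FormOp R C n) :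
    preRestrict φ n (x * x') = leftAct n x (preRestrict φ n x') := by
  induction x using formOp_induction with
  | zero => simp only [zero_mul, map_zero, LinearMap.zero_apply]
  | add x y hx hy => simp only [add_mul, map_add, hx, hy, LinearMap.add_apply]
  | pure P η =>
    induction x' using formOp_induction with
    | zero => simp only [mul_zero, map_zero]
    | add x y hx hy => simp only [mul_add, map_add, hx, hy]
    | pure P' η' =>
      rw [pureOp_mul_pureOp, preRestrict_pureOp, preRestrict_pureOp, leftAct_pureOp]; rfl

theorem postRestrict_mul (y y' : FormOp R B n) :
    postRestrict φ n (y * y') = rightAct n (postRestrict φ n y) y' := by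
  induction y using formOp_induction with
  | zero => simp only [zero_mul, map_zero, LinearMap.zero_apply]
  | add x y hx hy => simp only [add_mul, map_add, hx, hy, LinearMap.add_apply]
  | pure P η =>
    induction y' using formOp_induction with
    | zero => simp only [mul_zero, map_zero]
    | add x y hx hy => simp only [mul_add, map_add, hx, hy]
    | pure P' η' =>
      rw [pureOp_mul_pureOp, postRestrict_pureOp, postRestrict_pureOp, rightAct_pureOp]; rfl

/-- Associativity of composition. It is what makes the relation of extending along φ compatible with
products. -/
theorem leftAct_postRestrict (x : FormOp R C n) (y : FormOp R B n) :
    leftAct n x (postRestrict φ n y) = rightAct n (preRestrict φ n x) y := by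
  induction x using formOp_induction with
  | zero => simp only [map_zero, LinearMap.zero_apply]
  | add x y hx hy => simp only [map_add, hx, hy, LinearMap.add_apply]
  | pure P η =>
    induction y using formOp_induction with
    | zero => simp only [map_zero]
    | add x y hx hy => simp only [map_add, hx, hy]
    | pure P' η' =>
      exact (leftAct_pureOp P η ((formsMap φ).toLinearMap ∘ₗ P') η').trans
        (rightAct_pureOp P' η' (P ∘ₗ (formsMap φ).toLinearMap) η).symm

variable (B) in
/-- A linear map between spaces of forms on simplices, with coefficients in operators. -/
def formMap (h : SimplexForms R n →ₗ[R] SimplexForms R k) : FormOp R B n →ₗ[R] FormOp R B k :=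
  LinearMap.lTensor (Op R B) h

theorem formMap_pureOp (h : SimplexForms R n →ₗ[R] SimplexForms R k) (P : Op R B)
    (η : SimplexForms R n) : formMap B h (pureOp P η) = pureOp P (h η) := rfl

theorem preRestrict_formMap (h : SimplexForms R n →ₗ[R] SimplexForms R k) (x : FormOp R C n) :
    preRestrict φ k (formMap C h x) = LinearMap.lTensor _ h (preRestrict φ n x) := by
  induction x using formOp_induction with
  | zero => simp only [map_zero]
  | add x y hx hy => simp only [map_add, hx, hy]
  | pure P η => rw [formMap_pureOp, preRestrict_pureOp, preRestrict_pureOp, LinearMap.lTensor_tmul]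

theorem postRestrict_formMap (h : SimplexForms R n →ₗ[R] SimplexForms R k) (y : FormOp R B n) :
    postRestrict φ k (formMap B h y) = LinearMap.lTensor _ h (postRestrict φ n y) := by
  induction y using formOp_induction with
  | zero => simp only [map_zero]
  | add x y hx hy => simp only [map_add, hx, hy]
  | pure P η =>
    rw [formMap_pureOp, postRestrict_pureOp, postRestrict_pureOp, LinearMap.lTensor_tmul]

theorem pull_eq_formMap (θ : Fin (k + 1) → Fin (n + 1)) (x : FormOp R B n) :
    pull R B θ x = formMap B (formsMap (simplexPull R θ)).toLinearMap x := rfl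

/-- Restriction to a face, followed by `preRestrict`. -/
def facePreRestrict (θ : Fin (k + 1) → Fin (n + 1)) :
    FormOp R C n →ₗ[R] (Forms R B →ₗ[R] Forms R C) ⊗[R] SimplexForms R k :=
  TensorProduct.map (LinearMap.lcomp R (Forms R C) (formsMap φ).toLinearMap)
    (formsMap (simplexPull R θ)).toLinearMap

theorem facePreRestrict_pureOp (θ : Fin (k + 1) → Fin (n + 1)) (P : Op R C) (η : SimplexForms R n) :
    facePreRestrict φ θ (pureOp P η) =
      (P ∘ₗ (formsMap φ).toLinearMap) ⊗ₜ[R] formsMap (simplexPull R θ) η := rfl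

theorem facePreRestrict_eq (θ : Fin (k + 1) → Fin (n + 1)) (x : FormOp R C n) :
    facePreRestrict φ θ x = preRestrict φ k (pull R C θ x) := by
  induction x using formOp_induction with
  | zero => simp only [map_zero]
  | add x y hx hy => simp only [map_add, hx, hy]
  | pure P η => rw [pull_pureOp, preRestrict_pureOp, facePreRestrict_pureOp]

variable {φ}

namespace FormRel

variable {y y' : FormOp R B n} {x x' : FormOp R C n}

theorem zero : FormRel φ (0 : FormOp R B n) 0 := by rw [FormRel, map_zero, map_zero]

theorem add (h : FormRel φ y x) (h' : FormRel φ y' x') : FormRel φ (y + y') (x + x') := by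
  rw [FormRel, map_add, map_add, h, h']

theorem sub (h : FormRel φ y x) (h' : FormRel φ y' x') : FormRel φ (y - y') (x - x') := by
  rw [FormRel, map_sub, map_sub, h, h']

theorem smul (r : R) (h : FormRel φ y x) : FormRel φ (r • y) (r • x) := by
  rw [FormRel, map_smul, map_smul, h]

theorem zsmul (r : ℤ) (h : FormRel φ y x) : FormRel φ (r • y) (r • x) := by
  rw [FormRel, map_zsmul, map_zsmul, h]

theorem sum {ι : Type*} (s : Finset ι) {y : ι → FormOp R B n} {x : ι → FormOp R C n}
    (h : ∀ i, FormRel φ (y i) (x i)) : FormRel φ (∑ i ∈ s, y i) (∑ i ∈ s, x i) := by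
  rw [FormRel, map_sum, map_sum]
  exact Finset.sum_congr rfl fun i _ => h i

theorem mul (h : FormRel φ y x) (h' : FormRel φ y' x') : FormRel φ (y * y') (x * x') := by
  rw [FormRel, preRestrict_mul, h', leftAct_postRestrict, h, postRestrict_mul]

theorem pureOp {P : Op R B} {Q : Op R C} (h : Extends φ P Q) (η : SimplexForms R n) :
    FormRel φ (DCrit.pureOp P η) (DCrit.pureOp Q η) := by
  rw [FormRel, preRestrict_pureOp, postRestrict_pureOp, h]

theorem simplexDiff (h : FormRel φ y x) : FormRel φ (DCrit.simplexDiff y) (DCrit.simplexDiff x) :=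
  (pureOp Extends.parity 1).mul (x := DCrit.pureOp (parity R C) 1)
    (x' := formMap C (deRham R (SimplexRing R n)) x) (y' := formMap B (deRham R _) y) (by
      rw [FormRel, preRestrict_formMap, postRestrict_formMap, h])

theorem pull (θ : Fin (k + 1) → Fin (n + 1)) (h : FormRel φ y x) :
    FormRel φ (DCrit.pull R B θ y) (DCrit.pull R C θ x) := by
  rw [FormRel, pull_eq_formMap, pull_eq_formMap, preRestrict_formMap, postRestrict_formMap, h]

theorem id (y : FormOp R B n) : FormRel (AlgHom.id R B) y y := by
  have e : (formsMap (AlgHom.id R B)).toLinearMap = LinearMap.id := LinearMap.ext formsMap_id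
  induction y using formOp_induction with
  | zero => exact zero
  | add x y hx hy => exact hx.add hy
  | pure P η => exact pureOp (by rw [Extends, e]; rfl) η

theorem comp {D : Type*} [CommRing D] [Algebra R D] {ψ : C →ₐ[R] D} {z : FormOp R D n}
    (h : FormRel φ y x) (h' : FormRel ψ x z) : FormRel (ψ.comp φ) y z := by
  have e : (formsMap (ψ.comp φ)).toLinearMap =
      (formsMap ψ).toLinearMap ∘ₗ (formsMap φ).toLinearMap := LinearMap.ext fun α => formsMap_comp φ ψ α
  have h1 : ∀ z : FormOp R D n, preRestrict (ψ.comp φ) n z = LinearMap.rTensor (SimplexForms R n)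
      (LinearMap.lcomp R (Forms R D) (formsMap φ).toLinearMap) (preRestrict ψ n z) := fun z => by
    induction z using formOp_induction with
    | zero => simp only [map_zero]
    | add x y hx hy => simp only [map_add, hx, hy]
    | pure P η =>
      rw [preRestrict_pureOp, preRestrict_pureOp, e]; rfl
  have h2 : ∀ x : FormOp R C n, LinearMap.rTensor (SimplexForms R n)
      (LinearMap.lcomp R (Forms R D) (formsMap φ).toLinearMap) (postRestrict ψ n x) =
      LinearMap.rTensor (SimplexForms R n) (LinearMap.compRight R (formsMap ψ).toLinearMap)
        (preRestrict φ n x) := fun x => by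
    induction x using formOp_induction with
    | zero => simp only [map_zero]
    | add x y hx hy => simp only [map_add, hx, hy]
    | pure P η => rfl
  have h3 : ∀ y : FormOp R B n, postRestrict (ψ.comp φ) n y = LinearMap.rTensor (SimplexForms R n)
      (LinearMap.compRight R (formsMap ψ).toLinearMap) (postRestrict φ n y) := fun y => by
    induction y using formOp_induction with
    | zero => simp only [map_zero]
    | add x y hx hy => simp only [map_add, hx, hy]
    | pure P η => rw [postRestrict_pureOp, postRestrict_pureOp, e]; rfl
  rw [FormRel, h1, h', h2, h, h3]

end FormRel

variable (φ) in
/-- The coefficients of `x` extend those of `y` along `φ`. -/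
def SeriesRel (y : QSeries R B n) (x : QSeries R C n) : Prop :=
  ∀ i, FormRel φ (y.coeff i) (x.coeff i)

theorem restricts_iff {θ : Fin (k + 1) → Fin (n + 1)} {y : QSeries R B k} {x : QSeries R C n} :
    Restricts φ θ y x ↔ SeriesRel φ y (pullSeries R C θ x) := by
  refine forall_congr' fun i => ?_
  change facePreRestrict φ θ (x.coeff i) = postRestrict φ k (y.coeff i) ↔ _
  rw [facePreRestrict_eq]
  rfl

namespace SeriesRel

variable {y y' : QSeries R B n} {x x' : QSeries R C n}

theorem add (h : SeriesRel φ y x) (h' : SeriesRel φ y' x') : SeriesRel φ (y + y') (x + x') :=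
  fun i => (h i).add (h' i)

theorem sub (h : SeriesRel φ y x) (h' : SeriesRel φ y' x') : SeriesRel φ (y - y') (x - x') :=
  fun i => (h i).sub (h' i)

theorem mul (h : SeriesRel φ y x) (h' : SeriesRel φ y' x') : SeriesRel φ (y * y') (x * x') := by
  intro i
  obtain ⟨N, h1, h2⟩ := exists_lower_bound₂ y y'
  obtain ⟨N', h3, h4⟩ := exists_lower_bound₂ x x'
  rw [coeff_mul_eq_sum (N := min N N') (fun i hi => h1 i (lt_of_lt_of_le hi (min_le_left _ _)))
      (fun i hi => h2 i (lt_of_lt_of_le hi (min_le_left _ _))),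
    coeff_mul_eq_sum (N := min N N') (fun i hi => h3 i (lt_of_lt_of_le hi (min_le_right _ _)))
      (fun i hi => h4 i (lt_of_lt_of_le hi (min_le_right _ _)))]
  exact FormRel.sum _ fun a => (h a).mul (h' _)

theorem term {P : Op R B} {Q : Op R C} (h : Extends φ P Q) (i : ℤ) :
    SeriesRel φ (DCrit.term i P : QSeries R B n) (DCrit.term i Q) := fun a => by
  rw [coeff_term, coeff_term]
  split_ifs
  · exact FormRel.pureOp h 1
  · exact FormRel.zero

theorem diff (h : SeriesRel φ y x) : SeriesRel φ (seriesDiff R B n y) (seriesDiff R C n x) :=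
  fun i => (h i).simplexDiff

theorem hbar (h : SeriesRel φ y x) : SeriesRel φ (hbarLin R B n y) (hbarLin R C n x) :=
  fun i => (h i).zsmul i

theorem pull (θ : Fin (k + 1) → Fin (n + 1)) (h : SeriesRel φ y x) :
    SeriesRel φ (pullSeries R B θ y) (pullSeries R C θ x) := fun i => (h i).pull θ

theorem id (y : QSeries R B n) : SeriesRel (AlgHom.id R B) y y := fun _ => FormRel.id _

theorem comp {D : Type*} [CommRing D] [Algebra R D] {ψ : C →ₐ[R] D} {z : QSeries R D n}
    (h : SeriesRel φ y x) (h' : SeriesRel ψ x z) : SeriesRel (ψ.comp φ) y z :=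
  fun i => (h i).comp (h' i)

variable (φ) in
theorem explicitDelta (n : ℕ) : SeriesRel φ (DCrit.explicitDelta n) (DCrit.explicitDelta n) :=
  term Extends.deRham 1

variable (φ) in
theorem twisted (f : B) (n : ℕ) : SeriesRel φ (DCrit.twisted f n) (DCrit.twisted (φ f) n) :=
  (term (Extends.koszul f) 0).add (explicitDelta φ n)

variable (φ) in
theorem explicitD [Algebra ℚ R] (m : ℕ) (f : B) (n : ℕ) :
    SeriesRel φ (DCrit.explicitD m f n) (DCrit.explicitD m (φ f) n) :=
  (term (Extends.degreeScale _) 0).sub (term (Extends.mulOp f) (-1))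

end SeriesRel

variable [Algebra ℚ R]

/-- Pull-back of forms commutes with parity, so the parity factors do not affect the uniqueness of
extensions of the coefficients. -/
theorem FrameExtension.form_eq_zero (T : FrameExtension φ m) {i w J : ℤ} {x : FormOp R C n}
    (hx : x ∈ tens (selfDualSub R C m i w) J) (h : preRestrict φ n x = 0) : x = 0 := by
  refine tens_eq_zero (LinearMap.lcomp R (Forms R C) (formsMap φ).toLinearMap)
    (fun d j P (hP : P ∈ selfDualSub R C m i w j) e => T.eq_zero (OrdLT.base hP.2) (LinearMap.ext fun α => ?_)) hx h
  have h1 : parity R B ^ d * parity R B ^ d = 1 := parity_pow_mul_parity_pow d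
  have h2 := LinearMap.congr_fun e ((parity R B ^ d) α)
  have h3 := extends_iff.1 (Extends.parity.pow d : Extends φ _ (parity R C ^ d)) ((parity R B ^ d) α)
  have h4 : (parity R B ^ d) ((parity R B ^ d) α) = α := LinearMap.congr_fun h1 α
  rw [h4] at h3
  change P ((parity R C ^ d) (formsMap φ ((parity R B ^ d) α))) = 0 at h2
  rw [h3] at h2
  exact h2

/-- Series are determined by their restriction. -/
theorem FrameExtension.series_unique (T : FrameExtension φ m) {l : ℕ} {J : ℤ} {y : QSeries R B n}
    {x x' : QSeries R C n} (hx : x ∈ filt R C n m l J) (hx' : x' ∈ filt R C n m l J)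
    (h : SeriesRel φ y x) (h' : SeriesRel φ y x') : x = x' := by
  refine sub_eq_zero.1 (HahnSeries.ext (funext fun i => ?_))
  refine T.form_eq_zero (sub_mem hx hx' i) ?_
  have := (h.sub h') i
  rwa [sub_self, HahnSeries.coeff_zero, FormRel, map_zero] at this

theorem FrameExtension.exists_form (T : FrameExtension φ m) {i w J : ℤ} {y : FormOp R B n}
    (hy : y ∈ tens (selfDualSub R B m i w) J) :
    ∃ x ∈ tens (n := n) (selfDualSub R C m i w) J, FormRel φ y x := by
  induction hy using tens_induction with
  | zero => exact ⟨0, zero_mem _, FormRel.zero⟩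
  | add x y _ _ hx hy =>
    obtain ⟨x', h1, h2⟩ := hx
    obtain ⟨y', h3, h4⟩ := hy
    exact ⟨_, add_mem h1 h3, h2.add h4⟩
  | smul r x _ hx =>
    obtain ⟨x', h1, h2⟩ := hx
    exact ⟨_, Submodule.smul_mem _ r h1, h2.smul r⟩
  | pure q P hP η hη =>
    obtain ⟨Q, h1, h2, h3⟩ := T.exists_extends_selfDual hP.1 hP.2
    exact ⟨_, pureOp_mem (V := fun j => (selfDualSub R C m i w j : Set (Op R C))) ⟨h1, h2⟩ hη,
      FormRel.pureOp (h3.mul (Extends.parity.pow q)) η⟩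

theorem FrameExtension.exists_series (T : FrameExtension φ m) {l : ℕ} {J : ℤ} {y : QSeries R B n}
    (hy : y ∈ filt R B n m l J) : ∃ x ∈ filt R C n m l J, SeriesRel φ y x := by
  choose c h1 h2 using fun i => T.exists_form (hy i)
  obtain ⟨x, hx, e⟩ := DCrit.exists_series h1
  exact ⟨x, hx, fun i => by rw [e]; exact h2 i⟩

/-- The uniqueness of extensions requires the Maurer--Cartan expressions to lie in the filtration.
The square does so as half of a graded commutator of an odd element with itself. -/
theorem isMC_mem (F : Frame R B m) (f : B) {a b : QSeries R B n}
    (ha : a ∈ filt R B n m 2 1) (hb : b ∈ filt R B n m 2 0) :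
    (twisted f n + a) * (twisted f n + a) + seriesDiff R B n (twisted f n + a) ∈ filt R B n m 0 2 ∧
    (twisted f n + a) * (explicitD m f n + b) - (explicitD m f n + b) * (twisted f n + a) +
      seriesDiff R B n (explicitD m f n + b) - hbarLin R B n (twisted f n + a) ∈
        filt R B n m 0 1 := by
  have hX : twisted f n + a ∈ filt R B n m 0 1 :=
    add_mem (twisted_mem f) (filt_mono (Nat.zero_le _) ha)
  have hY : explicitD m f n + b ∈ filt R B n m 0 0 :=
    add_mem (explicitD_mem f) (filt_mono (Nat.zero_le _) hb)
  have h1 := filt_bracket F hX hX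
  have h2 := filt_bracket F hX hY
  have h3 := seriesDiff_filt hX
  have h4 := seriesDiff_filt hY
  rw [mul_one, Int.negOnePow_one, Units.neg_smul, one_smul, sub_neg_eq_add] at h1
  rw [mul_zero, Int.negOnePow_zero, one_smul] at h2
  refine ⟨add_mem ?_ h3, sub_mem (add_mem h2 ?_) (hbarLin_filt hX)⟩
  · rw [← half_smul_add (R := R) ((twisted f n + a) * (twisted f n + a))]
    exact Submodule.smul_mem _ _ h1
  · rwa [zero_add] at h4

/-- Quantisations restrict along open immersions. -/
theorem FrameExtension.exists_quantisation (T : FrameExtension φ m) (f : B)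
    {y : QSeries R B n × QSeries R B n} (hy : IsQuantisation m f y) :
    ∃ x : QSeries R C n × QSeries R C n, IsQuantisation m (φ f) x ∧
      SeriesRel φ y.1 x.1 ∧ SeriesRel φ y.2 x.2 := by
  obtain ⟨h1, h2, h3⟩ := (isQuantisation_iff T.frame f y).1 hy
  obtain ⟨a, ha, ea⟩ := T.exists_series h1
  obtain ⟨b, hb, eb⟩ := T.exists_series h2
  refine ⟨(explicitDelta n + a, explicitD m (φ f) n + b), ?_, ?_, ?_⟩
  · rw [isQuantisation_iff T.target]
    dsimp only
    rw [add_sub_cancel_left, add_sub_cancel_left]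
    obtain ⟨m1, m2⟩ := isMC_mem T.target (φ f) ha hb
    obtain ⟨e1, e2⟩ := h3
    have rX := (SeriesRel.twisted φ f n).add ea
    have rY := (SeriesRel.explicitD φ m f n).add eb
    -- The Maurer--Cartan expressions over C extend those over B, which are zero, so they vanish by
    -- uniqueness of extensions.
    refine ⟨ha, hb, T.series_unique m1 (zero_mem _) ((rX.mul rX).add rX.diff) ?_,
      sub_eq_zero.1 (T.series_unique m2 (zero_mem _)
        ((((rX.mul rY).sub (rY.mul rX)).add rY.diff).sub rX.hbar) ?_)⟩
    · intro i
      refine Eq.mpr (congrArg (fun z => FormRel φ (HahnSeries.coeff z i) _) e1) ?_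
      exact FormRel.zero
    · intro i
      refine Eq.mpr (congrArg (fun z => FormRel φ (HahnSeries.coeff z i) _) (sub_eq_zero.2 e2)) ?_
      exact FormRel.zero
  · have := (SeriesRel.explicitDelta φ n).add ea
    rwa [add_sub_cancel] at this
  · have := (SeriesRel.explicitD φ m f n).add eb
    rwa [add_sub_cancel] at this

theorem IsQuantisation.mem_filt (F : Frame R B m) {f : B} {x : QSeries R B n × QSeries R B n}
    (hx : IsQuantisation m f x) : x.1 ∈ filt R B n m 0 1 ∧ x.2 ∈ filt R B n m 0 0 := by
  obtain ⟨h1, h2, -⟩ := (isQuantisation_iff F f x).1 hx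
  have hΔ : (explicitDelta n : QSeries R B n) ∈ filt R B n m 0 1 := term_mem_filt deRham_mem_selfDual
  have hD : explicitD m f n ∈ filt R B n m 0 0 := explicitD_mem f
  have c1 := add_mem (filt_mono (Nat.zero_le 2) h1) hΔ
  have c2 := add_mem (filt_mono (Nat.zero_le 2) h2) hD
  rw [sub_add_cancel] at c1 c2
  exact ⟨c1, c2⟩

end Restriction

end DCrit

end

noncomputable section

namespace DCrit

/-! ## Compatible families of quantisations -/

section Chains

variable {R : Type u} [CommRing R] {Y : Scheme.{u}} (s : Y ⟶ Spec (CommRingCat.of R)) {m : ℕ}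
  {N n k l : ℕ}

theorem restrict_refl (U : Y.Opens) : restrict s (le_refl U) = AlgHom.id R (Sections s U) := by
  ext b
  change (Y.presheaf.map (𝟙 _)).hom b = b
  rw [CategoryTheory.Functor.map_id]
  rfl

theorem restrict_comp {U V W : Y.Opens} (h : V ≤ U) (h' : W ≤ V) :
    (restrict s h').comp (restrict s h) = restrict s (h'.trans h) := by
  ext b
  change (Y.presheaf.map (homOfLE h).op ≫ Y.presheaf.map (homOfLE h').op).hom b = _
  rw [← Functor.map_comp]
  rfl

theorem restrict_resTop (f : Γ(Y, ⊤)) {U V : Y.Opens} (h : V ≤ U) :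
    restrict s h (resTop s f U) = resTop s f V := by
  change (Y.presheaf.map (homOfLE le_top).op ≫ Y.presheaf.map (homOfLE h).op).hom f = _
  rw [← Functor.map_comp]
  rfl

theorem Chain.OnBoundary.face {c : Chain Y N n} (hc : c.OnBoundary) (θ : Fin (k + 1) ↪o Fin (n + 1)) :
    (c.face θ).OnBoundary := fun h => hc fun i => by
  obtain ⟨j, hj⟩ := h i
  exact ⟨θ j, hj⟩

open scoped Classical in
/-- An extension of a family of quantisations from the boundary, chosen by recursion. -/
def extendFamily (m : ℕ) (f : Γ(Y, ⊤)) (x : Cochains s N) : Cochains s N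
  | n, c => if c.OnBoundary then x n c else
    -- A filling of the chain is chosen if one exists. Only faces of smaller dimension are
    -- consulted, which makes the recursion well founded.
    Classical.epsilon fun z => IsQuantisation m (resTop s f c.opens) z ∧
      ∀ (k : ℕ) (_ : k < n) (θ : Fin (k + 1) ↪o Fin (n + 1)),
        Restricts (restrict s (c.opens_le θ)) θ (extendFamily m f x k (c.face θ)).1 z.1 ∧
        Restricts (restrict s (c.opens_le θ)) θ (extendFamily m f x k (c.face θ)).2 z.2
termination_by n => n

theorem restricts_refl {A : Type v} [CommRing A] [Algebra R A] (y : QSeries R A n) :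
    Restricts (AlgHom.id R A) id y y := by
  rw [restricts_iff, pullSeries_id]
  exact SeriesRel.id y

theorem orderEmbedding_eq_refl (θ : Fin (n + 1) ↪o Fin (n + 1)) : θ = RelEmbedding.refl _ :=
  DFunLike.coe_injective ((StrictMono.range_inj (g := id) θ.strictMono strictMono_id).1 (by
    rw [(Finite.injective_iff_surjective.1 θ.injective).range_eq, Set.range_id]))

variable [Algebra ℚ R]

/-- Compatible quantisations on the proper faces of a chain extend to the chain. -/
theorem exists_chain_fill
    (hF : ∀ (U V : Y.affineOpens) (h : (V : Y.Opens) ≤ U), Nonempty (FrameExtension (restrict s h) m))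
    (f : Γ(Y, ⊤)) (y : Cochains s N) (c : Chain Y N n)
    (hy : ∀ l < n, ∀ c : Chain Y N l, IsQuantisation m (resTop s f c.opens) (y l c) ∧
      ∀ (k : ℕ) (θ : Fin (k + 1) ↪o Fin (l + 1)),
        Restricts (restrict s (c.opens_le θ)) θ (y k (c.face θ)).1 (y l c).1 ∧
        Restricts (restrict s (c.opens_le θ)) θ (y k (c.face θ)).2 (y l c).2) :
    ∃ z, IsQuantisation m (resTop s f c.opens) z ∧
      ∀ (k : ℕ) (_ : k < n) (θ : Fin (k + 1) ↪o Fin (n + 1)),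
        Restricts (restrict s (c.opens_le θ)) θ (y k (c.face θ)).1 z.1 ∧
        Restricts (restrict s (c.opens_le θ)) θ (y k (c.face θ)).2 z.2 := by
  obtain ⟨T⟩ := hF (c.vertex 0).1 (c.vertex 0).1 le_rfl
  have F : Frame R (Sections s c.opens) m := T.frame
  cases n with
  | zero => exact ⟨_, isQuantisation_explicit F _ 0, fun k hk => absurd hk (Nat.not_lt_zero _)⟩
  | succ n =>
    -- A facet may involve a larger smallest open set than the chain itself, so its quantisation is
    -- first restricted to the open set of the chain.
    have hd : ∀ i : Fin (n + 2), ∃ a, IsQuantisation m (resTop s f c.opens) a ∧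
        SeriesRel (restrict s (c.opens_le (Fin.succAboveOrderEmb i)))
          (y n (c.face (Fin.succAboveOrderEmb i))).1 a.1 ∧
        SeriesRel (restrict s (c.opens_le (Fin.succAboveOrderEmb i)))
          (y n (c.face (Fin.succAboveOrderEmb i))).2 a.2 := fun i => by
      obtain ⟨T⟩ := hF (c.vertex (Fin.succAboveOrderEmb i 0)).1 (c.vertex 0).1
        (c.opens_le (Fin.succAboveOrderEmb i))
      obtain ⟨a, h, h'⟩ := FrameExtension.exists_quantisation T _
        (hy n (Nat.lt_succ_self n) (c.face (Fin.succAboveOrderEmb i))).1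
      exact ⟨a, (restrict_resTop s f (c.opens_le (Fin.succAboveOrderEmb i))) ▸ h, h'⟩
    choose a ha h1 h2 using hd
    have hrel : ∀ (i : Fin (n + 2)) (k : ℕ) (θ : Fin (k + 1) ↪o Fin (n + 1))
        (τ : Fin (k + 1) ↪o Fin (n + 2)), (∀ j, i.succAbove (θ j) = τ j) →
        SeriesRel (restrict s (c.opens_le τ)) (y k (c.face τ)).1 (pullSeries R _ θ (a i).1) ∧
        SeriesRel (restrict s (c.opens_le τ)) (y k (c.face τ)).2 (pullSeries R _ θ (a i).2) := by
      intro i k θ τ hτ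
      obtain rfl : θ.trans (Fin.succAboveOrderEmb i) = τ := RelEmbedding.ext hτ
      obtain ⟨r1, r2⟩ := (hy n (Nat.lt_succ_self n) (c.face (Fin.succAboveOrderEmb i))).2 k θ
      rw [restricts_iff] at r1 r2
      have e := restrict_comp s ((c.face (Fin.succAboveOrderEmb i)).opens_le θ)
        (c.opens_le (Fin.succAboveOrderEmb i))
      exact ⟨e ▸ r1.comp ((h1 i).pull θ), e ▸ r2.comp ((h2 i).pull θ)⟩
    obtain ⟨z, hz, ez⟩ := exists_fill F _ a ha fun i i' k θ θ' h => by
      obtain ⟨r1, r2⟩ := hrel i k θ (θ.trans (Fin.succAboveOrderEmb i)) fun _ => rfl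
      obtain ⟨r1', r2'⟩ := hrel i' k θ' (θ.trans (Fin.succAboveOrderEmb i)) fun j => (h j).symm
      -- The restrictions of two facets to a common face extend the same series, so they agree by
      -- uniqueness; this is the compatibility needed for filling.
      obtain ⟨T⟩ := hF (c.vertex (θ.trans (Fin.succAboveOrderEmb i) 0)).1 (c.vertex 0).1
        (c.opens_le (θ.trans (Fin.succAboveOrderEmb i)))
      obtain ⟨m1, m2⟩ := (ha i).mem_filt F
      obtain ⟨m1', m2'⟩ := (ha i').mem_filt F
      exact ⟨FrameExtension.series_unique T (pullSeries_filt θ m1) (pullSeries_filt θ' m1') r1 r1',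
        FrameExtension.series_unique T (pullSeries_filt θ m2) (pullSeries_filt θ' m2') r2 r2'⟩
    refine ⟨z, hz, fun k hk θ => ?_⟩
    -- A proper face misses a vertex, so it lies in a facet, where the compatibility is known.
    obtain ⟨i, hi⟩ : ∃ i, ∀ j, θ j ≠ i := by
      by_contra! h
      have := Fintype.card_le_of_surjective θ h
      simp only [Fintype.card_fin] at this
      omega
    obtain ⟨θ', hθ'⟩ := exists_succAbove_comp hi
    have e : (θ : Fin (k + 1) → Fin (n + 2)) = i.succAbove ∘ θ' := funext fun j => (hθ' j).symm
    obtain ⟨r1, r2⟩ := hrel i k θ' θ hθ'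
    rw [restricts_iff, restricts_iff, e, pullSeries_comp, pullSeries_comp, (ez i).1, (ez i).2]
    exact ⟨r1, r2⟩

/-- The space of quantisations is contractible if affine open subsets have compatible frames. -/
theorem quantisationsContractible_of_frames
    (hF : ∀ (U V : Y.affineOpens) (h : (V : Y.Opens) ≤ U), Nonempty (FrameExtension (restrict s h) m))
    (f : Γ(Y, ⊤)) : QuantisationsContractible s m f := by
  intro N x hx
  have hb : ∀ (n : ℕ) (c : Chain Y N n), c.OnBoundary → extendFamily s m f x n c = x n c :=
    fun n c hc => by rw [extendFamily, if_pos hc]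
  refine ⟨extendFamily s m f x, fun n => ?_, hb⟩
  induction n using Nat.strong_induction_on with
  | _ n ih =>
    intro c _
    by_cases hc : c.OnBoundary
    · rw [hb n c hc]
      refine ⟨(hx n c hc).1, fun k θ => ?_⟩
      rw [hb k _ (hc.face θ)]
      exact (hx n c hc).2 k θ
    · have hz := Classical.epsilon_spec (exists_chain_fill s hF f (extendFamily s m f x) c
        fun l hl c' => ih l hl c' trivial)
      have e : extendFamily s m f x n c = _ := (extendFamily.eq_def s m f x n c).trans (if_neg hc)
      rw [← e] at hz
      refine ⟨hz.1, fun k θ => ?_⟩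
      rcases lt_or_ge k n with hk | hk
      · exact hz.2 k hk θ
      -- The only face that is not proper is the chain itself, where compatibility is trivial.
      · have h := Fintype.card_le_of_injective θ θ.injective
        simp only [Fintype.card_fin] at h
        obtain rfl : k = n := by omega
        obtain rfl := orderEmbedding_eq_refl θ
        have e : restrict s (c.opens_le (RelEmbedding.refl _)) = AlgHom.id R (Sections s c.opens) :=
          restrict_refl s c.opens
        constructor
        · change Restricts (restrict s (c.opens_le (RelEmbedding.refl _))) id
            (extendFamily s m f x k c).1 (extendFamily s m f x k c).1
          exact e ▸ restricts_refl _
        · change Restricts (restrict s (c.opens_le (RelEmbedding.refl _))) id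
            (extendFamily s m f x k c).2 (extendFamily s m f x k c).2
          exact e ▸ restricts_refl _

/-- The explicit quantisation is a point of the space of quantisations. -/
theorem isQuantisationOn_explicit
    (hF : ∀ (U V : Y.affineOpens) (h : (V : Y.Opens) ≤ U), Nonempty (FrameExtension (restrict s h) m))
    (f : Γ(Y, ⊤)) : IsQuantisationOn s m f (N := N) (fun _ _ => True) (fun n c =>
      (explicitDelta n, explicitD m (resTop s f c.opens) n)) := by
  intro n c _
  obtain ⟨T⟩ := hF (c.vertex 0).1 (c.vertex 0).1 le_rfl
  have F : Frame R (Sections s c.opens) m := T.frame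
  refine ⟨isQuantisation_explicit F _ n, fun k θ => ?_⟩
  rw [restricts_iff, restricts_iff, pullSeries_explicitDelta, pullSeries_explicitD,
    ← restrict_resTop s f (c.opens_le θ)]
  exact ⟨SeriesRel.explicitDelta _ k, SeriesRel.explicitD _ m _ k⟩

end Chains

end DCrit

end

noncomputable section

namespace DCrit

/-! ## Frames of smooth algebras -/

/-! ### Existence, trace and étale extension of frames -/

section SmoothFrames

variable {R : Type u} [CommRing R] {B : Type v} [CommRing B] [Algebra R B]
  {C : Type w} [CommRing C] [Algebra R C] {m : ℕ}

variable (R B) in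
-- Finitely many exact forms dg_i generate Ω¹, and projectivity splits the resulting surjection from
-- a free module. The coordinates of the splitting are the vector fields.
theorem exists_isFrame [Module.Finite B (Ω[B⁄R])] [Module.Projective B (Ω[B⁄R])] :
    ∃ (r : ℕ) (g : Fin r → B) (v : Fin r → Derivation R B B), IsFrame g v := by
  obtain ⟨t, ht1, ht2⟩ := Submodule.fg_span_iff_fg_span_finset_subset
    (Set.range (KaehlerDifferential.D R B)) |>.1 (by
      rw [KaehlerDifferential.span_range_derivation]; exact Module.Finite.fg_top)
  rw [KaehlerDifferential.span_range_derivation] at ht2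
  choose b hb using fun x : t => ht1 x.2
  let g : Fin t.card → B := fun i => b (t.equivFin.symm i)
  have hg : Submodule.span B (Set.range fun i => KaehlerDifferential.D R B (g i)) = ⊤ := by
    rw [ht2]
    congr 1
    ext x
    constructor
    · rintro ⟨i, rfl⟩
      dsimp only [g]
      rw [hb]
      exact (t.equivFin.symm i).2
    · intro hx
      exact ⟨t.equivFin ⟨x, hx⟩, by simp only [g, Equiv.symm_apply_apply]; exact hb _⟩
  obtain ⟨σ, hσ⟩ := LinearMap.exists_rightInverse_of_surjective
    (Fintype.linearCombination B fun i => KaehlerDifferential.D R B (g i))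
    (by rw [Fintype.range_linearCombination]; exact hg)
  refine ⟨_, g, fun i => (LinearMap.proj i ∘ₗ σ).compDer (KaehlerDifferential.D R B), fun b => ?_⟩
  have h := LinearMap.congr_fun hσ (KaehlerDifferential.D R B b)
  rw [LinearMap.comp_apply, Fintype.linearCombination_apply] at h
  exact h.symm

/-- The trace of the canonical element of `T ⊗ Ω¹` is the rank of `Ω¹`. -/
theorem IsFrame.trace_eq_rank [Module.Free B (Ω[B⁄R])] [Module.Finite B (Ω[B⁄R])] {r : ℕ}
    {g : Fin r → B} {v : Fin r → Derivation R B B} (h : IsFrame g v) :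
    ∑ i, v i (g i) = (Module.finrank B (Ω[B⁄R]) : B) := by
  nontriviality B
  let e := Module.Free.chooseBasis B (Ω[B⁄R])
  have h1 : ∀ i, v i (g i) = ∑ a, e.repr (KaehlerDifferential.D R B (g i)) a *
      (v i).liftKaehlerDifferential (e a) := fun i => by
    conv_lhs => rw [← Derivation.liftKaehlerDifferential_comp_D (v i),
      ← e.sum_repr (KaehlerDifferential.D R B (g i)), map_sum]
    exact Finset.sum_congr rfl fun a _ => map_smul _ _ _
  have h2 : ∀ a, ∑ i, e.repr (KaehlerDifferential.D R B (g i)) a *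
      (v i).liftKaehlerDifferential (e a) = 1 := fun a => by
    have := congrArg (fun x => e.repr x a) (h.expand (e a))
    simp only [map_sum, map_smul, Finsupp.coe_finsetSum, Finset.sum_apply, Finsupp.smul_apply,
      smul_eq_mul, Module.Basis.repr_self, Finsupp.single_eq_same] at this
    rw [this]
    exact Finset.sum_congr rfl fun i _ => mul_comm _ _
  rw [Finset.sum_congr rfl fun i _ => h1 i, Finset.sum_comm, Finset.sum_congr rfl fun a _ => h2 a,
    Finset.sum_const, Finset.card_univ, nsmul_one, Module.finrank_eq_card_chooseBasisIndex]

/-- Frames extend along étale maps. -/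
theorem exists_isFrame_extension (φ : B →ₐ[R] C) (hφ : φ.toRingHom.Etale) {r : ℕ}
    {g : Fin r → B} {v : Fin r → Derivation R B B} (h : IsFrame g v) :
    ∃ w : Fin r → Derivation R C C, (∀ i b, w i (φ b) = φ (v i b)) ∧ IsFrame (fun i => φ (g i)) w := by
  let : Algebra B C := φ.toRingHom.toAlgebra
  have : IsScalarTower R B C := IsScalarTower.of_algebraMap_eq' φ.comp_algebraMap.symm
  have : Algebra.Etale B C := hφ
  -- For an étale map Ω_C is the base change of Ω_B, so the functionals given by the v_i extend
  -- linearly.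
  let ε := KaehlerDifferential.tensorKaehlerEquivOfFormallyEtale R B C
  let W : Fin r → (Ω[C⁄R] →ₗ[C] C) := fun i =>
    (TensorProduct.AlgebraTensorModule.lift ((LinearMap.lsmul C (Ω[B⁄R] →ₗ[B] C)).flip
      ((Algebra.linearMap B C) ∘ₗ (v i).liftKaehlerDifferential))) ∘ₗ ε.symm.toLinearMap
  have hW : ∀ i b, W i (KaehlerDifferential.D R C (φ b)) = φ (v i b) := fun i b => by
    have e1 : ε.symm (KaehlerDifferential.D R C (φ b)) = 1 ⊗ₜ KaehlerDifferential.D R B b :=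
      KaehlerDifferential.tensorKaehlerEquivOfFormallyEtale_symm_D_algebraMap R B C b
    change TensorProduct.AlgebraTensorModule.lift _ (ε.symm _) = _
    rw [e1, TensorProduct.AlgebraTensorModule.lift_tmul]
    change (1 : C) • algebraMap B C ((v i).liftKaehlerDifferential _) = _
    rw [one_smul, Derivation.liftKaehlerDifferential_comp_D]
    rfl
  refine ⟨fun i => (W i).compDer (KaehlerDifferential.D R C), hW, fun c => ?_⟩
  have key : LinearMap.id = ∑ i, (W i).smulRight (KaehlerDifferential.D R C (φ (g i))) := by
    refine LinearMap.ext fun x => ?_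
    obtain ⟨y, rfl⟩ := ε.surjective x
    induction y with
    | zero => simp only [map_zero]
    | add x y hx hy => rw [map_add, map_add, map_add, hx, hy]
    | tmul c x =>
      have e2 : ∀ x, ε (c ⊗ₜ x) = c • KaehlerDifferential.map R R B C x := fun x =>
        KaehlerDifferential.mapBaseChange_tmul R B C c x
      rw [e2, map_smul, map_smul]
      congr 1
      have hx : x ∈ Submodule.span B (Set.range (KaehlerDifferential.D R B)) := by
        rw [KaehlerDifferential.span_range_derivation]; trivial
      induction hx using Submodule.span_induction with
      | zero => simp only [map_zero]
      | add x y _ _ hx hy => simp only [map_add] at *; rw [← hx, ← hy]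
      | smul b x _ hx =>
        rw [map_smul, ← algebraMap_smul C b, map_smul, map_smul, hx]
      | mem x hx =>
        obtain ⟨b, rfl⟩ := hx
        have e3 : KaehlerDifferential.map R R B C (KaehlerDifferential.D R B b) =
            KaehlerDifferential.D R C (φ b) := KaehlerDifferential.map_D R R B C b
        rw [e3, LinearMap.id_apply, LinearMap.sum_apply]
        simp only [LinearMap.smulRight_apply, hW]
        rw [← e3, h b, map_sum]
        refine Finset.sum_congr rfl fun i _ => ?_
        rw [map_smul, KaehlerDifferential.map_D]
        exact (algebraMap_smul C _ _).symm
  have := LinearMap.congr_fun key (KaehlerDifferential.D R C c)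
  rw [LinearMap.sum_apply] at this
  exact this

/-- A frame extends along étale maps. -/
theorem Frame.exists_extension (F : Frame R B m) (φ : B →ₐ[R] C) (hφ : φ.toRingHom.Etale) :
    Nonempty (FrameExtension φ m) := by
  obtain ⟨w, h1, h2⟩ := exists_isFrame_extension φ hφ F.isFrame
  exact ⟨⟨F, w, h1, h2⟩⟩

end SmoothFrames

/-! ### Frames from local standard smoothness -/

section Locally

variable {R B : Type u} [CommRing R] [CommRing B] [Algebra R B] {m : ℕ}

/-- Smooth algebras of relative dimension `m` have frames. -/
theorem exists_frame (h : RingHom.Locally (RingHom.IsStandardSmoothOfRelativeDimension m)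
    (algebraMap R B)) : Nonempty (Frame R B m) := by
  have : Algebra.Smooth R B := RingHom.smooth_algebraMap.1
    (RingHom.smooth_iff_locally_isStandardSmooth.2
      (RingHom.locally_of_locally (fun h => h.isStandardSmooth) h))
  obtain ⟨r, g, v, hf⟩ := exists_isFrame R B
  refine ⟨⟨r, g, v, hf, sub_eq_zero.1 ?_⟩⟩
  obtain ⟨s, hs, hP⟩ := h
  set x := ∑ i, v i (g i) - (m : B)
  -- The annihilator of the difference between trace and m. On each member of a standard smooth
  -- cover Ω¹ is free of rank m and the difference vanishes, so the cover lies in the radical of the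
  -- annihilator and generates the unit ideal.
  let I : Ideal B := LinearMap.ker (LinearMap.mulRight B x)
  have hann : ∀ t ∈ s, t ∈ I.radical := fun t ht => by
    have hC := hP t ht
    rw [← IsScalarTower.algebraMap_eq] at hC
    have : Algebra.IsStandardSmoothOfRelativeDimension m R (Localization.Away t) :=
      (RingHom.isStandardSmoothOfRelativeDimension_algebraMap m).1 hC
    have : Algebra.IsStandardSmooth R (Localization.Away t) :=
      Algebra.IsStandardSmoothOfRelativeDimension.isStandardSmooth m
    have hx : algebraMap B (Localization.Away t) x = 0 := by
      nontriviality (Localization.Away t)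
      obtain ⟨w, h1, h2⟩ := exists_isFrame_extension
        (IsScalarTower.toAlgHom R B (Localization.Away t))
        (RingHom.etale_algebraMap.2 (Algebra.Etale.of_isLocalizationAway t)) hf
      have h3 := h2.trace_eq_rank
      rw [Module.finrank, Algebra.IsStandardSmoothOfRelativeDimension.rank_kaehlerDifferential m,
        Cardinal.toNat_natCast] at h3
      simp only [h1, ← map_sum] at h3
      rw [map_sub, map_natCast, ← h3, sub_eq_zero]
      rfl
    obtain ⟨⟨_, n, rfl⟩, hn⟩ := (IsLocalization.map_eq_zero_iff (Submonoid.powers t) _ x).1 hx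
    exact ⟨n, hn⟩
  have htop : I.radical = ⊤ :=
    top_le_iff.1 (hs ▸ Ideal.span_le.2 hann)
  have h1 : (1 : B) ∈ I :=
    (Ideal.eq_top_iff_one _).1 (Ideal.radical_eq_top.1 htop)
  simpa [I] using h1

end Locally

/-! ### Frames on affine open subsets -/

section SchemeFrames

variable {R : Type u} [CommRing R] {Y : Scheme.{u}} (s : Y ⟶ Spec (CommRingCat.of R)) (m : ℕ)

theorem exists_frame_affine [SmoothOfRelativeDimension m s] (U : Y.affineOpens) :
    Nonempty (Frame R (Sections s U) m) := by
  refine exists_frame ?_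
  have h := HasRingHomProperty.appLE (@SmoothOfRelativeDimension m) s inferInstance
    ⟨⊤, isAffineOpen_top _⟩ U le_top
  have e := (HasRingHomProperty.isLocal_ringHomProperty (@SmoothOfRelativeDimension m)).respectsIso.2
    _ (Scheme.ΓSpecIso (CommRingCat.of R)).commRingCatIsoToRingEquiv.symm h
  exact e

/-- An inclusion of affine open sets is étale, being an open immersion, so the frame on the larger
set extends. -/
theorem exists_frameExtension [SmoothOfRelativeDimension m s] (U V : Y.affineOpens)
    (h : (V : Y.Opens) ≤ U) : Nonempty (FrameExtension (restrict s h) m) := by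
  obtain ⟨F⟩ := exists_frame_affine s m U
  refine F.exists_extension _ ?_
  have := HasRingHomProperty.appLE @Etale (𝟙 Y) inferInstance U V h
  have e : (𝟙 Y : Y ⟶ Y).appLE U V h = Y.presheaf.map (homOfLE h).op := by
    simp only [Scheme.Hom.appLE, Scheme.Hom.id_app]
    exact Category.id_comp _
  rw [e] at this
  exact this

end SchemeFrames

end DCrit

end

noncomputable section

namespace DCrit

/-! ### The line bundle as a complex of forms -/

section LineBundle

variable {R : Type u} [CommRing R] [Algebra ℚ R] {B : Type v} [CommRing B] [Algebra R B] {m : ℕ}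

/-- Contraction of polyvector fields with forms of top degree is an isomorphism of complexes. -/
theorem lineBundleMap_isomorphism (F : Frame R B m) (f : B) :
    Function.Bijective (lineBundleMap R B m) ∧
    (∀ q, ∀ a ∈ ⋀[B]^q (Derivation R B B), ∀ κ p, p + q = m →
      lineBundleMap R B m (a ⊗ₜ κ) ∈ ⋀[B]^p (Ω[B⁄R])) ∧
    ∀ a κ, lineBundleMap R B m (polyDiff R B f a ⊗ₜ κ) =
      koszul f (lineBundleMap R B m (a ⊗ₜ κ)) :=
  ⟨⟨lineBundleMap_injective F, lineBundleMap_surjective F⟩,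
    fun _ a ha κ _ h => by rw [lineBundleMap_tmul]; exact opOf_mem h ha κ.2,
    lineBundleMap_polyDiff F f⟩

end LineBundle

end DCrit

end

theorem proposition4p19 {R : Type u} [CommRing R] [Algebra ℚ R] (Y : Scheme.{u})
    (s : Y ⟶ Spec (CommRingCat.of R)) (m : ℕ) [SmoothOfRelativeDimension m s] (f : Γ(Y, ⊤)) :
    -- `i^*K_Y` is identified with `(Ω^*_Y, df ∧ -)[m]` by contraction
    (∀ U : Y.affineOpens,
      Function.Bijective (DCrit.lineBundleMap R (DCrit.Sections s U) m) ∧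
      (∀ q, ∀ a ∈ ⋀[DCrit.Sections s U]^q (Derivation R (DCrit.Sections s U) (DCrit.Sections s U)),
        ∀ κ p, p + q = m → DCrit.lineBundleMap R (DCrit.Sections s U) m (a ⊗ₜ κ) ∈
          ⋀[DCrit.Sections s U]^p (Ω[DCrit.Sections s U⁄R])) ∧
      ∀ a κ, DCrit.lineBundleMap R (DCrit.Sections s U) m
          (DCrit.polyDiff R (DCrit.Sections s U) (DCrit.resTop s f U) a ⊗ₜ κ) =
        DCrit.koszul (DCrit.resTop s f U)
          (DCrit.lineBundleMap R (DCrit.Sections s U) m (a ⊗ₜ κ))) ∧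
    -- `Δ = ħ d` and `D = (m/2 - p) - ħ⁻¹ f` on `Ω^p` define a point of the space of self-dual
    -- quantisations with `ħ∂_ħ`-derivation of the canonical exact symplectic structure
    DCrit.IsQuantisationOn s m f (N := 0) (fun _ _ => True) (fun n c =>
      (DCrit.explicitDelta n, DCrit.explicitD m (DCrit.resTop s f c.opens) n)) ∧
    -- which is essentially unique
    DCrit.QuantisationsContractible s m f := by
  refine ⟨fun U => ?_, DCrit.isQuantisationOn_explicit s (DCrit.exists_frameExtension s m) f,
    DCrit.quantisationsContractible_of_frames s (DCrit.exists_frameExtension s m) f⟩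
  obtain ⟨F⟩ := DCrit.exists_frame_affine s m U
  exact DCrit.lineBundleMap_isomorphism F _
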